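/- Let $f\in C^\infty(\mathbb R)$ satisfy $f'(\pm1)=0$, $f''(\pm1)>0$, $f(-1)=f(1)$ and $f>f(1)$ in $(-1,1)$, and let $\theta_0\in C^2(\mathbb R)$ be the solution of $-\theta_0''+f'(\theta_0)=0$, $\theta_0(0)=0$, $\lim_{z\to\pm\infty}\theta_0(z)=\pm1$. Let $\mathbb R^2_+=\{(R,H):R\in\mathbb R,\ H>0\}$ and let $\eta:\mathbb R\to\mathbb R$ be smooth with $\eta(R)=|R|$ for all $|R|\ge\overline R$ and some $\overline R>0$. For $k\in\mathbb N_0$, $\beta,\gamma\ge0$ consider the spaces of real-valued functions (up to equality almost everywhere) \[ H^k_{(\beta,\gamma)}(\mathbb R^2_+)=\{u: e^{\beta\eta(R)+\gamma H}u\in H^k(\mathbb R^2_+)\},\qquad H^{k+\frac12}_{(\beta)}(\mathbb R)=\{g: e^{\beta\eta(R)}g\in H^{k+\frac12}(\mathbb R)\} \] with norms $\|e^{\beta\eta(R)+\gamma H}u\|_{H^k(\mathbb R^2_+)}$ and $\|e^{\beta\eta(R)}g\|_{H^{k+1/2}(\mathbb R)}$ (Sobolev–Slobodeckij norm), and \[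 Y^k_{(\beta,\gamma)}=\Big\{(G,g)\in H^k_{(\beta,\gamma)}(\mathbb R^2_+)\times H^{k+\frac12}_{(\beta)}(\mathbb R):\ \int_{\mathbb R^2_+}G(R,H)\,\theta_0'(R)\,d(R,H)+\int_{\mathbb R}g\,\theta_0'\,dR=0\Big\} \] with the norm $\|G\|_{H^k_{(\beta,\gamma)}(\mathbb R^2_+)}+\|g\|_{H^{k+1/2}_{(\beta)}(\mathbb R)}$. Let $L_{\frac\pi2}u=\big(-\Delta u+f''(\theta_0(R))u,\ -\partial_Hu|_{H=0}\big)$, with weak derivatives and the trace at $H=0$. Call a pair of $\overline\gamma>0$ and a non-decreasing $\overline\beta:(0,\overline\gamma]\to(0,\infty)$ admissible if there is a constant $\tilde C>0$ such that, for all $\gamma\in(0,\overline\gamma]$ and $\beta\in[0,\overline\beta(\gamma)]$, $L_{\frac\pi2}:H^2_{(\beta,\gamma)}(\mathbb R^2_+)\to Y^0_{(\beta,\gamma)}$ is well-defined and an isomorphism (bounded, bijective) with $\|L_{\frac\pi2}^{-1}\|\le\tilde C(1+\frac1{\gamma^2})$. Theorem. Admissible pairs $(\overline\gamma,\overline\beta)$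 exist. Moreover, for every admissible pair and every $k\in\mathbb N_0$ there is a constant $C(k)>0$ such that for all $\gamma\in(0,\overline\gamma]$ and $\beta\in[0,\overline\beta(\gamma)]$ the operator \[ L_{\frac\pi2}:H^{k+2}_{(\beta,\gamma)}(\mathbb R^2_+)\to Y^k_{(\beta,\gamma)} \] is well-defined and an isomorphism, and the operator norm of its inverse is bounded by $C(k)\big(1+\frac1{\gamma^2}\big)^{k+1}$. -/

import Mathlib

open MeasureTheory Filter Topology Set
open scoped ENNReal NNReal ContDiff

namespace ContactModel

/-! Points of the half-plane are written `x = (R, H)`, with `x.1 = R` and `x.2 = H`. -/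

/-- A double well potential with wells of equal depth at `-1` and `1`. -/
structure IsDoubleWell (f : ℝ → ℝ) : Prop where
  smooth : ContDiff ℝ ∞ f
  deriv_neg_one : deriv f (-1) = 0
  deriv_one : deriv f 1 = 0
  deriv2_neg_one : 0 < deriv (deriv f) (-1)
  deriv2_one : 0 < deriv (deriv f) 1
  equal_depth : f (-1) = f 1
  above : ∀ z ∈ Ioo (-1 : ℝ) 1, f 1 < f z

/-- The optimal profile: the `C²` solution of `-θ'' + f'(θ) = 0`, `θ(0) = 0`, `θ(±∞) = ±1`. -/
structure IsOptimalProfile (f θ : ℝ → ℝ) : Prop where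
  contDiff : ContDiff ℝ 2 θ
  ode : ∀ z, -deriv (deriv θ) z + deriv f (θ z) = 0
  zero : θ 0 = 0
  tendsto_top : Tendsto θ atTop (𝓝 1)
  tendsto_bot : Tendsto θ atBot (𝓝 (-1))

/-- A smooth function that equals `|R|` for all large `|R|`. -/
def IsSmoothAbs (η : ℝ → ℝ) : Prop :=
  ContDiff ℝ ∞ η ∧ ∃ Rbar : ℝ, 0 < Rbar ∧ ∀ R : ℝ, Rbar ≤ |R| → η R = |R|

/-- The open half-plane `ℝ²₊ = ℝ × (0, ∞)`. -/
def halfPlane : Set (ℝ × ℝ) := {x | 0 < x.2}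

/-- The classical partial derivative `∂_R^i ∂_H^j φ`. -/
noncomputable def partialDeriv (i j : ℕ) (φ : ℝ × ℝ → ℝ) : ℝ × ℝ → ℝ :=
  (fun ψ x => fderiv ℝ ψ x (1, 0))^[i] ((fun ψ x => fderiv ℝ ψ x (0, 1))^[j] φ)

/-- `v` is the weak derivative `∂_R^i ∂_H^j u` on the half-plane. -/
def IsWeakPartial (i j : ℕ) (u v : ℝ × ℝ → ℝ) : Prop :=
  LocallyIntegrableOn u halfPlane ∧ LocallyIntegrableOn v halfPlane ∧
    ∀ φ : ℝ × ℝ → ℝ, ContDiff ℝ ∞ φ → HasCompactSupport φ → tsupport φ ⊆ halfPlane →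
      ∫ x in halfPlane, u x * partialDeriv i j φ x
        = (-1) ^ (i + j) * ∫ x in halfPlane, v x * φ x

/-- `h` is the weak derivative of order `i` of `g` on `ℝ`. -/
def IsWeakDeriv (i : ℕ) (g h : ℝ → ℝ) : Prop :=
  LocallyIntegrable g ∧ LocallyIntegrable h ∧
    ∀ φ : ℝ → ℝ, ContDiff ℝ ∞ φ → HasCompactSupport φ →
      ∫ r, g r * iteratedDeriv i φ r = (-1) ^ i * ∫ r, h r * φ r

/-- The norm of `H^k(ℝ²₊)`, namely `(∑_{i+j≤k} ‖∂_R^i ∂_H^j u‖²_{L²})^{1/2}`. Weak derivatives are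
unique almost everywhere, so the infimum is over a single value if they exist up to order `k`, and
is `∞` otherwise. Thus `u ∈ H^k(ℝ²₊)` exactly if this is finite. -/
noncomputable def sobolevNorm (k : ℕ) (u : ℝ × ℝ → ℝ) : ℝ≥0∞ :=
  ⨅ (D : ℕ → ℕ → ℝ × ℝ → ℝ) (_ : ∀ i j, i + j ≤ k → IsWeakPartial i j u (D i j)),
    (∑ i ∈ Finset.range (k + 1), ∑ j ∈ Finset.range (k + 1 - i),
      eLpNorm (D i j) 2 (volume.restrict halfPlane) ^ 2) ^ (1 / 2 : ℝ)

/-- The Sobolev-Slobodeckij norm of `H^{k+1/2}(ℝ)`, namely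
`(∑_{i≤k} ‖g^{(i)}‖²_{L²} + ∬ |g^{(k)}(x) - g^{(k)}(y)|² / |x - y|² dy dx)^{1/2}`,
with weak derivatives (and the value `∞` outside of the space). -/
noncomputable def slobodeckijNorm (k : ℕ) (g : ℝ → ℝ) : ℝ≥0∞ :=
  ⨅ (D : ℕ → ℝ → ℝ) (_ : ∀ i, i ≤ k → IsWeakDeriv i g (D i)),
    ((∑ i ∈ Finset.range (k + 1), eLpNorm (D i) 2 volume ^ 2)
      + ∫⁻ x, ∫⁻ y, ENNReal.ofReal ((D k x - D k y) ^ 2 / |x - y| ^ 2)) ^ (1 / 2 : ℝ)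

/-- The norm `‖e^{β η(R) + γ H} u‖_{H^k(ℝ²₊)}` of `H^k_{(β,γ)}(ℝ²₊)`. -/
noncomputable def weightedNorm (η : ℝ → ℝ) (k : ℕ) (β γ : ℝ) (u : ℝ × ℝ → ℝ) : ℝ≥0∞ :=
  sobolevNorm k fun x => Real.exp (β * η x.1 + γ * x.2) * u x

/-- The norm `‖e^{β η(R)} g‖_{H^{k+1/2}(ℝ)}` of `H^{k+1/2}_{(β)}(ℝ)`. -/
noncomputable def weightedBdryNorm (η : ℝ → ℝ) (k : ℕ) (β : ℝ) (g : ℝ → ℝ) : ℝ≥0∞ :=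
  slobodeckijNorm k fun r => Real.exp (β * η r) * g r

/-- `u ∈ H^k_{(β,γ)}(ℝ²₊)`. -/
def MemWeighted (η : ℝ → ℝ) (k : ℕ) (β γ : ℝ) (u : ℝ × ℝ → ℝ) : Prop :=
  weightedNorm η k β γ u < ⊤

/-- `(G, g) ∈ Y^k_{(β,γ)}`: the pair lies in `H^k_{(β,γ)}(ℝ²₊) × H^{k+1/2}_{(β)}(ℝ)` and satisfies
the compatibility condition. -/
def MemData (θ η : ℝ → ℝ) (k : ℕ) (β γ : ℝ) (G : ℝ × ℝ → ℝ) (g : ℝ → ℝ) : Prop :=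
  MemWeighted η k β γ G ∧ weightedBdryNorm η k β g < ⊤ ∧
    (∫ x in halfPlane, G x * deriv θ x.1) + ∫ r, g r * deriv θ r = 0

/-- The norm of `Y^k_{(β,γ)}`. -/
noncomputable def dataNorm (η : ℝ → ℝ) (k : ℕ) (β γ : ℝ) (G : ℝ × ℝ → ℝ) (g : ℝ → ℝ) : ℝ≥0∞ :=
  weightedNorm η k β γ G + weightedBdryNorm η k β g

/-- `t` is the trace `w|_{H=0}` of a function `w` such that `w` and `∂_H w` are in `L²(ℝ²₊)`. The
trace is the only locally integrable function on `ℝ` for which the Gauss-Green formula holds with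
every smooth `φ` of compact support in the closed half-plane. -/
def IsTrace (w : ℝ × ℝ → ℝ) (t : ℝ → ℝ) : Prop :=
  LocallyIntegrable t ∧ MemLp w 2 (volume.restrict halfPlane) ∧
    ∃ wH : ℝ × ℝ → ℝ, IsWeakPartial 0 1 w wH ∧ MemLp wH 2 (volume.restrict halfPlane) ∧
      ∀ φ : ℝ × ℝ → ℝ, ContDiff ℝ ∞ φ → HasCompactSupport φ →
        (∫ x in halfPlane, w x * partialDeriv 0 1 φ x) + ∫ x in halfPlane, wH x * φ x
          = -∫ r, t r * φ (r, 0)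

/-- `(-Δ + f''(θ(R)), -∂_H|_{H=0}) u = (G, g)`, with weak derivatives and the trace. -/
def OperatorEq (f θ : ℝ → ℝ) (u G : ℝ × ℝ → ℝ) (g : ℝ → ℝ) : Prop :=
  (∃ uRR uHH : ℝ × ℝ → ℝ, IsWeakPartial 2 0 u uRR ∧ IsWeakPartial 0 2 u uHH ∧
    ∀ᵐ x ∂(volume.restrict halfPlane),
      G x = -(uRR x + uHH x) + deriv (deriv f) (θ x.1) * u x) ∧
  ∃ uH : ℝ × ℝ → ℝ, IsWeakPartial 0 1 u uH ∧ IsTrace uH fun r => -g r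

/-- The operator `(-Δ + f''(θ(R)), -∂_H|_{H=0})` is an isomorphism from `H^{k+2}_{(β,γ)}(ℝ²₊)` onto
`Y^k_{(β,γ)}` (functions being identified if they agree almost everywhere), and its inverse has
operator norm at most `K`. -/
structure IsIsoWithInverseBound (f θ η : ℝ → ℝ) (k : ℕ) (β γ K : ℝ) : Prop where
  /-- The operator is defined on all of the space. -/
  total : ∀ u, MemWeighted η (k + 2) β γ u → ∃ G g, OperatorEq f θ u G g
  /-- The operator maps into `Y^k_{(β,γ)}` and is bounded. -/
  bounded : ∃ M : ℝ≥0, ∀ u, MemWeighted η (k + 2) β γ u → ∀ G g, OperatorEq f θ u G g →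
    MemData θ η k β γ G g ∧ dataNorm η k β γ G g ≤ M * weightedNorm η (k + 2) β γ u
  injective : ∀ u u', MemWeighted η (k + 2) β γ u → MemWeighted η (k + 2) β γ u' →
    ∀ G g, OperatorEq f θ u G g → OperatorEq f θ u' G g → u =ᵐ[volume.restrict halfPlane] u'
  surjective : ∀ G g, MemData θ η k β γ G g → ∃ u, MemWeighted η (k + 2) β γ u ∧
    OperatorEq f θ u G g
  inverse_bound : ∀ u, MemWeighted η (k + 2) β γ u → ∀ G g, OperatorEq f θ u G g →
    weightedNorm η (k + 2) β γ u ≤ ENNReal.ofReal K * dataNorm η k β γ G g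

/-- `γbar > 0` and the non-decreasing function `βbar : (0, γbar] → (0, ∞)` are such that for all
`γ ∈ (0, γbar]` and `β ∈ [0, βbar γ]` the operator is an isomorphism from `H²_{(β,γ)}(ℝ²₊)` onto
`Y^0_{(β,γ)}` with inverse bounded by `C (1 + 1/γ²)`, where `C` does not depend on `(β, γ)`. -/
structure IsDecayRange (f θ η : ℝ → ℝ) (γbar : ℝ) (βbar : ℝ → ℝ) : Prop where
  pos : 0 < γbar
  βbar_pos : ∀ γ ∈ Ioc 0 γbar, 0 < βbar γ
  mono : MonotoneOn βbar (Ioc 0 γbar)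
  iso : ∃ C : ℝ, 0 < C ∧ ∀ γ ∈ Ioc 0 γbar, ∀ β ∈ Icc 0 (βbar γ),
    IsIsoWithInverseBound f θ η 0 β γ (C * (1 + 1 / γ ^ 2))

end ContactModel

namespace ContactModel

section

/-! ### Test functions -/

/-- Smooth functions of compact support. -/
structure IsTest {E : Type*} [NormedAddCommGroup E] [NormedSpace ℝ E] (φ : E → ℝ) : Prop where
  smooth : ContDiff ℝ ∞ φ
  compact : HasCompactSupport φ

/-- The derivative in the direction `e`. -/
noncomputable def dirDeriv {E : Type*} [NormedAddCommGroup E] [NormedSpace ℝ E] (e : E)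
    (φ : E → ℝ) : E → ℝ := fun x => fderiv ℝ φ x e

section TestFunctions

variable {E : Type*} [NormedAddCommGroup E] [NormedSpace ℝ E] {φ ψ : E → ℝ} {e : E}

theorem contDiff_dirDeriv (h : ContDiff ℝ ∞ φ) : ContDiff ℝ ∞ (dirDeriv e φ) :=
  (h.fderiv_right (m := ∞) (by simp)).clm_apply contDiff_const

theorem tsupport_dirDeriv_subset : tsupport (dirDeriv e φ) ⊆ tsupport φ :=
  tsupport_fderiv_apply_subset ℝ e

theorem IsTest.dirDeriv (h : IsTest φ) (e : E) : IsTest (dirDeriv e φ) :=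
  ⟨contDiff_dirDeriv h.smooth, h.compact.fderiv_apply ℝ e⟩

theorem IsTest.continuous (h : IsTest φ) : Continuous φ := h.smooth.continuous

theorem IsTest.differentiable (h : IsTest φ) : Differentiable ℝ φ :=
  h.smooth.differentiable (by simp)

theorem IsTest.add (h : IsTest φ) (h' : IsTest ψ) : IsTest (fun x => φ x + ψ x) :=
  ⟨h.smooth.add h'.smooth, h.compact.add h'.compact⟩

theorem IsTest.mul_left (h : IsTest φ) (h' : ContDiff ℝ ∞ ψ) : IsTest (fun x => ψ x * φ x) :=
  ⟨h'.mul h.smooth, h.compact.mul_left⟩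

theorem IsTest.const_mul (h : IsTest φ) (c : ℝ) : IsTest (fun x => c * φ x) :=
  h.mul_left contDiff_const

theorem IsTest.neg (h : IsTest φ) : IsTest (fun x => -φ x) :=
  ⟨h.smooth.neg, h.compact.neg⟩

theorem IsTest.sub (h : IsTest φ) (h' : IsTest ψ) : IsTest (fun x => φ x - ψ x) := by
  simpa [sub_eq_add_neg] using h.add h'.neg

theorem IsTest.translate (h : IsTest φ) (a : E) : IsTest (fun x => φ (x + a)) :=
  ⟨h.smooth.comp (contDiff_id.add contDiff_const),
    h.compact.comp_homeomorph (Homeomorph.addRight a)⟩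

theorem dirDeriv_translate (a : E) :
    dirDeriv e (fun x => φ (x + a)) = fun x => dirDeriv e φ (x + a) := by
  ext x
  simp only [dirDeriv]
  rw [fderiv_comp_add_right]

theorem dirDeriv_mul (h : Differentiable ℝ φ) (h' : Differentiable ℝ ψ) :
    dirDeriv e (fun x => φ x * ψ x) = fun x => dirDeriv e φ x * ψ x + φ x * dirDeriv e ψ x := by
  ext x
  simp only [dirDeriv]
  rw [fderiv_fun_mul (h x) (h' x)]
  simp [mul_comm]
  ring

theorem dirDeriv_comm (h : ContDiff ℝ ∞ φ) (e' : E) :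
    dirDeriv e (dirDeriv e' φ) = dirDeriv e' (dirDeriv e φ) := by
  ext x
  have hd : DifferentiableAt ℝ (fderiv ℝ φ) x :=
    (h.fderiv_right (m := 1) (by norm_cast)).differentiable (by simp) x
  have key : ∀ a b : E, dirDeriv a (dirDeriv b φ) x = fderiv ℝ (fderiv ℝ φ) x a b := by
    intro a b
    change fderiv ℝ (fun y => (fderiv ℝ φ y) b) x a = _
    rw [fderiv_clm_apply hd (differentiableAt_const b)]
    simp
  rw [key, key]
  exact (h.contDiffAt.isSymmSndFDerivAt (by rw [minSmoothness_of_isRCLikeNormedField]; exact WithTop.coe_le_coe.2 le_top)) e e'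

theorem IsTest.memLp [MeasurableSpace E] [BorelSpace E] (h : IsTest φ) (ν : Measure E)
    [IsFiniteMeasureOnCompacts ν] (p : ℝ≥0∞) : MemLp φ p ν :=
  h.continuous.memLp_of_hasCompactSupport h.compact

theorem IsTest.integrable [MeasurableSpace E] [BorelSpace E] (h : IsTest φ) (ν : Measure E)
    [IsFiniteMeasureOnCompacts ν] : Integrable φ ν :=
  h.continuous.integrable_of_hasCompactSupport h.compact

end TestFunctions

/-! ### Partial derivatives of test functions -/

theorem isOpen_halfPlane : IsOpen halfPlane := isOpen_lt continuous_const continuous_snd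

theorem measurableSet_halfPlane : MeasurableSet halfPlane := isOpen_halfPlane.measurableSet

/-- Lebesgue measure on the half-plane. -/
noncomputable abbrev volHalf : Measure (ℝ × ℝ) := volume.restrict halfPlane

theorem volHalf_eq_prod :
    volHalf = (volume : Measure ℝ).prod ((volume : Measure ℝ).restrict (Ioi 0)) := by
  have h : halfPlane = univ ×ˢ Ioi (0 : ℝ) := by ext x; simp [halfPlane]
  rw [volHalf, h, Measure.volume_eq_prod, ← Measure.prod_restrict, Measure.restrict_univ]

theorem partialDeriv_add (i j i' j' : ℕ) {φ : ℝ × ℝ → ℝ} (h : ContDiff ℝ ∞ φ) :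
    partialDeriv i j (partialDeriv i' j' φ) = partialDeriv (i + i') (j + j') φ := by
  have hsm : ∀ (e : ℝ × ℝ) (n : ℕ) (ψ : ℝ × ℝ → ℝ), ContDiff ℝ ∞ ψ →
      ContDiff ℝ ∞ ((dirDeriv e)^[n] ψ) := by
    intro e n
    induction n with
    | zero => intro ψ h; exact h
    | succ n ih => intro ψ h; exact ih _ (contDiff_dirDeriv h)
  have hcomm1 : ∀ (n : ℕ) (ψ : ℝ × ℝ → ℝ), ContDiff ℝ ∞ ψ →
      dirDeriv (0, 1) ((dirDeriv (1, 0))^[n] ψ) = (dirDeriv (1, 0))^[n] (dirDeriv (0, 1) ψ) := by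
    intro n
    induction n with
    | zero => intro ψ _; rfl
    | succ n ih =>
      intro ψ h
      rw [Function.iterate_succ_apply, ih _ (contDiff_dirDeriv h), dirDeriv_comm h,
        ← Function.iterate_succ_apply]
  have hcomm : ∀ (m n : ℕ) (ψ : ℝ × ℝ → ℝ), ContDiff ℝ ∞ ψ →
      (dirDeriv (0, 1))^[m] ((dirDeriv (1, 0))^[n] ψ)
        = (dirDeriv (1, 0))^[n] ((dirDeriv (0, 1))^[m] ψ) := by
    intro m
    induction m with
    | zero => intro n ψ _; rfl
    | succ m ih =>
      intro n ψ h
      rw [Function.iterate_succ_apply, hcomm1 n ψ h, ih n _ (contDiff_dirDeriv h),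
        ← Function.iterate_succ_apply]
  change (dirDeriv (1, 0))^[i] ((dirDeriv (0, 1))^[j]
      ((dirDeriv (1, 0))^[i'] ((dirDeriv (0, 1))^[j'] φ)))
    = (dirDeriv (1, 0))^[i + i'] ((dirDeriv (0, 1))^[j + j'] φ)
  rw [hcomm j i' _ (hsm _ _ _ h), ← Function.iterate_add_apply, ← Function.iterate_add_apply]

theorem IsTest.partialDeriv {φ : ℝ × ℝ → ℝ} (h : IsTest φ) (i j : ℕ) :
    IsTest (partialDeriv i j φ) := by
  have key : ∀ (e : ℝ × ℝ) (n : ℕ) (ψ : ℝ × ℝ → ℝ), IsTest ψ → IsTest ((ContactModel.dirDeriv e)^[n] ψ) := by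
    intro e n
    induction n with
    | zero => intro ψ h; exact h
    | succ n ih => intro ψ h; exact ih _ (h.dirDeriv e)
  exact key _ i _ (key _ j _ h)

theorem tsupport_partialDeriv_subset (i j : ℕ) (φ : ℝ × ℝ → ℝ) :
    tsupport (partialDeriv i j φ) ⊆ tsupport φ := by
  have key : ∀ (e : ℝ × ℝ) (n : ℕ) (ψ : ℝ × ℝ → ℝ),
      tsupport ((dirDeriv e)^[n] ψ) ⊆ tsupport ψ := by
    intro e n
    induction n with
    | zero => intro ψ; exact subset_rfl
    | succ n ih => intro ψ; exact (ih _).trans tsupport_dirDeriv_subset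
  exact (key _ i _).trans (key _ j _)

theorem partialDeriv_one_zero (φ : ℝ × ℝ → ℝ) : partialDeriv 1 0 φ = dirDeriv (1, 0) φ := rfl
theorem partialDeriv_zero_one (φ : ℝ × ℝ → ℝ) : partialDeriv 0 1 φ = dirDeriv (0, 1) φ := rfl
/-! ### Weak derivatives on the half-plane -/

/-- The product of a locally integrable function and a test function is integrable. -/
theorem LocallyIntegrableOn.integrable_mul_test {u φ : ℝ × ℝ → ℝ}
    (hu : LocallyIntegrableOn u halfPlane) (hφ : IsTest φ) (hs : tsupport φ ⊆ halfPlane) :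
    Integrable (fun x => u x * φ x) volHalf := by
  have h1 : IntegrableOn u (tsupport φ) := hu.integrableOn_compact_subset hs hφ.compact
  have h2 : IntegrableOn (fun x => u x * φ x) (tsupport φ) :=
    h1.mul_continuousOn hφ.continuous.continuousOn hφ.compact
  have h3 : Integrable (fun x => u x * φ x) volume := by
    rw [← integrableOn_iff_integrable_of_support_subset (s := tsupport φ)]
    · exact h2
    · exact (Function.support_mul_subset_right _ _).trans subset_closure
  exact h3.restrict

theorem MemLp.locallyIntegrableOn_halfPlane {u : ℝ × ℝ → ℝ} (h : MemLp u 2 volHalf) :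
    LocallyIntegrableOn u halfPlane :=
  locallyIntegrableOn_of_locallyIntegrable_restrict (h.locallyIntegrable (by norm_num))

theorem LocallyIntegrableOn.congr_halfPlane {u v : ℝ × ℝ → ℝ}
    (h : LocallyIntegrableOn u halfPlane) (huv : u =ᵐ[volHalf] v) :
    LocallyIntegrableOn v halfPlane := by
  rw [locallyIntegrableOn_iff isOpen_halfPlane.isLocallyClosed] at h ⊢
  intro k hk hkc
  exact (h k hk hkc).congr_fun_ae (ae_restrict_of_ae_restrict_of_subset hk huv)

theorem LocallyIntegrableOn.mul_smooth {u m : ℝ × ℝ → ℝ}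
    (h : LocallyIntegrableOn u halfPlane) (hm : Continuous m) :
    LocallyIntegrableOn (fun x => m x * u x) halfPlane := by
  rw [locallyIntegrableOn_iff isOpen_halfPlane.isLocallyClosed] at h ⊢
  intro k hk hkc
  exact (h k hk hkc).continuousOn_mul hm.continuousOn hkc

theorem ae_eq_of_forall_test {u v : ℝ × ℝ → ℝ} (hu : LocallyIntegrableOn u halfPlane)
    (hv : LocallyIntegrableOn v halfPlane)
    (h : ∀ φ, IsTest φ → tsupport φ ⊆ halfPlane →
      ∫ x in halfPlane, u x * φ x = ∫ x in halfPlane, v x * φ x) : u =ᵐ[volHalf] v := by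
  have := isOpen_halfPlane.ae_eq_zero_of_integral_contDiff_smul_eq_zero (hu.sub hv) (by
    intro φ h1 h2 h3
    have e : ∫ x, φ x • (u - v) x = ∫ x in halfPlane, φ x • (u - v) x := by
      refine (setIntegral_eq_integral_of_forall_compl_eq_zero fun x hx => ?_).symm
      rw [image_eq_zero_of_notMem_tsupport fun hx' => hx (h3 hx'), zero_smul]
    rw [e]
    have : ∀ x, φ x • (u - v) x = u x * φ x - v x * φ x := by
      intro x; simp; ring
    simp only [this]
    rw [integral_sub (LocallyIntegrableOn.integrable_mul_test hu ⟨h1, h2⟩ h3)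
      (LocallyIntegrableOn.integrable_mul_test hv ⟨h1, h2⟩ h3), h φ ⟨h1, h2⟩ h3, sub_self])
  rw [Filter.EventuallyEq, ae_restrict_iff' measurableSet_halfPlane]
  filter_upwards [this] with x hx hx'
  have := hx hx'
  simpa [sub_eq_zero] using this

theorem IsWeakPartial.test {i j : ℕ} {u v φ : ℝ × ℝ → ℝ} (h : IsWeakPartial i j u v)
    (hφ : IsTest φ) (hs : tsupport φ ⊆ halfPlane) :
    ∫ x in halfPlane, u x * partialDeriv i j φ x
        = (-1) ^ (i + j) * ∫ x in halfPlane, v x * φ x := h.2.2 φ hφ.1 hφ.2 hs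

theorem IsWeakPartial.unique {i j : ℕ} {u v w : ℝ × ℝ → ℝ} (h : IsWeakPartial i j u v)
    (h' : IsWeakPartial i j u w) : v =ᵐ[volHalf] w := by
  refine ae_eq_of_forall_test h.2.1 h'.2.1 fun φ hφ hs => ?_
  have := (h.test hφ hs).symm.trans (h'.test hφ hs)
  exact mul_left_cancel₀ (pow_ne_zero _ (by norm_num)) this

theorem IsWeakPartial.congr {i j : ℕ} {u v u' v' : ℝ × ℝ → ℝ} (h : IsWeakPartial i j u v)
    (hu : u =ᵐ[volHalf] u') (hv : v =ᵐ[volHalf] v') : IsWeakPartial i j u' v' := by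
  refine ⟨LocallyIntegrableOn.congr_halfPlane h.1 hu,
    LocallyIntegrableOn.congr_halfPlane h.2.1 hv, fun φ h1 h2 h3 => ?_⟩
  have e1 : ∫ x in halfPlane, u' x * partialDeriv i j φ x
      = ∫ x in halfPlane, u x * partialDeriv i j φ x :=
    integral_congr_ae (by filter_upwards [hu] with x hx; rw [hx])
  have e2 : ∫ x in halfPlane, v' x * φ x = ∫ x in halfPlane, v x * φ x :=
    integral_congr_ae (by filter_upwards [hv] with x hx; rw [hx])
  rw [e1, e2, h.2.2 φ h1 h2 h3]

theorem isWeakPartial_zero_zero {u : ℝ × ℝ → ℝ} (h : LocallyIntegrableOn u halfPlane) :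
    IsWeakPartial 0 0 u u := ⟨h, h, fun φ _ _ _ => by simp [partialDeriv]⟩

theorem IsWeakPartial.comp {i j i' j' : ℕ} {u v w : ℝ × ℝ → ℝ} (h : IsWeakPartial i j u v)
    (h' : IsWeakPartial i' j' v w) : IsWeakPartial (i + i') (j + j') u w := by
  refine ⟨h.1, h'.2.1, fun φ h1 h2 h3 => ?_⟩
  have hφ : IsTest φ := ⟨h1, h2⟩
  rw [← partialDeriv_add i j i' j' h1,
    h.test (hφ.partialDeriv i' j') ((tsupport_partialDeriv_subset _ _ _).trans h3),
    h'.test hφ h3]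
  ring

theorem IsWeakPartial.of_comp {i j i' j' : ℕ} {u v w : ℝ × ℝ → ℝ} (h : IsWeakPartial i j u v)
    (h' : IsWeakPartial (i + i') (j + j') u w) : IsWeakPartial i' j' v w := by
  refine ⟨h.2.1, h'.2.1, fun φ h1 h2 h3 => ?_⟩
  have hφ : IsTest φ := ⟨h1, h2⟩
  have e1 := h.test (hφ.partialDeriv i' j') ((tsupport_partialDeriv_subset _ _ _).trans h3)
  rw [partialDeriv_add i j i' j' h1, h'.test hφ h3] at e1
  have : ((-1 : ℝ)) ^ (i + j) * ((-1) ^ (i + j)) = 1 := by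
    rw [← mul_pow]; norm_num
  calc _ = (-1 : ℝ) ^ (i + j) * ((-1) ^ (i + j)
        * ∫ x in halfPlane, v x * partialDeriv i' j' φ x) := by rw [← mul_assoc, this, one_mul]
    _ = _ := by rw [← e1]; linear_combination ((-1) ^ (i' + j') * ∫ x in halfPlane, w x * φ x) * this

theorem IsWeakPartial.add {i j : ℕ} {u v u' v' : ℝ × ℝ → ℝ} (h : IsWeakPartial i j u v)
    (h' : IsWeakPartial i j u' v') :
    IsWeakPartial i j (fun x => u x + u' x) (fun x => v x + v' x) := by
  refine ⟨h.1.add h'.1, h.2.1.add h'.2.1, fun φ h1 h2 h3 => ?_⟩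
  have hφ : IsTest φ := ⟨h1, h2⟩
  have hs := (tsupport_partialDeriv_subset i j φ).trans h3
  simp only [add_mul]
  rw [integral_add (LocallyIntegrableOn.integrable_mul_test h.1 (hφ.partialDeriv i j) hs)
      (LocallyIntegrableOn.integrable_mul_test h'.1 (hφ.partialDeriv i j) hs),
    integral_add (LocallyIntegrableOn.integrable_mul_test h.2.1 hφ h3)
      (LocallyIntegrableOn.integrable_mul_test h'.2.1 hφ h3), h.test hφ h3, h'.test hφ h3]
  ring

theorem IsWeakPartial.const_mul {i j : ℕ} {u v : ℝ × ℝ → ℝ} (h : IsWeakPartial i j u v) (c : ℝ) :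
    IsWeakPartial i j (fun x => c * u x) (fun x => c * v x) := by
  refine ⟨LocallyIntegrableOn.mul_smooth h.1 continuous_const,
    LocallyIntegrableOn.mul_smooth h.2.1 continuous_const, fun φ h1 h2 h3 => ?_⟩
  simp only [mul_assoc]
  rw [integral_const_mul, integral_const_mul, h.2.2 φ h1 h2 h3]
  ring

theorem IsWeakPartial.neg {i j : ℕ} {u v : ℝ × ℝ → ℝ} (h : IsWeakPartial i j u v) :
    IsWeakPartial i j (fun x => -u x) (fun x => -v x) := by
  simpa using h.const_mul (-1)

theorem IsWeakPartial.sub {i j : ℕ} {u v u' v' : ℝ × ℝ → ℝ} (h : IsWeakPartial i j u v)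
    (h' : IsWeakPartial i j u' v') :
    IsWeakPartial i j (fun x => u x - u' x) (fun x => v x - v' x) := by
  simpa [sub_eq_add_neg] using h.add h'.neg

/-- Product rule with a smooth factor; `e` is the direction of the first order derivative. -/
theorem isWeakPartial_mul_aux {i j : ℕ} {e : ℝ × ℝ} (hij : i + j = 1)
    (he : ∀ φ, partialDeriv i j φ = dirDeriv e φ) {u v m : ℝ × ℝ → ℝ}
    (h : IsWeakPartial i j u v) (hm : ContDiff ℝ ∞ m) :
    IsWeakPartial i j (fun x => m x * u x) (fun x => m x * v x + dirDeriv e m x * u x) := by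
  have hm' : ContDiff ℝ ∞ (dirDeriv e m) := contDiff_dirDeriv hm
  have l1 := LocallyIntegrableOn.mul_smooth h.1 hm.continuous
  have l2 := LocallyIntegrableOn.mul_smooth h.2.1 hm.continuous
  have l3 := LocallyIntegrableOn.mul_smooth h.1 hm'.continuous
  refine ⟨l1, l2.add l3, fun φ h1 h2 h3 => ?_⟩
  have hφ : IsTest φ := ⟨h1, h2⟩
  have hs := (tsupport_dirDeriv_subset (e := e) (φ := φ)).trans h3
  have hmφ : tsupport (fun x => m x * φ x) ⊆ halfPlane := (tsupport_mul_subset_right).trans h3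
  have key := h.test (hφ.mul_left hm) hmφ
  rw [hij, he, dirDeriv_mul (hm.differentiable (by simp)) hφ.differentiable] at key
  rw [hij, he]
  have e1 : ∀ x, u x * (dirDeriv e m x * φ x + m x * dirDeriv e φ x)
      = dirDeriv e m x * u x * φ x + m x * u x * dirDeriv e φ x := fun x => by ring
  simp only [e1] at key
  simp only [add_mul]
  have i1 := LocallyIntegrableOn.integrable_mul_test l3 hφ h3
  have i2 := LocallyIntegrableOn.integrable_mul_test l1 (hφ.dirDeriv e) hs
  have i3 := LocallyIntegrableOn.integrable_mul_test l2 hφ h3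
  rw [integral_add i1 i2] at key
  rw [integral_add i3 i1]
  have e2 : ∫ x in halfPlane, m x * v x * φ x = ∫ x in halfPlane, v x * (m x * φ x) := by
    congr 1; ext x; ring
  rw [e2]
  linear_combination key

theorem IsWeakPartial.mul_fst {u v m : ℝ × ℝ → ℝ} (h : IsWeakPartial 1 0 u v)
    (hm : ContDiff ℝ ∞ m) :
    IsWeakPartial 1 0 (fun x => m x * u x) (fun x => m x * v x + dirDeriv (1, 0) m x * u x) :=
  isWeakPartial_mul_aux rfl (fun _ => rfl) h hm

theorem IsWeakPartial.mul_snd {u v m : ℝ × ℝ → ℝ} (h : IsWeakPartial 0 1 u v)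
    (hm : ContDiff ℝ ∞ m) :
    IsWeakPartial 0 1 (fun x => m x * u x) (fun x => m x * v x + dirDeriv (0, 1) m x * u x) :=
  isWeakPartial_mul_aux rfl (fun _ => rfl) h hm

end

section

/-! ### Quantitative Sobolev regularity -/

/-- `u ∈ L²` with norm at most `A`. -/
def L2Bound (u : ℝ × ℝ → ℝ) (A : ℝ≥0∞) : Prop := MemLp u 2 volHalf ∧ eLpNorm u 2 volHalf ≤ A

/-- All weak derivatives of `u` up to order `k` are bounded by `A` in `L²(ℝ²₊)`. -/
def SobBound : ℕ → (ℝ × ℝ → ℝ) → ℝ≥0∞ → Prop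
  | 0, u, A => L2Bound u A
  | k + 1, u, A => L2Bound u A ∧ ∃ uR uH, IsWeakPartial 1 0 u uR ∧ IsWeakPartial 0 1 u uH ∧
      SobBound k uR A ∧ SobBound k uH A

theorem L2Bound.mono {u : ℝ × ℝ → ℝ} {A B : ℝ≥0∞} (h : L2Bound u A) (hAB : A ≤ B) :
    L2Bound u B := ⟨h.1, h.2.trans hAB⟩

theorem L2Bound.congr {u v : ℝ × ℝ → ℝ} {A : ℝ≥0∞} (h : L2Bound u A) (huv : u =ᵐ[volHalf] v) :
    L2Bound v A := ⟨h.1.ae_eq huv, (eLpNorm_congr_ae huv).symm.trans_le h.2⟩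

theorem L2Bound.add {u v : ℝ × ℝ → ℝ} {A B : ℝ≥0∞} (h : L2Bound u A) (h' : L2Bound v B) :
    L2Bound (fun x => u x + v x) (A + B) :=
  ⟨h.1.add h'.1, (eLpNorm_add_le h.1.1 h'.1.1 (by norm_num)).trans (add_le_add h.2 h'.2)⟩

/-- Multiplication by a measurable function bounded by `C`. -/
theorem L2Bound.mul {u m : ℝ × ℝ → ℝ} {A : ℝ≥0∞} (h : L2Bound u A) {C : ℝ≥0}
    (hm : Measurable m) (hC : ∀ x ∈ halfPlane, |m x| ≤ C) : L2Bound (fun x => m x * u x) (C * A) := by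
  have hb : ∀ᵐ x ∂volHalf, ‖m x * u x‖ ≤ C * ‖u x‖ := by
    filter_upwards [ae_restrict_mem measurableSet_halfPlane] with x hx
    rw [norm_mul]
    exact mul_le_mul_of_nonneg_right (hC x hx) (norm_nonneg _)
  refine ⟨h.1.of_le_mul (hm.aestronglyMeasurable.mul h.1.1) hb, ?_⟩
  calc _ ≤ ENNReal.ofReal C * eLpNorm u 2 volHalf := eLpNorm_le_mul_eLpNorm_of_ae_le_mul hb 2
    _ ≤ C * A := by
      rw [ENNReal.ofReal_coe_nnreal]
      exact mul_le_mul_right h.2 _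

theorem L2Bound.const_mul {u : ℝ × ℝ → ℝ} {A : ℝ≥0∞} (h : L2Bound u A) (c : ℝ) :
    L2Bound (fun x => c * u x) (‖c‖₊ * A) :=
  h.mul (m := fun _ => c) measurable_const fun _ _ => by simp

theorem L2Bound.locallyIntegrableOn {u : ℝ × ℝ → ℝ} {A : ℝ≥0∞} (h : L2Bound u A) :
    LocallyIntegrableOn u halfPlane := MemLp.locallyIntegrableOn_halfPlane h.1

theorem SobBound.l2Bound : ∀ {k : ℕ} {u : ℝ × ℝ → ℝ} {A : ℝ≥0∞}, SobBound k u A → L2Bound u A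
  | 0, _, _, h => h
  | _ + 1, _, _, h => h.1

theorem SobBound.mono : ∀ {k : ℕ} {u : ℝ × ℝ → ℝ} {A B : ℝ≥0∞}, SobBound k u A → A ≤ B →
    SobBound k u B
  | 0, _, _, _, h, hAB => L2Bound.mono h hAB
  | _ + 1, _, _, _, ⟨h, uR, uH, h1, h2, h3, h4⟩, hAB =>
    ⟨h.mono hAB, uR, uH, h1, h2, h3.mono hAB, h4.mono hAB⟩

theorem SobBound.of_succ : ∀ {k : ℕ} {u : ℝ × ℝ → ℝ} {A : ℝ≥0∞}, SobBound (k + 1) u A →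
    SobBound k u A
  | 0, _, _, h => h.1
  | _ + 1, _, _, ⟨h, uR, uH, h1, h2, h3, h4⟩ => ⟨h, uR, uH, h1, h2, h3.of_succ, h4.of_succ⟩

theorem SobBound.of_le {k l : ℕ} {u : ℝ × ℝ → ℝ} {A : ℝ≥0∞} (h : SobBound k u A) (hl : l ≤ k) :
    SobBound l u A := by
  induction k with
  | zero => rwa [Nat.le_zero.1 hl]
  | succ k ih =>
    rcases Nat.lt_or_ge l (k + 1) with h' | h'
    · exact ih h.of_succ (Nat.lt_succ_iff.1 h')
    · rwa [le_antisymm hl h']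

theorem SobBound.congr {k : ℕ} {u v : ℝ × ℝ → ℝ} {A : ℝ≥0∞} (h : SobBound k u A)
    (huv : u =ᵐ[volHalf] v) : SobBound k v A := by
  cases k with
  | zero => exact L2Bound.congr h huv
  | succ k =>
    obtain ⟨h, uR, uH, h1, h2, h3, h4⟩ := h
    exact ⟨h.congr huv, uR, uH, h1.congr huv .rfl, h2.congr huv .rfl, h3, h4⟩

theorem SobBound.of_fst {k : ℕ} {u v : ℝ × ℝ → ℝ} {A : ℝ≥0∞} (h : SobBound (k + 1) u A)
    (hv : IsWeakPartial 1 0 u v) : SobBound k v A := by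
  obtain ⟨h, uR, uH, h1, h2, h3, h4⟩ := h
  exact h3.congr (h1.unique hv)

theorem SobBound.of_snd {k : ℕ} {u v : ℝ × ℝ → ℝ} {A : ℝ≥0∞} (h : SobBound (k + 1) u A)
    (hv : IsWeakPartial 0 1 u v) : SobBound k v A := by
  obtain ⟨h, uR, uH, h1, h2, h3, h4⟩ := h
  exact h4.congr (h2.unique hv)

theorem SobBound.add : ∀ {k : ℕ} {u v : ℝ × ℝ → ℝ} {A B : ℝ≥0∞}, SobBound k u A →
    SobBound k v B → SobBound k (fun x => u x + v x) (A + B)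
  | 0, _, _, _, _, h, h' => L2Bound.add h h'
  | _ + 1, _, _, _, _, ⟨h, _, _, h1, h2, h3, h4⟩, ⟨h', _, _, h1', h2', h3', h4'⟩ =>
    ⟨h.add h', _, _, h1.add h1', h2.add h2', h3.add h3', h4.add h4'⟩

theorem SobBound.const_mul (c : ℝ) : ∀ {k : ℕ} {u : ℝ × ℝ → ℝ} {A : ℝ≥0∞}, SobBound k u A →
    SobBound k (fun x => c * u x) (‖c‖₊ * A)
  | 0, _, _, h => L2Bound.const_mul h c
  | _ + 1, _, _, ⟨h, _, _, h1, h2, h3, h4⟩ =>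
    ⟨h.const_mul c, _, _, h1.const_mul c, h2.const_mul c, h3.const_mul c, h4.const_mul c⟩

theorem SobBound.neg {k : ℕ} {u : ℝ × ℝ → ℝ} {A : ℝ≥0∞} (h : SobBound k u A) :
    SobBound k (fun x => -u x) A := by
  simpa using h.const_mul (-1)

theorem SobBound.sub {k : ℕ} {u v : ℝ × ℝ → ℝ} {A B : ℝ≥0∞} (h : SobBound k u A)
    (h' : SobBound k v B) : SobBound k (fun x => u x - v x) (A + B) := by
  simpa [sub_eq_add_neg] using h.add h'.neg

/-- Smooth functions on `ℝ` that are bounded together with all their derivatives. -/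
def BddSmooth (m : ℝ → ℝ) : Prop :=
  ContDiff ℝ ∞ m ∧ ∀ n : ℕ, ∃ C : ℝ≥0, ∀ x, |iteratedDeriv n m x| ≤ C

theorem BddSmooth.deriv {m : ℝ → ℝ} (h : BddSmooth m) : BddSmooth (deriv m) := by
  refine ⟨(contDiff_infty_iff_deriv.1 h.1).2, fun n => ?_⟩
  obtain ⟨C, hC⟩ := h.2 (n + 1)
  exact ⟨C, fun x => by rw [← iteratedDeriv_succ']; exact hC x⟩

theorem BddSmooth.bound {m : ℝ → ℝ} (h : BddSmooth m) : ∃ C : ℝ≥0, ∀ x, |m x| ≤ C := by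
  simpa using h.2 0

theorem BddSmooth.differentiable {m : ℝ → ℝ} (h : BddSmooth m) : Differentiable ℝ m :=
  h.1.differentiable (by simp)

theorem bddSmooth_const (c : ℝ) : BddSmooth fun _ => c := by
  refine ⟨contDiff_const, fun n => ?_⟩
  cases n with
  | zero => exact ⟨‖c‖₊, fun x => by simp⟩
  | succ n => exact ⟨0, fun x => by simp [iteratedDeriv_const]⟩

theorem BddSmooth.add {m₁ m₂ : ℝ → ℝ} (h₁ : BddSmooth m₁) (h₂ : BddSmooth m₂) :
    BddSmooth fun x => m₁ x + m₂ x := by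
  refine ⟨h₁.1.add h₂.1, fun n => ?_⟩
  obtain ⟨C₁, hC₁⟩ := h₁.2 n
  obtain ⟨C₂, hC₂⟩ := h₂.2 n
  refine ⟨C₁ + C₂, fun x => ?_⟩
  rw [iteratedDeriv_fun_add ((h₁.1.of_le (by exact_mod_cast le_top)).contDiffAt)
    ((h₂.1.of_le (by exact_mod_cast le_top)).contDiffAt)]
  exact (abs_add_le _ _).trans (add_le_add (hC₁ x) (hC₂ x))

theorem BddSmooth.mul {m₁ m₂ : ℝ → ℝ} (h₁ : BddSmooth m₁) (h₂ : BddSmooth m₂) :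
    BddSmooth fun x => m₁ x * m₂ x := by
  refine ⟨h₁.1.mul h₂.1, fun n => ?_⟩
  choose C₁ hC₁ using h₁.2
  choose C₂ hC₂ using h₂.2
  refine ⟨∑ i ∈ Finset.range (n + 1), n.choose i * C₁ i * C₂ (n - i), fun x => ?_⟩
  have := iteratedDeriv_fun_mul (n := n) (x := x)
    (h₁.1.of_le (by exact_mod_cast le_top)).contDiffAt
    (h₂.1.of_le (by exact_mod_cast le_top)).contDiffAt
  rw [this]
  push_cast
  refine (Finset.abs_sum_le_sum_abs _ _).trans (Finset.sum_le_sum fun i _ => ?_)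
  rw [abs_mul, abs_mul, Nat.abs_cast]
  gcongr
  · exact hC₁ _ _
  · exact hC₂ _ _

theorem dirDeriv_comp_fst {m : ℝ → ℝ} (hm : Differentiable ℝ m) (e : ℝ × ℝ) (x : ℝ × ℝ) :
    dirDeriv e (fun x : ℝ × ℝ => m x.1) x = e.1 * deriv m x.1 := by
  have h : HasFDerivAt (fun x : ℝ × ℝ => m x.1) _ x :=
    (hm x.1).hasFDerivAt.comp x hasFDerivAt_fst
  rw [dirDeriv, h.fderiv]
  simp

theorem contDiff_comp_fst {m : ℝ → ℝ} (hm : ContDiff ℝ ∞ m) :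
    ContDiff ℝ ∞ fun x : ℝ × ℝ => m x.1 := hm.comp contDiff_fst

theorem IsWeakPartial.fst_mul_fst {u v : ℝ × ℝ → ℝ} {m : ℝ → ℝ} (h : IsWeakPartial 1 0 u v)
    (hm : ContDiff ℝ ∞ m) :
    IsWeakPartial 1 0 (fun x => m x.1 * u x) (fun x => m x.1 * v x + deriv m x.1 * u x) := by
  have := h.mul_fst (contDiff_comp_fst hm)
  simpa [dirDeriv_comp_fst (hm.differentiable (by simp))] using this

theorem IsWeakPartial.fst_mul_snd {u v : ℝ × ℝ → ℝ} {m : ℝ → ℝ} (h : IsWeakPartial 0 1 u v)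
    (hm : ContDiff ℝ ∞ m) :
    IsWeakPartial 0 1 (fun x => m x.1 * u x) (fun x => m x.1 * v x) := by
  have := h.mul_snd (contDiff_comp_fst hm)
  simpa [dirDeriv_comp_fst (hm.differentiable (by simp))] using this

theorem L2Bound.mul_fst {u : ℝ × ℝ → ℝ} {m : ℝ → ℝ} {A : ℝ≥0∞} (h : L2Bound u A) {C : ℝ≥0}
    (hm : Measurable m) (hC : ∀ x, |m x| ≤ C) : L2Bound (fun x => m x.1 * u x) (C * A) :=
  h.mul (m := fun x => m x.1) (hm.comp measurable_fst) fun x _ => hC x.1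

theorem SobBound.mul_fst (k : ℕ) {m : ℝ → ℝ} (hm : BddSmooth m) :
    ∃ C : ℝ≥0, ∀ u A, SobBound k u A → SobBound k (fun x => m x.1 * u x) (C * A) := by
  induction k generalizing m with
  | zero =>
    obtain ⟨C, hC⟩ := hm.bound
    exact ⟨C, fun u A h => L2Bound.mul_fst h hm.1.continuous.measurable hC⟩
  | succ k ih =>
    obtain ⟨C₀, hC₀⟩ := hm.bound
    obtain ⟨C₁, hC₁⟩ := ih hm
    obtain ⟨C₂, hC₂⟩ := ih hm.deriv
    refine ⟨C₀ + C₁ + C₂, fun u A h => ?_⟩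
    have h0 := h
    obtain ⟨h, uR, uH, h1, h2, h3, h4⟩ := h
    refine ⟨(L2Bound.mul_fst h hm.1.continuous.measurable hC₀).mono ?_, _, _, h1.fst_mul_fst hm.1,
      h2.fst_mul_snd hm.1, ((hC₁ _ _ h3).add (hC₂ _ _ h0.of_succ)).mono ?_,
      (hC₁ _ _ h4).mono ?_⟩
    · gcongr; exact le_add_right le_self_add
    · rw [← add_mul]; gcongr; push_cast; rw [add_assoc]; exact le_add_self
    · gcongr; rw [add_right_comm]; exact le_add_self

/-! ### Comparison with the Sobolev norm -/

theorem SobBound.exists_family {k : ℕ} {u : ℝ × ℝ → ℝ} {A : ℝ≥0∞} (h : SobBound k u A) :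
    ∃ D : ℕ → ℕ → ℝ × ℝ → ℝ, ∀ i j, i + j ≤ k → IsWeakPartial i j u (D i j) ∧ L2Bound (D i j) A := by
  induction k generalizing u with
  | zero =>
    refine ⟨fun _ _ => u, fun i j hij => ?_⟩
    obtain ⟨rfl, rfl⟩ : i = 0 ∧ j = 0 := by omega
    exact ⟨isWeakPartial_zero_zero (L2Bound.locallyIntegrableOn h), h⟩
  | succ k ih =>
    obtain ⟨h, uR, uH, h1, h2, h3, h4⟩ := h
    obtain ⟨DR, hDR⟩ := ih h3
    obtain ⟨DH, hDH⟩ := ih h4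
    refine ⟨fun i j => match i, j with
      | 0, 0 => u
      | 0, j + 1 => DH 0 j
      | i + 1, j => DR i j, fun i j hij => ?_⟩
    match i, j with
    | 0, 0 => exact ⟨isWeakPartial_zero_zero h.locallyIntegrableOn, h⟩
    | 0, j + 1 =>
      obtain ⟨a, b⟩ := hDH 0 j (by omega)
      refine ⟨?_, b⟩
      have := h2.comp a
      rwa [add_zero, add_comm 1 j] at this
    | i + 1, j =>
      obtain ⟨a, b⟩ := hDR i j (by omega)
      refine ⟨?_, b⟩
      have := h1.comp a
      rwa [zero_add, add_comm 1 i] at this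

theorem SobBound.of_family {k : ℕ} {u : ℝ × ℝ → ℝ} {A : ℝ≥0∞} {D : ℕ → ℕ → ℝ × ℝ → ℝ}
    (hD : ∀ i j, i + j ≤ k → IsWeakPartial i j u (D i j) ∧ L2Bound (D i j) A) : SobBound k u A := by
  have h0 : L2Bound u A :=
    (hD 0 0 (by omega)).2.congr ((hD 0 0 (by omega)).1.unique
      (isWeakPartial_zero_zero (hD 0 0 (by omega)).1.1))
  induction k generalizing u D with
  | zero => exact h0
  | succ k ih =>
    refine ⟨h0, D 1 0, D 0 1, (hD 1 0 (by omega)).1, (hD 0 1 (by omega)).1,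
      ih (D := fun i j => D (i + 1) j) (fun i j hij => ⟨?_, (hD (i + 1) j (by omega)).2⟩)
        (hD 1 0 (by omega)).2,
      ih (D := fun i j => D i (j + 1)) (fun i j hij => ⟨?_, (hD i (j + 1) (by omega)).2⟩)
        (hD 0 1 (by omega)).2⟩
    · refine (hD 1 0 (by omega)).1.of_comp (i' := i) (j' := j) ?_
      rw [zero_add, add_comm 1 i]
      exact (hD (i + 1) j (by omega)).1
    · refine (hD 0 1 (by omega)).1.of_comp (i' := i) (j' := j) ?_
      rw [zero_add, add_comm 1 j]
      exact (hD i (j + 1) (by omega)).1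

theorem sq_rpow_half (a : ℝ≥0∞) : (a ^ 2) ^ (1 / 2 : ℝ) = a := by
  rw [← ENNReal.rpow_natCast, ← ENNReal.rpow_mul]; norm_num

theorem SobBound.sobolevNorm_le {k : ℕ} {u : ℝ × ℝ → ℝ} {A : ℝ≥0∞} (h : SobBound k u A) :
    sobolevNorm k u ≤ (k + 1) * A := by
  obtain ⟨D, hD⟩ := h.exists_family
  refine (iInf₂_le D fun i j hij => (hD i j hij).1).trans ?_
  rw [← sq_rpow_half ((k + 1) * A)]
  refine ENNReal.rpow_le_rpow ?_ (by norm_num)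
  calc _ ≤ ∑ i ∈ Finset.range (k + 1), ∑ j ∈ Finset.range (k + 1), A ^ 2 := by
        refine Finset.sum_le_sum fun i hi => ?_
        refine (Finset.sum_le_sum fun j hj => ?_).trans (Finset.sum_le_sum_of_subset
          (Finset.range_mono (Nat.sub_le _ _)))
        have := Finset.mem_range.1 hi
        have := Finset.mem_range.1 hj
        gcongr
        exact (hD i j (by omega)).2.2
    _ = ((k + 1) * A) ^ 2 := by simp; ring

theorem sobBound_of_sobolevNorm {k : ℕ} {u : ℝ × ℝ → ℝ} (h : sobolevNorm k u < ⊤) :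
    SobBound k u (sobolevNorm k u) := by
  have h' := h
  rw [sobolevNorm, iInf_lt_iff] at h'
  obtain ⟨D, h'⟩ := h'
  rw [iInf_lt_iff] at h'
  obtain ⟨hD, h'⟩ := h'
  have key : ∀ i j, i + j ≤ k → eLpNorm (D i j) 2 volHalf ≤ sobolevNorm k u := by
    intro i j hij
    refine le_iInf₂ fun D' hD' => ?_
    rw [eLpNorm_congr_ae ((hD i j hij).unique (hD' i j hij)), ← sq_rpow_half (eLpNorm _ _ _)]
    refine ENNReal.rpow_le_rpow ?_ (by norm_num)
    refine le_trans ?_ (Finset.single_le_sum (fun _ _ => zero_le) (Finset.mem_range.2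
      (show i < k + 1 by omega)))
    exact Finset.single_le_sum (f := fun j => eLpNorm (D' i j) 2 volHalf ^ 2) (fun _ _ => zero_le)
      (Finset.mem_range.2 (show j < k + 1 - i by omega))
  refine SobBound.of_family (D := D) fun i j hij => ⟨hD i j hij, ⟨?_, (key i j hij).trans_lt h⟩,
    key i j hij⟩
  exact (hD i j hij).2.1.aestronglyMeasurable

/-! ### Weak derivatives on the line -/

theorem ae_eq_of_forall_isTest {u v : ℝ → ℝ} (hu : LocallyIntegrable u)
    (hv : LocallyIntegrable v) (h : ∀ φ, IsTest φ → ∫ x, u x * φ x = ∫ x, v x * φ x) :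
    u =ᵐ[volume] v := by
  refine ae_eq_of_integral_contDiff_smul_eq hu hv fun φ h1 h2 => ?_
  simpa [mul_comm] using h φ ⟨h1, h2⟩

theorem IsTest.iteratedDeriv {φ : ℝ → ℝ} (h : IsTest φ) (n : ℕ) :
    IsTest (iteratedDeriv n φ) := by
  induction n with
  | zero => simpa using h
  | succ n ih =>
    rw [iteratedDeriv_succ]
    exact ⟨(contDiff_infty_iff_deriv.1 ih.1).2, ih.2.deriv⟩

theorem IsWeakDeriv.unique {i : ℕ} {u v w : ℝ → ℝ} (h : IsWeakDeriv i u v)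
    (h' : IsWeakDeriv i u w) : v =ᵐ[volume] w := by
  refine ae_eq_of_forall_isTest h.2.1 h'.2.1 fun φ hφ => ?_
  have := (h.2.2 φ hφ.1 hφ.2).symm.trans (h'.2.2 φ hφ.1 hφ.2)
  exact mul_left_cancel₀ (pow_ne_zero _ (by norm_num)) this

theorem isWeakDeriv_zero {u : ℝ → ℝ} (h : LocallyIntegrable u) : IsWeakDeriv 0 u u :=
  ⟨h, h, fun φ _ _ => by simp⟩

theorem iteratedDeriv_add_comp (i j : ℕ) (φ : ℝ → ℝ) :
    iteratedDeriv i (iteratedDeriv j φ) = iteratedDeriv (i + j) φ := by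
  simp only [iteratedDeriv_eq_iterate, Function.iterate_add_apply]

theorem IsWeakDeriv.comp {i j : ℕ} {u v w : ℝ → ℝ} (h : IsWeakDeriv i u v)
    (h' : IsWeakDeriv j v w) : IsWeakDeriv (i + j) u w := by
  refine ⟨h.1, h'.2.1, fun φ h1 h2 => ?_⟩
  have hφ : IsTest φ := ⟨h1, h2⟩
  rw [← iteratedDeriv_add_comp, h.2.2 _ (hφ.iteratedDeriv j).1 (hφ.iteratedDeriv j).2,
    h'.2.2 φ h1 h2]
  ring

theorem IsWeakDeriv.of_comp {i j : ℕ} {u v w : ℝ → ℝ} (h : IsWeakDeriv i u v)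
    (h' : IsWeakDeriv (i + j) u w) : IsWeakDeriv j v w := by
  refine ⟨h.2.1, h'.2.1, fun φ h1 h2 => ?_⟩
  have hφ : IsTest φ := ⟨h1, h2⟩
  have e1 := h.2.2 _ (hφ.iteratedDeriv j).1 (hφ.iteratedDeriv j).2
  rw [iteratedDeriv_add_comp, h'.2.2 φ h1 h2] at e1
  have : ((-1 : ℝ)) ^ i * ((-1) ^ i) = 1 := by
    rw [← mul_pow]; norm_num
  linear_combination (-1) ^ i * (-e1) - ((∫ x, v x * iteratedDeriv j φ x)
    - (-1) ^ j * ∫ x, w x * φ x) * this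

end

section

/-! ### Difference quotients -/

theorem abs_integral_mul_le {X : Type*} [MeasurableSpace X] {ν : Measure X} {f g : X → ℝ}
    (hf : MemLp f 2 ν) (hg : MemLp g 2 ν) :
    |∫ x, f x * g x ∂ν| ≤ (eLpNorm f 2 ν).toReal * (eLpNorm g 2 ν).toReal := by
  have h := abs_real_inner_le_norm hg.toLp hf.toLp
  rw [L2.inner_def, Lp.norm_toLp, Lp.norm_toLp, mul_comm] at h
  convert h using 2
  refine integral_congr_ae ?_
  filter_upwards [hf.coeFn_toLp, hg.coeFn_toLp] with x hx hx'
  rw [hx, hx']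
  simp

theorem integrable_mul_of_memLp {X : Type*} [MeasurableSpace X] {ν : Measure X} {f g : X → ℝ}
    (hf : MemLp f 2 ν) (hg : MemLp g 2 ν) : Integrable (fun x => f x * g x) ν :=
  hf.integrable_mul hg

theorem integral_mul_congr_ae {X : Type*} [MeasurableSpace X] {ν : Measure X} {u v ψ : X → ℝ}
    (h : u =ᵐ[ν] v) : ∫ x, u x * ψ x ∂ν = ∫ x, v x * ψ x ∂ν :=
  integral_congr_ae (by filter_upwards [h] with x hx; rw [hx])

theorem integral_sub_const_mul_mul {X : Type*} [MeasurableSpace X] {ν : Measure X} {u v ψ : X → ℝ}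
    (hu : MemLp u 2 ν) (hv : MemLp v 2 ν) (hψ : MemLp ψ 2 ν) (c : ℝ) :
    ∫ x, (u x - c * v x) * ψ x ∂ν = (∫ x, u x * ψ x ∂ν) - c * ∫ x, v x * ψ x ∂ν := by
  rw [← integral_const_mul, ← integral_sub (integrable_mul_of_memLp hu hψ)
    ((integrable_mul_of_memLp hv hψ).const_mul c)]
  simp only [sub_mul, mul_assoc]

section Directional

variable {E : Type*} [NormedAddCommGroup E] [NormedSpace ℝ E] [FiniteDimensional ℝ E]
  [MeasurableSpace E] [BorelSpace E] {ν : Measure E} [IsFiniteMeasureOnCompacts ν]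

/-- If `z ∈ L²` pairs with test functions like a function of norm at most `A`, then its norm is at
most `A`. -/
theorem eLpNorm_le_of_forall_test {z : E → ℝ} (hz : MemLp z 2 ν) {A : ℝ} (hA : 0 ≤ A)
    (h : ∀ φ, IsTest φ → |∫ x, z x * φ x ∂ν| ≤ A * (eLpNorm φ 2 ν).toReal) :
    eLpNorm z 2 ν ≤ ENNReal.ofReal A := by
  have key : ∀ ψ : Lp ℝ 2 ν, |inner ℝ ψ hz.toLp| ≤ A * ‖ψ‖ := by
    have hcl : IsClosed {ψ : Lp ℝ 2 ν | |inner ℝ ψ hz.toLp| ≤ A * ‖ψ‖} :=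
      isClosed_le (by fun_prop) (by fun_prop)
    have hd := Lp.dense_hasCompactSupport_contDiff (E := E) (F := ℝ) (μ := ν) (p := 2) (by norm_num)
    intro ψ
    refine (hcl.closure_subset_iff.2 ?_) (hd ψ)
    rintro ψ ⟨φ, hφ, h1, h2⟩
    have := h φ ⟨h2, h1⟩
    rw [mem_ofPred_eq, L2.inner_def, Lp.norm_def, eLpNorm_congr_ae hφ]
    convert this using 2
    refine integral_congr_ae ?_
    filter_upwards [hφ, hz.coeFn_toLp] with x hx hx'
    rw [hx, hx']
    simp
  have h1 := key hz.toLp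
  rw [real_inner_self_eq_norm_sq, abs_of_nonneg (by positivity), sq] at h1
  have h2 : ‖hz.toLp‖ ≤ A := by
    by_contra hc
    push Not at hc
    have : 0 < ‖hz.toLp‖ := hA.trans_lt hc
    nlinarith
  rw [Lp.norm_toLp] at h2
  exact (ENNReal.le_ofReal_iff_toReal_le hz.2.ne hA).2 h2

omit [FiniteDimensional ℝ E] in
theorem hasDerivAt_integral_translate [ProperSpace E] {w φ : E → ℝ} (hw : MemLp w 2 ν)
    (hφ : IsTest φ) (e : E) (s : ℝ) :
    HasDerivAt (fun s : ℝ => ∫ x, w x * φ (x + s • e) ∂ν)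
      (∫ x, w x * dirDeriv e φ (x + s • e) ∂ν) s := by
  obtain ⟨ρ, hρ⟩ := hφ.compact.isCompact.isBounded.subset_closedBall (0 : E)
  have hφ' := hφ.dirDeriv e
  obtain ⟨C, hC⟩ := hφ'.continuous.bounded_above_of_compact_support hφ'.compact
  set K : Set E := Metric.closedBall 0 (ρ + (|s| + 1) * ‖e‖) with hK
  have hKc : IsCompact K := isCompact_closedBall _ _
  have hwK : IntegrableOn w K ν := (hw.locallyIntegrable (by norm_num)).integrableOn_isCompact hKc
  refine (hasDerivAt_integral_of_dominated_loc_of_deriv_le (μ := ν)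
    (F := fun s x => w x * φ (x + s • e)) (F' := fun s x => w x * dirDeriv e φ (x + s • e))
    (bound := K.indicator fun x => ‖w x‖ * C) (s := Metric.ball s 1)
    (Metric.ball_mem_nhds s one_pos) ?_ ?_ ?_ ?_ ?_ ?_).2
  · refine Eventually.of_forall fun t => hw.1.mul ?_
    exact (hφ.translate (t • e)).continuous.aestronglyMeasurable
  · exact integrable_mul_of_memLp hw ((hφ.translate (s • e)).memLp ν 2)
  · exact hw.1.mul (hφ'.translate (s • e)).continuous.aestronglyMeasurable
  · refine Eventually.of_forall fun x t ht => ?_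
    by_cases hx : x ∈ K
    · rw [indicator_of_mem hx, norm_mul]
      exact mul_le_mul_of_nonneg_left (hC _) (norm_nonneg _)
    · have h0 : x + t • e ∉ tsupport (dirDeriv e φ) := by
        intro hx'
        refine hx ?_
        have h1 := hρ (tsupport_dirDeriv_subset hx')
        rw [mem_closedBall_zero_iff] at h1
        rw [hK, mem_closedBall_zero_iff]
        have h2 : |t| ≤ |s| + 1 := by
          rw [Metric.mem_ball, Real.dist_eq] at ht
          have := abs_sub_abs_le_abs_sub t s
          linarith
        calc ‖x‖ = ‖(x + t • e) - t • e‖ := by simp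
          _ ≤ ‖x + t • e‖ + ‖t • e‖ := norm_sub_le _ _
          _ ≤ ρ + (|s| + 1) * ‖e‖ := by
            rw [norm_smul, Real.norm_eq_abs]
            gcongr
      rw [indicator_of_notMem hx, image_eq_zero_of_notMem_tsupport h0, mul_zero, norm_zero]
  · exact (integrable_indicator_iff hKc.measurableSet).2 (hwK.norm.mul_const C)
  · refine Eventually.of_forall fun x t _ => ?_
    have h1 : HasDerivAt (fun t : ℝ => x + t • e) e t := by
      simpa using ((hasDerivAt_id t).smul_const e).const_add x
    have h2 := (hφ.differentiable (x + t • e)).hasFDerivAt.comp_hasDerivAt t h1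
    exact h2.const_mul (w x)

/-- `v` is the weak derivative of `u` in the direction `e`, both in `L²(ν)`. The test functions need
not vanish at the boundary. -/
def WeakDir (ν : Measure E) (e : E) (u v : E → ℝ) : Prop :=
  MemLp u 2 ν ∧ MemLp v 2 ν ∧
    ∀ φ, IsTest φ → ∫ x, u x * dirDeriv e φ x ∂ν = -∫ x, v x * φ x ∂ν

omit [FiniteDimensional ℝ E] [BorelSpace E] [IsFiniteMeasureOnCompacts ν] in
theorem integral_translate_mul [BorelSpace E] {e : E} (hν : ∀ s : ℝ, MeasurePreserving (fun x : E => x + s • e) ν ν)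
    (w φ : E → ℝ) (s : ℝ) :
    ∫ x, w (x + s • e) * φ x ∂ν = ∫ x, w x * φ (x + (-s) • e) ∂ν := by
  have := (hν s).integral_comp (Homeomorph.addRight (s • e)).measurableEmbedding
    (fun x => w x * φ (x + (-s) • e))
  rw [← this]
  congr 1
  ext x
  simp [add_assoc]

theorem WeakDir.eLpNorm_translate_sub_le {e : E} {u v : E → ℝ} (h : WeakDir ν e u v)
    (hν : ∀ s : ℝ, MeasurePreserving (fun x : E => x + s • e) ν ν) (s : ℝ) :
    eLpNorm (fun x => u (x + s • e) - u x) 2 ν ≤ ENNReal.ofReal |s| * eLpNorm v 2 ν := by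
  obtain ⟨hu, hv, h⟩ := h
  have hus : MemLp (fun x => u (x + s • e)) 2 ν := hu.comp_measurePreserving (hν s)
  have e1 : ENNReal.ofReal |s| * eLpNorm v 2 ν
      = ENNReal.ofReal (|s| * (eLpNorm v 2 ν).toReal) := by
    rw [ENNReal.ofReal_mul (abs_nonneg _), ENNReal.ofReal_toReal hv.2.ne]
  rw [e1]
  refine eLpNorm_le_of_forall_test (hus.sub hu) (by positivity) fun φ hφ => ?_
  have e2 : ∫ x, (u (x + s • e) - u x) * φ x ∂ν
      = (∫ x, u x * φ (x + (-s) • e) ∂ν) - ∫ x, u x * φ (x + (0 : ℝ) • e) ∂ν := by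
    simp only [sub_mul]
    rw [integral_sub (integrable_mul_of_memLp hus (hφ.memLp ν 2))
      (integrable_mul_of_memLp hu (hφ.memLp ν 2)), integral_translate_mul hν]
    simp
  change |∫ x, (u (x + s • e) - u x) * φ x ∂ν| ≤ _
  rw [e2]
  have := Convex.norm_image_sub_le_of_norm_hasDerivWithin_le (s := univ)
    (f := fun s : ℝ => ∫ x, u x * φ (x + s • e) ∂ν)
    (f' := fun s : ℝ => ∫ x, u x * dirDeriv e φ (x + s • e) ∂ν)
    (C := (eLpNorm v 2 ν).toReal * (eLpNorm φ 2 ν).toReal) (x := 0) (y := -s)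
    (fun t _ => (hasDerivAt_integral_translate hu hφ e t).hasDerivWithinAt) (fun t _ => by
      have h1 := h _ (hφ.translate (t • e))
      rw [dirDeriv_translate] at h1
      rw [h1, norm_neg, Real.norm_eq_abs]
      refine (abs_integral_mul_le hv ((hφ.translate (t • e)).memLp ν 2)).trans ?_
      rw [← eLpNorm_comp_measurePreserving (g := φ) hφ.continuous.aestronglyMeasurable (hν t)]
      rfl) convex_univ (mem_univ _) (mem_univ _)
  rw [Real.norm_eq_abs, Real.norm_eq_abs] at this
  refine this.trans_eq ?_
  rw [sub_zero, abs_neg]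
  ring

theorem exists_weakDir_of_translate_bound {e : E} {u : E → ℝ} (hu : MemLp u 2 ν)
    (hν : ∀ s : ℝ, MeasurePreserving (fun x : E => x + s • e) ν ν) {A : ℝ≥0∞} (hA : A ≠ ⊤)
    (h : ∀ s ∈ Ioc (0 : ℝ) 1, eLpNorm (fun x => u (x + s • e) - u x) 2 ν ≤ ENNReal.ofReal s * A) :
    ∃ v, WeakDir ν e u v ∧ eLpNorm v 2 ν ≤ A := by
  set t : ℕ → ℝ := fun n => 1 / ((n : ℝ) + 1) with ht
  have ht0 : ∀ n, 0 < t n := fun n => Nat.one_div_pos_of_nat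
  have ht1 : ∀ n, t n ≤ 1 := fun n => by
    rw [ht]; simp only; rw [div_le_one (by positivity)]; linarith [(Nat.cast_nonneg n : (0:ℝ) ≤ n)]
  have hz : ∀ n, MemLp (fun x => u (x + t n • e) - u x) 2 ν := fun n =>
    (hu.comp_measurePreserving (hν (t n))).sub hu
  set x : ℕ → WeakDual ℝ (Lp ℝ 2 ν) := fun n =>
    StrongDual.toWeakDual (InnerProductSpace.toDual ℝ (Lp ℝ 2 ν) ((t n)⁻¹ • (hz n).toLp)) with hx
  have hxA : ∀ n, x n ∈ (WeakDual.toStrongDual (𝕜 := ℝ) (E := Lp ℝ 2 ν)) ⁻¹' Metric.closedBall 0 A.toReal := by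
    intro n
    rw [mem_preimage, mem_closedBall_zero_iff]
    change ‖InnerProductSpace.toDual ℝ (Lp ℝ 2 ν) ((t n)⁻¹ • (hz n).toLp)‖ ≤ _
    rw [LinearIsometryEquiv.norm_map, norm_smul, Lp.norm_toLp, norm_inv, Real.norm_eq_abs,
      abs_of_pos (ht0 n), inv_mul_le_iff₀ (ht0 n)]
    have := ENNReal.toReal_mono (by finiteness) (h (t n) ⟨ht0 n, ht1 n⟩)
    rwa [ENNReal.toReal_mul, ENNReal.toReal_ofReal (ht0 n).le] at this
  obtain ⟨y, hy, hyc⟩ := (WeakDual.isCompact_closedBall (𝕜 := ℝ) (0 : StrongDual ℝ (Lp ℝ 2 ν))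
    A.toReal).exists_mapClusterPt (f := atTop) (u := x)
      (tendsto_principal.2 (Eventually.of_forall hxA))
  set v : Lp ℝ 2 ν := (InnerProductSpace.toDual ℝ (Lp ℝ 2 ν)).symm (WeakDual.toStrongDual y) with hv
  have hvn : ‖v‖ ≤ A.toReal := by
    rw [hv, LinearIsometryEquiv.norm_map]
    simpa [mem_closedBall_zero_iff] using hy
  refine ⟨v, ⟨hu, Lp.memLp v, fun φ hφ => ?_⟩, ?_⟩
  · have hφ2 := hφ.memLp ν 2
    have c1 : MapClusterPt (y hφ2.toLp) atTop fun n => x n hφ2.toLp :=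
      hyc.continuousAt_comp (WeakDual.eval_continuous _).continuousAt
    have c2 : Tendsto (fun n => x n hφ2.toLp) atTop (𝓝 (-∫ x, u x * dirDeriv e φ x ∂ν)) := by
      have hd := (hasDerivAt_integral_translate hu hφ e 0).tendsto_slope
      have htn : Tendsto (fun n => -t n) atTop (𝓝[≠] 0) := by
        refine tendsto_nhdsWithin_iff.2 ⟨?_, Eventually.of_forall fun n => ?_⟩
        · simpa [ht] using (tendsto_one_div_add_atTop_nhds_zero_nat (𝕜 := ℝ)).neg
        · exact neg_ne_zero.2 (ht0 n).ne'
      have := (hd.comp htn).neg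
      simp only [zero_smul, add_zero] at this
      refine this.congr fun n => ?_
      simp only [Function.comp, slope, vsub_eq_sub, smul_eq_mul, zero_smul, add_zero]
      change _ = inner ℝ ((t n)⁻¹ • (hz n).toLp) hφ2.toLp
      rw [real_inner_smul_left, L2.inner_def]
      have e1 : ∫ x, inner ℝ ((hz n).toLp _ x) (hφ2.toLp _ x) ∂ν
          = ∫ x, (u (x + t n • e) - u x) * φ x ∂ν := by
        refine integral_congr_ae ?_
        filter_upwards [(hz n).coeFn_toLp, hφ2.coeFn_toLp] with x hx hx'
        rw [hx, hx']
        simp [mul_comm]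
      rw [e1]
      simp only [sub_mul]
      have hus : MemLp (fun x => u (x + t n • e)) 2 ν := hu.comp_measurePreserving (hν (t n))
      rw [integral_sub (integrable_mul_of_memLp hus hφ2)
        (integrable_mul_of_memLp hu hφ2), integral_translate_mul hν, sub_zero, inv_neg]
      ring
    have c3 : y hφ2.toLp = -∫ x, u x * dirDeriv e φ x ∂ν := by
      by_contra hne
      obtain ⟨U, V, hU, hV, hyU, hV', hd⟩ := t2_separation hne
      obtain ⟨n, hn1, hn2⟩ := ((c1.frequently (hU.mem_nhds hyU)).and_eventually
        (c2.eventually (hV.mem_nhds hV'))).exists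
      exact (disjoint_left.1 hd) hn1 hn2
    have c4 : y hφ2.toLp = ∫ x, v x * φ x ∂ν := by
      have : y hφ2.toLp = inner ℝ v hφ2.toLp := by
        rw [hv, InnerProductSpace.toDual_symm_apply]; rfl
      rw [this, L2.inner_def]
      refine integral_congr_ae ?_
      filter_upwards [hφ2.coeFn_toLp] with x hx'
      rw [hx']
      simp [mul_comm]
    rw [← c4, c3, neg_neg]
  · rw [Lp.norm_def] at hvn
    exact (ENNReal.toReal_le_toReal (Lp.eLpNorm_ne_top v) hA).1 hvn

end Directional

/-! ### Tangential derivatives on the half-plane -/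

theorem measurePreserving_translate (s : ℝ) :
    MeasurePreserving (fun x : ℝ × ℝ => x + s • ((1, 0) : ℝ × ℝ)) volHalf volHalf := by
  have h := (measurePreserving_add_right (volume : Measure (ℝ × ℝ)) (s • ((1, 0) : ℝ × ℝ))).restrict_preimage
    measurableSet_halfPlane
  have e : (fun x : ℝ × ℝ => x + s • ((1, 0) : ℝ × ℝ)) ⁻¹' halfPlane = halfPlane := by
    ext x; simp [halfPlane]
  rwa [e] at h

theorem measurePreserving_translate_line (s : ℝ) :
    MeasurePreserving (fun x : ℝ => x + s • (1 : ℝ)) volume volume :=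
  measurePreserving_add_right volume (s • (1 : ℝ))

theorem weakDir_of_isWeakPartial {w wR : ℝ × ℝ → ℝ} (h : IsWeakPartial 1 0 w wR)
    (hw : MemLp w 2 volHalf) (hwR : MemLp wR 2 volHalf) : WeakDir volHalf (1, 0) w wR := by
  refine ⟨hw, hwR, fun φ hφ => ?_⟩
  set ζ : ℕ → ℝ × ℝ → ℝ := fun n x => Real.smoothTransition (n * x.2 - 1) with hζ
  have hζs : ∀ n, ContDiff ℝ ∞ (ζ n) := fun n =>
    Real.smoothTransition.contDiff.comp ((contDiff_const.mul contDiff_snd).sub contDiff_const)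
  have hζ1 : ∀ n x, ‖ζ n x‖ ≤ 1 := fun n x => by
    rw [Real.norm_eq_abs, abs_of_nonneg (Real.smoothTransition.nonneg _)]
    exact Real.smoothTransition.le_one _
  have hζd : ∀ n, dirDeriv (1, 0) (ζ n) = 0 := by
    intro n
    ext x
    have h1 : HasFDerivAt (fun x : ℝ × ℝ => Real.smoothTransition (n * x.2 - 1)) _ x :=
      HasFDerivAt.comp (g := fun H : ℝ => Real.smoothTransition (n * H - 1)) x
        (((Real.smoothTransition.contDiff (n := 1)).differentiable (by simp)).comp
          ((differentiable_id.const_mul _).sub_const _) x.2).hasFDerivAt hasFDerivAt_snd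
    rw [dirDeriv, hζ]
    simp only
    rw [h1.fderiv]
    simp
  have hζt : ∀ x ∈ halfPlane, Tendsto (fun n => ζ n x) atTop (𝓝 1) := by
    intro x hx
    refine tendsto_const_nhds.congr' ?_
    obtain ⟨N, hN⟩ := exists_nat_gt (2 / x.2)
    filter_upwards [eventually_ge_atTop N] with n hn
    have hx : 0 < x.2 := hx
    have : 2 / x.2 ≤ n := hN.le.trans (by exact_mod_cast hn)
    rw [div_le_iff₀ hx] at this
    exact (Real.smoothTransition.one_of_one_le (by linarith)).symm
  have hsupp : ∀ n, tsupport (fun x => ζ n x * φ x) ⊆ halfPlane := by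
    intro n x hx
    have hcl : IsClosed {x : ℝ × ℝ | 1 ≤ n * x.2} := isClosed_le continuous_const (by fun_prop)
    have : x ∈ {x : ℝ × ℝ | 1 ≤ n * x.2} := by
      refine closure_minimal ?_ hcl hx
      intro y hy
      by_contra hc
      refine hy ?_
      rw [mem_ofPred_eq, not_le] at hc
      simp only [hζ]
      rw [Real.smoothTransition.zero_of_nonpos (by linarith), zero_mul]
    by_contra hc
    have hc : x.2 ≤ 0 := not_lt.1 hc
    have h2 : 1 ≤ n * x.2 := this
    nlinarith [(Nat.cast_nonneg n : (0:ℝ) ≤ n)]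
  have key : ∀ n, ∫ x in halfPlane, ζ n x * (w x * dirDeriv (1, 0) φ x)
      = -∫ x in halfPlane, ζ n x * (wR x * φ x) := by
    intro n
    have := h.test (hφ.mul_left (hζs n)) (hsupp n)
    rw [partialDeriv_one_zero, dirDeriv_mul ((hζs n).differentiable (by simp)) hφ.differentiable,
      hζd] at this
    simp only [Pi.zero_apply, zero_mul, zero_add] at this
    calc _ = _ := by congr 1; ext x; ring
      _ = _ := this
      _ = _ := by
        have e : ∫ x in halfPlane, wR x * (ζ n x * φ x) = ∫ x in halfPlane, ζ n x * (wR x * φ x) := by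
          congr 1; ext x; ring
        rw [e]; norm_num
  have lim : ∀ g : ℝ × ℝ → ℝ, Integrable g volHalf →
      Tendsto (fun n => ∫ x in halfPlane, ζ n x * g x) atTop (𝓝 (∫ x in halfPlane, g x)) := by
    intro g hg
    refine tendsto_integral_of_dominated_convergence (fun x => ‖g x‖)
      (fun n => (hζs n).continuous.aestronglyMeasurable.mul hg.1) hg.norm (fun n => ?_) ?_
    · refine Eventually.of_forall fun x => ?_
      rw [norm_mul]
      exact mul_le_of_le_one_left (norm_nonneg _) (hζ1 n x)
    · filter_upwards [ae_restrict_mem measurableSet_halfPlane] with x hx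
      simpa using (hζt x hx).mul_const (g x)
  have l1 := lim _ (integrable_mul_of_memLp hw ((hφ.dirDeriv (1, 0)).memLp volHalf 2))
  have l2 := (lim _ (integrable_mul_of_memLp hwR (hφ.memLp volHalf 2))).neg
  simp only [key] at l1
  exact tendsto_nhds_unique l1 l2

theorem WeakDir.isWeakPartial {w wR : ℝ × ℝ → ℝ} (h : WeakDir volHalf (1, 0) w wR) :
    IsWeakPartial 1 0 w wR :=
  ⟨MemLp.locallyIntegrableOn_halfPlane h.1, MemLp.locallyIntegrableOn_halfPlane h.2.1,
    fun φ h1 h2 _ => by simpa [partialDeriv_one_zero] using h.2.2 φ ⟨h1, h2⟩⟩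

theorem dirDeriv_one (φ : ℝ → ℝ) : dirDeriv 1 φ = iteratedDeriv 1 φ := by
  ext x; simp [dirDeriv]

theorem weakDir_of_isWeakDeriv {g h : ℝ → ℝ} (hd : IsWeakDeriv 1 g h) (hg : MemLp g 2)
    (hh : MemLp h 2) : WeakDir volume 1 g h :=
  ⟨hg, hh, fun φ hφ => by
    rw [dirDeriv_one, hd.2.2 φ hφ.1 hφ.2]; simp⟩

theorem partialDeriv_translate (i j : ℕ) (φ : ℝ × ℝ → ℝ) (a : ℝ × ℝ) :
    partialDeriv i j (fun x => φ (x + a)) = fun x => partialDeriv i j φ (x + a) := by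
  have key : ∀ (e : ℝ × ℝ) (n : ℕ) (ψ : ℝ × ℝ → ℝ),
      (dirDeriv e)^[n] (fun x => ψ (x + a)) = fun x => (dirDeriv e)^[n] ψ (x + a) := by
    intro e n
    induction n with
    | zero => intro ψ; rfl
    | succ n ih =>
      intro ψ
      rw [Function.iterate_succ_apply, dirDeriv_translate, ih, ← Function.iterate_succ_apply]
  change (dirDeriv (1, 0))^[i] ((dirDeriv (0, 1))^[j] _) = fun x =>
    (dirDeriv (1, 0))^[i] ((dirDeriv (0, 1))^[j] φ) (x + a)
  rw [key, key]

theorem L2Bound.translate {u : ℝ × ℝ → ℝ} {A : ℝ≥0∞} (h : L2Bound u A) (s : ℝ) :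
    L2Bound (fun x => u (x + s • ((1, 0) : ℝ × ℝ))) A :=
  ⟨h.1.comp_measurePreserving (measurePreserving_translate s),
    (eLpNorm_comp_measurePreserving h.1.1 (measurePreserving_translate s)).trans_le h.2⟩

theorem IsWeakPartial.translate {i j : ℕ} {u v : ℝ × ℝ → ℝ} (h : IsWeakPartial i j u v)
    (hu : MemLp u 2 volHalf) (hv : MemLp v 2 volHalf) (s : ℝ) :
    IsWeakPartial i j (fun x => u (x + s • ((1, 0) : ℝ × ℝ)))
      (fun x => v (x + s • ((1, 0) : ℝ × ℝ))) := by
  refine ⟨(L2Bound.translate ⟨hu, le_rfl⟩ s).locallyIntegrableOn,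
    (L2Bound.translate ⟨hv, le_rfl⟩ s).locallyIntegrableOn, fun φ h1 h2 h3 => ?_⟩
  have hφ : IsTest φ := ⟨h1, h2⟩
  rw [integral_translate_mul measurePreserving_translate,
    integral_translate_mul measurePreserving_translate,
    ← h.test (hφ.translate ((-s) • ((1, 0) : ℝ × ℝ))) ?_, partialDeriv_translate]
  intro x hx
  have h4 := tsupport_comp_subset_preimage φ (f := fun x => x + (-s) • ((1, 0) : ℝ × ℝ))
    (by fun_prop) hx
  have := h3 h4
  simpa [halfPlane] using this

/-- If all difference quotients are bounded by `A` in `H^k`, then so is the derivative. -/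
theorem SobBound.exists_fst {k : ℕ} {u : ℝ × ℝ → ℝ} {A B : ℝ≥0∞} (hA : A ≠ ⊤) (hu : SobBound k u B)
    (h : ∀ s ∈ Ioc (0 : ℝ) 1, SobBound k
      (fun x => s⁻¹ * (u (x + s • ((1, 0) : ℝ × ℝ)) - u x)) A) :
    ∃ uR, IsWeakPartial 1 0 u uR ∧ SobBound k uR A := by
  obtain ⟨D, hD⟩ := hu.exists_family
  have key : ∀ i j, i + j ≤ k → ∃ v, WeakDir volHalf (1, 0) (D i j) v ∧ eLpNorm v 2 volHalf ≤ A := by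
    intro i j hij
    obtain ⟨hw, hl⟩ := hD i j hij
    refine exists_weakDir_of_translate_bound hl.1 measurePreserving_translate hA fun s hs => ?_
    obtain ⟨D', hD'⟩ := (h s hs).exists_family
    obtain ⟨hw', hl'⟩ := hD' i j hij
    have h1 := ((hw.translate hu.l2Bound.1 hl.1 s).sub hw).const_mul s⁻¹
    have h2 := hl'.congr (hw'.unique h1)
    have h3 := (h2.const_mul s).2
    have e : ∀ x, s * (s⁻¹ * (D i j (x + s • ((1, 0) : ℝ × ℝ)) - D i j x))
        = D i j (x + s • ((1, 0) : ℝ × ℝ)) - D i j x := fun x => by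
      rw [← mul_assoc, mul_inv_cancel₀ hs.1.ne', one_mul]
    simp only [e] at h3
    have e2 : (‖s‖₊ : ℝ≥0∞) = ENNReal.ofReal s := by
      rw [← Real.enorm_of_nonneg hs.1.le]; rfl
    rwa [e2] at h3
  obtain ⟨v, hv, hvA⟩ := key 0 0 (by omega)
  have hD0 : D 0 0 =ᵐ[volHalf] u :=
    (hD 0 0 (by omega)).1.unique (isWeakPartial_zero_zero hu.l2Bound.locallyIntegrableOn)
  have huv : IsWeakPartial 1 0 u v := hv.isWeakPartial.congr hD0 .rfl
  choose! V hV using key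
  refine ⟨v, huv, SobBound.of_family (D := V) fun i j hij => ⟨?_, (hV i j hij).1.2.1,
    (hV i j hij).2⟩⟩
  have := (hD i j hij).1.comp (hV i j hij).1.isWeakPartial
  refine huv.of_comp (i' := i) (j' := j) ?_
  rwa [zero_add, add_comm 1 i]

end

section

/-! ### The Slobodeckij seminorm -/

theorem eLpNorm_two_sq {X : Type*} [MeasurableSpace X] (ν : Measure X) (f : X → ℝ) :
    eLpNorm f 2 ν ^ 2 = ∫⁻ x, ‖f x‖ₑ ^ 2 ∂ν := by
  rw [eLpNorm_eq_lintegral_rpow_enorm_toReal (by norm_num) (by norm_num), ← ENNReal.rpow_natCast,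
    ← ENNReal.rpow_mul]
  norm_num

theorem lintegral_mul_sq_le {X : Type*} [MeasurableSpace X] {ν : Measure X} {f g : X → ℝ≥0∞}
    (hf : AEMeasurable f ν) (hg : AEMeasurable g ν) :
    (∫⁻ x, f x * g x ∂ν) ^ 2 ≤ (∫⁻ x, f x ^ 2 ∂ν) * ∫⁻ x, g x ^ 2 ∂ν := by
  have h := ENNReal.lintegral_mul_le_Lp_mul_Lq ν Real.HolderConjugate.two_two hf hg
  have h2 : (∫⁻ x, f x * g x ∂ν) ^ 2 ≤ ((∫⁻ x, f x ^ (2:ℝ) ∂ν) ^ (1 / 2 : ℝ)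
      * (∫⁻ x, g x ^ (2:ℝ) ∂ν) ^ (1 / 2 : ℝ)) ^ 2 := by gcongr; exact h
  refine h2.trans_eq ?_
  rw [mul_pow, ← ENNReal.rpow_natCast, ← ENNReal.rpow_natCast, ← ENNReal.rpow_mul,
    ← ENNReal.rpow_mul]
  norm_num

/-- The square of the Slobodeckij seminorm. -/
noncomputable def slobSemi (g : ℝ → ℝ) : ℝ≥0∞ :=
  ∫⁻ x, ∫⁻ y, ENNReal.ofReal ((g x - g y) ^ 2 / |x - y| ^ 2)

theorem aemeasurable_comp_add {g : ℝ → ℝ} (hg : AEStronglyMeasurable g volume) :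
    AEStronglyMeasurable (fun p : ℝ × ℝ => g (p.1 + p.2)) (volume.prod volume) :=
  hg.comp_quasiMeasurePreserving (quasiMeasurePreserving_add volume volume)

theorem slobSemi_eq {g : ℝ → ℝ} (hg : AEStronglyMeasurable g volume) :
    slobSemi g = ∫⁻ h, ENNReal.ofReal ((h ^ 2)⁻¹)
      * eLpNorm (fun x => g (x + h • (1 : ℝ)) - g x) 2 volume ^ 2 := by
  have e1 : slobSemi g = ∫⁻ x, ∫⁻ h, ENNReal.ofReal ((h ^ 2)⁻¹) * ‖g (x + h) - g x‖ₑ ^ 2 := by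
    refine lintegral_congr fun x => ?_
    rw [← lintegral_add_left_eq_self _ x]
    refine lintegral_congr fun h => ?_
    rw [div_eq_inv_mul, ENNReal.ofReal_mul (by positivity), Real.enorm_eq_ofReal_abs,
      ← ENNReal.ofReal_pow (abs_nonneg _), sq_abs, sq_abs]
    congr 2
    · congr 1; ring
    · ring
  rw [e1, lintegral_lintegral_swap]
  · refine lintegral_congr fun h => ?_
    rw [lintegral_const_mul' _ _ ENNReal.ofReal_ne_top, eLpNorm_two_sq]
    simp
  · have h1 : AEMeasurable (fun p : ℝ × ℝ => ENNReal.ofReal ((p.2 ^ 2)⁻¹)) (volume.prod volume) :=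
      (Measurable.ennreal_ofReal (by fun_prop)).aemeasurable
    exact h1.mul (((aemeasurable_comp_add hg).sub hg.comp_fst).enorm.pow_const 2)

theorem slobSemi_congr {g h : ℝ → ℝ} (hgh : g =ᵐ[volume] h) : slobSemi g = slobSemi h := by
  refine lintegral_congr_ae ?_
  filter_upwards [hgh] with x hx
  refine lintegral_congr_ae ?_
  filter_upwards [hgh] with y hy
  rw [hx, hy]

/-- `g ∈ H^{1/2}(ℝ)` with norm at most `A`, up to a constant. -/
def HalfBound (g : ℝ → ℝ) (A : ℝ≥0∞) : Prop :=
  MemLp g 2 volume ∧ eLpNorm g 2 volume ≤ A ∧ slobSemi g ≤ A ^ 2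

theorem HalfBound.mono {g : ℝ → ℝ} {A B : ℝ≥0∞} (h : HalfBound g A) (hAB : A ≤ B) :
    HalfBound g B := ⟨h.1, h.2.1.trans hAB, h.2.2.trans (by gcongr)⟩

theorem HalfBound.congr {g h : ℝ → ℝ} {A : ℝ≥0∞} (hg : HalfBound g A) (hgh : g =ᵐ[volume] h) :
    HalfBound h A :=
  ⟨hg.1.ae_eq hgh, (eLpNorm_congr_ae hgh).symm.trans_le hg.2.1,
    (slobSemi_congr hgh).symm.trans_le hg.2.2⟩

theorem HalfBound.slobodeckijNorm_le {k : ℕ} {g : ℝ → ℝ} {D : ℕ → ℝ → ℝ} {A : ℝ≥0∞}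
    (hD : ∀ i ≤ k, IsWeakDeriv i g (D i) ∧ HalfBound (D i) A) :
    slobodeckijNorm k g ≤ (k + 2) * A := by
  refine (iInf₂_le D fun i hi => (hD i hi).1).trans ?_
  rw [← sq_rpow_half ((k + 2) * A)]
  refine ENNReal.rpow_le_rpow ?_ (by norm_num)
  calc _ ≤ ∑ i ∈ Finset.range (k + 1), A ^ 2 + A ^ 2 := by
        refine add_le_add (Finset.sum_le_sum fun i hi => ?_) (hD k le_rfl).2.2.2
        gcongr
        exact (hD i (Nat.lt_succ_iff.1 (Finset.mem_range.1 hi))).2.2.1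
    _ = (k + 2) * A ^ 2 := by simp; ring
    _ ≤ ((k + 2) * A) ^ 2 := by
      rw [mul_pow]
      gcongr
      refine le_self_pow₀ ?_ (by norm_num)
      exact le_add_left (by norm_num)

theorem lintegral_Ioi_inv_sq : ∫⁻ h in Ioi (1 : ℝ), ENNReal.ofReal ((h ^ 2)⁻¹) = 1 := by
  have e : ∀ h ∈ Ioi (1 : ℝ), (h ^ 2)⁻¹ = h ^ (-2 : ℝ) := fun h hh => by
    have : (0 : ℝ) ≤ h := zero_le_one.trans (le_of_lt hh)
    rw [Real.rpow_neg this]; norm_num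
  rw [setLIntegral_congr_fun measurableSet_Ioi fun h hh => by rw [e h hh],
    ← ofReal_integral_eq_lintegral_ofReal (integrableOn_Ioi_rpow_of_lt (by norm_num) one_pos),
    integral_Ioi_rpow_of_lt (by norm_num) one_pos]
  · norm_num
  · filter_upwards [ae_restrict_mem measurableSet_Ioi] with h hh
    exact Real.rpow_nonneg (zero_le_one.trans (le_of_lt hh)) _

theorem slobSemi_le_of_weakDir {g g' : ℝ → ℝ} (h : WeakDir volume 1 g g') {A : ℝ≥0∞}
    (hA : eLpNorm g 2 volume ≤ A) (hA' : eLpNorm g' 2 volume ≤ A) : slobSemi g ≤ 10 * A ^ 2 := by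
  rw [slobSemi_eq h.1.1]
  set F : ℝ → ℝ≥0∞ := fun t => ENNReal.ofReal ((t ^ 2)⁻¹)
      * eLpNorm (fun x => g (x + t • (1 : ℝ)) - g x) 2 volume ^ 2 with hF
  have b1 : ∀ t, F t ≤ A ^ 2 := by
    intro t
    by_cases ht : t = 0
    · simp [hF, ht]
    have h1 := h.eLpNorm_translate_sub_le measurePreserving_translate_line t
    calc F t ≤ ENNReal.ofReal ((t ^ 2)⁻¹) * (ENNReal.ofReal |t| * A) ^ 2 := by
          simp only [hF]; gcongr; exact h1.trans (by gcongr)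
      _ = A ^ 2 := by
          rw [mul_pow, ← mul_assoc, ← ENNReal.ofReal_pow (abs_nonneg _), sq_abs,
            ← ENNReal.ofReal_mul (by positivity), inv_mul_cancel₀ (by positivity),
            ENNReal.ofReal_one, one_mul]
  have b2 : ∀ t, F t ≤ ENNReal.ofReal ((t ^ 2)⁻¹) * (4 * A ^ 2) := by
    intro t
    simp only [hF]
    gcongr
    have : eLpNorm (fun x => g (x + t • (1 : ℝ)) - g x) 2 volume ≤ A + A := by
      refine (eLpNorm_sub_le (h.1.comp_measurePreserving (measurePreserving_translate_line t)).1
        h.1.1 (by norm_num)).trans (add_le_add ?_ hA)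
      exact (eLpNorm_comp_measurePreserving h.1.1 (measurePreserving_translate_line t)).trans_le hA
    calc _ ≤ (A + A) ^ 2 := by gcongr
      _ = 4 * A ^ 2 := by ring
  have c1 : ∫⁻ t in Icc (-1) 1, F t ≤ 2 * A ^ 2 := by
    calc _ ≤ ∫⁻ t in Icc (-1 : ℝ) 1, A ^ 2 := lintegral_mono fun t => b1 t
      _ = 2 * A ^ 2 := by
        rw [setLIntegral_const, Real.volume_Icc, mul_comm]; norm_num
  have c2 : ∫⁻ t in Ioi 1, F t ≤ 4 * A ^ 2 := by
    calc _ ≤ ∫⁻ t in Ioi (1 : ℝ), ENNReal.ofReal ((t ^ 2)⁻¹) * (4 * A ^ 2) :=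
          lintegral_mono fun t => b2 t
      _ = 4 * A ^ 2 := by
        rw [lintegral_mul_const _ (Measurable.ennreal_ofReal (by fun_prop)), lintegral_Ioi_inv_sq,
          one_mul]
  have c3 : ∫⁻ t in Iio (-1), F t ≤ 4 * A ^ 2 := by
    calc _ ≤ ∫⁻ t in Iio (-1 : ℝ), ENNReal.ofReal ((t ^ 2)⁻¹) * (4 * A ^ 2) :=
          lintegral_mono fun t => b2 t
      _ = ∫⁻ t in Ioi (1 : ℝ), ENNReal.ofReal ((t ^ 2)⁻¹) * (4 * A ^ 2) := by
        have := (Measure.measurePreserving_neg (volume : Measure ℝ)).setLIntegral_comp_preimage_emb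
          (Homeomorph.neg ℝ).measurableEmbedding
          (fun t => ENNReal.ofReal ((t ^ 2)⁻¹) * (4 * A ^ 2)) (Iio (-1))
        rw [← this]
        simp
      _ = 4 * A ^ 2 := by
        rw [lintegral_mul_const _ (Measurable.ennreal_ofReal (by fun_prop)), lintegral_Ioi_inv_sq,
          one_mul]
  have hU : (univ : Set ℝ) = (Icc (-1) 1 ∪ Ioi 1) ∪ Iio (-1) := by
    ext t; simp
  calc ∫⁻ t, F t = ∫⁻ t in univ, F t := by rw [Measure.restrict_univ]
    _ ≤ ((∫⁻ t in Icc (-1) 1, F t) + ∫⁻ t in Ioi 1, F t) + ∫⁻ t in Iio (-1), F t := by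
      rw [hU]
      exact (lintegral_union_le _ _ _).trans (add_le_add_left (lintegral_union_le _ _ _) _)
    _ ≤ (2 * A ^ 2 + 4 * A ^ 2) + 4 * A ^ 2 := by gcongr
    _ = 10 * A ^ 2 := by ring

theorem exists_family_of_slobodeckijNorm {k : ℕ} {g : ℝ → ℝ} (h : slobodeckijNorm k g < ⊤) :
    ∃ D : ℕ → ℝ → ℝ, ∀ i ≤ k, IsWeakDeriv i g (D i) ∧ HalfBound (D i) (4 * slobodeckijNorm k g) := by
  have h' := h
  rw [slobodeckijNorm, iInf_lt_iff] at h'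
  obtain ⟨D, h'⟩ := h'
  rw [iInf_lt_iff] at h'
  obtain ⟨hD, h'⟩ := h'
  have key : ∀ i ≤ k, eLpNorm (D i) 2 volume ≤ slobodeckijNorm k g := by
    intro i hi
    refine le_iInf₂ fun D' hD' => ?_
    rw [eLpNorm_congr_ae ((hD i hi).unique (hD' i hi)), ← sq_rpow_half (eLpNorm _ _ _)]
    refine ENNReal.rpow_le_rpow (le_add_right ?_) (by norm_num)
    exact Finset.single_le_sum (f := fun i => eLpNorm (D' i) 2 volume ^ 2) (fun _ _ => zero_le)
      (Finset.mem_range.2 (Nat.lt_succ_of_le hi))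
  have key2 : slobSemi (D k) ≤ slobodeckijNorm k g ^ 2 := by
    have : (slobSemi (D k)) ^ (1 / 2 : ℝ) ≤ slobodeckijNorm k g := by
      refine le_iInf₂ fun D' hD' => ?_
      rw [slobSemi_congr ((hD k le_rfl).unique (hD' k le_rfl))]
      exact ENNReal.rpow_le_rpow le_add_self (by norm_num)
    calc _ = ((slobSemi (D k)) ^ (1 / 2 : ℝ)) ^ 2 := by
          rw [← ENNReal.rpow_natCast, ← ENNReal.rpow_mul]; norm_num
      _ ≤ _ := by gcongr
  have hm : ∀ i ≤ k, MemLp (D i) 2 volume := fun i hi =>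
    ⟨(hD i hi).2.1.aestronglyMeasurable, (key i hi).trans_lt h⟩
  have h4 : slobodeckijNorm k g ≤ 4 * slobodeckijNorm k g :=
    le_mul_of_one_le_left zero_le (by norm_num)
  refine ⟨D, fun i hi => ⟨hD i hi, hm i hi, (key i hi).trans h4, ?_⟩⟩
  rcases hi.lt_or_eq with hi' | rfl
  · have hw : IsWeakDeriv 1 (D i) (D (i + 1)) := (hD i hi).of_comp (hD (i + 1) hi')
    refine (slobSemi_le_of_weakDir (weakDir_of_isWeakDeriv hw (hm i hi) (hm (i + 1) hi'))
      (key i hi) (key (i + 1) hi')).trans ?_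
    rw [mul_pow]
    gcongr
    norm_num
  · refine key2.trans ?_
    gcongr

end

section

/-! ### Boundary values of test functions -/

theorem IsTest.slice_snd {φ : ℝ × ℝ → ℝ} (hφ : IsTest φ) (H : ℝ) : IsTest fun r => φ (r, H) := by
  refine ⟨hφ.smooth.comp (contDiff_id.prodMk contDiff_const), ?_⟩
  exact hφ.compact.comp_isClosedEmbedding (Isometry.isClosedEmbedding
    (Isometry.of_dist_eq fun a b => by simp [Prod.dist_eq]))

theorem IsTest.slice_fst {φ : ℝ × ℝ → ℝ} (hφ : IsTest φ) (r : ℝ) : IsTest fun H => φ (r, H) := by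
  refine ⟨hφ.smooth.comp (contDiff_const.prodMk contDiff_id), ?_⟩
  exact hφ.compact.comp_isClosedEmbedding (Isometry.isClosedEmbedding
    (Isometry.of_dist_eq fun a b => by simp [Prod.dist_eq]))

theorem dirDeriv_slice_snd {φ : ℝ × ℝ → ℝ} (hφ : IsTest φ) (H : ℝ) :
    dirDeriv 1 (fun r => φ (r, H)) = fun r => dirDeriv (1, 0) φ (r, H) := by
  ext r
  have h : HasDerivAt (fun r => φ (r, H)) (fderiv ℝ φ (r, H) (1, 0)) r :=
    (hφ.differentiable (r, H)).hasFDerivAt.comp_hasDerivAt r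
      ((hasDerivAt_id r).prodMk (hasDerivAt_const r H))
  rw [dirDeriv_one, iteratedDeriv_one, h.deriv, dirDeriv]

theorem hasDerivAt_slice_fst {φ : ℝ × ℝ → ℝ} (hφ : IsTest φ) (r H : ℝ) :
    HasDerivAt (fun H => φ (r, H)) (dirDeriv (0, 1) φ (r, H)) H :=
  (hφ.differentiable (r, H)).hasFDerivAt.comp_hasDerivAt H
    ((hasDerivAt_const H r).prodMk (hasDerivAt_id H))

theorem IsTest.exists_box {φ : ℝ × ℝ → ℝ} (hφ : IsTest φ) :
    ∃ n C : ℝ, 0 ≤ n ∧ (∀ x, |φ x| ≤ C) ∧ ∀ x, φ x ≠ 0 → |x.1| ≤ n ∧ |x.2| ≤ n := by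
  obtain ⟨n, hn⟩ := hφ.compact.isCompact.isBounded.subset_closedBall (0 : ℝ × ℝ)
  obtain ⟨C, hC⟩ := hφ.continuous.bounded_above_of_compact_support hφ.compact
  refine ⟨max n 0, C, le_max_right _ _, hC, fun x hx => ?_⟩
  have := hn (subset_tsupport φ hx)
  rw [mem_closedBall_zero_iff, Prod.norm_def, max_le_iff] at this
  exact ⟨this.1.trans (le_max_left _ _), this.2.trans (le_max_left _ _)⟩

/-- Integrability of `g(R) Q(R, H)` for `g ∈ L²` and `Q` bounded with bounded support. -/
theorem integrable_fst_mul {g : ℝ → ℝ} (hg : MemLp g 2 volume) {Q : ℝ × ℝ → ℝ}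
    (hQm : AEStronglyMeasurable Q volHalf) {n C : ℝ}
    (hC : ∀ᵐ x ∂volHalf, |Q x| ≤ C) (hn : ∀ᵐ x ∂volHalf, Q x ≠ 0 → |x.1| ≤ n ∧ |x.2| ≤ n) :
    Integrable (fun x => g x.1 * Q x) volHalf := by
  have hg1 : Integrable ((Icc (-n) n).indicator g) volume :=
    (integrable_indicator_iff measurableSet_Icc).2
      ((hg.locallyIntegrable (by norm_num)).integrableOn_isCompact isCompact_Icc)
  have h1 : Integrable ((Icc (-n) n).indicator fun _ => C) ((volume : Measure ℝ).restrict (Ioi 0)) :=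
    ((integrable_indicator_iff measurableSet_Icc).2 (continuous_const.integrableOn_Icc)).restrict
  have h2 := hg1.mul_prod h1
  have hgm : AEStronglyMeasurable (fun x : ℝ × ℝ => g x.1) volHalf := by
    rw [volHalf_eq_prod]; exact hg.1.comp_fst
  rw [← volHalf_eq_prod] at h2
  refine h2.mono (hgm.mul hQm) ?_
  filter_upwards [hC, hn] with x hx hx'
  by_cases h0 : Q x = 0
  · rw [h0, mul_zero, norm_zero]; positivity
  · obtain ⟨a, b⟩ := hx' h0
    have ha : x.1 ∈ Icc (-n) n := abs_le.1 a
    have hb : x.2 ∈ Icc (-n) n := abs_le.1 b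
    rw [indicator_of_mem ha, indicator_of_mem hb, norm_mul, norm_mul]
    gcongr
    exact hx.trans (le_abs_self C)

theorem IsTest.integrable_fst_mul {g : ℝ → ℝ} (hg : MemLp g 2 volume) {φ : ℝ × ℝ → ℝ}
    (hφ : IsTest φ) : Integrable (fun x => g x.1 * φ x) volHalf := by
  obtain ⟨n, C, _, hC, hn⟩ := hφ.exists_box
  exact ContactModel.integrable_fst_mul hg hφ.continuous.aestronglyMeasurable
    (Eventually.of_forall hC) (Eventually.of_forall hn)

/-- The divergence theorem in the direction of `H`, with a factor depending on `R`. -/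
theorem integral_fst_mul_dirDeriv_snd {g : ℝ → ℝ} (hg : MemLp g 2 volume) {φ : ℝ × ℝ → ℝ}
    (hφ : IsTest φ) :
    ∫ x in halfPlane, g x.1 * dirDeriv (0, 1) φ x = -∫ r, g r * φ (r, 0) := by
  have hi := (hφ.dirDeriv (0, 1)).integrable_fst_mul hg
  change ∫ x, g x.1 * dirDeriv (0, 1) φ x ∂volHalf = _
  rw [volHalf_eq_prod] at hi ⊢
  rw [integral_prod _ hi, ← integral_neg]
  congr 1
  ext r
  change ∫ H in Ioi (0 : ℝ), g r * dirDeriv (0, 1) φ (r, H) = _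
  rw [integral_const_mul]
  have := HasCompactSupport.integral_Ioi_deriv_eq
    (((hφ.slice_fst r).smooth.of_le (by exact_mod_cast le_top) : ContDiff ℝ 1 _))
    (hφ.slice_fst r).compact 0
  have e : ∀ H, deriv (fun H => φ (r, H)) H = dirDeriv (0, 1) φ (r, H) := fun H =>
    (hasDerivAt_slice_fst hφ r H).deriv
  simp only [e] at this
  rw [this]
  ring

theorem integral_dirDeriv_snd {φ : ℝ × ℝ → ℝ} (hφ : IsTest φ) :
    ∫ x in halfPlane, dirDeriv (0, 1) φ x = -∫ r, φ (r, 0) := by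
  obtain ⟨n, _, hn0, _, hn⟩ := hφ.exists_box
  have hφ' := (hφ.dirDeriv (0, 1))
  have hi := hφ'.integrable volHalf
  change ∫ x, dirDeriv (0, 1) φ x ∂volHalf = _
  rw [volHalf_eq_prod] at hi ⊢
  rw [integral_prod _ hi, ← integral_neg]
  congr 1
  ext r
  have := HasCompactSupport.integral_Ioi_deriv_eq
    (((hφ.slice_fst r).smooth.of_le (by exact_mod_cast le_top) : ContDiff ℝ 1 _))
    (hφ.slice_fst r).compact 0
  have e : ∀ H, deriv (fun H => φ (r, H)) H = dirDeriv (0, 1) φ (r, H) := fun H =>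
    (hasDerivAt_slice_fst hφ r H).deriv
  simp only [e] at this
  exact this

theorem integral_dirDeriv_fst {φ : ℝ × ℝ → ℝ} (hφ : IsTest φ) :
    ∫ x in halfPlane, dirDeriv (1, 0) φ x = 0 := by
  have hi := (hφ.dirDeriv (1, 0)).integrable volHalf
  change ∫ x, dirDeriv (1, 0) φ x ∂volHalf = _
  rw [volHalf_eq_prod] at hi ⊢
  rw [integral_prod_symm _ hi]
  refine integral_eq_zero_of_ae (Eventually.of_forall fun H => ?_)
  change ∫ r, dirDeriv (1, 0) φ (r, H) = 0
  have h := hφ.slice_snd H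
  have := integral_eq_zero_of_hasDerivAt_of_integrable (f := fun r => φ (r, H))
    (f' := fun r => dirDeriv 1 (fun r => φ (r, H)) r)
    (fun r => by rw [dirDeriv_one, iteratedDeriv_one]; exact (h.differentiable r).hasDerivAt)
    ((h.dirDeriv 1).integrable volume) (h.integrable volume)
  rwa [dirDeriv_slice_snd hφ] at this

/-- Integration by parts in the direction of `H`. -/
theorem integral_green {φ ψ : ℝ × ℝ → ℝ} (hφ : IsTest φ) (hψ : IsTest ψ) :
    (∫ x in halfPlane, φ x * dirDeriv (0, 1) ψ x) + ∫ x in halfPlane, dirDeriv (0, 1) φ x * ψ x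
      = -∫ r, φ (r, 0) * ψ (r, 0) := by
  have h := integral_dirDeriv_snd (hψ.mul_left hφ.smooth)
  rw [dirDeriv_mul hφ.differentiable hψ.differentiable] at h
  rw [← h, add_comm]
  exact (integral_add ((hψ.mul_left (hφ.dirDeriv _).smooth).integrable _)
    (((hψ.dirDeriv _).mul_left hφ.smooth).integrable _)).symm

theorem eLpNorm_trace_le {φ : ℝ × ℝ → ℝ} (hφ : IsTest φ) :
    (eLpNorm (fun r => φ (r, 0)) 2 volume).toReal ^ 2
      ≤ 2 * ((eLpNorm φ 2 volHalf).toReal * (eLpNorm (dirDeriv (0, 1) φ) 2 volHalf).toReal) := by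
  have h := integral_green hφ hφ
  have e1 : ∫ x in halfPlane, dirDeriv (0, 1) φ x * φ x = ∫ x in halfPlane, φ x * dirDeriv (0, 1) φ x := by
    congr 1; ext x; ring
  rw [e1] at h
  have h2 := abs_integral_mul_le (hφ.memLp volHalf 2) ((hφ.dirDeriv (0, 1)).memLp volHalf 2)
  have hm := (hφ.slice_snd 0).memLp volume 2
  have e2 : (eLpNorm (fun r => φ (r, 0)) 2 volume).toReal ^ 2 = ∫ r, φ (r, 0) * φ (r, 0) := by
    have := real_inner_self_eq_norm_sq hm.toLp
    rw [Lp.norm_toLp, L2.inner_def] at this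
    rw [← this]
    refine integral_congr_ae ?_
    filter_upwards [hm.coeFn_toLp] with x hx
    rw [hx]; simp; ring
  rw [e2]
  have := neg_abs_le (∫ x, φ x * dirDeriv (0, 1) φ x ∂volHalf)
  linarith

theorem ennreal_add_sq_le (a b : ℝ≥0∞) : (a + b) ^ 2 ≤ 4 * (a ^ 2 + b ^ 2) := by
  calc (a + b) ^ 2 ≤ (2 * max a b) ^ 2 := by
        gcongr; rw [two_mul]; exact add_le_add (le_max_left _ _) (le_max_right _ _)
    _ = 4 * max a b ^ 2 := by ring
    _ ≤ 4 * (a ^ 2 + b ^ 2) := by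
        gcongr
        rcases le_total a b with h | h
        · rw [max_eq_right h]; exact le_add_self
        · rw [max_eq_left h]; exact le_self_add

theorem eLpNorm_translate_neg {g : ℝ → ℝ} (hg : AEStronglyMeasurable g volume) (h : ℝ) :
    eLpNorm (fun x => g (x + (-h) • (1 : ℝ)) - g x) 2 volume
      = eLpNorm (fun x => g (x + h • (1 : ℝ)) - g x) 2 volume := by
  have hm : AEStronglyMeasurable (fun x => g (x + (-h) • (1 : ℝ)) - g x) volume :=
    (hg.comp_measurePreserving (measurePreserving_translate_line _)).sub hg
  rw [← eLpNorm_comp_measurePreserving hm (measurePreserving_translate_line h), ← eLpNorm_neg]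
  congr 1
  ext x
  simp

theorem lintegral_Ioi_rpow {s : ℝ} (hs : 0 < s) :
    ∫⁻ h in Ici s, ENNReal.ofReal (h ^ (-(3 / 2) : ℝ)) = ENNReal.ofReal (2 * s ^ (-(1 / 2) : ℝ)) := by
  rw [setLIntegral_congr Ioi_ae_eq_Ici.symm,
    ← ofReal_integral_eq_lintegral_ofReal (integrableOn_Ioi_rpow_of_lt (by norm_num) hs),
    integral_Ioi_rpow_of_lt (by norm_num) hs]
  · congr 1; norm_num; ring
  · filter_upwards [ae_restrict_mem measurableSet_Ioi] with h hh
    exact Real.rpow_nonneg (hs.le.trans (le_of_lt hh)) _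

theorem lintegral_Ioc_rpow {h : ℝ} (hh : 0 < h) :
    ∫⁻ s in Ioc 0 h, ENNReal.ofReal (s ^ (-(1 / 2) : ℝ)) = ENNReal.ofReal (2 * h ^ (1 / 2 : ℝ)) := by
  have hi : IntervalIntegrable (fun s : ℝ => s ^ (-(1 / 2) : ℝ)) volume 0 h :=
    intervalIntegral.intervalIntegrable_rpow' (by norm_num)
  rw [← ofReal_integral_eq_lintegral_ofReal
    ((intervalIntegrable_iff_integrableOn_Ioc_of_le hh.le).1 hi),
    ← intervalIntegral.integral_of_le hh.le, integral_rpow (Or.inl (by norm_num))]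
  · congr 1; norm_num; ring
  · filter_upwards [ae_restrict_mem measurableSet_Ioc] with s hs
    exact Real.rpow_nonneg hs.1.le _

/-- Hardy's inequality for the increments of a test function away from the boundary. -/
theorem hardy_trace {φ : ℝ × ℝ → ℝ} (hφ : IsTest φ) :
    ∫⁻ h in Ioi (0 : ℝ), ENNReal.ofReal ((h ^ 2)⁻¹)
        * eLpNorm (fun r => φ (r, h) - φ (r, 0)) 2 volume ^ 2
      ≤ 4 * eLpNorm (dirDeriv (0, 1) φ) 2 volHalf ^ 2 := by
  set ψ := dirDeriv (0, 1) φ with hψ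
  have hψt : IsTest ψ := hφ.dirDeriv _
  have hψm : Measurable fun x : ℝ × ℝ => ‖ψ x‖ₑ ^ 2 := hψt.continuous.measurable.enorm.pow_const 2
  set K : ℝ → ℝ≥0∞ := fun s => ∫⁻ r, ‖ψ (r, s)‖ₑ ^ 2 with hK
  have hKm : Measurable K := hψm.lintegral_prod_left'
  have b1 : ∀ h ∈ Ioi (0 : ℝ), eLpNorm (fun r => φ (r, h) - φ (r, 0)) 2 volume ^ 2
      ≤ ENNReal.ofReal (2 * h ^ (1 / 2 : ℝ))
        * ∫⁻ s in Ioc 0 h, ENNReal.ofReal (s ^ (1 / 2 : ℝ)) * K s := by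
    intro h hh
    have hh : 0 < h := hh
    have p1 : ∀ r, ‖φ (r, h) - φ (r, 0)‖ₑ ^ 2 ≤ ENNReal.ofReal (2 * h ^ (1 / 2 : ℝ))
        * ∫⁻ s in Ioc 0 h, ENNReal.ofReal (s ^ (1 / 2 : ℝ)) * ‖ψ (r, s)‖ₑ ^ 2 := by
      intro r
      have q1 : ‖φ (r, h) - φ (r, 0)‖ₑ ≤ ∫⁻ s in Ioc 0 h, ‖ψ (r, s)‖ₑ := by
        rw [← intervalIntegral.integral_eq_sub_of_hasDerivAt
          (fun s _ => hasDerivAt_slice_fst hφ r s)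
          ((hψt.slice_fst r).continuous.intervalIntegrable 0 h),
          intervalIntegral.integral_of_le hh.le]
        exact enorm_integral_le_lintegral_enorm _
      have q2 : ∫⁻ s in Ioc 0 h, ‖ψ (r, s)‖ₑ = ∫⁻ s in Ioc 0 h,
          ENNReal.ofReal (s ^ (-(1 / 4) : ℝ)) * (ENNReal.ofReal (s ^ (1 / 4 : ℝ)) * ‖ψ (r, s)‖ₑ) := by
        refine setLIntegral_congr_fun measurableSet_Ioc fun s hs => ?_
        rw [← mul_assoc, ← ENNReal.ofReal_mul (Real.rpow_nonneg hs.1.le _),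
          ← Real.rpow_add hs.1]
        norm_num
      have q3 : ∀ (a : ℝ), ∀ s ∈ Ioc 0 h, ENNReal.ofReal (s ^ (a / 2)) ^ 2 = ENNReal.ofReal (s ^ a) := by
        intro a s hs
        rw [← ENNReal.ofReal_pow (Real.rpow_nonneg hs.1.le _), ← Real.rpow_natCast,
          ← Real.rpow_mul hs.1.le]
        norm_num
      calc _ ≤ (∫⁻ s in Ioc 0 h, ENNReal.ofReal (s ^ (-(1 / 4) : ℝ))
            * (ENNReal.ofReal (s ^ (1 / 4 : ℝ)) * ‖ψ (r, s)‖ₑ)) ^ 2 := by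
              rw [← q2]; gcongr
        _ ≤ _ := lintegral_mul_sq_le (Measurable.ennreal_ofReal (by fun_prop)).aemeasurable
              ((Measurable.ennreal_ofReal (by fun_prop)).mul
                (hψt.slice_fst r).continuous.measurable.enorm).aemeasurable
        _ = _ := by
          rw [← lintegral_Ioc_rpow hh]
          congr 1
          · refine setLIntegral_congr_fun measurableSet_Ioc fun s hs => ?_
            rw [← q3 (-(1 / 2)) s hs]; norm_num
          · refine setLIntegral_congr_fun measurableSet_Ioc fun s hs => ?_
            rw [mul_pow, ← q3 (1 / 2) s hs]; norm_num
    rw [eLpNorm_two_sq]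
    refine (lintegral_mono p1).trans_eq ?_
    rw [lintegral_const_mul' _ _ ENNReal.ofReal_ne_top, lintegral_lintegral_swap]
    · congr 1
      refine lintegral_congr fun s => ?_
      rw [lintegral_const_mul' _ _ ENNReal.ofReal_ne_top]
    · refine Measurable.aemeasurable (Measurable.mul (f := fun x : ℝ × ℝ =>
        ENNReal.ofReal (x.2 ^ (1 / 2 : ℝ))) (Measurable.ennreal_ofReal (by fun_prop)) hψm)
  calc _ ≤ ∫⁻ h in Ioi (0 : ℝ), ∫⁻ s in Ioi (0 : ℝ), (Ici s).indicator
        (fun h => ENNReal.ofReal (2 * h ^ (-(3 / 2) : ℝ))) h * (ENNReal.ofReal (s ^ (1 / 2 : ℝ)) * K s) := by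
        refine setLIntegral_mono' measurableSet_Ioi fun h hh => ?_
        have hh0 : 0 < h := hh
        refine (mul_le_mul_right (b1 h hh) _).trans_eq ?_
        rw [← mul_assoc, ← ENNReal.ofReal_mul (by positivity),
          ← lintegral_const_mul' _ _ ENNReal.ofReal_ne_top]
        have e : (h ^ 2)⁻¹ * (2 * h ^ (1 / 2 : ℝ)) = 2 * h ^ (-(3 / 2) : ℝ) := by
          have : (h ^ 2)⁻¹ = h ^ (-2 : ℝ) := by rw [Real.rpow_neg hh0.le]; norm_num
          rw [this, mul_left_comm, ← Real.rpow_add hh0]; norm_num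
        rw [e, ← Ioi_inter_Iic, inter_comm, ← Measure.restrict_restrict measurableSet_Iic,
          ← lintegral_indicator measurableSet_Iic]
        refine lintegral_congr fun s => ?_
        by_cases hs : s ≤ h
        · rw [indicator_of_mem (show s ∈ Iic h from hs), indicator_of_mem (show h ∈ Ici s from hs)]
        · rw [indicator_of_notMem (show s ∉ Iic h from hs),
            indicator_of_notMem (show h ∉ Ici s from hs), zero_mul]
    _ = ∫⁻ s in Ioi (0 : ℝ), ∫⁻ h in Ioi (0 : ℝ), (Ici s).indicator
        (fun h => ENNReal.ofReal (2 * h ^ (-(3 / 2) : ℝ))) h * (ENNReal.ofReal (s ^ (1 / 2 : ℝ)) * K s) := by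
        refine lintegral_lintegral_swap (Measurable.aemeasurable ?_)
        refine Measurable.mul ?_ ((Measurable.ennreal_ofReal (by fun_prop)).mul (hKm.comp measurable_snd))
        have : (Function.uncurry fun h s : ℝ => (Ici s).indicator
            (fun h => ENNReal.ofReal (2 * h ^ (-(3 / 2) : ℝ))) h)
            = ({p : ℝ × ℝ | p.2 ≤ p.1}).indicator
              (fun p => ENNReal.ofReal (2 * p.1 ^ (-(3 / 2) : ℝ))) := by
          ext p; simp [indicator, Function.uncurry]
        change Measurable (Function.uncurry fun h s : ℝ => (Ici s).indicator
            (fun h => ENNReal.ofReal (2 * h ^ (-(3 / 2) : ℝ))) h)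
        rw [this]
        exact (Measurable.ennreal_ofReal (by fun_prop)).indicator
          (measurableSet_le measurable_snd measurable_fst)
    _ = ∫⁻ s in Ioi (0 : ℝ), 4 * K s := by
        refine setLIntegral_congr_fun measurableSet_Ioi fun s hs => ?_
        have hs0 : 0 < s := hs
        rw [lintegral_mul_const _ ((Measurable.ennreal_ofReal (by fun_prop)).indicator measurableSet_Ici),
          lintegral_indicator measurableSet_Ici, Measure.restrict_restrict measurableSet_Ici,
          inter_eq_left.2 (Ici_subset_Ioi.2 hs0)]
        have : ∀ h : ℝ, ENNReal.ofReal (2 * h ^ (-(3 / 2) : ℝ)) = 2 * ENNReal.ofReal (h ^ (-(3 / 2) : ℝ)) := by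
          intro h; rw [ENNReal.ofReal_mul (by norm_num)]; norm_num
        simp only [this]
        rw [lintegral_const_mul' _ _ (by norm_num), lintegral_Ioi_rpow hs0, ← mul_assoc, mul_assoc 2,
          ← ENNReal.ofReal_mul (by positivity), mul_assoc (2 : ℝ), ← Real.rpow_add hs0]
        norm_num
    _ = 4 * ∫⁻ s in Ioi (0 : ℝ), K s := lintegral_const_mul' _ _ (by norm_num)
    _ = _ := by
        rw [eLpNorm_two_sq, volHalf_eq_prod, lintegral_prod_symm _ hψm.aemeasurable]

theorem lintegral_eq_two_mul_Ioi {F : ℝ → ℝ≥0∞} (hF : ∀ h, F (-h) = F h) :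
    ∫⁻ h, F h = 2 * ∫⁻ h in Ioi (0 : ℝ), F h := by
  have h1 : ∫⁻ h in Iio (0 : ℝ), F h = ∫⁻ h in Ioi (0 : ℝ), F h := by
    have := (Measure.measurePreserving_neg (volume : Measure ℝ)).setLIntegral_comp_preimage_emb
      (Homeomorph.neg ℝ).measurableEmbedding F (Ioi 0)
    simp only [hF] at this
    rw [← this]
    simp
  have h2 : ∫⁻ h in Iio (0 : ℝ), F h = ∫⁻ h in Iic (0 : ℝ), F h :=
    setLIntegral_congr Iio_ae_eq_Iic
  rw [two_mul]
  nth_rewrite 1 [← h1]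
  rw [h2, ← compl_Iic, lintegral_add_compl _ measurableSet_Iic]

theorem IsTest.weakDir_line {φ : ℝ → ℝ} (hφ : IsTest φ) : WeakDir volume 1 φ (ContactModel.dirDeriv 1 φ) := by
  refine ⟨hφ.memLp _ _, (hφ.dirDeriv 1).memLp _ _, fun ψ hψ => ?_⟩
  have i1 := (hψ.mul_left (hφ.dirDeriv 1).smooth).integrable volume
  have i2 := ((hψ.dirDeriv 1).mul_left hφ.smooth).integrable volume
  have hz := integral_eq_zero_of_hasDerivAt_of_integrable (f := fun r => φ r * ψ r)
    (f' := fun r => ContactModel.dirDeriv 1 φ r * ψ r + φ r * ContactModel.dirDeriv 1 ψ r)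
    (fun r => by
      rw [dirDeriv_one, dirDeriv_one, iteratedDeriv_one, iteratedDeriv_one]
      exact (hφ.differentiable r).hasDerivAt.mul (hψ.differentiable r).hasDerivAt)
    (i1.add i2) ((hψ.mul_left hφ.smooth).integrable _)
  rw [integral_add i1 i2] at hz
  linarith

theorem IsTest.weakDir_slice {φ : ℝ × ℝ → ℝ} (hφ : IsTest φ) (H : ℝ) :
    WeakDir volume 1 (fun r => φ (r, H)) (fun r => ContactModel.dirDeriv (1, 0) φ (r, H)) := by
  rw [← dirDeriv_slice_snd hφ]
  exact (hφ.slice_snd H).weakDir_line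

theorem slobSemi_trace_le {φ : ℝ × ℝ → ℝ} (hφ : IsTest φ) :
    slobSemi (fun r => φ (r, 0)) ≤ 136 * (eLpNorm (dirDeriv (1, 0) φ) 2 volHalf ^ 2
      + eLpNorm (dirDeriv (0, 1) φ) 2 volHalf ^ 2) := by
  have hm : AEStronglyMeasurable (fun r => φ (r, 0)) volume :=
    (hφ.slice_snd 0).continuous.aestronglyMeasurable
  rw [slobSemi_eq hm, lintegral_eq_two_mul_Ioi (fun h => by rw [eLpNorm_translate_neg hm, neg_sq])]
  set α : ℝ → ℝ≥0∞ := fun h => eLpNorm (fun r => φ (r, h) - φ (r, 0)) 2 volume with hα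
  set ρ : ℝ → ℝ≥0∞ := fun h => eLpNorm (fun r => dirDeriv (1, 0) φ (r, h)) 2 volume with hρ
  have b1 : ∀ h ∈ Ioi (0 : ℝ), ENNReal.ofReal ((h ^ 2)⁻¹)
      * eLpNorm (fun x => φ (x + h • (1 : ℝ), 0) - φ (x, 0)) 2 volume ^ 2
      ≤ 16 * (ENNReal.ofReal ((h ^ 2)⁻¹) * α h ^ 2) + 4 * ρ h ^ 2 := by
    intro h hh
    have hh : 0 < h := hh
    have hW := hφ.weakDir_slice h
    have h1 := hW.eLpNorm_translate_sub_le measurePreserving_translate_line h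
    have c1 : Continuous fun r => φ (r, h) := (hφ.slice_snd h).continuous
    have c0 : Continuous fun r => φ (r, 0) := (hφ.slice_snd 0).continuous
    have ha : AEStronglyMeasurable (fun r => φ (r, h) - φ (r, 0)) volume :=
      (c1.sub c0).aestronglyMeasurable
    have ha2 : eLpNorm (fun x => φ (x + h • (1 : ℝ), h) - φ (x + h • (1 : ℝ), 0)) 2 volume = α h := by
      have := eLpNorm_comp_measurePreserving (p := 2) ha (measurePreserving_translate_line h)
      simp only [Function.comp_def] at this
      exact this
    have hc := hφ.continuous
    have e : (fun x => φ (x + h • (1 : ℝ), 0) - φ (x, 0))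
        = (((fun x => φ (x + h • (1 : ℝ), h) - φ (x, h)) + fun x => φ (x, h) - φ (x, 0))
          - fun x => φ (x + h • (1 : ℝ), h) - φ (x + h • (1 : ℝ), 0)) := by
      ext x; simp
    have t : eLpNorm (fun x => φ (x + h • (1 : ℝ), 0) - φ (x, 0)) 2 volume
        ≤ 2 * α h + ENNReal.ofReal h * ρ h := by
      rw [e]
      refine (eLpNorm_sub_le (Continuous.aestronglyMeasurable (Continuous.add (by fun_prop) (by fun_prop)))
        (Continuous.aestronglyMeasurable (by fun_prop)) (by norm_num)).trans ?_
      refine (add_le_add_left (eLpNorm_add_le (Continuous.aestronglyMeasurable (by fun_prop))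
        (Continuous.aestronglyMeasurable (by fun_prop)) (by norm_num)) _).trans ?_
      rw [ha2]
      rw [abs_of_pos hh] at h1
      calc _ ≤ ENNReal.ofReal h * ρ h + α h + α h := by gcongr
        _ = _ := by ring
    calc _ ≤ ENNReal.ofReal ((h ^ 2)⁻¹) * (4 * ((2 * α h) ^ 2 + (ENNReal.ofReal h * ρ h) ^ 2)) := by
          gcongr
          exact (pow_le_pow_left₀ zero_le t 2).trans (ennreal_add_sq_le _ _)
      _ = 16 * (ENNReal.ofReal ((h ^ 2)⁻¹) * α h ^ 2)
          + 4 * ((ENNReal.ofReal ((h ^ 2)⁻¹) * ENNReal.ofReal h ^ 2) * ρ h ^ 2) := by ring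
      _ = _ := by
          rw [← ENNReal.ofReal_pow hh.le, ← ENNReal.ofReal_mul (by positivity),
            inv_mul_cancel₀ (by positivity), ENNReal.ofReal_one, one_mul]
  have hψm : Measurable fun x : ℝ × ℝ => ‖dirDeriv (1, 0) φ x‖ₑ ^ 2 :=
    (hφ.dirDeriv _).continuous.measurable.enorm.pow_const 2
  have hρi : ∫⁻ h in Ioi (0 : ℝ), ρ h ^ 2 = eLpNorm (dirDeriv (1, 0) φ) 2 volHalf ^ 2 := by
    simp only [hρ, eLpNorm_two_sq]
    rw [volHalf_eq_prod, lintegral_prod_symm _ hψm.aemeasurable]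
  have hρm : Measurable fun h => ρ h ^ 2 := by
    simp only [hρ, eLpNorm_two_sq]
    exact hψm.lintegral_prod_left'
  calc _ ≤ 2 * ∫⁻ h in Ioi (0 : ℝ), (16 * (ENNReal.ofReal ((h ^ 2)⁻¹) * α h ^ 2) + 4 * ρ h ^ 2) := by
        gcongr 2 * ?_
        exact setLIntegral_mono' measurableSet_Ioi b1
    _ = 2 * (16 * (∫⁻ h in Ioi (0 : ℝ), ENNReal.ofReal ((h ^ 2)⁻¹) * α h ^ 2)
        + 4 * eLpNorm (dirDeriv (1, 0) φ) 2 volHalf ^ 2) := by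
        rw [lintegral_add_right _ (hρm.const_mul _), lintegral_const_mul' _ _ (by norm_num),
          lintegral_const_mul' _ _ (by norm_num), hρi]
    _ ≤ 2 * (16 * (4 * eLpNorm (dirDeriv (0, 1) φ) 2 volHalf ^ 2)
        + 4 * eLpNorm (dirDeriv (1, 0) φ) 2 volHalf ^ 2) := by
        gcongr
        exact hardy_trace hφ
    _ = 128 * eLpNorm (dirDeriv (0, 1) φ) 2 volHalf ^ 2
        + 8 * eLpNorm (dirDeriv (1, 0) φ) 2 volHalf ^ 2 := by ring
    _ ≤ 136 * eLpNorm (dirDeriv (0, 1) φ) 2 volHalf ^ 2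
        + 136 * eLpNorm (dirDeriv (1, 0) φ) 2 volHalf ^ 2 := by
        gcongr <;> norm_num
    _ = _ := by ring

end

section

/-! ### Duality between boundary values and `H^{1/2}` -/

/-- The shear `(R, H) ↦ (R - sH, H)`. -/
def shear (s : ℝ) (x : ℝ × ℝ) : ℝ × ℝ := (x.1 - s * x.2, x.2)

theorem continuous_shear (s : ℝ) : Continuous (shear s) := by
  unfold shear; fun_prop

theorem IsTest.comp_shear {φ : ℝ × ℝ → ℝ} (hφ : IsTest φ) (s : ℝ) :
    IsTest fun x => φ (shear s x) := by
  refine ⟨hφ.smooth.comp ?_, ?_⟩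
  · exact (contDiff_fst.sub (contDiff_const.mul contDiff_snd)).prodMk contDiff_snd
  · let e : (ℝ × ℝ) ≃ₜ (ℝ × ℝ) :=
      { toFun := shear s
        invFun := shear (-s)
        left_inv := fun x => by simp [shear]
        right_inv := fun x => by simp [shear]
        continuous_toFun := continuous_shear s
        continuous_invFun := continuous_shear (-s) }
    exact hφ.compact.comp_homeomorph e

theorem fderiv_apply_prod (φ : ℝ × ℝ → ℝ) (x : ℝ × ℝ) (a b : ℝ) :
    fderiv ℝ φ x (a, b) = a * dirDeriv (1, 0) φ x + b * dirDeriv (0, 1) φ x := by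
  have : ((a, b) : ℝ × ℝ) = a • ((1, 0) : ℝ × ℝ) + b • ((0, 1) : ℝ × ℝ) := by simp
  rw [this, map_add, map_smul, map_smul]
  simp [dirDeriv]

theorem hasDerivAt_shear_snd {φ : ℝ × ℝ → ℝ} (hφ : IsTest φ) (s r H : ℝ) :
    HasDerivAt (fun H => φ (shear s (r, H)))
      (dirDeriv (0, 1) φ (shear s (r, H)) - s * dirDeriv (1, 0) φ (shear s (r, H))) H := by
  have h1 : HasDerivAt (fun H => shear s (r, H)) ((-s, 1) : ℝ × ℝ) H := by
    have a : HasDerivAt (fun H : ℝ => r - s * H) (-s) H := by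
      simpa using ((hasDerivAt_id H).const_mul s).const_sub r
    exact a.prodMk (hasDerivAt_id H)
  have h2 : HasDerivAt (fun H => φ (shear s (r, H))) (fderiv ℝ φ (shear s (r, H)) (-s, 1)) H :=
    (hφ.differentiable (shear s (r, H))).hasFDerivAt.comp_hasDerivAt
      (f := fun H => shear s (r, H)) H h1
  exact h2.congr_deriv (by rw [fderiv_apply_prod]; ring)

theorem hasDerivAt_shear_param {φ : ℝ × ℝ → ℝ} (hφ : IsTest φ) (s : ℝ) (x : ℝ × ℝ) :
    HasDerivAt (fun s => φ (shear s x)) (-(x.2 * dirDeriv (1, 0) φ (shear s x))) s := by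
  have h1 : HasDerivAt (fun s => shear s x) ((-x.2, 0) : ℝ × ℝ) s := by
    have a : HasDerivAt (fun s : ℝ => x.1 - s * x.2) (-x.2) s := by
      simpa using ((hasDerivAt_id s).mul_const x.2).const_sub x.1
    exact a.prodMk (hasDerivAt_const s x.2)
  have h2 : HasDerivAt (fun s => φ (shear s x)) (fderiv ℝ φ (shear s x) (-x.2, 0)) s :=
    (hφ.differentiable (shear s x)).hasFDerivAt.comp_hasDerivAt (f := fun s => shear s x) s h1
  exact h2.congr_deriv (by rw [fderiv_apply_prod]; ring)

theorem integral_shear {g : ℝ → ℝ} (hg : MemLp g 2 volume) {φ : ℝ × ℝ → ℝ} (hφ : IsTest φ) (s : ℝ) :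
    ∫ x in halfPlane, g x.1 * (dirDeriv (0, 1) φ (shear s x) - s * dirDeriv (1, 0) φ (shear s x))
      = -∫ r, g r * φ (r, 0) := by
  have h := integral_fst_mul_dirDeriv_snd hg (hφ.comp_shear s)
  have e : ∀ x, dirDeriv (0, 1) (fun x => φ (shear s x)) x
      = dirDeriv (0, 1) φ (shear s x) - s * dirDeriv (1, 0) φ (shear s x) := fun x =>
    (hasDerivAt_slice_fst (hφ.comp_shear s) x.1 x.2).unique (hasDerivAt_shear_snd hφ s x.1 x.2)
  simp only [e] at h
  rw [h]
  simp [shear]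

theorem IsTest.shear_box {φ : ℝ × ℝ → ℝ} (hφ : IsTest φ) :
    ∃ n, ∀ s x, |s| ≤ 2 → φ (shear s x) ≠ 0 → |x.1| ≤ n ∧ |x.2| ≤ n := by
  obtain ⟨n, C, hn0, hC, hn⟩ := hφ.exists_box
  refine ⟨3 * n, fun s x hs hx => ?_⟩
  obtain ⟨h1, h2⟩ := hn _ hx
  simp only [shear] at h1 h2
  refine ⟨?_, by linarith⟩
  have h3 : |s * x.2| ≤ 2 * n := by
    rw [abs_mul]; gcongr
  calc |x.1| = |(x.1 - s * x.2) + s * x.2| := by ring_nf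
    _ ≤ |x.1 - s * x.2| + |s * x.2| := abs_add_le _ _
    _ ≤ 3 * n := by linarith

/-- The increment of a test function along shears, divided by `H`. -/
noncomputable def shearQuot (φ : ℝ × ℝ → ℝ) (s σ : ℝ) (x : ℝ × ℝ) : ℝ :=
  (φ (shear s x) - φ (shear σ x)) / x.2

theorem measurable_shearQuot {φ : ℝ × ℝ → ℝ} (hφ : IsTest φ) (s σ : ℝ) :
    Measurable (shearQuot φ s σ) :=
  ((hφ.comp_shear s).continuous.measurable.sub (hφ.comp_shear σ).continuous.measurable).div
    measurable_snd

theorem integrable_shearQuot {g : ℝ → ℝ} (hg : MemLp g 2 volume) {φ : ℝ × ℝ → ℝ} (hφ : IsTest φ)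
    {s σ : ℝ} (hs : |s| ≤ 2) (hσ : |σ| ≤ 2) :
    Integrable (fun x => g x.1 * shearQuot φ s σ x) volHalf := by
  obtain ⟨n, hn⟩ := hφ.shear_box
  obtain ⟨L, hL⟩ := ContDiff.lipschitzWith_of_hasCompactSupport hφ.compact
    (hφ.smooth.of_le (by exact_mod_cast le_top) : ContDiff ℝ 1 φ) one_ne_zero
  refine integrable_fst_mul hg (measurable_shearQuot hφ s σ).aestronglyMeasurable
    (n := n) (C := L * |s - σ|) ?_ (Eventually.of_forall fun x hx => ?_)
  · filter_upwards [ae_restrict_mem measurableSet_halfPlane] with x hx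
    have hx : 0 < x.2 := hx
    rw [shearQuot, abs_div, abs_of_pos hx, div_le_iff₀ hx]
    have := hL.dist_le_mul (shear s x) (shear σ x)
    rw [Real.dist_eq] at this
    refine this.trans_eq ?_
    have e : dist (shear s x) (shear σ x) = |s - σ| * x.2 := by
      rw [Prod.dist_eq, Real.dist_eq, Real.dist_eq]
      simp only [shear, sub_self, abs_zero]
      rw [max_eq_left (abs_nonneg _), ← abs_of_pos hx, ← abs_mul, abs_of_pos hx, abs_sub_comm]
      congr 1; ring
    rw [e]; ring
  · by_contra hc
    refine hx ?_
    have h1 : φ (shear s x) = 0 := by_contra fun h => hc (hn s x hs h)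
    have h2 : φ (shear σ x) = 0 := by_contra fun h => hc (hn σ x hσ h)
    rw [shearQuot, h1, h2]; simp

theorem hasDerivAt_integral_shearQuot {g : ℝ → ℝ} (hg : MemLp g 2 volume) {φ : ℝ × ℝ → ℝ}
    (hφ : IsTest φ) {s σ : ℝ} (hs : s ∈ Icc (0 : ℝ) 1) (hσ : |σ| ≤ 2) :
    HasDerivAt (fun s => ∫ x in halfPlane, g x.1 * shearQuot φ s σ x)
      (∫ x in halfPlane, -(g x.1 * dirDeriv (1, 0) φ (shear s x))) s := by
  have hφ' := hφ.dirDeriv (1, 0)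
  obtain ⟨n, hn⟩ := hφ'.shear_box
  obtain ⟨_, C, _, hC, _⟩ := hφ'.exists_box
  have hgm : AEStronglyMeasurable (fun x : ℝ × ℝ => g x.1) volHalf := by
    rw [volHalf_eq_prod]; exact hg.1.comp_fst
  have hs2 : |s| ≤ 2 := abs_le.2 ⟨by linarith [hs.1], by linarith [hs.2]⟩
  have hb : Integrable (fun x => g x.1 * (Icc (-n) n ×ˢ Icc (-n) n).indicator (fun _ => C) x) volHalf := by
    refine integrable_fst_mul hg (n := n) (C := |C|) ?_ (Eventually.of_forall fun x => ?_)
      (Eventually.of_forall fun x hx => ?_)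
    · exact (measurable_const.indicator (measurableSet_Icc.prod measurableSet_Icc)).aestronglyMeasurable
    · by_cases h : x ∈ Icc (-n) n ×ˢ Icc (-n) n
      · rw [indicator_of_mem h]
      · rw [indicator_of_notMem h, abs_zero]; exact abs_nonneg C
    · have := mem_of_indicator_ne_zero hx
      exact ⟨abs_le.2 this.1, abs_le.2 this.2⟩
  refine (hasDerivAt_integral_of_dominated_loc_of_deriv_le (μ := volHalf)
    (F := fun s x => g x.1 * shearQuot φ s σ x)
    (F' := fun s x => -(g x.1 * dirDeriv (1, 0) φ (shear s x)))
    (bound := fun x => ‖g x.1 * (Icc (-n) n ×ˢ Icc (-n) n).indicator (fun _ => C) x‖)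
    (s := Metric.ball s 1)
    (Metric.ball_mem_nhds s one_pos) ?_ ?_ ?_ ?_ ?_ ?_).2
  · exact Eventually.of_forall fun t => hgm.mul (measurable_shearQuot hφ t σ).aestronglyMeasurable
  · exact integrable_shearQuot hg hφ hs2 hσ
  · exact (hgm.mul (hφ'.comp_shear s).continuous.aestronglyMeasurable).neg
  · refine Eventually.of_forall fun x t ht => ?_
    have ht2 : |t| ≤ 2 := by
      rw [Metric.mem_ball, Real.dist_eq, abs_lt] at ht
      exact abs_le.2 ⟨by linarith [hs.1], by linarith [hs.2]⟩
    rw [norm_neg]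
    by_cases h : dirDeriv (1, 0) φ (shear t x) = 0
    · rw [h, mul_zero, norm_zero]; positivity
    · obtain ⟨h1, h2⟩ := hn t x ht2 h
      have hm : x ∈ Icc (-n) n ×ˢ Icc (-n) n := ⟨abs_le.1 h1, abs_le.1 h2⟩
      rw [indicator_of_mem hm, norm_mul, norm_mul]
      gcongr
      exact (hC _).trans (le_abs_self C)
  · exact hb.norm
  · filter_upwards [ae_restrict_mem measurableSet_halfPlane] with x hx t _
    have hx : 0 < x.2 := hx
    have := (((hasDerivAt_shear_param hφ t x).sub_const (φ (shear σ x))).div_const x.2).const_mul (g x.1)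
    refine this.congr_deriv ?_
    field_simp

theorem lintegral_translate_scaled {g : ℝ → ℝ} (hg : AEStronglyMeasurable g volume) (l : ℝ)
    (hl : |l| ≤ 1) :
    ∫⁻ H, ENNReal.ofReal ((H ^ 2)⁻¹)
      * eLpNorm (fun x => g (x + (l * H) • (1 : ℝ)) - g x) 2 volume ^ 2 ≤ slobSemi g := by
  by_cases h0 : l = 0
  · simp [h0]
  set F : ℝ → ℝ≥0∞ := fun h => ENNReal.ofReal ((h ^ 2)⁻¹)
      * eLpNorm (fun x => g (x + h • (1 : ℝ)) - g x) 2 volume ^ 2 with hF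
  have e : ∀ H, ENNReal.ofReal ((H ^ 2)⁻¹)
      * eLpNorm (fun x => g (x + (l * H) • (1 : ℝ)) - g x) 2 volume ^ 2
      = ENNReal.ofReal (l ^ 2) * F (l * H) := by
    intro H
    rw [hF]
    simp only
    rw [← mul_assoc, ← ENNReal.ofReal_mul (by positivity), mul_pow, mul_inv, ← mul_assoc,
      mul_inv_cancel₀ (by positivity), one_mul]
  simp only [e]
  have hemb : MeasurableEmbedding fun H : ℝ => l * H := (Homeomorph.mulLeft₀ l h0).measurableEmbedding
  rw [lintegral_const_mul' _ _ ENNReal.ofReal_ne_top, ← hemb.lintegral_map,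
    Real.map_volume_mul_left h0, lintegral_smul_measure, slobSemi_eq hg, smul_eq_mul, ← mul_assoc,
    ← ENNReal.ofReal_mul (by positivity), abs_inv, ← sq_abs, sq, mul_assoc,
    mul_inv_cancel₀ (abs_ne_zero.2 h0), mul_one]
  exact mul_le_of_le_one_left zero_le (by simpa using hl)

theorem abs_integral_shearQuot_le {g : ℝ → ℝ} {A : ℝ≥0∞} (hA : A ≠ ⊤) (hg : HalfBound g A)
    {φ : ℝ × ℝ → ℝ} (hφ : IsTest φ) {s σ : ℝ} (hs : s ∈ Icc (0 : ℝ) 1) (hσ : σ ∈ Icc (0 : ℝ) 1) :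
    |∫ x in halfPlane, g x.1 * shearQuot φ s σ x| ≤ A.toReal * (eLpNorm φ 2 volHalf).toReal := by
  have hs2 : |s| ≤ 2 := abs_le.2 ⟨by linarith [hs.1], by linarith [hs.2]⟩
  have hσ2 : |σ| ≤ 2 := abs_le.2 ⟨by linarith [hσ.1], by linarith [hσ.2]⟩
  have hsσ : |s - σ| ≤ 1 := abs_le.2 ⟨by linarith [hs.1, hσ.2], by linarith [hs.2, hσ.1]⟩
  have hi := integrable_shearQuot hg.1 hφ hs2 hσ2
  rw [volHalf_eq_prod] at hi
  set W : ℝ → ℝ≥0∞ := fun H => eLpNorm (fun x => g (x + ((s - σ) * H) • (1 : ℝ)) - g x) 2 volume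
    with hW
  set N : ℝ → ℝ≥0∞ := fun H => eLpNorm (fun r => φ (r, H)) 2 volume with hN
  have slice : ∀ H ∈ Ioi (0 : ℝ), ‖∫ r, g r * shearQuot φ s σ (r, H)‖ₑ
      ≤ ENNReal.ofReal H⁻¹ * W H * N H := by
    intro H hH
    have hH : 0 < H := hH
    have hτ : ∀ a : ℝ, MemLp (fun x => g (x + a • (1 : ℝ))) 2 volume := fun a =>
      hg.1.comp_measurePreserving (measurePreserving_translate_line a)
    have hsl : ∀ a : ℝ, IsTest fun r => φ (shear a (r, H)) := fun a => (hφ.comp_shear a).slice_snd H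
    have e : ∫ r, g r * shearQuot φ s σ (r, H)
        = H⁻¹ * ∫ r, (g (r + ((s - σ) * H) • (1 : ℝ)) - g r) * φ (shear σ (r, H)) := by
      have e1 : ∀ r, g r * shearQuot φ s σ (r, H)
          = H⁻¹ * (g r * φ (shear s (r, H)) - g r * φ (shear σ (r, H))) := by
        intro r; simp only [shearQuot]; field_simp
      simp only [e1, sub_mul]
      rw [integral_const_mul, integral_sub (integrable_mul_of_memLp hg.1 ((hsl s).memLp _ _))
          (integrable_mul_of_memLp hg.1 ((hsl σ).memLp _ _)),
        integral_sub (integrable_mul_of_memLp (hτ _) ((hsl σ).memLp _ _))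
          (integrable_mul_of_memLp hg.1 ((hsl σ).memLp _ _))]
      have := integral_translate_mul measurePreserving_translate_line g
        (fun r => φ (shear σ (r, H))) ((s - σ) * H)
      simp only [sub_mul] at this
      rw [this]
      congr 3
      ext r
      congr 2
      simp only [shear, smul_eq_mul]
      congr 1
      ring
    have h1 := abs_integral_mul_le ((hτ ((s - σ) * H)).sub hg.1) ((hsl σ).memLp volume 2)
    have e2 : eLpNorm (fun r => φ (shear σ (r, H))) 2 volume = N H := by
      have := eLpNorm_comp_measurePreserving (p := 2)
        (hφ.slice_snd H).continuous.aestronglyMeasurable (measurePreserving_translate_line (-(σ * H)))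
      rw [hN]
      refine Eq.trans ?_ this
      congr 1
      ext r
      simp [shear, sub_eq_add_neg]
    rw [e2] at h1
    rw [e, enorm_mul, mul_assoc, Real.enorm_of_nonneg (inv_nonneg.2 hH.le)]
    gcongr
    rw [Real.enorm_eq_ofReal_abs]
    refine (ENNReal.ofReal_le_ofReal h1).trans_eq ?_
    rw [ENNReal.ofReal_mul ENNReal.toReal_nonneg, ENNReal.ofReal_toReal ((hτ _).sub hg.1).2.ne,
      ENNReal.ofReal_toReal ((hφ.slice_snd H).memLp _ _).2.ne]
    rfl
  have hφm : Measurable fun x : ℝ × ℝ => ‖φ x‖ₑ ^ 2 := hφ.continuous.measurable.enorm.pow_const 2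
  have hNm : Measurable fun H => N H := by
    have h2 : Measurable fun H => N H ^ 2 := by
      simp only [hN, eLpNorm_two_sq]
      exact hφm.lintegral_prod_left'
    have := h2.pow_const (1 / 2 : ℝ)
    simpa only [sq_rpow_half] using this
  have hWm : AEMeasurable (fun H => W H) volume := by
    have h2 : AEMeasurable (fun H => W H ^ 2) volume := by
      simp only [hW, eLpNorm_two_sq]
      have hadd : AEStronglyMeasurable (fun p : ℝ × ℝ => g (p.2 + ((s - σ) * p.1) • (1 : ℝ)))
          (volume.prod volume) := by
        by_cases h0 : s - σ = 0
        · simpa [h0] using hg.1.1.comp_snd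
        · have q1 : Measure.QuasiMeasurePreserving (fun H : ℝ => (s - σ) * H) volume volume := by
            refine ⟨by fun_prop, ?_⟩
            rw [Real.map_volume_mul_left h0]
            exact Measure.smul_absolutelyContinuous
          have q2 := MeasureTheory.QuasiMeasurePreserving.prodMap q1
            (Measure.QuasiMeasurePreserving.id (volume : Measure ℝ))
          have := (aemeasurable_comp_add hg.1.1).comp_quasiMeasurePreserving q2
          refine this.congr (Eventually.of_forall fun p => ?_)
          simp [add_comm]
      exact ((hadd.sub hg.1.1.comp_snd).enorm.pow_const 2).lintegral_prod_right'
    have := h2.pow_const (1 / 2 : ℝ)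
    simpa only [sq_rpow_half] using this
  have main : ‖∫ x in halfPlane, g x.1 * shearQuot φ s σ x‖ₑ ≤ A * eLpNorm φ 2 volHalf := by
    change ‖∫ x, g x.1 * shearQuot φ s σ x ∂volHalf‖ₑ ≤ _
    have hI : ∫ x, g x.1 * shearQuot φ s σ x ∂volHalf
        = ∫ H in Ioi 0, ∫ r, g r * shearQuot φ s σ (r, H) := by
      rw [volHalf_eq_prod, integral_prod_symm _ hi]
    rw [hI]
    refine (enorm_integral_le_lintegral_enorm _).trans ?_
    refine (setLIntegral_mono' measurableSet_Ioi slice).trans ?_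
    have hsq : (∫⁻ H in Ioi (0 : ℝ), ENNReal.ofReal H⁻¹ * W H * N H) ^ 2
        ≤ (A * eLpNorm φ 2 volHalf) ^ 2 := by
      refine (lintegral_mul_sq_le ?_ hNm.aemeasurable).trans ?_
      · exact (Measurable.ennreal_ofReal (by fun_prop)).aemeasurable.mul hWm.restrict
      rw [mul_pow]
      gcongr
      · refine le_trans ?_ hg.2.2
        refine le_trans ?_ (lintegral_translate_scaled hg.1.1 (s - σ) hsσ)
        refine (setLIntegral_le_lintegral (Ioi 0) _).trans' (le_of_eq ?_)
        refine setLIntegral_congr_fun measurableSet_Ioi fun H hH => ?_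
        rw [mul_pow, ← ENNReal.ofReal_pow (inv_nonneg.2 (le_of_lt hH)), inv_pow]
      · rw [eLpNorm_two_sq, volHalf_eq_prod, lintegral_prod_symm _ hφm.aemeasurable]
        simp only [hN, eLpNorm_two_sq]
        rfl
    exact (ENNReal.pow_le_pow_left_iff two_ne_zero).1 hsq
  have hφf := (hφ.memLp volHalf 2).2.ne
  have := ENNReal.toReal_mono (by finiteness) main
  rwa [ENNReal.toReal_mul, toReal_enorm, Real.norm_eq_abs] at this

/-- The tangential derivative of the boundary values of a test function is bounded in the dual of
`H^{1/2}` by its Dirichlet norm. -/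
theorem abs_integral_mul_dirDeriv_trace_le {g : ℝ → ℝ} {A : ℝ≥0∞} (hA : A ≠ ⊤) (hg : HalfBound g A)
    {φ : ℝ × ℝ → ℝ} (hφ : IsTest φ) :
    |∫ r, g r * dirDeriv (1, 0) φ (r, 0)| ≤ A.toReal * ((eLpNorm (dirDeriv (1, 0) φ) 2 volHalf).toReal
      + (eLpNorm (dirDeriv (0, 1) φ) 2 volHalf).toReal) := by
  set T := ∫ r, g r * dirDeriv (1, 0) φ (r, 0) with hT
  set φR := dirDeriv (1, 0) φ with hφR
  set φH := dirDeriv (0, 1) φ with hφH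
  have hR : IsTest φR := hφ.dirDeriv _
  have hH : IsTest φH := hφ.dirDeriv _
  have h01 : |(0 : ℝ)| ≤ 2 := by norm_num
  have h11 : |(1 : ℝ)| ≤ 2 := by norm_num
  have hd : ∀ s ∈ Icc (0 : ℝ) 1, HasDerivAt (fun s => (∫ x in halfPlane, g x.1 * shearQuot φH s 0 x)
      - s * (∫ x in halfPlane, g x.1 * shearQuot φR s 1 x) - s * T)
      (-∫ x in halfPlane, g x.1 * shearQuot φR s 1 x) s := by
    intro s hs
    have d1 := hasDerivAt_integral_shearQuot hg.1 hH hs h01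
    have d2 := hasDerivAt_integral_shearQuot hg.1 hR hs h11
    have d3 := (d1.sub ((hasDerivAt_id s).mul d2)).sub ((hasDerivAt_id s).mul_const T)
    refine HasDerivAt.congr_deriv (f := _) d3 ?_
    have h := integral_shear hg.1 hR s
    have i1 := ((hR.dirDeriv (0, 1)).comp_shear s).integrable_fst_mul hg.1
    have i2 := ((hR.dirDeriv (1, 0)).comp_shear s).integrable_fst_mul hg.1
    have e1 : ∫ x in halfPlane, g x.1 * (dirDeriv (0, 1) φR (shear s x)
        - s * dirDeriv (1, 0) φR (shear s x))
        = (∫ x in halfPlane, g x.1 * dirDeriv (0, 1) φR (shear s x))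
          - s * ∫ x in halfPlane, g x.1 * dirDeriv (1, 0) φR (shear s x) := by
      rw [← integral_const_mul, ← integral_sub i1 (i2.const_mul s)]
      congr 1; ext x; ring
    have e2 : dirDeriv (1, 0) φH = dirDeriv (0, 1) φR := dirDeriv_comm hφ.smooth _
    rw [e2, integral_neg, integral_neg]
    rw [e1] at h
    simp only [id]
    linear_combination -h
  have := Convex.norm_image_sub_le_of_norm_hasDerivWithin_le (s := Icc (0 : ℝ) 1)
    (x := 0) (y := 1) (fun s hs => (hd s hs).hasDerivWithinAt) (fun s hs => by
      rw [norm_neg]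
      exact abs_integral_shearQuot_le hA hg hR hs ⟨zero_le_one, le_rfl⟩) (convex_Icc 0 1)
    ⟨le_rfl, zero_le_one⟩ ⟨zero_le_one, le_rfl⟩
  have z0 : ∀ x, shearQuot φH 0 0 x = 0 := fun x => by simp [shearQuot]
  have z1 : ∀ x, shearQuot φR 1 1 x = 0 := fun x => by simp [shearQuot]
  simp only [z0, z1, mul_zero, integral_zero, zero_mul, sub_zero, one_mul, Real.norm_eq_abs,
    abs_one, mul_one] at this
  have h2 := abs_integral_shearQuot_le hA hg hH (s := 1) (σ := 0) ⟨zero_le_one, le_rfl⟩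
    ⟨le_rfl, zero_le_one⟩
  have h3 := abs_sub_abs_le_abs_sub T (∫ x in halfPlane, g x.1 * shearQuot φH 1 0 x)
  rw [abs_sub_comm] at h3
  rw [mul_add]
  linarith

theorem abs_integral_mul_translate_trace_le {g : ℝ → ℝ} {A : ℝ≥0∞} (hA : A ≠ ⊤) (hg : HalfBound g A)
    {φ : ℝ × ℝ → ℝ} (hφ : IsTest φ) (s : ℝ) :
    |∫ r, g r * (φ (r + s, 0) - φ (r, 0))| ≤ |s| * (A.toReal
      * ((eLpNorm (dirDeriv (1, 0) φ) 2 volHalf).toReal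
      + (eLpNorm (dirDeriv (0, 1) φ) 2 volHalf).toReal)) := by
  have hφ0 := hφ.slice_snd 0
  have := Convex.norm_image_sub_le_of_norm_hasDerivWithin_le (s := univ)
    (f := fun s : ℝ => ∫ r, g r * φ (r + s • (1 : ℝ), 0))
    (f' := fun s : ℝ => ∫ r, g r * dirDeriv 1 (fun r => φ (r, 0)) (r + s • (1 : ℝ)))
    (C := A.toReal * ((eLpNorm (dirDeriv (1, 0) φ) 2 volHalf).toReal
      + (eLpNorm (dirDeriv (0, 1) φ) 2 volHalf).toReal)) (x := 0) (y := s)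
    (fun t _ => (hasDerivAt_integral_translate hg.1 hφ0 1 t).hasDerivWithinAt) (fun t _ => by
      have h := abs_integral_mul_dirDeriv_trace_le hA hg (hφ.translate (t • ((1, 0) : ℝ × ℝ)))
      rw [dirDeriv_translate, dirDeriv_translate] at h
      have n : ∀ ψ : ℝ × ℝ → ℝ, IsTest ψ →
          eLpNorm (fun x => ψ (x + t • ((1, 0) : ℝ × ℝ))) 2 volHalf = eLpNorm ψ 2 volHalf :=
        fun ψ hψ => eLpNorm_comp_measurePreserving hψ.continuous.aestronglyMeasurable
          (measurePreserving_translate t)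
      rw [n _ (hφ.dirDeriv _), n _ (hφ.dirDeriv _)] at h
      rw [dirDeriv_slice_snd hφ, Real.norm_eq_abs]
      simpa using h) convex_univ (mem_univ _) (mem_univ _)
  rw [Real.norm_eq_abs, Real.norm_eq_abs, sub_zero] at this
  rw [mul_comm |s|]
  refine le_trans (le_of_eq ?_) this
  rw [← integral_sub (integrable_mul_of_memLp hg.1 ((hφ0.translate (s • (1 : ℝ))).memLp _ _))
    (integrable_mul_of_memLp hg.1 ((hφ0.translate ((0 : ℝ) • (1 : ℝ))).memLp _ _))]
  congr 2
  ext r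
  simp
  ring

end

section

/-! ### Convergence in `L²` -/

section L2

variable {X : Type*} [MeasurableSpace X] {ν : Measure X}

theorem tendsto_toLp {f : ℕ → X → ℝ} {g : X → ℝ} (hf : ∀ n, MemLp (f n) 2 ν) (hg : MemLp g 2 ν)
    (h : Tendsto (fun n => eLpNorm (fun x => f n x - g x) 2 ν) atTop (𝓝 0)) :
    Tendsto (fun n => (hf n).toLp) atTop (𝓝 hg.toLp) :=
  (Lp.tendsto_Lp_iff_tendsto_eLpNorm'' f hf g hg).2 h

theorem inner_toLp {f g : X → ℝ} (hf : MemLp f 2 ν) (hg : MemLp g 2 ν) :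
    inner ℝ hf.toLp hg.toLp = ∫ x, f x * g x ∂ν := by
  rw [L2.inner_def]
  refine integral_congr_ae ?_
  filter_upwards [hf.coeFn_toLp, hg.coeFn_toLp] with x h1 h2
  rw [h1, h2, RCLike.inner_apply', conj_trivial]

theorem tendsto_integral_mul {f : ℕ → X → ℝ} {g ψ : X → ℝ} (hf : ∀ n, MemLp (f n) 2 ν)
    (hg : MemLp g 2 ν) (hψ : MemLp ψ 2 ν)
    (h : Tendsto (fun n => eLpNorm (fun x => f n x - g x) 2 ν) atTop (𝓝 0)) :
    Tendsto (fun n => ∫ x, f n x * ψ x ∂ν) atTop (𝓝 (∫ x, g x * ψ x ∂ν)) := by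
  have := (tendsto_toLp hf hg h).inner (tendsto_const_nhds (x := hψ.toLp)) (𝕜 := ℝ)
  simpa only [inner_toLp] using this

theorem tendsto_eLpNorm {f : ℕ → X → ℝ} {g : X → ℝ} (hf : ∀ n, MemLp (f n) 2 ν) (hg : MemLp g 2 ν)
    (h : Tendsto (fun n => eLpNorm (fun x => f n x - g x) 2 ν) atTop (𝓝 0)) :
    Tendsto (fun n => eLpNorm (f n) 2 ν) atTop (𝓝 (eLpNorm g 2 ν)) := by
  have := ENNReal.tendsto_ofReal (tendsto_toLp hf hg h).norm
  simpa only [Lp.norm_toLp, ENNReal.ofReal_toReal (hf _).2.ne, ENNReal.ofReal_toReal hg.2.ne]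
    using this

theorem tendsto_eLpNorm_mul_zero {m : ℕ → X → ℝ} {u : X → ℝ} (hu : MemLp u 2 ν)
    (hm : ∀ n, AEStronglyMeasurable (m n) ν) (hb : ∀ n x, |m n x| ≤ 1)
    (h0 : ∀ x, Tendsto (fun n => m n x) atTop (𝓝 0)) :
    Tendsto (fun n => eLpNorm (fun x => m n x * u x) 2 ν) atTop (𝓝 0) := by
  have h : Tendsto (fun n => ∫⁻ x, ‖m n x * u x‖ₑ ^ 2 ∂ν) atTop (𝓝 (∫⁻ x, 0 ∂ν)) := by
    refine tendsto_lintegral_of_dominated_convergence' (fun x => ‖u x‖ₑ ^ 2)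
      (fun n => ((hm n).mul hu.1).enorm.pow_const 2) (fun n => Eventually.of_forall fun x => ?_) ?_ ?_
    · simp only [enorm_mul, mul_pow]
      refine mul_le_of_le_one_left zero_le (pow_le_one' ?_ 2)
      rw [Real.enorm_eq_ofReal_abs]
      simpa using hb n x
    · rw [← eLpNorm_two_sq]
      exact ENNReal.pow_ne_top hu.2.ne
    · refine Eventually.of_forall fun x => ?_
      have := ENNReal.Tendsto.pow (n := 2) ((h0 x).mul_const (u x)).enorm
      simpa using this
  simp only [← eLpNorm_two_sq, lintegral_zero] at h
  have := h.ennrpow_const (1 / 2 : ℝ)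
  simpa only [sq_rpow_half, ENNReal.zero_rpow_of_pos (show (0 : ℝ) < 1 / 2 by norm_num)]
    using this

end L2

theorem exists_translate_lt {u : ℝ × ℝ → ℝ} (hu : MemLp u 2 volume) {ε : ℝ} (hε : 0 < ε) :
    ∃ δ > 0, ∀ a : ℝ × ℝ, ‖a‖ < δ →
      eLpNorm (fun x => u (x + a) - u x) 2 volume ≤ ENNReal.ofReal ε := by
  let τ : ℝ × ℝ → C(ℝ × ℝ, ℝ × ℝ) :=
    (ContinuousMap.curry ⟨fun p : (ℝ × ℝ) × (ℝ × ℝ) => p.2 + p.1, by fun_prop⟩)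
  have hτ : Continuous τ := (ContinuousMap.curry _).continuous
  have hp : ∀ a, MeasurePreserving (τ a) (volume : Measure (ℝ × ℝ)) volume := fun a =>
    measurePreserving_add_right volume a
  have hc := (continuous_const (y := hu.toLp)).compMeasurePreservingLp hτ hp (by norm_num)
  obtain ⟨δ, hδ, h⟩ := Metric.continuousAt_iff.1 (hc.continuousAt (x := 0)) ε hε
  refine ⟨δ, hδ, fun a ha => ?_⟩
  have := h (x := a) (by simpa using ha)
  rw [Lp.dist_def, ← ENNReal.lt_ofReal_iff_toReal_lt
    ((Lp.memLp _).sub (Lp.memLp _)).2.ne] at this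
  refine le_of_eq_of_le (eLpNorm_congr_ae ?_) this.le
  have q : ∀ b, Lp.compMeasurePreserving (τ b) (hp b) hu.toLp =ᵐ[volume] fun x => u (x + b) := by
    intro b
    refine (Lp.coeFn_compMeasurePreserving _ (hp b)).trans ?_
    exact (hp b).quasiMeasurePreserving.ae_eq_comp hu.coeFn_toLp
  filter_upwards [q a, q 0] with x h1 h2
  rw [Pi.sub_apply, h1, h2, add_zero]

/-! ### Mollification from the interior -/

/-- The average of translates of `u` (extended by zero), weighted with `ρ`. -/
noncomputable def mollify (ρ u : ℝ × ℝ → ℝ) (x : ℝ × ℝ) : ℝ :=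
  ∫ t, halfPlane.indicator u t * ρ (t - x)

theorem memLp_indicator {u : ℝ × ℝ → ℝ} (hu : MemLp u 2 volHalf) :
    MemLp (halfPlane.indicator u) 2 volume :=
  (memLp_indicator_iff_restrict measurableSet_halfPlane).2 hu

theorem contDiff_mollify {ρ u : ℝ × ℝ → ℝ} (hρ : IsTest ρ) (hu : MemLp u 2 volHalf) :
    ContDiff ℝ ∞ (mollify ρ u) := by
  have h1 : HasCompactSupport fun x : ℝ × ℝ => ρ (-x) :=
    hρ.compact.comp_homeomorph (Homeomorph.neg (ℝ × ℝ))
  have h2 : ContDiff ℝ ∞ fun x : ℝ × ℝ => ρ (-x) := hρ.smooth.comp contDiff_neg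
  have := h1.contDiff_convolution_right (n := ⊤) (μ := volume) (ContinuousLinearMap.mul ℝ ℝ)
    ((memLp_indicator hu).locallyIntegrable (by norm_num)) h2
  have e : mollify ρ u = convolution (halfPlane.indicator u) (fun x => ρ (-x))
      (ContinuousLinearMap.mul ℝ ℝ) volume := by
    ext x
    simp [mollify, convolution_def]
  rw [e]
  exact this

theorem dirDeriv_mollify {ρ u : ℝ × ℝ → ℝ} (hρ : IsTest ρ) (hu : MemLp u 2 volHalf) (e x : ℝ × ℝ) :
    dirDeriv e (mollify ρ u) x = -mollify (dirDeriv e ρ) u x := by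
  have h1 : HasDerivAt (fun s : ℝ => mollify ρ u (x + s • e)) (dirDeriv e (mollify ρ u) x) 0 := by
    have hd := ((contDiff_mollify hρ hu).differentiable (by simp) x).hasFDerivAt
    exact hd.hasLineDerivAt e
  have h2 := hasDerivAt_integral_translate (memLp_indicator hu) (hρ.translate (-x)) (-e) 0
  have e1 : ∀ s : ℝ, ∫ t, halfPlane.indicator u t * ρ (t + s • (-e) + -x)
      = mollify ρ u (x + s • e) := by
    intro s
    refine integral_congr_ae (Eventually.of_forall fun t => ?_)
    simp only
    congr 2
    rw [smul_neg]; abel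
  simp only [e1] at h2
  rw [h1.unique h2, mollify, ← integral_neg]
  refine integral_congr_ae (Eventually.of_forall fun t => ?_)
  rw [dirDeriv_translate]
  simp [dirDeriv, sub_eq_add_neg]

theorem mollify_eq_setIntegral (ρ u : ℝ × ℝ → ℝ) (x : ℝ × ℝ) :
    mollify ρ u x = ∫ t in halfPlane, u t * ρ (t - x) := by
  rw [mollify, ← integral_indicator measurableSet_halfPlane]
  congr 1; ext t
  by_cases ht : t ∈ halfPlane
  · rw [indicator_of_mem ht, indicator_of_mem ht]
  · rw [indicator_of_notMem ht, indicator_of_notMem ht, zero_mul]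

theorem dirDeriv_mollify_eq {i j : ℕ} {e : ℝ × ℝ} (hij : i + j = 1)
    (he : ∀ φ, partialDeriv i j φ = dirDeriv e φ) {ρ u v : ℝ × ℝ → ℝ} (hρ : IsTest ρ)
    (hs : tsupport ρ ⊆ halfPlane) (hu : MemLp u 2 volHalf) (h : IsWeakPartial i j u v)
    {x : ℝ × ℝ} (hx : x ∈ halfPlane) :
    dirDeriv e (mollify ρ u) x = mollify ρ v x := by
  have hsx : tsupport (fun t => ρ (t + -x)) ⊆ halfPlane := by
    have := tsupport_comp_eq_preimage ρ (Homeomorph.addRight (-x))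
    intro t ht
    have ht : t + -x ∈ tsupport ρ := by
      have : t ∈ tsupport (ρ ∘ Homeomorph.addRight (-x)) := ht
      rwa [tsupport_comp_eq_preimage] at this
    have h1 : 0 < (t + -x).2 := hs ht
    have h2 : 0 < x.2 := hx
    simp only [Prod.snd_add, Prod.snd_neg] at h1
    change 0 < t.2
    linarith
  have := h.test (hρ.translate (-x)) hsx
  rw [he, dirDeriv_translate, hij] at this
  rw [dirDeriv_mollify hρ hu, mollify_eq_setIntegral, mollify_eq_setIntegral]
  simp only [sub_eq_add_neg]
  rw [this]; ring

theorem eLpNorm_mollify_sub_le {ρ u : ℝ × ℝ → ℝ} (hρ : IsTest ρ)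
    (h0 : ∀ x, 0 ≤ ρ x) (h1 : ∫ x, ρ x = 1) (hu : MemLp u 2 volHalf) {δ : ℝ≥0∞}
    (hδ : ∀ a, ρ a ≠ 0 → eLpNorm (fun x => halfPlane.indicator u (x + a) - halfPlane.indicator u x)
      2 volume ≤ δ) :
    eLpNorm (fun x => mollify ρ u x - u x) 2 volHalf ≤ δ := by
  set w := halfPlane.indicator u with hw
  have hwm : MemLp w 2 volume := memLp_indicator hu
  have hτ : ∀ a : ℝ × ℝ, MeasurePreserving (fun x => x + a) (volume : Measure (ℝ × ℝ)) volume :=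
    measurePreserving_add_right volume
  have hρq : Continuous fun a => √(ρ a) := hρ.continuous.sqrt
  have hmass : ∫⁻ a, ‖√(ρ a)‖ₑ ^ 2 = 1 := by
    have : ∀ a, ‖√(ρ a)‖ₑ ^ 2 = ENNReal.ofReal (ρ a) := by
      intro a
      rw [Real.enorm_of_nonneg (Real.sqrt_nonneg _), ← ENNReal.ofReal_pow (Real.sqrt_nonneg _),
        Real.sq_sqrt (h0 a)]
    simp only [this]
    rw [← ofReal_integral_eq_lintegral_ofReal (hρ.integrable _) (Eventually.of_forall h0), h1,
      ENNReal.ofReal_one]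
  have hjoint : AEStronglyMeasurable (fun p : (ℝ × ℝ) × (ℝ × ℝ) => w (p.1 + p.2) - w p.1)
      (volume.prod volume) :=
    (hwm.1.comp_quasiMeasurePreserving (quasiMeasurePreserving_add volume volume)).sub
      hwm.1.comp_fst
  have pt : ∀ᵐ x ∂(volume : Measure (ℝ × ℝ)), x ∈ halfPlane →
      ‖mollify ρ u x - u x‖ₑ ^ 2 ≤ ∫⁻ a, (‖√(ρ a)‖ₑ * ‖w (x + a) - w x‖ₑ) ^ 2 := by
    filter_upwards [hjoint.prodMk_left] with x hxm hx
    have i1 : Integrable (fun a => ρ a * w (x + a)) := by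
      have : MemLp (fun a => w (x + a)) 2 volume :=
        hwm.comp_measurePreserving (measurePreserving_add_left volume x)
      exact integrable_mul_of_memLp (hρ.memLp _ _) this
    have e : mollify ρ u x - u x = ∫ a, √(ρ a) * (√(ρ a) * (w (x + a) - w x)) := by
      have e1 : ∀ a, √(ρ a) * (√(ρ a) * (w (x + a) - w x)) = ρ a * w (x + a) - ρ a * w x := by
        intro a; rw [← mul_assoc, Real.mul_self_sqrt (h0 a)]; ring
      simp only [e1]
      rw [integral_sub i1 ((hρ.integrable _).mul_const _), integral_mul_const, h1, one_mul]
      congr 1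
      · rw [mollify, ← integral_add_right_eq_self _ x]
        congr 1; ext a
        rw [add_sub_cancel_right, mul_comm, add_comm]
      · rw [hw, indicator_of_mem hx]
    rw [e]
    calc ‖∫ a, √(ρ a) * (√(ρ a) * (w (x + a) - w x))‖ₑ ^ 2
        ≤ (∫⁻ a, ‖√(ρ a)‖ₑ * (‖√(ρ a)‖ₑ * ‖w (x + a) - w x‖ₑ)) ^ 2 := by
          gcongr
          refine (enorm_integral_le_lintegral_enorm _).trans_eq ?_
          simp only [enorm_mul]
      _ ≤ (∫⁻ a, ‖√(ρ a)‖ₑ ^ 2) * ∫⁻ a, (‖√(ρ a)‖ₑ * ‖w (x + a) - w x‖ₑ) ^ 2 :=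
          lintegral_mul_sq_le hρq.measurable.enorm.aemeasurable
            (hρq.measurable.enorm.aemeasurable.mul hxm.enorm)
      _ = _ := by rw [hmass, one_mul]
  refine (ENNReal.pow_le_pow_left_iff two_ne_zero).1 ?_
  rw [eLpNorm_two_sq]
  calc ∫⁻ x in halfPlane, ‖mollify ρ u x - u x‖ₑ ^ 2
      ≤ ∫⁻ x in halfPlane, ∫⁻ a, (‖√(ρ a)‖ₑ * ‖w (x + a) - w x‖ₑ) ^ 2 :=
        setLIntegral_mono_ae' measurableSet_halfPlane pt
    _ ≤ ∫⁻ x, ∫⁻ a, (‖√(ρ a)‖ₑ * ‖w (x + a) - w x‖ₑ) ^ 2 := setLIntegral_le_lintegral _ _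
    _ = ∫⁻ a, ∫⁻ x, (‖√(ρ a)‖ₑ * ‖w (x + a) - w x‖ₑ) ^ 2 := by
        refine lintegral_lintegral_swap ?_
        exact (((hρq.measurable.enorm.comp measurable_snd).aemeasurable).mul hjoint.enorm).pow_const 2
    _ ≤ ∫⁻ a, ‖√(ρ a)‖ₑ ^ 2 * δ ^ 2 := by
        refine lintegral_mono fun a => ?_
        simp only [mul_pow]
        rw [lintegral_const_mul' _ _ (by finiteness)]
        by_cases ha : ρ a = 0
        · simp [ha]
        · gcongr
          rw [← eLpNorm_two_sq]
          gcongr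
          exact hδ a ha
    _ = δ ^ 2 := by
        rw [lintegral_mul_const _ (hρq.measurable.enorm.pow_const 2), hmass, one_mul]

theorem exists_mollifier {δ : ℝ} (hδ : 0 < δ) : ∃ ρ : ℝ × ℝ → ℝ, IsTest ρ ∧
    tsupport ρ ⊆ halfPlane ∧ (∀ x, 0 ≤ ρ x) ∧ ∫ x, ρ x = 1 ∧ ∀ a, ρ a ≠ 0 → ‖a‖ < δ := by
  let b : ContDiffBump ((0, δ / 2) : ℝ × ℝ) := ⟨δ / 8, δ / 4, by positivity, by linarith⟩
  refine ⟨b.normed volume, ⟨b.contDiff_normed, b.hasCompactSupport_normed⟩, ?_, b.nonneg_normed,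
    b.integral_normed, fun a ha => ?_⟩
  · rw [b.tsupport_normed_eq]
    intro x hx
    rw [Metric.mem_closedBall, Prod.dist_eq] at hx
    have := (le_max_right _ _).trans hx
    rw [Real.dist_eq, abs_le] at this
    change 0 < x.2
    have h4 : b.rOut = δ / 4 := rfl
    rw [h4] at this
    simp only at this
    linarith [this.1]
  · have : a ∈ Metric.ball ((0, δ / 2) : ℝ × ℝ) b.rOut := by
      rw [← b.support_normed_eq (μ := volume)]; exact ha
    rw [Metric.mem_ball] at this
    have h4 : b.rOut = δ / 4 := rfl
    rw [h4] at this
    calc ‖a‖ ≤ dist a (0, δ / 2) + ‖((0, δ / 2) : ℝ × ℝ)‖ := by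
          rw [← dist_zero_right, ← dist_zero_right]; exact dist_triangle _ _ _
      _ < δ / 4 + δ / 2 := by
          refine add_lt_add_of_lt_of_le this ?_
          rw [Prod.norm_mk, norm_zero, Real.norm_of_nonneg (by positivity)]
          exact max_le (by positivity) le_rfl
      _ < δ := by linarith

theorem exists_smooth_approx {w wR wH : ℝ × ℝ → ℝ} (hR : IsWeakPartial 1 0 w wR)
    (hH : IsWeakPartial 0 1 w wH) (m0 : MemLp w 2 volHalf) (m1 : MemLp wR 2 volHalf)
    (m2 : MemLp wH 2 volHalf) {ε : ℝ} (hε : 0 < ε) :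
    ∃ Φ : ℝ × ℝ → ℝ, ContDiff ℝ ∞ Φ ∧ eLpNorm (fun x => Φ x - w x) 2 volHalf ≤ ENNReal.ofReal ε ∧
      eLpNorm (fun x => dirDeriv (1, 0) Φ x - wR x) 2 volHalf ≤ ENNReal.ofReal ε ∧
      eLpNorm (fun x => dirDeriv (0, 1) Φ x - wH x) 2 volHalf ≤ ENNReal.ofReal ε := by
  obtain ⟨δ0, hδ0, h0⟩ := exists_translate_lt (memLp_indicator m0) hε
  obtain ⟨δ1, hδ1, h1⟩ := exists_translate_lt (memLp_indicator m1) hε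
  obtain ⟨δ2, hδ2, h2⟩ := exists_translate_lt (memLp_indicator m2) hε
  obtain ⟨ρ, hρ, hs, hn, hi, hb⟩ := exists_mollifier (lt_min hδ0 (lt_min hδ1 hδ2))
  refine ⟨mollify ρ w, contDiff_mollify hρ m0, ?_, ?_, ?_⟩
  · exact eLpNorm_mollify_sub_le hρ hn hi m0 fun a ha => h0 a ((hb a ha).trans_le (min_le_left _ _))
  · refine le_of_eq_of_le (eLpNorm_congr_ae ?_) (eLpNorm_mollify_sub_le hρ hn hi m1 fun a ha =>
      h1 a ((hb a ha).trans_le ((min_le_right _ _).trans (min_le_left _ _))))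
    filter_upwards [ae_restrict_mem measurableSet_halfPlane] with x hx
    rw [dirDeriv_mollify_eq (by rfl) partialDeriv_one_zero hρ hs m0 hR hx]
  · refine le_of_eq_of_le (eLpNorm_congr_ae ?_) (eLpNorm_mollify_sub_le hρ hn hi m2 fun a ha =>
      h2 a ((hb a ha).trans_le ((min_le_right _ _).trans (min_le_right _ _))))
    filter_upwards [ae_restrict_mem measurableSet_halfPlane] with x hx
    rw [dirDeriv_mollify_eq (by rfl) partialDeriv_zero_one hρ hs m0 hH hx]

/-- A smooth function with square integrable gradient is the limit of test functions. -/
theorem exists_test_seq_smooth {Φ : ℝ × ℝ → ℝ} (hΦ : ContDiff ℝ ∞ Φ) (m0 : MemLp Φ 2 volHalf)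
    (mD : ∀ e : ℝ × ℝ, MemLp (dirDeriv e Φ) 2 volHalf) :
    ∃ φ : ℕ → ℝ × ℝ → ℝ, (∀ n, IsTest (φ n)) ∧
      Tendsto (fun n => eLpNorm (fun x => φ n x - Φ x) 2 volHalf) atTop (𝓝 0) ∧
      (∀ e, Tendsto (fun n => eLpNorm (fun x => dirDeriv e (φ n) x - dirDeriv e Φ x) 2 volHalf)
        atTop (𝓝 0)) ∧ (∀ n x, |φ n x| ≤ |Φ x|) ∧
      ∀ x, Tendsto (fun n => φ n x) atTop (𝓝 (Φ x)) := by
  let κ : ContDiffBump (0 : ℝ × ℝ) := ⟨1, 2, one_pos, one_lt_two⟩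
  have hκ : IsTest κ := ⟨κ.contDiff, κ.hasCompactSupport⟩
  let s : ℕ → ℝ := fun n => 1 / (n + 1)
  have hs : ∀ n, 0 < s n := fun n => by positivity
  have hs0 : Tendsto s atTop (𝓝 0) := tendsto_one_div_add_atTop_nhds_zero_nat
  have hκs : ∀ n, IsTest fun x => κ (s n • x) := fun n =>
    ⟨κ.contDiff.comp (contDiff_const_smul _), hκ.compact.comp_homeomorph
      (Homeomorph.smulOfNeZero (s n) (hs n).ne')⟩
  have hd : ∀ n e, dirDeriv e (fun x => κ (s n • x)) = fun x => s n * dirDeriv e κ (s n • x) := by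
    intro n e; ext x
    have h1 : HasFDerivAt (fun x : ℝ × ℝ => s n • x) (s n • ContinuousLinearMap.id ℝ (ℝ × ℝ)) x :=
      (hasFDerivAt_id x).const_smul (s n)
    have h2 := ((hκ.differentiable (s n • x)).hasFDerivAt.comp x h1).fderiv
    have h3 : fderiv ℝ (fun x => κ (s n • x)) x
        = (fderiv ℝ κ (s n • x)).comp (s n • ContinuousLinearMap.id ℝ (ℝ × ℝ)) := h2
    simp only [dirDeriv]
    rw [h3]
    simp
  have hlim : ∀ x, Tendsto (fun n => κ (s n • x)) atTop (𝓝 1) := fun x => by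
    have h1 : Tendsto (fun n => s n • x) atTop (𝓝 0) := by simpa using hs0.smul_const x
    have h2 := (κ.continuous.tendsto 0).comp h1
    rwa [κ.one_of_mem_closedBall (Metric.mem_closedBall_self zero_le_one)] at h2
  have hone : ∀ u, MemLp u 2 volHalf →
      Tendsto (fun n => eLpNorm (fun x => (κ (s n • x) - 1) * u x) 2 volHalf) atTop (𝓝 0) := by
    intro u hu
    refine tendsto_eLpNorm_mul_zero hu
      (fun n => ((hκs n).continuous.sub continuous_const).aestronglyMeasurable) (fun n x => ?_)
      (fun x => ?_)
    · have h1 := κ.nonneg (x := s n • x)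
      have h2 := κ.le_one (x := s n • x)
      exact abs_le.2 ⟨by linarith, by linarith⟩
    · simpa using (hlim x).sub_const 1
  refine ⟨fun n x => κ (s n • x) * Φ x, fun n => ?_, ?_, fun e => ?_, fun n x => ?_, fun x => by
    simpa using (hlim x).mul_const (Φ x)⟩
  · have := (hκs n).mul_left hΦ
    simpa only [mul_comm] using this
  · refine (hone Φ m0).congr fun n => ?_
    congr 1; ext x; ring
  · obtain ⟨_, C, _, hC, _⟩ := (hκ.dirDeriv e).exists_box
    have hC0 : 0 ≤ C := (abs_nonneg _).trans (hC 0)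
    have hmaj : Tendsto (fun n => eLpNorm (fun x => (κ (s n • x) - 1) * dirDeriv e Φ x) 2 volHalf
        + ENNReal.ofReal (s n * C) * eLpNorm Φ 2 volHalf) atTop (𝓝 0) := by
      have h2 : Tendsto (fun n => ENNReal.ofReal (s n * C)) atTop (𝓝 0) := by
        have := ENNReal.tendsto_ofReal (hs0.mul_const C)
        simpa using this
      have h3 := ENNReal.Tendsto.mul_const h2 (Or.inr m0.2.ne)
      simpa using (hone _ (mD e)).add h3
    refine tendsto_of_tendsto_of_tendsto_of_le_of_le tendsto_const_nhds hmaj (fun _ => zero_le)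
      fun n => ?_
    have hm1 : AEStronglyMeasurable (fun x => (κ (s n • x) - 1) * dirDeriv e Φ x) volHalf :=
      ((hκs n).continuous.sub continuous_const).aestronglyMeasurable.mul (mD e).1
    have hm2 : AEStronglyMeasurable (fun x => s n * dirDeriv e κ (s n • x) * Φ x) volHalf := by
      have := ((hκs n).dirDeriv e).continuous.aestronglyMeasurable.mul m0.1
      rw [hd] at this
      exact this
    have e1 : (fun x => dirDeriv e (fun x => κ (s n • x) * Φ x) x - dirDeriv e Φ x)
        = (fun x => (κ (s n • x) - 1) * dirDeriv e Φ x) + fun x => s n * dirDeriv e κ (s n • x) * Φ x := by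
      ext x
      rw [dirDeriv_mul (hκs n).differentiable (hΦ.differentiable (by simp)), hd, Pi.add_apply]
      ring
    rw [e1]
    refine (eLpNorm_add_le hm1 hm2 (by norm_num)).trans ?_
    gcongr
    refine eLpNorm_le_mul_eLpNorm_of_ae_le_mul (Eventually.of_forall fun x => ?_) 2
    rw [norm_mul, norm_mul, Real.norm_of_nonneg (hs n).le]
    gcongr
    exact hC _
  · rw [abs_mul, abs_of_nonneg κ.nonneg]
    exact mul_le_of_le_one_left (abs_nonneg _) κ.le_one

theorem exists_test_seq {w wR wH : ℝ × ℝ → ℝ} (hR : IsWeakPartial 1 0 w wR)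
    (hH : IsWeakPartial 0 1 w wH) (m0 : MemLp w 2 volHalf) (m1 : MemLp wR 2 volHalf)
    (m2 : MemLp wH 2 volHalf) : ∃ φ : ℕ → ℝ × ℝ → ℝ, (∀ n, IsTest (φ n)) ∧
      Tendsto (fun n => eLpNorm (fun x => φ n x - w x) 2 volHalf) atTop (𝓝 0) ∧
      Tendsto (fun n => eLpNorm (fun x => dirDeriv (1, 0) (φ n) x - wR x) 2 volHalf) atTop (𝓝 0) ∧
      Tendsto (fun n => eLpNorm (fun x => dirDeriv (0, 1) (φ n) x - wH x) 2 volHalf)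
        atTop (𝓝 0) := by
  have key : ∀ n : ℕ, ∃ φ, IsTest φ ∧
      eLpNorm (fun x => φ x - w x) 2 volHalf ≤ ENNReal.ofReal (2 * (1 / (n + 1))) ∧
      eLpNorm (fun x => dirDeriv (1, 0) φ x - wR x) 2 volHalf ≤ ENNReal.ofReal (2 * (1 / (n + 1))) ∧
      eLpNorm (fun x => dirDeriv (0, 1) φ x - wH x) 2 volHalf
        ≤ ENNReal.ofReal (2 * (1 / (n + 1))) := by
    intro n
    have hε : (0 : ℝ) < 1 / (n + 1) := by positivity
    set ε : ℝ := 1 / (n + 1)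
    obtain ⟨Φ, hΦ, a0, a1, a2⟩ := exists_smooth_approx hR hH m0 m1 m2 hε
    have mem : ∀ {F u : ℝ × ℝ → ℝ}, Continuous F → MemLp u 2 volHalf →
        eLpNorm (fun x => F x - u x) 2 volHalf ≤ ENNReal.ofReal ε → MemLp F 2 volHalf := by
      intro F u hF hu h
      have : MemLp (fun x => F x - u x) 2 volHalf :=
        ⟨hF.aestronglyMeasurable.sub hu.1, h.trans_lt ENNReal.ofReal_lt_top⟩
      refine (this.add hu).ae_eq (Eventually.of_forall fun x => ?_)
      simp
    have cR := (contDiff_dirDeriv (e := ((1, 0) : ℝ × ℝ)) hΦ).continuous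
    have cH := (contDiff_dirDeriv (e := ((0, 1) : ℝ × ℝ)) hΦ).continuous
    have b0 := mem hΦ.continuous m0 a0
    have b1 := mem cR m1 a1
    have b2 := mem cH m2 a2
    obtain ⟨φ, hφ, c0, c1, -⟩ := exists_test_seq_smooth hΦ b0 fun e => by
      have : dirDeriv e Φ = fun x => e.1 * dirDeriv (1, 0) Φ x + e.2 * dirDeriv (0, 1) Φ x := by
        ext x; exact fderiv_apply_prod Φ x e.1 e.2
      rw [this]
      exact (b1.const_mul _).add (b2.const_mul _)
    have hpos : (0 : ℝ≥0∞) < ENNReal.ofReal ε := ENNReal.ofReal_pos.2 hε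
    obtain ⟨k, k0, k1, k2⟩ := ((c0.eventually_le_const hpos).and
      (((c1 (1, 0)).eventually_le_const hpos).and ((c1 (0, 1)).eventually_le_const hpos))).exists
    have tri : ∀ {f F u : ℝ × ℝ → ℝ}, Continuous f → Continuous F → MemLp u 2 volHalf →
        eLpNorm (fun x => f x - F x) 2 volHalf ≤ ENNReal.ofReal ε →
        eLpNorm (fun x => F x - u x) 2 volHalf ≤ ENNReal.ofReal ε →
        eLpNorm (fun x => f x - u x) 2 volHalf ≤ ENNReal.ofReal (2 * ε) := by
      intro f F u hf hF hu h1 h2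
      have e : (fun x => f x - u x) = (fun x => f x - F x) + fun x => F x - u x := by
        ext x; simp
      rw [e, two_mul, ENNReal.ofReal_add hε.le hε.le]
      exact (eLpNorm_add_le (hf.sub hF).aestronglyMeasurable (hF.aestronglyMeasurable.sub hu.1)
        (by norm_num)).trans (add_le_add h1 h2)
    exact ⟨φ k, hφ k, tri (hφ k).continuous hΦ.continuous m0 k0 a0,
      tri ((hφ k).dirDeriv _).continuous cR m1 k1 a1, tri ((hφ k).dirDeriv _).continuous cH m2 k2 a2⟩
  choose φ hφ h0 h1 h2 using key
  have hz : Tendsto (fun n : ℕ => ENNReal.ofReal (2 * (1 / ((n : ℝ) + 1)))) atTop (𝓝 0) := by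
    have := ENNReal.tendsto_ofReal ((tendsto_one_div_add_atTop_nhds_zero_nat (𝕜 := ℝ)).const_mul 2)
    simpa using this
  have sq : ∀ f : ℕ → ℝ≥0∞, (∀ n, f n ≤ ENNReal.ofReal (2 * (1 / ((n : ℝ) + 1)))) →
      Tendsto f atTop (𝓝 0) := fun f hf =>
    tendsto_of_tendsto_of_tendsto_of_le_of_le tendsto_const_nhds hz (fun _ => zero_le) hf
  exact ⟨φ, hφ, sq _ h0, sq _ h1, sq _ h2⟩

end

section

/-! ### Traces -/

/-- `φ n` are test functions whose `1`-jets converge to `(w, wR, wH)` in `L²`. -/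
structure IsApprox (w wR wH : ℝ × ℝ → ℝ) (φ : ℕ → ℝ × ℝ → ℝ) : Prop where
  mem : MemLp w 2 volHalf
  mem_fst : MemLp wR 2 volHalf
  mem_snd : MemLp wH 2 volHalf
  test : ∀ n, IsTest (φ n)
  tendsto : Tendsto (fun n => eLpNorm (fun x => φ n x - w x) 2 volHalf) atTop (𝓝 0)
  tendsto_fst : Tendsto (fun n => eLpNorm (fun x => dirDeriv (1, 0) (φ n) x - wR x) 2 volHalf)
    atTop (𝓝 0)
  tendsto_snd : Tendsto (fun n => eLpNorm (fun x => dirDeriv (0, 1) (φ n) x - wH x) 2 volHalf)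
    atTop (𝓝 0)

theorem exists_isApprox {w wR wH : ℝ × ℝ → ℝ} (hR : IsWeakPartial 1 0 w wR)
    (hH : IsWeakPartial 0 1 w wH) (m0 : MemLp w 2 volHalf) (m1 : MemLp wR 2 volHalf)
    (m2 : MemLp wH 2 volHalf) : ∃ φ, IsApprox w wR wH φ := by
  obtain ⟨φ, h, h0, h1, h2⟩ := exists_test_seq hR hH m0 m1 m2
  exact ⟨φ, m0, m1, m2, h, h0, h1, h2⟩

variable {w wR wH : ℝ × ℝ → ℝ} {φ : ℕ → ℝ × ℝ → ℝ}

theorem IsApprox.memLp_trace (h : IsApprox w wR wH φ) (n : ℕ) :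
    MemLp (fun r => φ n (r, 0)) 2 volume := ((h.test n).slice_snd 0).memLp _ _

theorem IsApprox.exists_trace (h : IsApprox w wR wH φ) : ∃ t : ℝ → ℝ, MemLp t 2 volume ∧
    Tendsto (fun n => eLpNorm (fun r => φ n (r, 0) - t r) 2 volume) atTop (𝓝 0) := by
  have c0 := (tendsto_toLp (fun n => (h.test n).memLp volHalf 2) h.mem h.tendsto).cauchySeq
  have c2 := (tendsto_toLp (fun n => ((h.test n).dirDeriv (0, 1)).memLp volHalf 2) h.mem_snd
    h.tendsto_snd).cauchySeq
  have ct : CauchySeq fun n => (h.memLp_trace n).toLp := by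
    rw [Metric.cauchySeq_iff] at c0 c2 ⊢
    intro ε hε
    obtain ⟨N0, h0⟩ := c0 (ε / 2) (by positivity)
    obtain ⟨N2, h2⟩ := c2 (ε / 2) (by positivity)
    refine ⟨max N0 N2, fun m hm n hn => ?_⟩
    have a0 := h0 m ((le_max_left _ _).trans hm) n ((le_max_left _ _).trans hn)
    have a2 := h2 m ((le_max_right _ _).trans hm) n ((le_max_right _ _).trans hn)
    rw [dist_eq_norm, ← MemLp.toLp_sub, Lp.norm_toLp] at a0 a2 ⊢
    have ht := (h.test m).sub (h.test n)
    have tr := eLpNorm_trace_le ht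
    have e : dirDeriv (0, 1) (fun x => φ m x - φ n x)
        = dirDeriv (0, 1) (φ m) - dirDeriv (0, 1) (φ n) := by
      ext x
      simp only [dirDeriv, Pi.sub_apply]
      rw [fderiv_fun_sub ((h.test m).differentiable x) ((h.test n).differentiable x)]
      rfl
    rw [e] at tr
    have tr' : (eLpNorm ((fun r => φ m (r, 0)) - fun r => φ n (r, 0)) 2 volume).toReal ^ 2
        ≤ 2 * ((eLpNorm (φ m - φ n) 2 volHalf).toReal
          * (eLpNorm (dirDeriv (0, 1) (φ m) - dirDeriv (0, 1) (φ n)) 2 volHalf).toReal) := tr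
    have p0 : 0 ≤ (eLpNorm (φ m - φ n) 2 volHalf).toReal := ENNReal.toReal_nonneg
    have p2 : 0 ≤ (eLpNorm (dirDeriv (0, 1) (φ m) - dirDeriv (0, 1) (φ n)) 2 volHalf).toReal :=
      ENNReal.toReal_nonneg
    refine lt_of_pow_lt_pow_left₀ 2 hε.le (tr'.trans_lt ?_)
    have : (eLpNorm (φ m - φ n) 2 volHalf).toReal
      * (eLpNorm (dirDeriv (0, 1) (φ m) - dirDeriv (0, 1) (φ n)) 2 volHalf).toReal
      ≤ ε / 2 * (ε / 2) := by gcongr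
    nlinarith
  obtain ⟨t, ht⟩ := cauchySeq_tendsto_of_complete ct
  refine ⟨t, Lp.memLp t, ?_⟩
  have := (Lp.tendsto_Lp_iff_tendsto_eLpNorm' _ _).1 ht
  refine this.congr fun n => eLpNorm_congr_ae ?_
  filter_upwards [(h.memLp_trace n).coeFn_toLp] with r hr
  rw [Pi.sub_apply, hr]

/-- The Gauss-Green formula with the boundary values `t`. -/
def Green (w wH : ℝ × ℝ → ℝ) (t : ℝ → ℝ) : Prop :=
  ∀ φ : ℝ × ℝ → ℝ, IsTest φ →
    (∫ x in halfPlane, w x * dirDeriv (0, 1) φ x) + ∫ x in halfPlane, wH x * φ x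
      = -∫ r, t r * φ (r, 0)

theorem IsApprox.green (h : IsApprox w wR wH φ) {t : ℝ → ℝ} (ht : MemLp t 2 volume)
    (hφt : Tendsto (fun n => eLpNorm (fun r => φ n (r, 0) - t r) 2 volume) atTop (𝓝 0)) :
    Green w wH t := by
  intro ψ hψ
  have l1 := tendsto_integral_mul (fun n => (h.test n).memLp volHalf 2) h.mem
    ((hψ.dirDeriv (0, 1)).memLp _ _) h.tendsto
  have l2 := tendsto_integral_mul (fun n => ((h.test n).dirDeriv (0, 1)).memLp volHalf 2) h.mem_snd
    (hψ.memLp _ _) h.tendsto_snd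
  have l3 := tendsto_integral_mul h.memLp_trace ht ((hψ.slice_snd 0).memLp _ _) hφt
  refine tendsto_nhds_unique (l1.add l2) (l3.neg.congr fun n => ?_)
  rw [← integral_green (h.test n) hψ]

theorem slobSemi_le_of_tendsto {f : ℕ → ℝ → ℝ} {t : ℝ → ℝ} (hf : ∀ n, MemLp (f n) 2 volume)
    (ht : MemLp t 2 volume)
    (h : Tendsto (fun n => eLpNorm (fun r => f n r - t r) 2 volume) atTop (𝓝 0)) {B : ℕ → ℝ≥0∞}
    {A : ℝ≥0∞} (hB : ∀ n, slobSemi (f n) ≤ B n) (hA : Tendsto B atTop (𝓝 A)) : slobSemi t ≤ A := by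
  have pt : ∀ s : ℝ, Tendsto (fun n => eLpNorm (fun x => f n (x + s • (1 : ℝ)) - f n x) 2 volume)
      atTop (𝓝 (eLpNorm (fun x => t (x + s • (1 : ℝ)) - t x) 2 volume)) := by
    intro s
    have hs := measurePreserving_translate_line s
    have mf : ∀ n, MemLp (fun x => f n (x + s • (1 : ℝ))) 2 volume := fun n =>
      (hf n).comp_measurePreserving hs
    have mt : MemLp (fun x => t (x + s • (1 : ℝ))) 2 volume := ht.comp_measurePreserving hs
    refine tendsto_eLpNorm (fun n => (mf n).sub (hf n)) (mt.sub ht) ?_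
    have hb := h.add h
    rw [add_zero] at hb
    refine tendsto_of_tendsto_of_tendsto_of_le_of_le tendsto_const_nhds hb (fun _ => zero_le)
      fun n => ?_
    have e : (fun x => (f n (x + s • (1 : ℝ)) - f n x) - (t (x + s • (1 : ℝ)) - t x))
        = (fun x => f n (x + s • (1 : ℝ)) - t (x + s • (1 : ℝ))) - fun x => f n x - t x := by
      ext x; simp only [Pi.sub_apply]; ring
    refine le_of_eq_of_le (congrArg (fun F => eLpNorm F 2 volume) e) ?_
    refine (eLpNorm_sub_le ((mf n).sub mt).1 ((hf n).sub ht).1 (by norm_num)).trans ?_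
    refine add_le_add ?_ le_rfl
    exact (eLpNorm_comp_measurePreserving (g := fun x => f n x - t x) ((hf n).sub ht).1 hs).le
  have meas : ∀ n, AEMeasurable (fun s : ℝ => ENNReal.ofReal ((s ^ 2)⁻¹)
      * eLpNorm (fun x => f n (x + s • (1 : ℝ)) - f n x) 2 volume ^ 2) volume := by
    intro n
    refine (Measurable.ennreal_ofReal (by fun_prop)).aemeasurable.mul ?_
    simp only [eLpNorm_two_sq]
    have := ((aemeasurable_comp_add (hf n).1).prod_swap.sub (hf n).1.comp_snd).enorm.pow_const 2
    refine AEMeasurable.lintegral_prod_right' (f := fun p : ℝ × ℝ =>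
      ‖f n (p.2 + p.1 • (1 : ℝ)) - f n p.2‖ₑ ^ 2) ?_
    refine this.congr (Eventually.of_forall fun p => ?_)
    simp
  rw [slobSemi_eq ht.1]
  calc ∫⁻ s : ℝ, ENNReal.ofReal ((s ^ 2)⁻¹)
        * eLpNorm (fun x => t (x + s • (1 : ℝ)) - t x) 2 volume ^ 2
      = ∫⁻ s : ℝ, liminf (fun n => ENNReal.ofReal ((s ^ 2)⁻¹)
        * eLpNorm (fun x => f n (x + s • (1 : ℝ)) - f n x) 2 volume ^ 2) atTop := by
        refine lintegral_congr fun s => (Tendsto.liminf_eq ?_).symm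
        exact ENNReal.Tendsto.const_mul (ENNReal.Tendsto.pow (pt s)) (Or.inr ENNReal.ofReal_ne_top)
    _ ≤ liminf (fun n => ∫⁻ s : ℝ, ENNReal.ofReal ((s ^ 2)⁻¹)
        * eLpNorm (fun x => f n (x + s • (1 : ℝ)) - f n x) 2 volume ^ 2) atTop :=
        lintegral_liminf_le' meas
    _ ≤ liminf B atTop := by
        refine liminf_le_liminf (Eventually.of_forall fun n => ?_)
        rw [← slobSemi_eq (hf n).1]
        exact hB n
    _ = A := hA.liminf_eq

theorem IsApprox.halfBound (h : IsApprox w wR wH φ) {t : ℝ → ℝ} (ht : MemLp t 2 volume)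
    (hφt : Tendsto (fun n => eLpNorm (fun r => φ n (r, 0) - t r) 2 volume) atTop (𝓝 0)) :
    HalfBound t (12 * (eLpNorm w 2 volHalf + eLpNorm wR 2 volHalf + eLpNorm wH 2 volHalf)) := by
  have l0 := tendsto_eLpNorm (fun n => (h.test n).memLp volHalf 2) h.mem h.tendsto
  have l1 := tendsto_eLpNorm (fun n => ((h.test n).dirDeriv (1, 0)).memLp volHalf 2) h.mem_fst
    h.tendsto_fst
  have l2 := tendsto_eLpNorm (fun n => ((h.test n).dirDeriv (0, 1)).memLp volHalf 2) h.mem_snd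
    h.tendsto_snd
  refine ⟨ht, ?_, ?_⟩
  · have lt := tendsto_eLpNorm h.memLp_trace ht hφt
    have : eLpNorm t 2 volume ≤ eLpNorm w 2 volHalf + eLpNorm wH 2 volHalf := by
      refine le_of_tendsto_of_tendsto' lt (l0.add l2) fun n => ?_
      have tr := eLpNorm_trace_le (h.test n)
      have f0 := ((h.test n).memLp volHalf 2).2.ne
      have f2 := (((h.test n).dirDeriv (0, 1)).memLp volHalf 2).2.ne
      rw [← ENNReal.toReal_le_toReal (h.memLp_trace n).2.ne (by finiteness), ENNReal.toReal_add f0 f2]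
      refine le_of_sq_le_sq ?_ (by positivity)
      nlinarith [sq_nonneg (eLpNorm (φ n) 2 volHalf).toReal,
        sq_nonneg (eLpNorm (dirDeriv (0, 1) (φ n)) 2 volHalf).toReal]
    refine this.trans ?_
    rw [add_right_comm]
    calc _ ≤ eLpNorm w 2 volHalf + eLpNorm wH 2 volHalf + eLpNorm wR 2 volHalf := le_self_add
      _ ≤ _ := le_mul_of_one_le_left zero_le (by norm_num)
  · refine (slobSemi_le_of_tendsto h.memLp_trace ht hφt (fun n => slobSemi_trace_le (h.test n))
      (A := 136 * (eLpNorm wR 2 volHalf ^ 2 + eLpNorm wH 2 volHalf ^ 2)) ?_).trans ?_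
    · exact ENNReal.Tendsto.const_mul ((ENNReal.Tendsto.pow l1).add (ENNReal.Tendsto.pow l2))
        (Or.inr (by norm_num))
    · rw [mul_pow]
      gcongr
      · norm_num
      · rw [add_assoc]
        calc _ ≤ (eLpNorm wR 2 volHalf + eLpNorm wH 2 volHalf) ^ 2 := by
              rw [add_sq, add_right_comm]; exact le_self_add
          _ ≤ _ := by exact pow_le_pow_left' le_add_self 2

/-- The trace theorem. -/
theorem exists_green {w wR wH : ℝ × ℝ → ℝ} (hR : IsWeakPartial 1 0 w wR)
    (hH : IsWeakPartial 0 1 w wH) (m0 : MemLp w 2 volHalf) (m1 : MemLp wR 2 volHalf)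
    (m2 : MemLp wH 2 volHalf) : ∃ t, Green w wH t ∧
      HalfBound t (12 * (eLpNorm w 2 volHalf + eLpNorm wR 2 volHalf + eLpNorm wH 2 volHalf)) := by
  obtain ⟨φ, h⟩ := exists_isApprox hR hH m0 m1 m2
  obtain ⟨t, ht, hφt⟩ := h.exists_trace
  exact ⟨t, h.green ht hφt, h.halfBound ht hφt⟩

/-- Every test function on the line extends to the plane. -/
theorem exists_extend {ψ : ℝ → ℝ} (hψ : IsTest ψ) :
    ∃ φ : ℝ × ℝ → ℝ, IsTest φ ∧ (∀ r, φ (r, 0) = ψ r) ∧ ∀ r, dirDeriv (1, 0) φ (r, 0) = dirDeriv 1 ψ r := by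
  let κ : ContDiffBump (0 : ℝ) := ⟨1, 2, one_pos, one_lt_two⟩
  have hφ : IsTest fun x : ℝ × ℝ => ψ x.1 * κ x.2 := by
    refine ⟨(hψ.smooth.comp contDiff_fst).mul (κ.contDiff.comp contDiff_snd), ?_⟩
    refine HasCompactSupport.intro (hψ.compact.prod κ.hasCompactSupport) fun x hx => ?_
    by_cases h1 : x.1 ∈ tsupport ψ
    · rw [image_eq_zero_of_notMem_tsupport (f := κ) fun h2 => hx ⟨h1, h2⟩, mul_zero]
    · rw [image_eq_zero_of_notMem_tsupport h1, zero_mul]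
  have h0 : ∀ r, ψ r * κ 0 = ψ r := fun r => by
    rw [κ.one_of_mem_closedBall (Metric.mem_closedBall_self zero_le_one), mul_one]
  refine ⟨_, hφ, h0, fun r => ?_⟩
  have := congrFun (dirDeriv_slice_snd hφ 0) r
  rw [← this]
  simp only [h0]

theorem green_unique {t t' : ℝ → ℝ} (ht : LocallyIntegrable t) (ht' : LocallyIntegrable t')
    (h : Green w wH t) (h' : Green w wH t') : t =ᵐ[volume] t' := by
  refine ae_eq_of_forall_isTest ht ht' fun ψ hψ => ?_
  obtain ⟨φ, hφ, h0, _⟩ := exists_extend hψ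
  have := (h φ hφ).symm.trans (h' φ hφ)
  simpa [h0] using this

/-- The trace commutes with tangential derivatives. -/
theorem Green.isWeakDeriv {y yR yH yRH : ℝ × ℝ → ℝ} {t t' : ℝ → ℝ} (h : Green y yH t)
    (h' : Green yR yRH t') (ht : LocallyIntegrable t) (ht' : LocallyIntegrable t')
    (m0 : MemLp y 2 volHalf) (m1 : MemLp yR 2 volHalf) (m2 : MemLp yH 2 volHalf)
    (m3 : MemLp yRH 2 volHalf) (hR : IsWeakPartial 1 0 y yR) (hRH : IsWeakPartial 1 0 yH yRH) :
    IsWeakDeriv 1 t t' := by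
  refine ⟨ht, ht', fun ψ h1 h2 => ?_⟩
  obtain ⟨φ, hφ, h0, hd⟩ := exists_extend ⟨h1, h2⟩
  have a := h _ (hφ.dirDeriv (1, 0))
  have b := h' φ hφ
  have c := (weakDir_of_isWeakPartial hR m0 m1).2.2 _ (hφ.dirDeriv (0, 1))
  have d := (weakDir_of_isWeakPartial hRH m2 m3).2.2 _ hφ
  rw [dirDeriv_comm hφ.smooth, c, d] at a
  simp only [h0, hd] at a b
  rw [← dirDeriv_one, pow_one]
  linarith

end

section

/-! ### The optimal profile -/

theorem pos_of_deriv_ge {u u' : ℝ → ℝ} {K : ℝ} (hu : ∀ z, HasDerivAt u (u' z) z) (h0 : 0 < u 0)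
    (h : ∀ z, 0 < u z → -(K * u z) ≤ u' z) {z : ℝ} (hz : 0 ≤ z) : 0 < u z := by
  by_contra hc
  push Not at hc
  have hcont : Continuous u := continuous_iff_continuousAt.2 fun z => (hu z).continuousAt
  set S := {y | 0 ≤ y ∧ u y ≤ 0} with hS
  have hSc : IsClosed S := isClosed_Ici.inter (isClosed_le hcont continuous_const)
  have hSne : S.Nonempty := ⟨z, hz, hc⟩
  have hbdd : BddBelow S := ⟨0, fun y hy => hy.1⟩
  obtain ⟨hy0, hy1⟩ : sInf S ∈ S := hSc.csInf_mem hSne hbdd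
  set y := sInf S with hy
  have hpos : ∀ x ∈ Ico 0 y, 0 < u x := fun x hx => by
    by_contra hcx
    push Not at hcx
    exact absurd (csInf_le hbdd (show x ∈ S from ⟨hx.1, hcx⟩)) (not_le.2 hx.2)
  have hd : ∀ x, HasDerivAt (fun x => u x * Real.exp (K * x))
      (u' x * Real.exp (K * x) + u x * (Real.exp (K * x) * K)) x := fun x => by
    have : HasDerivAt (fun x => K * x) K x := by simpa using (hasDerivAt_id x).const_mul K
    exact (hu x).mul this.exp
  have hmono : MonotoneOn (fun x => u x * Real.exp (K * x)) (Icc 0 y) := by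
    refine monotoneOn_of_deriv_nonneg (convex_Icc 0 y)
      (fun x _ => (hd x).continuousAt.continuousWithinAt)
      (fun x _ => (hd x).differentiableAt.differentiableWithinAt) fun x hx => ?_
    rw [interior_Icc] at hx
    rw [(hd x).deriv]
    have h1 := h x (hpos x ⟨hx.1.le, hx.2⟩)
    have h2 := Real.exp_pos (K * x)
    nlinarith
  have := hmono ⟨le_rfl, hy0⟩ ⟨hy0, le_rfl⟩ hy0
  simp only [mul_zero, Real.exp_zero, mul_one] at this
  have h2 := Real.exp_pos (K * y)
  nlinarith

theorem IsDoubleWell.contDiff_deriv {f : ℝ → ℝ} (hf : IsDoubleWell f) : ContDiff ℝ ∞ (deriv f) :=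
  (contDiff_infty_iff_deriv.1 hf.smooth).2

theorem IsDoubleWell.contDiff_deriv2 {f : ℝ → ℝ} (hf : IsDoubleWell f) :
    ContDiff ℝ ∞ (deriv (deriv f)) :=
  (contDiff_infty_iff_deriv.1 hf.contDiff_deriv).2

theorem IsDoubleWell.hasDerivAt {f : ℝ → ℝ} (hf : IsDoubleWell f) (s : ℝ) :
    HasDerivAt f (deriv f s) s := (hf.smooth.differentiable (by simp) s).hasDerivAt

theorem IsDoubleWell.hasDerivAt_deriv {f : ℝ → ℝ} (hf : IsDoubleWell f) (s : ℝ) :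
    HasDerivAt (deriv f) (deriv (deriv f) s) s :=
  (hf.contDiff_deriv.differentiable (by simp) s).hasDerivAt

/-- The potential reflected at the origin. -/
theorem IsDoubleWell.reflect {f : ℝ → ℝ} (hf : IsDoubleWell f) : IsDoubleWell fun s => f (-s) := by
  have d1 : deriv (fun s => f (-s)) = fun s => -deriv f (-s) := by ext s; exact deriv_comp_neg f s
  have d2 : deriv (deriv fun s => f (-s)) = fun s => deriv (deriv f) (-s) := by
    ext s; rw [d1, deriv.fun_neg, deriv_comp_neg, neg_neg]
  refine ⟨hf.smooth.comp contDiff_neg, ?_, ?_, ?_, ?_, ?_, fun z hz => ?_⟩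
  · simp [d1, hf.deriv_one]
  · simp [d1, hf.deriv_neg_one]
  · simp [d2, hf.deriv2_one]
  · simp [d2, hf.deriv2_neg_one]
  · simp [hf.equal_depth]
  · rw [← hf.equal_depth.symm]
    exact hf.above (-z) ⟨by linarith [hz.2], by linarith [hz.1]⟩

/-- `(b - s) * x ≤ ∫ ...`: an upper bound for a function with a critical zero at `1`. -/
theorem IsDoubleWell.le_near_one {f : ℝ → ℝ} (hf : IsDoubleWell f) {K a : ℝ}
    (hK : ∀ s ∈ Icc a 1, deriv (deriv f) s ≤ K) {s : ℝ} (hs : s ∈ Icc a 1) :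
    -(deriv f s) ≤ K * (1 - s) ∧ f s - f 1 ≤ K / 2 * (1 - s) ^ 2 := by
  have key : ∀ s ∈ Icc a 1, -(deriv f s) ≤ K * (1 - s) := by
    intro s hs
    have hm : AntitoneOn (fun s => deriv f s - K * s) (Icc a 1) := by
      refine antitoneOn_of_deriv_nonpos (convex_Icc a 1)
        (hf.contDiff_deriv.continuous.sub (by fun_prop)).continuousOn
        (fun x _ => ((hf.hasDerivAt_deriv x).differentiableAt.sub (by fun_prop)).differentiableWithinAt)
        fun x hx => ?_
      have : HasDerivAt (fun s => deriv f s - K * s) (deriv (deriv f) x - K * 1) x :=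
        (hf.hasDerivAt_deriv x).sub ((hasDerivAt_id x).const_mul K)
      rw [this.deriv]
      linarith [hK x (interior_subset hx)]
    have := hm hs ⟨hs.1.trans hs.2, le_rfl⟩ hs.2
    simp only [hf.deriv_one] at this
    linarith
  refine ⟨key s hs, ?_⟩
  have hm : MonotoneOn (fun s => f s - K / 2 * (1 - s) ^ 2) (Icc a 1) := by
    have hd : ∀ x, HasDerivAt (fun s => f s - K / 2 * (1 - s) ^ 2) (deriv f x + K * (1 - x)) x := by
      intro x
      have h1 : HasDerivAt (fun s : ℝ => 1 - s) (-1) x := by simpa using (hasDerivAt_id x).const_sub 1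
      refine ((hf.hasDerivAt x).sub ((h1.pow 2).const_mul (K / 2))).congr_deriv ?_
      simp; ring
    refine monotoneOn_of_deriv_nonneg (convex_Icc a 1)
      (fun x _ => (hd x).continuousAt.continuousWithinAt)
      (fun x _ => (hd x).differentiableAt.differentiableWithinAt) fun x hx => ?_
    rw [(hd x).deriv]
    linarith [key x (interior_subset hx)]
  have := hm hs ⟨hs.1.trans hs.2, le_rfl⟩ hs.2
  simp only [sub_self] at this
  nlinarith

theorem IsDoubleWell.ge_near_one {f : ℝ → ℝ} (hf : IsDoubleWell f) {m a : ℝ}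
    (hm : ∀ s ∈ Icc a 1, m ≤ deriv (deriv f) s) {s : ℝ} (hs : s ∈ Icc a 1) :
    m / 2 * (1 - s) ^ 2 ≤ f s - f 1 := by
  have key : ∀ s ∈ Icc a 1, m * (1 - s) ≤ -(deriv f s) := by
    intro s hs
    have hmn : MonotoneOn (fun s => deriv f s - m * s) (Icc a 1) := by
      refine monotoneOn_of_deriv_nonneg (convex_Icc a 1)
        (hf.contDiff_deriv.continuous.sub (by fun_prop)).continuousOn
        (fun x _ => ((hf.hasDerivAt_deriv x).differentiableAt.sub (by fun_prop)).differentiableWithinAt)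
        fun x hx => ?_
      have : HasDerivAt (fun s => deriv f s - m * s) (deriv (deriv f) x - m * 1) x :=
        (hf.hasDerivAt_deriv x).sub ((hasDerivAt_id x).const_mul m)
      rw [this.deriv]
      linarith [hm x (interior_subset hx)]
    have := hmn hs ⟨hs.1.trans hs.2, le_rfl⟩ hs.2
    simp only [hf.deriv_one] at this
    linarith
  have hmn : AntitoneOn (fun s => f s - m / 2 * (1 - s) ^ 2) (Icc a 1) := by
    have hd : ∀ x, HasDerivAt (fun s => f s - m / 2 * (1 - s) ^ 2) (deriv f x + m * (1 - x)) x := by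
      intro x
      have h1 : HasDerivAt (fun s : ℝ => 1 - s) (-1) x := by simpa using (hasDerivAt_id x).const_sub 1
      refine ((hf.hasDerivAt x).sub ((h1.pow 2).const_mul (m / 2))).congr_deriv ?_
      simp; ring
    refine antitoneOn_of_deriv_nonpos (convex_Icc a 1)
      (fun x _ => (hd x).continuousAt.continuousWithinAt)
      (fun x _ => (hd x).differentiableAt.differentiableWithinAt) fun x hx => ?_
    rw [(hd x).deriv]
    linarith [key x (interior_subset hx)]
  have := hmn hs ⟨hs.1.trans hs.2, le_rfl⟩ hs.2
  simp only [sub_self] at this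
  nlinarith

theorem IsDoubleWell.exists_upper {f : ℝ → ℝ} (hf : IsDoubleWell f) : ∃ K > 0, ∀ s ∈ Icc (-1 : ℝ) 1,
    |deriv f s| ≤ K * (1 - s ^ 2) ∧ f s - f 1 ≤ K / 2 * (1 - s ^ 2) ^ 2 := by
  obtain ⟨K, hK⟩ := (isCompact_Icc (a := (-1 : ℝ)) (b := 1)).exists_bound_of_continuousOn
    hf.contDiff_deriv2.continuous.continuousOn
  have hK' : ∀ s ∈ Icc (-1 : ℝ) 1, |deriv (deriv f) s| ≤ |K| + 1 := fun s hs =>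
    (hK s hs).trans ((le_abs_self K).trans (by linarith))
  have main : ∀ {f : ℝ → ℝ}, IsDoubleWell f → (∀ s ∈ Icc (-1 : ℝ) 1, |deriv (deriv f) s| ≤ |K| + 1) →
      ∀ s ∈ Icc (0 : ℝ) 1, |deriv f s| ≤ (|K| + 1) * (1 - s ^ 2)
        ∧ f s - f 1 ≤ (|K| + 1) / 2 * (1 - s ^ 2) ^ 2 := by
    intro f hf hK s hs
    have hs' : s ∈ Icc (-1 : ℝ) 1 := ⟨by linarith [hs.1], hs.2⟩
    have h1 := hf.le_near_one (K := |K| + 1) (a := -1) (fun x hx => (abs_le.1 (hK x hx)).2) hs'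
    have hd : |deriv f s| ≤ (|K| + 1) * (1 - s) := by
      have := Convex.norm_image_sub_le_of_norm_hasDerivWithin_le (f := deriv f) (s := Icc (-1 : ℝ) 1)
        (x := 1) (y := s) (fun x _ => (hf.hasDerivAt_deriv x).hasDerivWithinAt) hK (convex_Icc _ _)
        ⟨by norm_num, le_rfl⟩ hs'
      rw [hf.deriv_one, sub_zero, Real.norm_eq_abs, Real.norm_eq_abs, abs_sub_comm,
        abs_of_nonneg (by linarith [hs.2] : 0 ≤ 1 - s)] at this
      exact this
    have h2 : 1 - s ≤ 1 - s ^ 2 := by nlinarith [hs.1, hs.2]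
    have h3 : 0 ≤ 1 - s := by linarith [hs.2]
    have h4 : 0 ≤ |K| + 1 := by positivity
    refine ⟨hd.trans (by gcongr), h1.2.trans (by gcongr)⟩
  refine ⟨|K| + 1, by positivity, fun s hs => ?_⟩
  rcases le_total 0 s with h | h
  · exact main hf hK' s ⟨h, hs.2⟩
  · have d1 : deriv (fun s => f (-s)) = fun s => -deriv f (-s) := by ext s; exact deriv_comp_neg f s
    have d2 : deriv (deriv fun s => f (-s)) = fun s => deriv (deriv f) (-s) := by
      ext s; rw [d1, deriv.fun_neg, deriv_comp_neg, neg_neg]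
    have := main hf.reflect (fun s hs => by
      rw [d2]; exact hK' (-s) ⟨by linarith [hs.2], by linarith [hs.1]⟩) (-s)
      ⟨by linarith, by linarith [hs.1]⟩
    simpa [d1, hf.equal_depth] using this

theorem IsDoubleWell.exists_lower {f : ℝ → ℝ} (hf : IsDoubleWell f) : ∃ m > 0, ∀ s ∈ Icc (-1 : ℝ) 1,
    m * (1 - s ^ 2) ^ 2 ≤ f s - f 1 := by
  have main : ∀ {f : ℝ → ℝ}, IsDoubleWell f → ∃ m > 0, ∀ s ∈ Icc (0 : ℝ) 1,
      m * (1 - s ^ 2) ^ 2 ≤ f s - f 1 := by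
    intro f hf
    have hev : ∀ᶠ s in 𝓝 (1 : ℝ), deriv (deriv f) 1 / 2 < deriv (deriv f) s :=
      (hf.contDiff_deriv2.continuous.tendsto 1).eventually_const_lt (half_lt_self hf.deriv2_one)
    obtain ⟨δ, hδ, hb⟩ := Metric.eventually_nhds_iff.1 hev
    obtain ⟨a, ha0, ha1, haδ⟩ : ∃ a : ℝ, 0 ≤ a ∧ a < 1 ∧ 1 - δ < a :=
      ⟨max 0 (1 - δ / 2), le_max_left _ _, max_lt one_pos (by linarith),
        lt_max_of_lt_right (by linarith)⟩
    have hnear : ∀ s ∈ Icc a 1, deriv (deriv f) 1 / 2 / 2 * (1 - s) ^ 2 ≤ f s - f 1 := fun s hs =>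
      hf.ge_near_one (m := deriv (deriv f) 1 / 2) (a := a) (fun x hx => (hb (by
        rw [Real.dist_eq, abs_lt]; constructor <;> linarith [hx.1, hx.2])).le) hs
    obtain ⟨x, hx, hxm⟩ := (isCompact_Icc (a := (0 : ℝ)) (b := a)).exists_isMinOn ⟨0, le_rfl, ha0⟩
      (hf.smooth.continuous.continuousOn)
    have hμ : 0 < f x - f 1 := sub_pos.2 (hf.above x ⟨by linarith [hx.1], by linarith [hx.2]⟩)
    have hd := hf.deriv2_one
    refine ⟨min (f x - f 1) (deriv (deriv f) 1 / 16), lt_min hμ (by positivity), fun s hs => ?_⟩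
    have h1 : 0 ≤ 1 - s ^ 2 := by nlinarith [hs.1, hs.2]
    have h2 : 1 - s ^ 2 ≤ 1 := by nlinarith [hs.1]
    rcases le_total s a with h | h
    · have h3 : f x ≤ f s := hxm ⟨hs.1, h⟩
      calc min (f x - f 1) (deriv (deriv f) 1 / 16) * (1 - s ^ 2) ^ 2
          ≤ (f x - f 1) * 1 ^ 2 := by gcongr; exact min_le_left _ _
        _ ≤ f s - f 1 := by linarith
    · have h3 : 1 - s ^ 2 ≤ 2 * (1 - s) := by nlinarith [hs.2, sq_nonneg (1 - s)]
      calc min (f x - f 1) (deriv (deriv f) 1 / 16) * (1 - s ^ 2) ^ 2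
          ≤ (deriv (deriv f) 1 / 16) * (2 * (1 - s)) ^ 2 := by gcongr; exact min_le_right _ _
        _ = deriv (deriv f) 1 / 2 / 2 * (1 - s) ^ 2 := by ring
        _ ≤ _ := hnear s ⟨h, hs.2⟩
  obtain ⟨m1, h1, hm1⟩ := main hf
  obtain ⟨m2, h2, hm2⟩ := main hf.reflect
  refine ⟨min m1 m2, lt_min h1 h2, fun s hs => ?_⟩
  rcases le_total 0 s with h | h
  · refine le_trans ?_ (hm1 s ⟨h, hs.2⟩)
    gcongr; exact min_le_left _ _
  · have := hm2 (-s) ⟨by linarith, by linarith [hs.1]⟩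
    simp only [neg_neg, neg_sq, hf.equal_depth] at this
    refine le_trans ?_ this
    gcongr; exact min_le_right _ _

variable {f θ : ℝ → ℝ}

theorem IsOptimalProfile.hasDerivAt (hθ : IsOptimalProfile f θ) (z : ℝ) :
    HasDerivAt θ (deriv θ z) z := (hθ.contDiff.differentiable (by norm_num) z).hasDerivAt

theorem IsOptimalProfile.hasDerivAt_deriv (hθ : IsOptimalProfile f θ) (z : ℝ) :
    HasDerivAt (deriv θ) (deriv f (θ z)) z := by
  have h1 : ContDiff ℝ 1 (deriv θ) := by
    have := hθ.contDiff
    rw [show (2 : WithTop ℕ∞) = 1 + 1 by norm_num, contDiff_succ_iff_deriv] at this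
    exact this.2.2
  have := (h1.differentiable (by norm_num) z).hasDerivAt
  exact this.congr_deriv (by linarith [hθ.ode z])

theorem IsOptimalProfile.first_integral (hf : IsDoubleWell f) (hθ : IsOptimalProfile f θ) (z : ℝ) :
    deriv θ z ^ 2 = 2 * (f (θ z) - f 1) := by
  have hd : ∀ z, HasDerivAt (fun z => deriv θ z ^ 2 - 2 * f (θ z)) 0 z := by
    intro z
    have h1 := (hθ.hasDerivAt_deriv z).pow 2
    have h2 : HasDerivAt (fun z => f (θ z)) (deriv f (θ z) * deriv θ z) z :=
      (hf.hasDerivAt (θ z)).comp z (hθ.hasDerivAt z)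
    refine (h1.sub (h2.const_mul 2)).congr_deriv ?_
    simp; ring
  have hconst : ∀ z, deriv θ z ^ 2 - 2 * f (θ z) = deriv θ 0 ^ 2 - 2 * f (θ 0) := fun z =>
    is_const_of_deriv_eq_zero (fun z => (hd z).differentiableAt) (fun z => (hd z).deriv) z 0
  set e := deriv θ 0 ^ 2 - 2 * f (θ 0) with he
  have hlim : Tendsto (fun z => deriv θ z ^ 2) atTop (𝓝 (e + 2 * f 1)) := by
    have h1 : Tendsto (fun z => e + 2 * f (θ z)) atTop (𝓝 (e + 2 * f 1)) :=
      (((hf.smooth.continuous.tendsto 1).comp hθ.tendsto_top).const_mul 2).const_add e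
    refine h1.congr fun z => ?_
    linarith [hconst z]
  have hzero : e + 2 * f 1 = 0 := by
    by_contra hne
    have hpos : 0 < e + 2 * f 1 := lt_of_le_of_ne
      (ge_of_tendsto' hlim fun z => sq_nonneg _) (Ne.symm hne)
    set κ := e + 2 * f 1
    -- the increments of `θ` over unit intervals tend to zero
    have hinc : Tendsto (fun z => θ (z + 1) - θ z) atTop (𝓝 0) := by
      have := (hθ.tendsto_top.comp (tendsto_atTop_add_const_right _ 1 tendsto_id)).sub hθ.tendsto_top
      simpa using this
    have hsq : Tendsto (fun z => (θ (z + 1) - θ z) ^ 2) atTop (𝓝 0) := by simpa using hinc.pow 2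
    obtain ⟨N, hN⟩ := eventually_atTop.1 (hlim.eventually_const_lt (half_lt_self hpos))
    obtain ⟨z, hz1, hz2⟩ := ((hsq.eventually_lt_const (half_pos hpos)).and
      (eventually_ge_atTop N)).exists
    obtain ⟨c, hc, hce⟩ := exists_hasDerivAt_eq_slope θ (deriv θ) (lt_add_one z)
      (fun x _ => (hθ.hasDerivAt x).continuousAt.continuousWithinAt) (fun x _ => hθ.hasDerivAt x)
    have := hN c (hz2.trans hc.1.le)
    rw [hce] at this
    simp only [add_sub_cancel_left, div_one] at this
    linarith
  have := hconst z
  linarith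

theorem IsOptimalProfile.mem_Ioo (hf : IsDoubleWell f) (hθ : IsOptimalProfile f θ) (z : ℝ) :
    θ z ∈ Ioo (-1 : ℝ) 1 := by
  obtain ⟨K, hK0, hK⟩ := hf.exists_upper
  have hd : ∀ z, HasDerivAt (fun z => 1 - θ z ^ 2) (-(2 * θ z * deriv θ z)) z := by
    intro z
    refine (((hθ.hasDerivAt z).pow 2).const_sub 1).congr_deriv ?_
    simp
  have hb : ∀ z, 0 < 1 - θ z ^ 2 → |2 * θ z * deriv θ z| ≤ 2 * (K + 1) * (1 - θ z ^ 2) := by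
    intro z hz
    have h1 : |θ z| ≤ 1 := by
      rw [← sq_le_one_iff_abs_le_one]; linarith
    have h2 : |deriv θ z| ≤ (K + 1) * (1 - θ z ^ 2) := by
      refine abs_le_of_sq_le_sq ?_ (by positivity)
      have h3 := (hK (θ z) (abs_le.1 h1)).2
      rw [hθ.first_integral hf, mul_pow]
      nlinarith [sq_nonneg (1 - θ z ^ 2), sq_nonneg K]
    rw [abs_mul, abs_mul, abs_two]
    calc 2 * |θ z| * |deriv θ z| ≤ 2 * 1 * ((K + 1) * (1 - θ z ^ 2)) := by gcongr
      _ = _ := by ring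
  have hpos : 0 < 1 - θ z ^ 2 := by
    rcases le_total 0 z with hz | hz
    · exact pos_of_deriv_ge (K := 2 * (K + 1)) hd (by simp [hθ.zero])
        (fun z hz => neg_le_neg ((abs_le.1 (hb z hz)).2)) hz
    · have hd' : ∀ z, HasDerivAt (fun z => 1 - θ (-z) ^ 2) (2 * θ (-z) * deriv θ (-z)) z := by
        intro z
        have := (hd (-z)).comp z (hasDerivAt_neg z)
        exact this.congr_deriv (by ring)
      have := pos_of_deriv_ge (K := 2 * (K + 1)) hd' (by simp [hθ.zero])
        (fun z hz => (abs_le.1 (hb (-z) hz)).1) (neg_nonneg.2 hz)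
      simpa using this
  exact abs_lt.1 ((sq_lt_one_iff_abs_lt_one _).1 (by linarith))

theorem IsOptimalProfile.deriv_pos (hf : IsDoubleWell f) (hθ : IsOptimalProfile f θ) (z : ℝ) :
    0 < deriv θ z := by
  have hne : ∀ z, deriv θ z ≠ 0 := by
    intro z h
    have h1 := hθ.first_integral hf z
    have h2 := hf.above _ (hθ.mem_Ioo hf z)
    rw [h] at h1
    nlinarith
  have hcont : Continuous (deriv θ) := continuous_iff_continuousAt.2 fun z =>
    (hθ.hasDerivAt_deriv z).continuousAt
  by_contra hc
  have hneg : ∀ x, deriv θ x < 0 := by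
    intro x
    by_contra hx
    push Not at hc hx
    obtain ⟨y, hy⟩ := mem_range_of_exists_le_of_exists_ge hcont ⟨z, hc⟩ ⟨x, hx⟩
    exact hne y hy
  have hanti : StrictAnti θ := strictAnti_of_deriv_neg hneg
  have := ge_of_tendsto hθ.tendsto_bot ((eventually_le_atBot (0 : ℝ)).mono fun x hx =>
    hanti.antitone hx)
  rw [hθ.zero] at this
  norm_num at this

/-- Two-sided bounds for the derivative of the profile. -/
theorem IsOptimalProfile.exists_bounds (hf : IsDoubleWell f) (hθ : IsOptimalProfile f θ) :
    ∃ a > 0, ∃ K > 0, ∀ z, a * (1 - θ z ^ 2) ≤ deriv θ z ∧ deriv θ z ≤ K * (1 - θ z ^ 2) ∧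
      |deriv f (θ z)| ≤ K * (1 - θ z ^ 2) := by
  obtain ⟨K, hK0, hK⟩ := hf.exists_upper
  obtain ⟨m, hm0, hm⟩ := hf.exists_lower
  refine ⟨√m, Real.sqrt_pos.2 hm0, K + 1, by positivity, fun z => ?_⟩
  have hz := hθ.mem_Ioo hf z
  have hz' : θ z ∈ Icc (-1 : ℝ) 1 := ⟨hz.1.le, hz.2.le⟩
  have hu : 0 ≤ 1 - θ z ^ 2 := by nlinarith [hz.1, hz.2]
  have hd := hθ.deriv_pos hf z
  have hi := hθ.first_integral hf z
  refine ⟨?_, ?_, (hK _ hz').1.trans (by gcongr; linarith)⟩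
  · refine le_of_sq_le_sq ?_ hd.le
    rw [mul_pow, Real.sq_sqrt hm0.le, hi]
    nlinarith [hm _ hz', sq_nonneg (1 - θ z ^ 2)]
  · refine le_of_sq_le_sq ?_ (by positivity)
    rw [hi, mul_pow]
    nlinarith [(hK _ hz').2, sq_nonneg (1 - θ z ^ 2), sq_nonneg K]

theorem IsOptimalProfile.exists_decay (hf : IsDoubleWell f) (hθ : IsOptimalProfile f θ) :
    ∃ a > 0, ∃ C > 0, ∀ z, deriv θ z ≤ C * Real.exp (-(a * |z|)) := by
  obtain ⟨a, ha, K, hK, hb⟩ := hθ.exists_bounds hf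
  have h1p : ∀ z, 0 < 1 + θ z := fun z => by linarith [(hθ.mem_Ioo hf z).1]
  have h1m : ∀ z, 0 < 1 - θ z := fun z => by linarith [(hθ.mem_Ioo hf z).2]
  have hd : ∀ z, HasDerivAt (fun z => (1 - θ z) / (1 + θ z) * Real.exp (2 * a * z))
      ((2 * a - 2 * deriv θ z / (1 - θ z ^ 2)) * ((1 - θ z) / (1 + θ z) * Real.exp (2 * a * z))) z := by
    intro z
    have e1 : HasDerivAt (fun z => 2 * a * z) (2 * a) z := by
      simpa using (hasDerivAt_id z).const_mul (2 * a)
    have e2 := ((hθ.hasDerivAt z).const_sub 1).div ((hθ.hasDerivAt z).const_add 1) (h1p z).ne'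
    refine (e2.mul e1.exp).congr_deriv ?_
    have := (h1p z).ne'
    have := (h1m z).ne'
    rw [show (1 : ℝ) - θ z ^ 2 = (1 - θ z) * (1 + θ z) by ring]
    simp only [Pi.div_apply]
    field_simp
    ring
  have hanti : Antitone fun z => (1 - θ z) / (1 + θ z) * Real.exp (2 * a * z) := by
    refine antitone_of_hasDerivAt_nonpos hd fun z => ?_
    have hu : 0 < 1 - θ z ^ 2 := by nlinarith [h1p z, h1m z, mul_pos (h1p z) (h1m z)]
    refine mul_nonpos_of_nonpos_of_nonneg ?_ (by have := h1p z; have := h1m z; positivity)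
    rw [sub_nonpos, le_div_iff₀ hu]
    nlinarith [(hb z).1]
  refine ⟨2 * a, by positivity, K * 4, by positivity, fun z => (hb z).2.1.trans ?_⟩
  rw [mul_assoc]
  gcongr
  have hexp := Real.exp_pos (2 * a * z)
  have p := h1p z
  have m := h1m z
  rcases le_total 0 z with hz | hz
  · have := hanti hz
    simp only [hθ.zero, mul_zero, Real.exp_zero, sub_zero, add_zero, div_one, mul_one] at this
    rw [abs_of_nonneg hz, Real.exp_neg]
    have h2 : (1 - θ z) ≤ (1 + θ z) * (Real.exp (2 * a * z))⁻¹ := by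
      rw [div_mul_eq_mul_div, div_le_one p] at this
      rw [← div_eq_mul_inv, le_div_iff₀ hexp]
      exact this
    have h3 : 0 < (Real.exp (2 * a * z))⁻¹ := by positivity
    have h4 : 1 + θ z ≤ 2 := by linarith
    calc 1 - θ z ^ 2 = (1 - θ z) * (1 + θ z) := by ring
      _ ≤ ((1 + θ z) * (Real.exp (2 * a * z))⁻¹) * (1 + θ z) := by gcongr
      _ ≤ (2 * (Real.exp (2 * a * z))⁻¹) * 2 := by gcongr
      _ = _ := by ring
  · have := hanti hz
    simp only [hθ.zero, mul_zero, Real.exp_zero, sub_zero, add_zero, div_one, mul_one] at this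
    rw [abs_of_nonpos hz, mul_neg, neg_neg]
    have h2 : 1 + θ z ≤ (1 - θ z) * Real.exp (2 * a * z) := by
      rw [div_mul_eq_mul_div, le_div_iff₀ p] at this
      linarith
    have h4 : 1 - θ z ≤ 2 := by linarith
    calc 1 - θ z ^ 2 = (1 - θ z) * (1 + θ z) := by ring
      _ ≤ 2 * (2 * Real.exp (2 * a * z)) := by
          gcongr
          exact h2.trans (by gcongr)
      _ = _ := by ring

theorem IsOptimalProfile.smooth (hf : IsDoubleWell f) (hθ : IsOptimalProfile f θ) :
    ContDiff ℝ ∞ θ := by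
  have hdd : deriv (deriv θ) = fun z => deriv f (θ z) := by
    ext z; exact (hθ.hasDerivAt_deriv z).deriv
  have key : ∀ n : ℕ, ContDiff ℝ n θ := by
    intro n
    induction n with
    | zero => exact hθ.contDiff.of_le (by norm_num)
    | succ n ih =>
      have h1 : ContDiff ℝ n (deriv (deriv θ)) := by
        rw [hdd]
        exact (hf.contDiff_deriv.of_le (by exact_mod_cast le_top)).comp ih
      have h2 : ContDiff ℝ (n + 1) (deriv θ) := contDiff_succ_iff_deriv.2
        ⟨fun z => (hθ.hasDerivAt_deriv z).differentiableAt, by simp, h1⟩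
      have h3 : ContDiff ℝ ((n + 1 : ℕ) : WithTop ℕ∞) θ := by
        push_cast
        exact contDiff_succ_iff_deriv.2
          ⟨fun z => (hθ.hasDerivAt z).differentiableAt, by simp, h2.of_le le_self_add⟩
      exact h3
  exact contDiff_infty.2 key

theorem IsOptimalProfile.bddSmooth_comp (hf : IsDoubleWell f) (hθ : IsOptimalProfile f θ) {A : ℝ → ℝ}
    (hA : ContDiff ℝ ∞ A) : BddSmooth fun z => A (θ z) := by
  have key : ∀ n : ℕ, ∀ A B : ℝ → ℝ, ContDiff ℝ ∞ A → ContDiff ℝ ∞ B → ∃ A' B' : ℝ → ℝ,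
      ContDiff ℝ ∞ A' ∧ ContDiff ℝ ∞ B' ∧
      iteratedDeriv n (fun z => A (θ z) + B (θ z) * deriv θ z)
        = fun z => A' (θ z) + B' (θ z) * deriv θ z := by
    intro n
    induction n with
    | zero => exact fun A B hA hB => ⟨A, B, hA, hB, by simp⟩
    | succ n ih =>
      intro A B hA hB
      have dA := (contDiff_infty_iff_deriv.1 hA).2
      have dB := (contDiff_infty_iff_deriv.1 hB).2
      have hd : deriv (fun z => A (θ z) + B (θ z) * deriv θ z)
          = fun z => (2 * deriv B (θ z) * (f (θ z) - f 1) + B (θ z) * deriv f (θ z))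
            + deriv A (θ z) * deriv θ z := by
        ext z
        have h1 := ((hA.differentiable (by simp) (θ z)).hasDerivAt).comp z (hθ.hasDerivAt z)
        have h2 := ((hB.differentiable (by simp) (θ z)).hasDerivAt).comp z (hθ.hasDerivAt z)
        have h3 : HasDerivAt (fun z => A (θ z) + B (θ z) * deriv θ z) _ z :=
          h1.add (h2.mul (hθ.hasDerivAt_deriv z))
        rw [h3.deriv]
        have := hθ.first_integral hf z
        simp only [Function.comp]
        linear_combination deriv B (θ z) * this
      rw [iteratedDeriv_succ', hd]
      exact ih (fun s => 2 * deriv B s * (f s - f 1) + B s * deriv f s) (deriv A)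
        (((contDiff_const.mul dB).mul (hf.smooth.sub contDiff_const)).add (hB.mul hf.contDiff_deriv)) dA
  obtain ⟨a, ha, C, hC, hdec⟩ := hθ.exists_decay hf
  refine ⟨hA.comp (hθ.smooth hf), fun n => ?_⟩
  obtain ⟨A', B', hA', hB', e⟩ := key n A (fun _ => 0) hA contDiff_const
  simp only [zero_mul, add_zero] at e
  obtain ⟨C1, h1⟩ := (isCompact_Icc (a := (-1 : ℝ)) (b := 1)).exists_bound_of_continuousOn
    hA'.continuous.continuousOn
  obtain ⟨C2, h2⟩ := (isCompact_Icc (a := (-1 : ℝ)) (b := 1)).exists_bound_of_continuousOn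
    hB'.continuous.continuousOn
  refine ⟨(C1 + C2 * C).toNNReal, fun z => le_trans ?_ (Real.le_coe_toNNReal _)⟩
  have hz : θ z ∈ Icc (-1 : ℝ) 1 := ⟨(hθ.mem_Ioo hf z).1.le, (hθ.mem_Ioo hf z).2.le⟩
  have hθ' : |deriv θ z| ≤ C := by
    rw [abs_of_pos (hθ.deriv_pos hf z)]
    refine (hdec z).trans (mul_le_of_le_one_right hC.le (Real.exp_le_one_iff.2 ?_))
    have := abs_nonneg z
    nlinarith
  rw [e]
  calc |A' (θ z) + B' (θ z) * deriv θ z| ≤ |A' (θ z)| + |B' (θ z)| * |deriv θ z| := by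
        rw [← abs_mul]; exact abs_add_le _ _
    _ ≤ C1 + C2 * C := by
        gcongr
        · exact h1 _ hz
        · exact (norm_nonneg _).trans (h2 _ hz)
        · exact h2 _ hz

theorem IsSmoothAbs.bddSmooth_deriv {η : ℝ → ℝ} (hη : IsSmoothAbs η) : BddSmooth (deriv η) := by
  obtain ⟨hs, Rbar, hR, he⟩ := hη
  have hs' := (contDiff_infty_iff_deriv.1 hs).2
  refine ⟨hs', fun n => ?_⟩
  obtain ⟨C, hC⟩ := (isCompact_Icc (a := -Rbar) (b := Rbar)).exists_bound_of_continuousOn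
    (f := iteratedDeriv n (deriv η)) (hs'.continuous_iteratedDeriv n
      (by exact_mod_cast le_top)).continuousOn
  have lin : ∀ (σ : ℝ), |σ| = 1 → ∀ z, η =ᶠ[𝓝 z] (fun x => σ * x) →
      |iteratedDeriv n (deriv η) z| ≤ 1 := by
    intro σ hσ z hz
    rw [hz.deriv.iteratedDeriv_eq]
    have : deriv (fun x : ℝ => σ * x) = fun _ => σ := by ext x; simp
    rw [this, iteratedDeriv_const]
    split_ifs
    · exact hσ.le
    · simp
  refine ⟨(max C 1).toNNReal, fun z => le_trans ?_ (Real.le_coe_toNNReal _)⟩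
  by_cases hz : z ∈ Icc (-Rbar) Rbar
  · exact (hC z hz).trans (le_max_left _ _)
  · refine le_trans ?_ (le_max_right _ _)
    rw [mem_Icc, not_and_or, not_le, not_le] at hz
    rcases hz with hz | hz
    · refine lin (-1) (by simp) z ?_
      filter_upwards [gt_mem_nhds hz] with x hx
      rw [he x (by rw [abs_of_neg (by linarith)]; linarith), abs_of_neg (by linarith)]; ring
    · refine lin 1 (by simp) z ?_
      filter_upwards [lt_mem_nhds hz] with x hx
      rw [he x (by rw [abs_of_pos (by linarith)]; linarith), abs_of_pos (by linarith)]; ring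

theorem IsSmoothAbs.exists_abs_le {η : ℝ → ℝ} (hη : IsSmoothAbs η) :
    ∃ K ≥ 0, ∀ z, |η z| ≤ |z| + K := by
  obtain ⟨hs, Rbar, hR, he⟩ := hη
  obtain ⟨C, hC⟩ := (isCompact_Icc (a := -Rbar) (b := Rbar)).exists_bound_of_continuousOn
    hs.continuous.continuousOn
  refine ⟨|C|, abs_nonneg C, fun z => ?_⟩
  by_cases hz : z ∈ Icc (-Rbar) Rbar
  · have := hC z hz
    rw [Real.norm_eq_abs] at this
    linarith [abs_nonneg z, le_abs_self C]
  · rw [he z (not_lt.1 fun h => hz ⟨(abs_lt.1 h).1.le, (abs_lt.1 h).2.le⟩), abs_abs]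
    linarith [abs_nonneg C]

end

section

theorem sq_integral_mul_le {X : Type*} [MeasurableSpace X] {ν : Measure X} {f g : X → ℝ}
    (hf : MemLp f 2 ν) (hg : MemLp g 2 ν) :
    (∫ x, f x * g x ∂ν) ^ 2 ≤ (∫ x, f x ^ 2 ∂ν) * ∫ x, g x ^ 2 ∂ν := by
  have h := real_inner_mul_inner_self_le hf.toLp hg.toLp
  simp only [inner_toLp] at h
  simpa only [sq] using h

/-! ### The spectral gap of the linearized profile equation -/

theorem intervalIntegral_sq_le {s m k y p : ℝ → ℝ} {a b κ C : ℝ} (hab : a ≤ b) (hκ : 0 < κ)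
    (hy : ∀ z, HasDerivAt y (p z + s z * y z) z) (hm : ∀ z, HasDerivAt m (-k z - 2 * s z * m z) z)
    (hp : Continuous p) (hkc : Continuous k)
    (hk : ∀ z ∈ Icc a b, κ ≤ k z) (hC : ∀ z ∈ Icc a b, |m z| ≤ C)
    (hbd : 0 ≤ m b * y b ^ 2 - m a * y a ^ 2) :
    ∫ z in a..b, y z ^ 2 ≤ 4 * C ^ 2 / κ ^ 2 * ∫ z in a..b, p z ^ 2 := by
  have hyc : Continuous y := continuous_iff_continuousAt.2 fun z => (hy z).continuousAt
  have hmc : Continuous m := continuous_iff_continuousAt.2 fun z => (hm z).continuousAt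
  have hd : ∀ z, HasDerivAt (fun z => m z * y z ^ 2) (-k z * y z ^ 2 + 2 * m z * y z * p z) z := by
    intro z
    refine ((hm z).mul ((hy z).pow 2)).congr_deriv ?_
    simp; ring
  have hc : Continuous fun z => -k z * y z ^ 2 + 2 * m z * y z * p z := by fun_prop
  have hftc := intervalIntegral.integral_eq_sub_of_hasDerivAt (a := a) (b := b) (fun z _ => hd z)
    (hc.intervalIntegrable _ _)
  have hle : ∫ z in a..b, (-k z * y z ^ 2 + 2 * m z * y z * p z)
      ≤ ∫ z in a..b, (2 * C ^ 2 / κ * p z ^ 2 - κ / 2 * y z ^ 2) := by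
    refine intervalIntegral.integral_mono_on hab (hc.intervalIntegrable _ _)
      (Continuous.intervalIntegrable (by fun_prop) _ _) fun z hz => ?_
    have h1 := hk z hz
    have h2 : m z ^ 2 ≤ C ^ 2 := sq_le_sq' (abs_le.1 (hC z hz)).1 (abs_le.1 (hC z hz)).2
    have h3 : 2 * m z * y z * p z ≤ κ / 2 * y z ^ 2 + 2 * m z ^ 2 / κ * p z ^ 2 := by
      have : κ / 2 * y z ^ 2 + 2 * m z ^ 2 / κ * p z ^ 2 - 2 * m z * y z * p z
          = 2 / κ * (κ / 2 * y z - m z * p z) ^ 2 := by field_simp; ring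
      have : 0 ≤ 2 / κ * (κ / 2 * y z - m z * p z) ^ 2 := by positivity
      linarith
    have h4 : 2 * m z ^ 2 / κ * p z ^ 2 ≤ 2 * C ^ 2 / κ * p z ^ 2 := by gcongr
    nlinarith [sq_nonneg (y z)]
  rw [hftc, intervalIntegral.integral_sub (Continuous.intervalIntegrable (by fun_prop) _ _)
    (Continuous.intervalIntegrable (by fun_prop) _ _), intervalIntegral.integral_const_mul,
    intervalIntegral.integral_const_mul] at hle
  have : κ / 2 * ∫ z in a..b, y z ^ 2 ≤ 2 * C ^ 2 / κ * ∫ z in a..b, p z ^ 2 := by linarith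
  calc ∫ z in a..b, y z ^ 2 = 2 / κ * (κ / 2 * ∫ z in a..b, y z ^ 2) := by field_simp
    _ ≤ 2 / κ * (2 * C ^ 2 / κ * ∫ z in a..b, p z ^ 2) := by gcongr
    _ = _ := by field_simp; ring

variable {f θ : ℝ → ℝ}

theorem IsOptimalProfile.continuous_deriv (hθ : IsOptimalProfile f θ) : Continuous (deriv θ) :=
  continuous_iff_continuousAt.2 fun z => (hθ.hasDerivAt_deriv z).continuousAt

theorem memLp_exp_neg {a : ℝ} (ha : 0 < a) : MemLp (fun z : ℝ => Real.exp (-(a * |z|))) 2 volume := by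
  rw [memLp_two_iff_integrable_sq (by fun_prop : Continuous _).aestronglyMeasurable]
  have h : Integrable fun z : ℝ => Real.exp (-(2 * a) * |z|) := by
    have h1 : IntegrableOn (fun z : ℝ => Real.exp (-(2 * a) * |z|)) (Ioi 0) :=
      (exp_neg_integrableOn_Ioi 0 (show 0 < 2 * a by positivity)).congr_fun
        (fun z hz => by rw [abs_of_pos hz]) measurableSet_Ioi
    have h2 : IntegrableOn (fun z : ℝ => Real.exp (-(2 * a) * |z|)) (Iic 0) := by
      rw [← Measure.map_neg_eq_self (volume : Measure ℝ)]
      have m : MeasurableEmbedding fun x : ℝ => -x := (Homeomorph.neg ℝ).measurableEmbedding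
      rw [m.integrableOn_map_iff]
      simp_rw [Function.comp_def, abs_neg, neg_preimage, neg_Iic, neg_zero]
      exact Iff.mpr integrableOn_Ici_iff_integrableOn_Ioi h1
    rw [← integrableOn_univ, ← Iic_union_Ioi (a := (0 : ℝ))]
    exact h2.union h1
  refine h.congr (Eventually.of_forall fun z => ?_)
  simp only
  rw [← Real.exp_nat_mul]
  congr 1
  push_cast
  ring

theorem IsOptimalProfile.memLp_deriv (hf : IsDoubleWell f) (hθ : IsOptimalProfile f θ) :
    MemLp (deriv θ) 2 volume := by
  obtain ⟨a, ha, C, hC, h⟩ := hθ.exists_decay hf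
  refine ((memLp_exp_neg ha).const_mul C).mono hθ.continuous_deriv.aestronglyMeasurable
    (Eventually.of_forall fun z => ?_)
  rw [Real.norm_of_nonneg (hθ.deriv_pos hf z).le]
  exact (h z).trans (le_abs_self _)

theorem IsOptimalProfile.exists_gap (hf : IsDoubleWell f) (hθ : IsOptimalProfile f θ) :
    ∃ C > 0, ∀ v : ℝ → ℝ, IsTest v → ∫ r, v r ^ 2
      ≤ C * ((∫ r, (dirDeriv 1 v r ^ 2 + deriv (deriv f) (θ r) * v r ^ 2))
        + (∫ r, v r * deriv θ r) ^ 2) := by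
  obtain ⟨a, ha, K, hK, hb⟩ := hθ.exists_bounds hf
  set T := deriv θ with hT
  have hTpos := hθ.deriv_pos hf
  have hTd := hθ.hasDerivAt_deriv
  have hTc : Continuous T := hθ.continuous_deriv
  have hθc : Continuous θ := hθ.contDiff.continuous
  have hTne : ∀ z, T z ≠ 0 := fun z => (hTpos z).ne'
  set s : ℝ → ℝ := fun z => deriv f (θ z) / T z with hs
  have hsd : ∀ z, HasDerivAt s (deriv (deriv f) (θ z) - s z ^ 2) z := by
    intro z
    have h1 := (hf.hasDerivAt_deriv (θ z)).comp z (hθ.hasDerivAt z)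
    refine (h1.div (hTd z) (hTne z)).congr_deriv ?_
    have := hTne z
    simp only [hs, ← hT, Function.comp]
    field_simp
  have hsc : Continuous s := continuous_iff_continuousAt.2 fun z => (hsd z).continuousAt
  -- the multipliers
  have mult : ∀ σ : ℝ, σ ^ 2 = 1 → ∀ z, HasDerivAt (fun z => σ * (1 - σ * θ z) ^ 2 / T z ^ 2)
      (-(2 * (1 - σ * θ z) / T z) - 2 * s z * (σ * (1 - σ * θ z) ^ 2 / T z ^ 2)) z := by
    intro σ hσ z
    have h1 := (((hθ.hasDerivAt z).const_mul σ).const_sub 1).pow 2 |>.const_mul σ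
    refine (h1.div ((hTd z).pow 2) (pow_ne_zero 2 (hTne z))).congr_deriv ?_
    have := hTne z
    simp only [hs, ← hT, Pi.pow_apply]
    field_simp
    linear_combination (-2 * T z ^ 3 * (1 - σ * θ z)) * hσ
  have hu : ∀ z, 0 < 1 - θ z ^ 2 := fun z => by
    nlinarith [(hθ.mem_Ioo hf z).1, (hθ.mem_Ioo hf z).2]
  have hκ : ∀ σ : ℝ, σ ^ 2 = 1 → ∀ z, 1 / K ≤ 2 * (1 - σ * θ z) / T z := by
    intro σ hσ z
    rw [div_le_div_iff₀ hK (hTpos z), one_mul]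
    have h1 := (hb z).2.1
    have h2 : 1 - θ z ^ 2 ≤ 2 * (1 - σ * θ z) := by nlinarith [sq_nonneg (1 - σ * θ z)]
    nlinarith
  have hmono : Monotone θ := monotone_of_deriv_nonneg (fun z => (hθ.hasDerivAt z).differentiableAt)
    fun z => (hTpos z).le
  have hm : ∀ σ : ℝ, σ ^ 2 = 1 → ∀ z, 0 ≤ σ * z →
      |σ * (1 - σ * θ z) ^ 2 / T z ^ 2| ≤ 1 / a ^ 2 := by
    intro σ hσ z hz
    have h0 : 0 ≤ σ * θ z := by
      rcases eq_or_eq_neg_of_sq_eq_sq σ 1 (by rw [hσ, one_pow]) with rfl | rfl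
      · have := hmono (show (0 : ℝ) ≤ z by linarith)
        rw [hθ.zero] at this; linarith
      · have := hmono (show z ≤ (0 : ℝ) by linarith)
        rw [hθ.zero] at this; linarith
    have h1 : 0 < 1 - σ * θ z ∧ 1 - σ * θ z ≤ 1 - θ z ^ 2 := by
      have : |σ * θ z| < 1 := by
        have := (sq_lt_one_iff_abs_lt_one (σ * θ z)).1 (by rw [mul_pow, hσ]; linarith [hu z])
        exact this
      rw [abs_of_nonneg h0] at this
      have h3 : θ z ^ 2 = (σ * θ z) ^ 2 := by rw [mul_pow, hσ, one_mul]
      refine ⟨by linarith, ?_⟩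
      nlinarith
    have habs : |σ| = 1 := by rw [← sq_eq_sq₀ (abs_nonneg _) zero_le_one, sq_abs, hσ, one_pow]
    rw [abs_div, abs_mul, habs, one_mul, abs_of_nonneg (sq_nonneg _), abs_of_nonneg (sq_nonneg _),
      div_le_div_iff₀ (pow_pos (hTpos z) 2) (pow_pos ha 2), one_mul, ← mul_pow]
    refine pow_le_pow_left₀ (by have := h1.1; positivity) ?_ 2
    calc (1 - σ * θ z) * a ≤ (1 - θ z ^ 2) * a := mul_le_mul_of_nonneg_right h1.2 ha.le
      _ ≤ T z := by linarith [(hb z).1]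
  have hT2 : 0 < ∫ r, T r ^ 2 := by
    have hi : Integrable fun r => T r ^ 2 :=
      (memLp_two_iff_integrable_sq hTc.aestronglyMeasurable).1 (hθ.memLp_deriv hf)
    rw [integral_pos_iff_support_of_nonneg (fun r => sq_nonneg _) hi]
    have : (Function.support fun r => T r ^ 2) = univ := by
      ext r; simp [hTne r]
    rw [this]; simp
  set τ := ∫ r, T r ^ 2 with hτ
  set D := 4 * (1 / a ^ 2) ^ 2 / (1 / K) ^ 2 with hD
  have hDpos : 0 < D := by positivity
  refine ⟨8 * D + 4 / τ, by positivity, fun v hv => ?_⟩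
  have hvd : ∀ z, HasDerivAt v (dirDeriv 1 v z) z := fun z => by
    have := (hv.differentiable z).hasDerivAt
    exact this.congr_deriv rfl
  have hv' := hv.dirDeriv 1
  set v' := dirDeriv 1 v with hv'e
  have hss : ContDiff ℝ ∞ s := (hf.contDiff_deriv.comp (hθ.smooth hf)).div
    (contDiff_infty_iff_deriv.1 (hθ.smooth hf)).2 hTne
  set p : ℝ → ℝ := fun z => v' z - s z * v z with hp
  have hpt : IsTest p := hv'.sub (hv.mul_left hss)
  have hpc : Continuous p := hv'.continuous.sub (hsc.mul hv.continuous)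
  have hpi : Integrable fun z => p z ^ 2 := by
    simpa only [sq] using (hpt.mul_left hpt.smooth).integrable volume
  -- the Dirichlet form
  have hform : ∫ r, p r ^ 2 = ∫ r, (v' r ^ 2 + deriv (deriv f) (θ r) * v r ^ 2) := by
    have hd : ∀ z, HasDerivAt (fun z => s z * v z ^ 2)
        ((deriv (deriv f) (θ z) - s z ^ 2) * v z ^ 2 + 2 * s z * v z * v' z) z := by
      intro z
      refine ((hsd z).mul ((hvd z).pow 2)).congr_deriv ?_
      simp; ring
    have i1 : IsTest fun z => s z * v z ^ 2 := by
      have := (hv.mul_left hv.smooth).mul_left hss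
      simpa only [sq] using this
    have i2 : IsTest fun z => deriv (deriv f) (θ z) * v z ^ 2 := by
      have := (hv.mul_left hv.smooth).mul_left (hf.contDiff_deriv2.comp (hθ.smooth hf))
      simpa only [sq, Function.comp] using this
    have i3 : IsTest fun z => v' z ^ 2 := by
      have := hv'.mul_left hv'.smooth
      simpa only [sq] using this
    have e : ∀ z, p z ^ 2 = v' z ^ 2 + deriv (deriv f) (θ z) * v z ^ 2
        - ((deriv (deriv f) (θ z) - s z ^ 2) * v z ^ 2 + 2 * s z * v z * v' z) := by
      intro z; simp only [hp]; ring
    have i4 : Integrable fun z =>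
        (deriv (deriv f) (θ z) - s z ^ 2) * v z ^ 2 + 2 * s z * v z * v' z := by
      refine (((i3.add i2).integrable volume).sub hpi).congr (Eventually.of_forall fun z => ?_)
      simp only [Pi.sub_apply, e]; ring
    have hz := integral_eq_zero_of_hasDerivAt_of_integrable hd i4 (i1.integrable volume)
    calc ∫ r, p r ^ 2 = ∫ r, ((v' r ^ 2 + deriv (deriv f) (θ r) * v r ^ 2)
        - ((deriv (deriv f) (θ r) - s r ^ 2) * v r ^ 2 + 2 * s r * v r * v' r)) := by simp only [e]
      _ = _ := by rw [integral_sub ((i3.add i2).integrable volume) i4, hz, sub_zero]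
  rw [← hform]
  -- the part of `v` vanishing at the origin
  set w₀ := v 0 / T 0 with hw₀
  set y : ℝ → ℝ := fun z => v z - w₀ * T z with hy
  have hyd : ∀ z, HasDerivAt y (p z + s z * y z) z := by
    intro z
    refine ((hvd z).sub ((hTd z).const_mul w₀)).congr_deriv ?_
    have := hTne z
    simp only [hp, hy, hs]
    field_simp
    ring
  have hy0 : y 0 = 0 := by simp only [hy, hw₀]; field_simp [hTne 0]; simp
  have hyL : MemLp y 2 volume := (hv.memLp volume 2).sub ((hθ.memLp_deriv hf).const_mul w₀)
  have hyi : Integrable fun z => y z ^ 2 := (memLp_two_iff_integrable_sq hyL.1).1 hyL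
  have hkc : ∀ σ : ℝ, Continuous fun z => 2 * (1 - σ * θ z) / T z := fun σ =>
    (continuous_const.mul (continuous_const.sub (continuous_const.mul hθc))).div hTc hTne
  have hN : ∀ N : ℝ, 0 ≤ N → ∫ z in (-N)..N, y z ^ 2 ≤ D * ∫ z in (-N)..N, p z ^ 2 := by
    intro N hN
    have q1 := intervalIntegral_sq_le hN (one_div_pos.2 hK) hyd (mult 1 (by norm_num)) hpc (hkc 1)
      (fun z _ => hκ 1 (by norm_num) z) (fun z hz => hm 1 (by norm_num) z (by linarith [hz.1]))
      (by rw [hy0]; simp only [one_mul, ne_eq, OfNat.ofNat_ne_zero, not_false_eq_true, zero_pow,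
            mul_zero, sub_zero]; positivity)
    have q2 := intervalIntegral_sq_le (neg_nonpos.2 hN) (one_div_pos.2 hK) hyd
      (mult (-1) (by norm_num)) hpc (hkc (-1))
      (fun z _ => hκ (-1) (by norm_num) z) (fun z hz => hm (-1) (by norm_num) z (by linarith [hz.2]))
      (by
        rw [hy0, show ∀ A B : ℝ, -1 * A / B = -(A / B) by intro A B; ring]
        have : 0 ≤ (1 - -1 * θ (-N)) ^ 2 / T (-N) ^ 2 * y (-N) ^ 2 := by positivity
        simp only [ne_eq, OfNat.ofNat_ne_zero, not_false_eq_true, zero_pow, mul_zero]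
        rw [show ∀ A B : ℝ, -1 * A / B = -(A / B) by intro A B; ring]
        linarith)
    have iy : ∀ a b, IntervalIntegrable (fun z => y z ^ 2) volume a b := fun a b =>
      hyi.intervalIntegrable
    have ip : ∀ a b, IntervalIntegrable (fun z => p z ^ 2) volume a b := fun a b =>
      hpi.intervalIntegrable
    rw [← intervalIntegral.integral_add_adjacent_intervals (iy (-N) 0) (iy 0 N),
      ← intervalIntegral.integral_add_adjacent_intervals (ip (-N) 0) (ip 0 N), mul_add]
    exact add_le_add q2 q1
  have hyp : ∫ z, y z ^ 2 ≤ D * ∫ z, p z ^ 2 := by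
    have l1 := intervalIntegral_tendsto_integral hyi tendsto_neg_atTop_atBot tendsto_id
    have l2 := intervalIntegral_tendsto_integral hpi tendsto_neg_atTop_atBot tendsto_id
    exact le_of_tendsto_of_tendsto l1 (l2.const_mul D)
      ((eventually_ge_atTop 0).mono fun N h => hN N h)
  -- conclusion
  have iT : Integrable fun r => T r ^ 2 :=
    (memLp_two_iff_integrable_sq hTc.aestronglyMeasurable).1 (hθ.memLp_deriv hf)
  have iyT := integrable_mul_of_memLp hyL (hθ.memLp_deriv hf)
  have hsum : ∫ r, v r * T r = (∫ r, y r * T r) + w₀ * τ := by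
    rw [hτ, ← integral_const_mul, ← integral_add iyT (iT.const_mul w₀)]
    congr 1; ext r; simp only [hy]; ring
  have hcs : (∫ r, y r * T r) ^ 2 ≤ (∫ r, y r ^ 2) * τ := by
    have := sq_integral_mul_le hyL (hθ.memLp_deriv hf)
    exact this
  have hv2 : ∫ r, v r ^ 2 ≤ 2 * (∫ r, y r ^ 2) + 2 * w₀ ^ 2 * τ := by
    rw [hτ, ← integral_const_mul, ← integral_const_mul, ← integral_add (hyi.const_mul 2) (iT.const_mul _)]
    refine integral_mono (by simpa only [sq] using (hv.mul_left hv.smooth).integrable volume)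
      ((hyi.const_mul 2).add (iT.const_mul _)) fun r => ?_
    simp only [hy]
    nlinarith [sq_nonneg (v r - w₀ * T r - w₀ * T r)]
  set I := ∫ r, y r * T r
  set J := ∫ r, v r * T r
  set Y := ∫ r, y r ^ 2
  set P := ∫ r, p r ^ 2
  have hw : w₀ ^ 2 * τ ≤ 2 * J ^ 2 / τ + 2 * Y := by
    have e : w₀ * τ = J - I := by linarith
    have h1 : (w₀ * τ) ^ 2 ≤ 2 * J ^ 2 + 2 * I ^ 2 := by rw [e]; nlinarith [sq_nonneg (J + I)]
    have h2 : w₀ ^ 2 * τ = (w₀ * τ) ^ 2 / τ := by field_simp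
    rw [h2]
    calc (w₀ * τ) ^ 2 / τ ≤ (2 * J ^ 2 + 2 * (Y * τ)) / τ := by gcongr; linarith
      _ = _ := by field_simp
  have hP : 0 ≤ P := integral_nonneg fun r => sq_nonneg _
  have h5 : ∫ r, v r ^ 2 ≤ 6 * D * P + 4 / τ * J ^ 2 := by
    have : 2 * (2 * J ^ 2 / τ) = 4 / τ * J ^ 2 := by ring
    nlinarith
  refine h5.trans ?_
  have : 0 ≤ J ^ 2 := sq_nonneg J
  have : 0 ≤ D * P := by positivity
  have : 0 ≤ 1 / τ * P := by positivity
  have : 0 ≤ D * J ^ 2 := by positivity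
  have e4 : 4 / τ * J ^ 2 = 4 * (1 / τ * J ^ 2) := by ring
  have e5 : (8 * D + 4 / τ) * (P + J ^ 2) = 8 * (D * P) + 8 * (D * J ^ 2) + 4 * (1 / τ * P)
    + 4 * (1 / τ * J ^ 2) := by ring
  rw [e4, e5]
  nlinarith

/-! ### Slices -/

theorem ae_eq_comp_snd {b b' : ℝ → ℝ} (h : b =ᵐ[volume.restrict (Ioi 0)] b') :
    (fun x : ℝ × ℝ => b x.2) =ᵐ[volHalf] fun x => b' x.2 := by
  rw [volHalf_eq_prod]
  exact Measure.quasiMeasurePreserving_snd.ae_eq_comp h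

theorem eLpNorm_tensor {χ b : ℝ → ℝ} (hχ : MemLp χ 2 volume)
    (hb : MemLp b 2 (volume.restrict (Ioi 0))) :
    eLpNorm (fun x : ℝ × ℝ => χ x.1 * b x.2) 2 volHalf
      = eLpNorm χ 2 volume * eLpNorm b 2 (volume.restrict (Ioi 0)) := by
  rw [← sq_rpow_half (eLpNorm _ 2 volHalf), ← sq_rpow_half (eLpNorm χ 2 volume * _)]
  congr 1
  rw [mul_pow, eLpNorm_two_sq, eLpNorm_two_sq, eLpNorm_two_sq, volHalf_eq_prod,
    ← lintegral_prod_mul (hχ.1.enorm.pow_const 2) (hb.1.enorm.pow_const 2)]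
  simp only [enorm_mul, mul_pow]

theorem memLp_tensor {χ b : ℝ → ℝ} (hχ : MemLp χ 2 volume)
    (hb : MemLp b 2 (volume.restrict (Ioi 0))) :
    MemLp (fun x : ℝ × ℝ => χ x.1 * b x.2) 2 volHalf := by
  refine ⟨?_, ?_⟩
  · rw [volHalf_eq_prod]
    exact hχ.1.comp_fst.mul hb.1.comp_snd
  · rw [eLpNorm_tensor hχ hb]
    exact ENNReal.mul_lt_top hχ.2 hb.2

/-- The moments `∫ χ(r) u(r, H) dr`. -/
noncomputable def moment (χ : ℝ → ℝ) (u : ℝ × ℝ → ℝ) (H : ℝ) : ℝ := ∫ r, u (r, H) * χ r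

theorem memLp_moment {χ : ℝ → ℝ} (hχ : MemLp χ 2 volume) {φ : ℝ × ℝ → ℝ} (hφ : IsTest φ) :
    MemLp (moment χ φ) 2 (volume.restrict (Ioi 0)) := by
  have hm : AEStronglyMeasurable (moment χ φ) (volume.restrict (Ioi 0)) := by
    have : AEStronglyMeasurable (fun p : ℝ × ℝ => φ (p.2, p.1) * χ p.2)
        (((volume : Measure ℝ).restrict (Ioi 0)).prod volume) :=
      (hφ.continuous.comp (continuous_snd.prodMk continuous_fst)).aestronglyMeasurable.mul
        hχ.1.comp_snd
    exact this.integral_prod_right'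
  rw [memLp_two_iff_integrable_sq hm]
  have hφ2 : Integrable (fun x => φ x ^ 2) volHalf := by
    simpa only [sq] using (hφ.mul_left hφ.smooth).integrable volHalf
  rw [volHalf_eq_prod] at hφ2
  have h := (hφ2.integral_prod_right).mul_const (∫ r, χ r ^ 2)
  refine h.mono' (hm.pow 2) (Eventually.of_forall fun H => ?_)
  rw [Real.norm_of_nonneg (sq_nonneg _)]
  exact sq_integral_mul_le ((hφ.slice_snd H).memLp volume 2) hχ

theorem integral_moment_mul {χ : ℝ → ℝ} (hχ : MemLp χ 2 volume) {φ : ℝ × ℝ → ℝ} (hφ : IsTest φ)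
    {b : ℝ → ℝ} (hb : MemLp b 2 (volume.restrict (Ioi 0))) :
    ∫ x in halfPlane, φ x * (χ x.1 * b x.2) = ∫ H in Ioi 0, moment χ φ H * b H := by
  have hχb : MemLp (fun x : ℝ × ℝ => χ x.1 * b x.2) 2 volHalf := by
    exact memLp_tensor hχ hb
  have hi := integrable_mul_of_memLp (hφ.memLp volHalf 2) hχb
  change ∫ x, φ x * (χ x.1 * b x.2) ∂volHalf = _
  rw [volHalf_eq_prod] at hi ⊢
  rw [integral_prod_symm _ hi]
  refine integral_congr_ae (Eventually.of_forall fun H => ?_)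
  simp only [moment]
  rw [← integral_mul_const]
  congr 1; ext r; ring

theorem exists_gap_halfPlane (hf : IsDoubleWell f) (hθ : IsOptimalProfile f θ) :
    ∃ C > 0, ∀ φ : ℝ × ℝ → ℝ, IsTest φ → ∫ x in halfPlane, φ x ^ 2
      ≤ C * ((∫ x in halfPlane, (dirDeriv (1, 0) φ x ^ 2 + deriv (deriv f) (θ x.1) * φ x ^ 2))
        + ∫ H in Ioi 0, moment (deriv θ) φ H ^ 2) := by
  obtain ⟨C, hC, h⟩ := hθ.exists_gap hf
  refine ⟨C, hC, fun φ hφ => ?_⟩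
  have i1 : Integrable (fun x => φ x ^ 2) volHalf := by
    simpa only [sq] using (hφ.mul_left hφ.smooth).integrable volHalf
  have hφ' := hφ.dirDeriv (1, 0)
  have i2 : Integrable (fun x => dirDeriv (1, 0) φ x ^ 2 + deriv (deriv f) (θ x.1) * φ x ^ 2)
      volHalf := by
    have a := hφ'.mul_left hφ'.smooth
    have b := (hφ.mul_left hφ.smooth).mul_left (contDiff_comp_fst
      (hf.contDiff_deriv2.comp (hθ.smooth hf)))
    have := (a.add b).integrable volHalf
    simpa only [sq, Function.comp] using this
  have hm := memLp_moment (hθ.memLp_deriv hf) hφ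
  have i3 := (memLp_two_iff_integrable_sq hm.1).1 hm
  change ∫ x, φ x ^ 2 ∂volHalf ≤ C * (∫ x, _ ∂volHalf + _)
  rw [volHalf_eq_prod] at i1 i2 ⊢
  rw [integral_prod_symm _ i1, integral_prod_symm _ i2, ← integral_add i2.integral_prod_right i3,
    ← integral_const_mul]
  refine integral_mono i1.integral_prod_right ((i2.integral_prod_right.add i3).const_mul C)
    fun H => ?_
  have := h _ (hφ.slice_snd H)
  rw [dirDeriv_slice_snd hφ H] at this
  exact this

end

section

/-! ### Regularity for the Neumann problem -/

theorem weakDir_test {φ : ℝ × ℝ → ℝ} (hφ : IsTest φ) :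
    WeakDir volHalf (1, 0) φ (dirDeriv (1, 0) φ) := by
  refine ⟨hφ.memLp _ _, (hφ.dirDeriv _).memLp _ _, fun ψ hψ => ?_⟩
  have h := integral_dirDeriv_fst (hψ.mul_left hφ.smooth)
  rw [dirDeriv_mul hφ.differentiable hψ.differentiable] at h
  have i1 := integrable_mul_of_memLp ((hφ.dirDeriv (1, 0)).memLp volHalf 2) (hψ.memLp volHalf 2)
  have i2 := integrable_mul_of_memLp (hφ.memLp volHalf 2) ((hψ.dirDeriv (1, 0)).memLp volHalf 2)
  rw [integral_add i1 i2] at h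
  linarith

theorem neumann_diffQuot_le {w wR wH G : ℝ × ℝ → ℝ} {g : ℝ → ℝ} {A : ℝ≥0∞}
    (hR : IsWeakPartial 1 0 w wR) (hH : IsWeakPartial 0 1 w wH) (m0 : MemLp w 2 volHalf)
    (m1 : MemLp wR 2 volHalf) (m2 : MemLp wH 2 volHalf) (hG : MemLp G 2 volHalf) (hA : A ≠ ⊤)
    (hg : HalfBound g A)
    (hw : ∀ φ, IsTest φ → (∫ x in halfPlane, wR x * dirDeriv (1, 0) φ x)
      + ∫ x in halfPlane, wH x * dirDeriv (0, 1) φ x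
      = (∫ x in halfPlane, G x * φ x) + ∫ r, g r * φ (r, 0)) {s : ℝ} (hs : 0 < s) :
    eLpNorm (fun x => s⁻¹ * (wR (x + s • ((1, 0) : ℝ × ℝ)) - wR x)) 2 volHalf
        ≤ 2 * (eLpNorm G 2 volHalf + A) ∧
      eLpNorm (fun x => s⁻¹ * (wH (x + s • ((1, 0) : ℝ × ℝ)) - wH x)) 2 volHalf
        ≤ 2 * (eLpNorm G 2 volHalf + A) := by
  set e : ℝ × ℝ := (1, 0) with he
  have hmp : ∀ s : ℝ, MeasurePreserving (fun x : ℝ × ℝ => x + s • e) volHalf volHalf :=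
    measurePreserving_translate
  have mτ : ∀ {u : ℝ × ℝ → ℝ}, MemLp u 2 volHalf → MemLp (fun x => u (x + s • e)) 2 volHalf :=
    fun h => h.comp_measurePreserving (hmp s)
  have mD : ∀ {u : ℝ × ℝ → ℝ}, MemLp u 2 volHalf →
      MemLp (fun x => s⁻¹ * (u (x + s • e) - u x)) 2 volHalf := fun h => ((mτ h).sub h).const_mul _
  have zR : IsWeakPartial 1 0 (fun x => s⁻¹ * (w (x + s • e) - w x))
      fun x => s⁻¹ * (wR (x + s • e) - wR x) := ((hR.translate m0 m1 s).sub hR).const_mul _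
  have zH : IsWeakPartial 0 1 (fun x => s⁻¹ * (w (x + s • e) - w x))
      fun x => s⁻¹ * (wH (x + s • e) - wH x) := ((hH.translate m0 m2 s).sub hH).const_mul _
  obtain ⟨φ, hφ⟩ := exists_isApprox zR zH (mD m0) (mD m1) (mD m2)
  set c := (eLpNorm G 2 volHalf).toReal + A.toReal with hc
  have hc0 : 0 ≤ c := by positivity
  -- the weak form of the difference quotient
  have key : ∀ ψ : ℝ × ℝ → ℝ, IsTest ψ →
      (∫ x in halfPlane, (s⁻¹ * (wR (x + s • e) - wR x)) * dirDeriv (1, 0) ψ x)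
        + ∫ x in halfPlane, (s⁻¹ * (wH (x + s • e) - wH x)) * dirDeriv (0, 1) ψ x
        ≤ c * ((eLpNorm (dirDeriv (1, 0) ψ) 2 volHalf).toReal
          + (eLpNorm (dirDeriv (0, 1) ψ) 2 volHalf).toReal) := by
    intro ψ hψ
    have move : ∀ {u χ : ℝ × ℝ → ℝ}, MemLp u 2 volHalf → IsTest χ →
        ∫ x in halfPlane, (s⁻¹ * (u (x + s • e) - u x)) * χ x
          = s⁻¹ * ∫ x in halfPlane, u x * (χ (x + (-s) • e) - χ x) := by
      intro u χ hu hχ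
      have hχ2 := hχ.memLp volHalf 2
      have h1 := integral_translate_mul hmp u χ s
      have h2 : ∫ x in halfPlane, (u (x + s • e) - u x) * χ x
          = (∫ x in halfPlane, u (x + s • e) * χ x) - ∫ x in halfPlane, u x * χ x := by
        rw [← integral_sub (integrable_mul_of_memLp (mτ hu) hχ2) (integrable_mul_of_memLp hu hχ2)]
        simp only [sub_mul]
      have h3 : ∫ x in halfPlane, u x * (χ (x + (-s) • e) - χ x)
          = (∫ x in halfPlane, u x * χ (x + (-s) • e)) - ∫ x in halfPlane, u x * χ x := by
        rw [← integral_sub (integrable_mul_of_memLp hu ((hχ.translate _).memLp _ _))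
          (integrable_mul_of_memLp hu hχ2)]
        simp only [mul_sub]
      simp only [mul_assoc]
      rw [integral_const_mul, h2, h3, h1]
    rw [move m1 (hψ.dirDeriv _), move m2 (hψ.dirDeriv _), ← mul_add]
    have hψs := (hψ.translate ((-s) • e)).sub hψ
    have hw' := hw _ hψs
    have hdd : ∀ e', dirDeriv e' (fun x => ψ (x + (-s) • e) - ψ x)
        = fun x => dirDeriv e' ψ (x + (-s) • e) - dirDeriv e' ψ x := by
      intro e'
      have ht := dirDeriv_translate (φ := ψ) (e := e') ((-s) • e)
      ext x
      rw [← congrFun ht x]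
      simp only [dirDeriv]
      rw [fderiv_fun_sub ((hψ.translate _).differentiable x) (hψ.differentiable x)]
      rfl
    rw [hdd, hdd] at hw'
    rw [hw']
    have b1 : ∫ x in halfPlane, G x * (ψ (x + (-s) • e) - ψ x)
        ≤ (eLpNorm G 2 volHalf).toReal * (s * (eLpNorm (dirDeriv (1, 0) ψ) 2 volHalf).toReal) := by
      refine (le_abs_self _).trans ((abs_integral_mul_le hG (hψs.memLp _ _)).trans ?_)
      gcongr
      have := (weakDir_test hψ).eLpNorm_translate_sub_le hmp (-s)
      have h2 := ENNReal.toReal_mono (ENNReal.mul_ne_top ENNReal.ofReal_ne_top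
        ((hψ.dirDeriv e).memLp volHalf 2).2.ne) this
      rwa [ENNReal.toReal_mul, abs_neg, abs_of_pos hs, ENNReal.toReal_ofReal hs.le] at h2
    have b2 := (le_abs_self _).trans (abs_integral_mul_translate_trace_le hA hg hψ (-s))
    rw [abs_neg, abs_of_pos hs] at b2
    have e2 : ∫ r, g r * (ψ ((r, 0) + (-s) • e) - ψ (r, 0))
        = ∫ r, g r * (ψ (r + -s, 0) - ψ (r, 0)) := by
      simp [he]
    rw [e2]
    set X := (eLpNorm (dirDeriv (1, 0) ψ) 2 volHalf).toReal with hX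
    set Y := (eLpNorm (dirDeriv (0, 1) ψ) 2 volHalf).toReal with hY
    have hX0 : 0 ≤ X := ENNReal.toReal_nonneg
    have hY0 : 0 ≤ Y := ENNReal.toReal_nonneg
    have hG0 : 0 ≤ (eLpNorm G 2 volHalf).toReal := ENNReal.toReal_nonneg
    calc s⁻¹ * ((∫ x in halfPlane, G x * (ψ (x + (-s) • e) - ψ x))
          + ∫ r, g r * (ψ (r + -s, 0) - ψ (r, 0)))
        ≤ s⁻¹ * ((eLpNorm G 2 volHalf).toReal * (s * X) + s * (A.toReal * (X + Y))) := by
          gcongr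
      _ = (eLpNorm G 2 volHalf).toReal * X + A.toReal * (X + Y) := by field_simp
      _ ≤ c * (X + Y) := by rw [hc]; nlinarith
  -- passage to the limit
  set a := (eLpNorm (fun x => s⁻¹ * (wR (x + s • e) - wR x)) 2 volHalf).toReal with ha
  set b := (eLpNorm (fun x => s⁻¹ * (wH (x + s • e) - wH x)) 2 volHalf).toReal with hb
  have sqn : ∀ {u : ℝ × ℝ → ℝ}, MemLp u 2 volHalf →
      ∫ x in halfPlane, u x * u x = (eLpNorm u 2 volHalf).toReal ^ 2 := by
    intro u hu
    rw [← Lp.norm_toLp u hu, ← real_inner_self_eq_norm_sq, inner_toLp]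
  have lim : a ^ 2 + b ^ 2 ≤ c * (a + b) := by
    have l1 := tendsto_integral_mul (fun n => ((hφ.test n).dirDeriv (1, 0)).memLp volHalf 2) (mD m1)
      (mD m1) hφ.tendsto_fst
    have l2 := tendsto_integral_mul (fun n => ((hφ.test n).dirDeriv (0, 1)).memLp volHalf 2) (mD m2)
      (mD m2) hφ.tendsto_snd
    have n1 := (ENNReal.tendsto_toReal (mD m1).2.ne).comp (tendsto_eLpNorm
      (fun n => ((hφ.test n).dirDeriv (1, 0)).memLp volHalf 2) (mD m1) hφ.tendsto_fst)
    have n2 := (ENNReal.tendsto_toReal (mD m2).2.ne).comp (tendsto_eLpNorm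
      (fun n => ((hφ.test n).dirDeriv (0, 1)).memLp volHalf 2) (mD m2) hφ.tendsto_snd)
    have := le_of_tendsto_of_tendsto' (l1.add l2) ((n1.add n2).const_mul c) fun n => by
      have := key _ (hφ.test n)
      simp only [mul_comm] at this ⊢
      exact this
    rw [sqn (mD m1), sqn (mD m2)] at this
    exact this
  have ha0 : 0 ≤ a := ENNReal.toReal_nonneg
  have hb0 : 0 ≤ b := ENNReal.toReal_nonneg
  have hab : a + b ≤ 2 * c := by
    by_contra hcon
    push Not at hcon
    have : 0 < a + b := by linarith
    nlinarith [sq_nonneg (a - b)]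
  have fin : 2 * (eLpNorm G 2 volHalf + A) ≠ ⊤ :=
    ENNReal.mul_ne_top (by norm_num) (ENNReal.add_ne_top.2 ⟨hG.2.ne, hA⟩)
  have hr : (2 * (eLpNorm G 2 volHalf + A)).toReal = 2 * c := by
    rw [ENNReal.toReal_mul, ENNReal.toReal_add hG.2.ne hA]; simp [hc]
  constructor
  · rw [← ENNReal.toReal_le_toReal (mD m1).2.ne fin, hr]; linarith
  · rw [← ENNReal.toReal_le_toReal (mD m2).2.ne fin, hr]; linarith

/-- Weak solutions of the Neumann problem with data in `L²` and `H^{1/2}` lie in `H²`. -/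
theorem neumann_regularity {w wR wH G : ℝ × ℝ → ℝ} {g : ℝ → ℝ} {A : ℝ≥0∞}
    (hR : IsWeakPartial 1 0 w wR) (hH : IsWeakPartial 0 1 w wH) (m0 : MemLp w 2 volHalf)
    (m1 : MemLp wR 2 volHalf) (m2 : MemLp wH 2 volHalf) (hG : MemLp G 2 volHalf) (hA : A ≠ ⊤)
    (hg : HalfBound g A)
    (hw : ∀ φ, IsTest φ → (∫ x in halfPlane, wR x * dirDeriv (1, 0) φ x)
      + ∫ x in halfPlane, wH x * dirDeriv (0, 1) φ x
      = (∫ x in halfPlane, G x * φ x) + ∫ r, g r * φ (r, 0)) :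
    ∃ wRR wRH wHH, IsWeakPartial 1 0 wR wRR ∧ IsWeakPartial 0 1 wR wRH ∧ IsWeakPartial 1 0 wH wRH ∧
      IsWeakPartial 0 1 wH wHH ∧ L2Bound wRR (2 * (eLpNorm G 2 volHalf + A)) ∧
      L2Bound wRH (2 * (eLpNorm G 2 volHalf + A)) ∧ L2Bound wHH (3 * (eLpNorm G 2 volHalf + A)) ∧
      (∀ x, G x = -(wRR x + wHH x)) ∧ Green wH wHH fun r => -g r := by
  have hdq := fun (s : ℝ) (hs : s ∈ Ioc (0 : ℝ) 1) =>
    neumann_diffQuot_le hR hH m0 m1 m2 hG hA hg hw hs.1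
  have fin : 2 * (eLpNorm G 2 volHalf + A) ≠ ⊤ :=
    ENNReal.mul_ne_top (by norm_num) (ENNReal.add_ne_top.2 ⟨hG.2.ne, hA⟩)
  have mD : ∀ {u : ℝ × ℝ → ℝ} (s : ℝ), MemLp u 2 volHalf →
      MemLp (fun x => s⁻¹ * (u (x + s • ((1, 0) : ℝ × ℝ)) - u x)) 2 volHalf := fun s h =>
    ((h.comp_measurePreserving (measurePreserving_translate s)).sub h).const_mul _
  obtain ⟨wRR, h1, h2⟩ := SobBound.exists_fst (k := 0) fin
    (show SobBound 0 wR (eLpNorm wR 2 volHalf) from ⟨m1, le_rfl⟩)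
    fun s hs => ⟨mD s m1, (hdq s hs).1⟩
  obtain ⟨wRH, h3, h4⟩ := SobBound.exists_fst (k := 0) fin
    (show SobBound 0 wH (eLpNorm wH 2 volHalf) from ⟨m2, le_rfl⟩)
    fun s hs => ⟨mD s m2, (hdq s hs).2⟩
  have h2 : L2Bound wRR _ := h2
  have h4 : L2Bound wRH _ := h4
  have h5 : IsWeakPartial 0 1 wR wRH := hR.of_comp (hH.comp h3)
  have mHH : MemLp (fun x => -(G x + wRR x)) 2 volHalf := (hG.add h2.1).neg
  have hgreen : Green wH (fun x => -(G x + wRR x)) fun r => -g r := by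
    intro φ hφ
    have a := hw φ hφ
    have b := (weakDir_of_isWeakPartial h1 m1 h2.1).2.2 φ hφ
    have hφ2 := hφ.memLp volHalf 2
    have c : ∫ x in halfPlane, -(G x + wRR x) * φ x
        = -((∫ x in halfPlane, G x * φ x) + ∫ x in halfPlane, wRR x * φ x) := by
      rw [← integral_add (integrable_mul_of_memLp hG hφ2) (integrable_mul_of_memLp h2.1 hφ2),
        ← integral_neg]
      congr 1; ext x; ring
    have d : ∫ r, -g r * φ (r, 0) = -∫ r, g r * φ (r, 0) := by
      rw [← integral_neg]; congr 1; ext r; ring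
    rw [c, d]
    linarith
  refine ⟨wRR, wRH, fun x => -(G x + wRR x), h1, h5, h3, ⟨h3.1, MemLp.locallyIntegrableOn_halfPlane mHH, ?_⟩, h2,
    h4, ⟨mHH, ?_⟩, fun x => by ring, hgreen⟩
  · intro φ p1 p2 p3
    have := hgreen φ ⟨p1, p2⟩
    have z : ∀ r, φ (r, 0) = 0 := fun r => by
      refine image_eq_zero_of_notMem_tsupport fun h => ?_
      have : (0 : ℝ) < 0 := p3 h
      exact lt_irrefl _ this
    simp only [z, mul_zero, integral_zero, neg_zero] at this
    rw [partialDeriv_zero_one]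
    rw [zero_add, pow_one, neg_one_mul]
    linarith
  · have e : eLpNorm (fun x => -(G x + wRR x)) 2 volHalf = eLpNorm (G + wRR) 2 volHalf :=
      eLpNorm_neg (G + wRR) 2 volHalf
    rw [e]
    refine (eLpNorm_add_le hG.1 h2.1.1 (by norm_num)).trans ?_
    calc _ ≤ (eLpNorm G 2 volHalf + A) + 2 * (eLpNorm G 2 volHalf + A) :=
          add_le_add le_self_add h2.2
      _ = _ := by ring

end

section

/-! ### The conjugated problem -/

/-- The weak derivatives of `v` up to second order, all of them in `L²`. -/
structure H2Jet (v vR vH vRR vRH vHH : ℝ × ℝ → ℝ) : Prop where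
  fst : IsWeakPartial 1 0 v vR
  snd : IsWeakPartial 0 1 v vH
  fst_fst : IsWeakPartial 1 0 vR vRR
  fst_snd : IsWeakPartial 0 1 vR vRH
  snd_fst : IsWeakPartial 1 0 vH vRH
  snd_snd : IsWeakPartial 0 1 vH vHH
  mem : MemLp v 2 volHalf
  mem_fst : MemLp vR 2 volHalf
  mem_snd : MemLp vH 2 volHalf
  mem_fst_fst : MemLp vRR 2 volHalf
  mem_fst_snd : MemLp vRH 2 volHalf
  mem_snd_snd : MemLp vHH 2 volHalf

theorem SobBound.exists_h2Jet {v : ℝ × ℝ → ℝ} {A : ℝ≥0∞} (h : SobBound 2 v A) :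
    ∃ vR vH vRR vRH vHH, H2Jet v vR vH vRR vRH vHH ∧ SobBound 1 vR A ∧ SobBound 1 vH A := by
  obtain ⟨h0, vR, vH, h1, h2, ⟨h3, vRR, vRH, h4, h5, h6, h7⟩, ⟨h8, vHR, vHH, h9, h10, h11, h12⟩⟩ := h
  have h7 : L2Bound vRH A := h7
  have h9' : IsWeakPartial 1 0 vH vRH := h2.of_comp (h1.comp h5)
  exact ⟨vR, vH, vRR, vRH, vHH, ⟨h1, h2, h4, h5, h9', h10, h0.1, h3.1, h8.1, h6.l2Bound.1, h7.1,
    h12.l2Bound.1⟩, ⟨h3, vRR, vRH, h4, h5, h6, h7⟩, ⟨h8, vHR, vHH, h9, h10, h11, h12⟩⟩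

theorem H2Jet.sobBound {v vR vH vRR vRH vHH : ℝ × ℝ → ℝ} (h : H2Jet v vR vH vRR vRH vHH) {A : ℝ≥0∞}
    (h0 : eLpNorm v 2 volHalf ≤ A) (h1 : eLpNorm vR 2 volHalf ≤ A) (h2 : eLpNorm vH 2 volHalf ≤ A)
    (h3 : eLpNorm vRR 2 volHalf ≤ A) (h4 : eLpNorm vRH 2 volHalf ≤ A)
    (h5 : eLpNorm vHH 2 volHalf ≤ A) : SobBound 2 v A :=
  ⟨⟨h.mem, h0⟩, vR, vH, h.fst, h.snd, ⟨⟨h.mem_fst, h1⟩, vRR, vRH, h.fst_fst, h.fst_snd,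
    ⟨h.mem_fst_fst, h3⟩, ⟨h.mem_fst_snd, h4⟩⟩, ⟨⟨h.mem_snd, h2⟩, vRH, vHH, h.snd_fst, h.snd_snd,
    ⟨h.mem_fst_snd, h4⟩, ⟨h.mem_snd_snd, h5⟩⟩⟩

/-- The zeroth order coefficient of the conjugated operator. -/
noncomputable def potential (η c : ℝ → ℝ) (β γ : ℝ) (R : ℝ) : ℝ :=
  β * deriv (deriv η) R - β ^ 2 * deriv η R ^ 2 - γ ^ 2 + c R

/-- `v = e^W u` for a solution `u` of the model problem, `W = βη(R) + γH`. -/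
def IsSol (η c : ℝ → ℝ) (β γ : ℝ) (v G : ℝ × ℝ → ℝ) (g : ℝ → ℝ) : Prop :=
  ∃ vR vH vRR vRH vHH, H2Jet v vR vH vRR vRH vHH ∧
    (∀ᵐ x ∂volHalf, G x = -(vRR x + vHH x) + 2 * β * deriv η x.1 * vR x + 2 * γ * vH x
      + potential η c β γ x.1 * v x) ∧ LocallyIntegrable g ∧
    Green (fun x => vH x - γ * v x) (fun x => vHH x - γ * vH x) fun r => -g r

/-- The weight `e^{βη(R) + γH}`. -/
noncomputable def weight (η : ℝ → ℝ) (β γ : ℝ) (x : ℝ × ℝ) : ℝ := Real.exp (β * η x.1 + γ * x.2)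

theorem weight_neg (η : ℝ → ℝ) (β γ : ℝ) (x : ℝ × ℝ) :
    weight η (-β) (-γ) x = (weight η β γ x)⁻¹ := by
  rw [weight, weight, ← Real.exp_neg]; congr 1; ring

theorem weight_pos (η : ℝ → ℝ) (β γ : ℝ) (x : ℝ × ℝ) : 0 < weight η β γ x := Real.exp_pos _

theorem contDiff_weight {η : ℝ → ℝ} (hη : ContDiff ℝ ∞ η) (β γ : ℝ) :
    ContDiff ℝ ∞ (weight η β γ) :=
  ((contDiff_const.mul (hη.comp contDiff_fst)).add (contDiff_const.mul contDiff_snd)).exp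

theorem dirDeriv_weight {η : ℝ → ℝ} (hη : ContDiff ℝ ∞ η) (β γ a b : ℝ) :
    dirDeriv (a, b) (weight η β γ) = fun x => (a * (β * deriv η x.1) + b * γ) * weight η β γ x := by
  ext x
  have h1 : HasFDerivAt (fun x : ℝ × ℝ => η x.1)
      (deriv η x.1 • ContinuousLinearMap.fst ℝ ℝ ℝ) x := by
    have := (hη.differentiable (by simp) x.1).hasDerivAt.comp_hasFDerivAt x
      (hasFDerivAt_fst (𝕜 := ℝ) (p := x))
    exact this
  have h2 := ((h1.const_mul β).add ((hasFDerivAt_snd (𝕜 := ℝ) (p := x)).const_mul γ)).exp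
  have h3 : HasFDerivAt (weight η β γ) _ x := h2
  rw [dirDeriv, h3.fderiv]
  simp [weight]
  ring

theorem weight_inv_le {η : ℝ → ℝ} (hη : IsSmoothAbs η) {β γ : ℝ} (hβ : 0 ≤ β) (hγ : 0 ≤ γ) :
    ∃ C : ℝ, ∀ x ∈ halfPlane, |(weight η β γ x)⁻¹| ≤ C := by
  obtain ⟨hs, Rbar, hR, he⟩ := hη
  obtain ⟨C, hC⟩ := (isCompact_Icc (a := -Rbar) (b := Rbar)).exists_bound_of_continuousOn
    hs.continuous.continuousOn
  refine ⟨Real.exp (β * |C|), fun x hx => ?_⟩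
  have hx : 0 < x.2 := hx
  rw [abs_of_pos (inv_pos.2 (weight_pos _ _ _ _)), weight, ← Real.exp_neg, Real.exp_le_exp]
  have : -|C| ≤ η x.1 := by
    by_cases hz : x.1 ∈ Icc (-Rbar) Rbar
    · have := (abs_le.1 (hC _ hz)).1
      linarith [le_abs_self C]
    · rw [he x.1 (not_lt.1 fun h => hz ⟨(abs_lt.1 h).1.le, (abs_lt.1 h).2.le⟩)]
      linarith [abs_nonneg x.1, abs_nonneg C]
  nlinarith [mul_nonneg hγ hx.le]

variable {f θ η : ℝ → ℝ} {β γ : ℝ}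

/-- The derivatives of `e^{-W} v`. -/
theorem H2Jet.unweight (hη : ContDiff ℝ ∞ η) {v vR vH vRR vRH vHH : ℝ × ℝ → ℝ}
    (h : H2Jet v vR vH vRR vRH vHH) (β γ : ℝ) :
    IsWeakPartial 0 1 (fun x => weight η (-β) (-γ) x * v x)
      (fun x => weight η (-β) (-γ) x * (vH x - γ * v x)) ∧
    IsWeakPartial 0 1 (fun x => weight η (-β) (-γ) x * (vH x - γ * v x))
      (fun x => weight η (-β) (-γ) x * (vHH x - 2 * γ * vH x + γ ^ 2 * v x)) ∧
    IsWeakPartial 2 0 (fun x => weight η (-β) (-γ) x * v x)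
      (fun x => weight η (-β) (-γ) x * (vRR x - 2 * β * deriv η x.1 * vR x
        - (β * deriv (deriv η) x.1 - β ^ 2 * deriv η x.1 ^ 2) * v x)) := by
  have hE := contDiff_weight hη (-β) (-γ)
  have hη' := (contDiff_infty_iff_deriv.1 hη).2
  refine ⟨?_, ?_, ?_⟩
  · refine (h.snd.mul_snd hE).congr ae_eq_rfl (Eventually.of_forall fun x => ?_)
    simp only [dirDeriv_weight hη]; ring
  · refine ((h.snd_snd.sub (h.snd.const_mul γ)).mul_snd hE).congr ae_eq_rfl
      (Eventually.of_forall fun x => ?_)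
    simp only [dirDeriv_weight hη]; ring
  · have h1 := h.fst.mul_fst hE
    have h2 := (h.fst_fst.sub ((h.fst.fst_mul_fst hη').const_mul β)).mul_fst hE
    have h3 : IsWeakPartial (1 + 1) (0 + 0) _ _ := h1.comp (h2.congr
      (Eventually.of_forall fun x => by simp only [dirDeriv_weight hη]; ring) ae_eq_rfl)
    refine h3.congr ae_eq_rfl (Eventually.of_forall fun x => ?_)
    simp only [dirDeriv_weight hη]; ring

theorem green_weight_iff (hη : ContDiff ℝ ∞ η) {v vH vHH : ℝ × ℝ → ℝ} {g : ℝ → ℝ}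
    (m0 : MemLp v 2 volHalf) (m1 : MemLp vH 2 volHalf) (m2 : MemLp vHH 2 volHalf) :
    Green (fun x => weight η (-β) (-γ) x * (vH x - γ * v x))
      (fun x => weight η (-β) (-γ) x * (vHH x - 2 * γ * vH x + γ ^ 2 * v x)) (fun r => -g r) ↔
    Green (fun x => vH x - γ * v x) (fun x => vHH x - γ * vH x)
      (fun r => -(Real.exp (β * η r) * g r)) := by
  -- both formulas coincide for a pair of tests related by the weight
  have my : MemLp (fun x => vH x - γ * v x) 2 volHalf := m1.sub (m0.const_mul γ)
  have myH : MemLp (fun x => vHH x - γ * vH x) 2 volHalf := m2.sub (m1.const_mul γ)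
  have mz : MemLp (fun x => vHH x - 2 * γ * vH x + γ ^ 2 * v x) 2 volHalf :=
    (m2.sub (m1.const_mul (2 * γ))).add (m0.const_mul _)
  have key : ∀ ψ : ℝ × ℝ → ℝ, IsTest ψ →
      (∫ x in halfPlane, weight η (-β) (-γ) x * (vH x - γ * v x)
          * dirDeriv (0, 1) (fun x => weight η β γ x * ψ x) x)
        + (∫ x in halfPlane, weight η (-β) (-γ) x * (vHH x - 2 * γ * vH x + γ ^ 2 * v x)
          * (weight η β γ x * ψ x))
      = (∫ x in halfPlane, (vH x - γ * v x) * dirDeriv (0, 1) ψ x)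
        + ∫ x in halfPlane, (vHH x - γ * vH x) * ψ x := by
    intro ψ hψ
    have hψ2 := hψ.memLp volHalf 2
    have hψH := (hψ.dirDeriv (0, 1)).memLp volHalf 2
    have e1 : ∀ x, weight η (-β) (-γ) x * (vH x - γ * v x)
        * dirDeriv (0, 1) (fun x => weight η β γ x * ψ x) x
        = (vH x - γ * v x) * dirDeriv (0, 1) ψ x + γ * ((vH x - γ * v x) * ψ x) := by
      intro x
      rw [dirDeriv_mul ((contDiff_weight hη β γ).differentiable (by simp)) hψ.differentiable,
        dirDeriv_weight hη, weight_neg]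
      have := (weight_pos η β γ x).ne'
      field_simp
      ring
    have e2 : ∀ x, weight η (-β) (-γ) x * (vHH x - 2 * γ * vH x + γ ^ 2 * v x)
        * (weight η β γ x * ψ x) = (vHH x - γ * vH x) * ψ x - γ * ((vH x - γ * v x) * ψ x) := by
      intro x
      rw [weight_neg]
      have := (weight_pos η β γ x).ne'
      field_simp
      ring
    simp only [e1, e2]
    have i1 := integrable_mul_of_memLp my hψH
    have i2 := (integrable_mul_of_memLp my hψ2).const_mul γ
    have i3 := integrable_mul_of_memLp myH hψ2
    rw [integral_add i1 i2, integral_sub i3 i2]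
    ring
  constructor
  · intro h ψ hψ
    have := h _ (hψ.mul_left (contDiff_weight hη β γ))
    rw [key ψ hψ] at this
    rw [this]
    congr 1
    refine integral_congr_ae (Eventually.of_forall fun r => ?_)
    simp [weight]; ring
  · intro h φ hφ
    have h1 := key _ (hφ.mul_left (contDiff_weight hη (-β) (-γ)))
    have e : ∀ x, weight η β γ x * (weight η (-β) (-γ) x * φ x) = φ x := by
      intro x
      rw [weight_neg, mul_inv_cancel_left₀ (weight_pos η β γ x).ne']
    simp only [e] at h1
    rw [h1, h _ (hφ.mul_left (contDiff_weight hη (-β) (-γ)))]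
    congr 1
    refine integral_congr_ae (Eventually.of_forall fun r => ?_)
    simp only [weight]
    rw [show (-β) * η r + -γ * 0 = -(β * η r) by ring, Real.exp_neg]
    have := (Real.exp_pos (β * η r)).ne'
    field_simp

theorem MemLp.weight_mul (hη : IsSmoothAbs η) (hβ : 0 ≤ β) (hγ : 0 ≤ γ) {v : ℝ × ℝ → ℝ}
    (h : MemLp v 2 volHalf) : MemLp (fun x => weight η (-β) (-γ) x * v x) 2 volHalf := by
  obtain ⟨C, hC⟩ := weight_inv_le hη hβ hγ
  refine MemLp.of_le_mul (c := C) h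
    ((contDiff_weight hη.1 (-β) (-γ)).continuous.aestronglyMeasurable.mul h.1) ?_
  filter_upwards [ae_restrict_mem measurableSet_halfPlane] with x hx
  rw [norm_mul, weight_neg]
  gcongr
  exact hC x hx

/-- The model problem in terms of `v = e^W u`. -/
theorem operatorEq_iff_isSol (hη : IsSmoothAbs η) (hβ : 0 ≤ β) (hγ : 0 ≤ γ) {v : ℝ × ℝ → ℝ}
    {A : ℝ≥0∞} (hv : SobBound 2 v A) (G : ℝ × ℝ → ℝ) (g : ℝ → ℝ) :
    OperatorEq f θ (fun x => weight η (-β) (-γ) x * v x) G g ↔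
      IsSol η (fun R => deriv (deriv f) (θ R)) β γ v (fun x => weight η β γ x * G x)
        (fun r => Real.exp (β * η r) * g r) := by
  obtain ⟨vR, vH, vRR, vRH, vHH, h, -, -⟩ := hv.exists_h2Jet
  obtain ⟨d1, d2, d3⟩ := h.unweight hη.1 β γ
  have d4 : IsWeakPartial (0 + 0) (1 + 1) _ _ := d1.comp d2
  have my : MemLp (fun x => vH x - γ * v x) 2 volHalf := h.mem_snd.sub (h.mem.const_mul γ)
  have mz : MemLp (fun x => vHH x - 2 * γ * vH x + γ ^ 2 * v x) 2 volHalf :=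
    (h.mem_snd_snd.sub (h.mem_snd.const_mul (2 * γ))).add (h.mem.const_mul _)
  have hpde : ∀ x, (weight η β γ x * G x = -(vRR x + vHH x) + 2 * β * deriv η x.1 * vR x
      + 2 * γ * vH x + potential η (fun R => deriv (deriv f) (θ R)) β γ x.1 * v x) ↔
      G x = -(weight η (-β) (-γ) x * (vRR x - 2 * β * deriv η x.1 * vR x
        - (β * deriv (deriv η) x.1 - β ^ 2 * deriv η x.1 ^ 2) * v x)
        + weight η (-β) (-γ) x * (vHH x - 2 * γ * vH x + γ ^ 2 * v x))
        + deriv (deriv f) (θ x.1) * (weight η (-β) (-γ) x * v x) := by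
    intro x
    have hw := weight_pos η β γ x
    rw [weight_neg, ← mul_right_inj' hw.ne' (b := G x), potential]
    refine Eq.congr_right ?_
    field_simp
    ring
  have hexp : Continuous fun r => Real.exp (β * η r) := by
    have := hη.1.continuous; fun_prop
  have hexp' : Continuous fun r => Real.exp (-(β * η r)) := by
    have := hη.1.continuous; fun_prop
  have hloc : LocallyIntegrable g ↔ LocallyIntegrable fun r => Real.exp (β * η r) * g r := by
    constructor
    · intro hg
      have := (locallyIntegrableOn_univ.2 hg).continuousOn_mul hexp.continuousOn
        isOpen_univ.isLocallyClosed
      exact locallyIntegrableOn_univ.1 this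
    · intro hg
      have := (locallyIntegrableOn_univ.2 hg).continuousOn_mul hexp'.continuousOn
        isOpen_univ.isLocallyClosed
      refine (locallyIntegrableOn_univ.1 this).congr (Eventually.of_forall fun r => ?_)
      simp only
      rw [← mul_assoc, ← Real.exp_add]; simp
  constructor
  · rintro ⟨⟨uRR, uHH, hRR, hHH, hG⟩, uH, hH, hl, hm, wH, hwH, hwm, hgr⟩
    have e1 := hRR.unique d3
    have e2 := hHH.unique d4
    have e3 := hH.unique d1
    have e4 := (hwH.congr e3 ae_eq_rfl).unique d2
    refine ⟨vR, vH, vRR, vRH, vHH, h, ?_, hloc.1 ?_, ?_⟩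
    · filter_upwards [hG, e1, e2] with x a b c
      rw [hpde, a, b, c]
    · refine hl.neg.congr (Eventually.of_forall fun r => ?_)
      simp
    · rw [← green_weight_iff hη.1 h.mem h.mem_snd h.mem_snd_snd]
      intro φ hφ
      rw [← hgr φ hφ.1 hφ.2]
      congr 1
      · refine integral_congr_ae ?_
        filter_upwards [e3] with x hx
        rw [hx]; rfl
      · refine integral_congr_ae ?_
        filter_upwards [e4] with x hx
        rw [hx]
  · rintro ⟨wR, wH, wRR, wRH, wHH, hw, hG, hl, hgr⟩
    have e1 := h.fst.unique hw.fst
    have e2 := h.snd.unique hw.snd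
    have e3 := h.fst_fst.unique (hw.fst_fst.congr e1.symm ae_eq_rfl)
    have e4 := h.snd_snd.unique (hw.snd_snd.congr e2.symm ae_eq_rfl)
    refine ⟨⟨_, _, d3, d4, ?_⟩, _, d1, ?_, MemLp.weight_mul hη hβ hγ my, _, d2,
      MemLp.weight_mul hη hβ hγ mz, ?_⟩
    · filter_upwards [hG, e1, e2, e3, e4] with x a b c d e
      rw [← hpde, a, b, c, d, e]
    · exact (hloc.2 hl).neg
    · intro φ p1 p2
      refine (green_weight_iff hη.1 h.mem h.mem_snd h.mem_snd_snd).2 ?_ φ ⟨p1, p2⟩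
      intro ψ hψ
      rw [← hgr ψ hψ]
      congr 1
      · refine integral_congr_ae ?_
        filter_upwards [e2] with x hx
        rw [hx]
      · refine integral_congr_ae ?_
        filter_upwards [e2, e4] with x hx hy
        rw [hx, hy]

end

section

/-! ### The energy space -/

noncomputable abbrev L2Half := Lp ℝ 2 volHalf

noncomputable abbrev L2Line := Lp ℝ 2 (volume : Measure ℝ)

/-- The space of `1`-jets together with boundary values. -/
noncomputable abbrev JetSpace := WithLp 2 (WithLp 2 (L2Half × L2Half) × WithLp 2 (L2Half × L2Line))

/-- The jet with the given components. -/
noncomputable def mkJet (w wR wH : L2Half) (t : L2Line) : JetSpace :=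
  WithLp.toLp 2 (WithLp.toLp 2 (w, wR), WithLp.toLp 2 (wH, t))

/-- The function. -/
noncomputable def jetFun : JetSpace →L[ℝ] L2Half :=
  (WithLp.fstL 2 ℝ L2Half L2Half).comp (WithLp.fstL 2 ℝ _ _)

/-- The tangential derivative. -/
noncomputable def jetFst : JetSpace →L[ℝ] L2Half :=
  (WithLp.sndL 2 ℝ L2Half L2Half).comp (WithLp.fstL 2 ℝ _ _)

/-- The normal derivative. -/
noncomputable def jetSnd : JetSpace →L[ℝ] L2Half :=
  (WithLp.fstL 2 ℝ L2Half L2Line).comp (WithLp.sndL 2 ℝ _ _)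

/-- The boundary values. -/
noncomputable def jetTrace : JetSpace →L[ℝ] L2Line :=
  (WithLp.sndL 2 ℝ L2Half L2Line).comp (WithLp.sndL 2 ℝ _ _)

@[simp] theorem jetFun_mkJet (w wR wH : L2Half) (t : L2Line) : jetFun (mkJet w wR wH t) = w := rfl
@[simp] theorem jetFst_mkJet (w wR wH : L2Half) (t : L2Line) : jetFst (mkJet w wR wH t) = wR := rfl
@[simp] theorem jetSnd_mkJet (w wR wH : L2Half) (t : L2Line) : jetSnd (mkJet w wR wH t) = wH := rfl
@[simp] theorem jetTrace_mkJet (w wR wH : L2Half) (t : L2Line) :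
    jetTrace (mkJet w wR wH t) = t := rfl

theorem jet_norm_sq (e : JetSpace) :
    ‖e‖ ^ 2 = ‖jetFun e‖ ^ 2 + ‖jetFst e‖ ^ 2 + (‖jetSnd e‖ ^ 2 + ‖jetTrace e‖ ^ 2) := by
  rw [WithLp.prod_norm_sq_eq_of_L2, WithLp.prod_norm_sq_eq_of_L2, WithLp.prod_norm_sq_eq_of_L2]
  rfl

theorem continuous_mkJet :
    Continuous fun p : L2Half × L2Half × L2Half × L2Line => mkJet p.1 p.2.1 p.2.2.1 p.2.2.2 := by
  unfold mkJet
  refine (WithLp.prod_continuous_toLp 2 _ _).comp (Continuous.prodMk ?_ ?_)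
  · exact (WithLp.prod_continuous_toLp 2 _ _).comp (by fun_prop)
  · exact (WithLp.prod_continuous_toLp 2 _ _).comp (by fun_prop)

/-- The jet of a test function. -/
noncomputable def testJet (φ : ℝ × ℝ → ℝ) (hφ : IsTest φ) : JetSpace :=
  mkJet (hφ.memLp volHalf 2).toLp ((hφ.dirDeriv (1, 0)).memLp volHalf 2).toLp
    ((hφ.dirDeriv (0, 1)).memLp volHalf 2).toLp ((hφ.slice_snd 0).memLp volume 2).toLp

theorem dirDeriv_add' {φ ψ : ℝ × ℝ → ℝ} (hφ : IsTest φ) (hψ : IsTest ψ) (e : ℝ × ℝ) :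
    dirDeriv e (fun x => φ x + ψ x) = dirDeriv e φ + dirDeriv e ψ := by
  ext x
  simp only [dirDeriv, Pi.add_apply]
  rw [fderiv_fun_add (hφ.differentiable x) (hψ.differentiable x)]
  rfl

theorem dirDeriv_const_mul' {φ : ℝ × ℝ → ℝ} (hφ : IsTest φ) (c : ℝ) (e : ℝ × ℝ) :
    dirDeriv e (fun x => c * φ x) = c • dirDeriv e φ := by
  ext x
  simp only [dirDeriv, Pi.smul_apply]
  rw [fderiv_const_mul (hφ.differentiable x)]
  rfl

/-- The jets of test functions. -/
noncomputable def testJets : Submodule ℝ JetSpace where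
  carrier := {e | ∃ φ, ∃ hφ : IsTest φ, e = testJet φ hφ}
  add_mem' := by
    rintro _ _ ⟨φ, hφ, rfl⟩ ⟨ψ, hψ, rfl⟩
    refine ⟨_, hφ.add hψ, ?_⟩
    simp only [testJet, mkJet, dirDeriv_add' hφ hψ]
    rfl
  zero_mem' := by
    have h0 : IsTest (fun _ : ℝ × ℝ => (0 : ℝ)) := ⟨contDiff_const, HasCompactSupport.zero⟩
    refine ⟨_, h0, ?_⟩
    have : ∀ e, dirDeriv e (fun _ : ℝ × ℝ => (0 : ℝ)) = 0 := by
      intro e; ext x; simp [dirDeriv]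
    simp only [testJet, mkJet, this]
    rfl
  smul_mem' := by
    rintro c _ ⟨φ, hφ, rfl⟩
    refine ⟨_, hφ.const_mul c, ?_⟩
    simp only [testJet, mkJet, dirDeriv_const_mul' hφ]
    rfl

/-- The energy space, a realization of `H¹(ℝ²₊)`. -/
noncomputable def energySpace : Submodule ℝ JetSpace := testJets.topologicalClosure

noncomputable instance : CompleteSpace energySpace :=
  inferInstanceAs (CompleteSpace testJets.topologicalClosure)

theorem testJet_mem {φ : ℝ × ℝ → ℝ} (hφ : IsTest φ) : testJet φ hφ ∈ energySpace :=
  testJets.le_topologicalClosure ⟨φ, hφ, rfl⟩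

theorem energySpace_induction {P : JetSpace → Prop} (hP : IsClosed {e | P e})
    (h : ∀ φ (hφ : IsTest φ), P (testJet φ hφ)) {e : JetSpace} (he : e ∈ energySpace) : P e := by
  have : closure (testJets : Set JetSpace) ⊆ {e | P e} := by
    refine hP.closure_subset_iff.2 ?_
    rintro _ ⟨φ, hφ, rfl⟩
    exact h φ hφ
  exact this he

theorem inner_toLp_right {X : Type*} [MeasurableSpace X] {ν : Measure X} (u : Lp ℝ 2 ν) {g : X → ℝ}
    (hg : MemLp g 2 ν) : inner ℝ u hg.toLp = ∫ x, u x * g x ∂ν := by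
  rw [← inner_toLp (Lp.memLp u) hg, Lp.toLp_coeFn]

theorem jetTrace_sq_le {e : JetSpace} (he : e ∈ energySpace) :
    ‖jetTrace e‖ ^ 2 ≤ ‖jetFun e‖ ^ 2 + ‖jetSnd e‖ ^ 2 := by
  refine energySpace_induction (P := fun e => ‖jetTrace e‖ ^ 2 ≤ ‖jetFun e‖ ^ 2 + ‖jetSnd e‖ ^ 2)
    (isClosed_le (by fun_prop) (by fun_prop)) (fun φ hφ => ?_) he
  simp only [testJet, jetTrace_mkJet, jetFun_mkJet, jetSnd_mkJet, Lp.norm_toLp]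
  have := eLpNorm_trace_le hφ
  nlinarith [sq_nonneg ((eLpNorm φ 2 volHalf).toReal - (eLpNorm (dirDeriv (0, 1) φ) 2 volHalf).toReal)]

theorem jetGreen {e : JetSpace} (he : e ∈ energySpace) :
    Green (jetFun e) (jetSnd e) (jetTrace e) := by
  intro ψ hψ
  have a := (hψ.dirDeriv (0, 1)).memLp volHalf 2
  have b := hψ.memLp volHalf 2
  have c := (hψ.slice_snd 0).memLp volume 2
  have := energySpace_induction (P := fun e => inner ℝ (jetFun e) a.toLp + inner ℝ (jetSnd e) b.toLp
      = -inner ℝ (jetTrace e) c.toLp)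
    (isClosed_eq (by fun_prop) (by fun_prop)) (fun φ hφ => by
      simp only [testJet, jetTrace_mkJet, jetFun_mkJet, jetSnd_mkJet, inner_toLp]
      exact integral_green hφ hψ) he
  simpa only [inner_toLp_right] using this

theorem jetWeak_fst {e : JetSpace} (he : e ∈ energySpace) :
    IsWeakPartial 1 0 (jetFun e) (jetFst e) := by
  refine ⟨MemLp.locallyIntegrableOn_halfPlane (Lp.memLp _),
    MemLp.locallyIntegrableOn_halfPlane (Lp.memLp _), fun ψ h1 h2 _ => ?_⟩
  have hψ : IsTest ψ := ⟨h1, h2⟩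
  have a := (hψ.dirDeriv (1, 0)).memLp volHalf 2
  have b := hψ.memLp volHalf 2
  have := energySpace_induction (P := fun e => inner ℝ (jetFun e) a.toLp = -inner ℝ (jetFst e) b.toLp)
    (isClosed_eq (by fun_prop) (by fun_prop)) (fun φ hφ => by
      simp only [testJet, jetFst_mkJet, jetFun_mkJet, inner_toLp]
      exact (weakDir_test hφ).2.2 ψ hψ) he
  rw [inner_toLp_right, inner_toLp_right] at this
  rw [partialDeriv_one_zero, this]
  ring

theorem jetWeak_snd {e : JetSpace} (he : e ∈ energySpace) :
    IsWeakPartial 0 1 (jetFun e) (jetSnd e) := by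
  refine ⟨MemLp.locallyIntegrableOn_halfPlane (Lp.memLp _),
    MemLp.locallyIntegrableOn_halfPlane (Lp.memLp _), fun ψ h1 h2 hs => ?_⟩
  have := jetGreen he ψ ⟨h1, h2⟩
  have z : ∀ r, ψ (r, 0) = 0 := fun r => by
    refine image_eq_zero_of_notMem_tsupport fun h => ?_
    have : (0 : ℝ) < 0 := hs h
    exact lt_irrefl _ this
  simp only [z, mul_zero, integral_zero, neg_zero] at this
  rw [partialDeriv_zero_one, zero_add, pow_one, neg_one_mul]
  linarith

theorem IsApprox.mem_energySpace {w wR wH : ℝ × ℝ → ℝ} {φ : ℕ → ℝ × ℝ → ℝ} (h : IsApprox w wR wH φ)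
    {t : ℝ → ℝ} (ht : MemLp t 2 volume)
    (hφt : Tendsto (fun n => eLpNorm (fun r => φ n (r, 0) - t r) 2 volume) atTop (𝓝 0)) :
    mkJet h.mem.toLp h.mem_fst.toLp h.mem_snd.toLp ht.toLp ∈ energySpace := by
  have l0 := tendsto_toLp (fun n => (h.test n).memLp volHalf 2) h.mem h.tendsto
  have l1 := tendsto_toLp (fun n => ((h.test n).dirDeriv (1, 0)).memLp volHalf 2) h.mem_fst
    h.tendsto_fst
  have l2 := tendsto_toLp (fun n => ((h.test n).dirDeriv (0, 1)).memLp volHalf 2) h.mem_snd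
    h.tendsto_snd
  have l3 := tendsto_toLp h.memLp_trace ht hφt
  have := (continuous_mkJet.tendsto _).comp
    (l0.prodMk_nhds (l1.prodMk_nhds (l2.prodMk_nhds l3)))
  exact mem_closure_of_tendsto this (Eventually.of_forall fun n => ⟨φ n, h.test n, rfl⟩)

/-- Functions with square integrable weak gradient lie in the energy space. -/
theorem exists_mem_energySpace {w wR wH : ℝ × ℝ → ℝ} (hR : IsWeakPartial 1 0 w wR)
    (hH : IsWeakPartial 0 1 w wH) (m0 : MemLp w 2 volHalf) (m1 : MemLp wR 2 volHalf)
    (m2 : MemLp wH 2 volHalf) : ∃ t, ∃ ht : MemLp t 2 volume,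
      mkJet m0.toLp m1.toLp m2.toLp ht.toLp ∈ energySpace := by
  obtain ⟨φ, h⟩ := exists_isApprox hR hH m0 m1 m2
  obtain ⟨t, ht, hφt⟩ := h.exists_trace
  exact ⟨t, ht, h.mem_energySpace ht hφt⟩

/-! ### Operators between `L²` spaces -/

section Op

variable {X Y : Type*} [MeasurableSpace X] [MeasurableSpace Y] {μ : Measure X} {ν : Measure Y}

/-- The operator induced by a map between functions. -/
noncomputable def opL2 (T : (X → ℝ) → Y → ℝ) (C : ℝ≥0) (hadd : ∀ u v, T (u + v) = T u + T v)
    (hsmul : ∀ (c : ℝ) u, T (c • u) = c • T u) (hcongr : ∀ u v, u =ᵐ[μ] v → T u =ᵐ[ν] T v)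
    (hT : ∀ u, MemLp u 2 μ → MemLp (T u) 2 ν) (hC : ∀ u, MemLp u 2 μ →
      eLpNorm (T u) 2 ν ≤ C * eLpNorm u 2 μ) : Lp ℝ 2 μ →L[ℝ] Lp ℝ 2 ν :=
  LinearMap.mkContinuous
    { toFun := fun u => (hT u (Lp.memLp u)).toLp
      map_add' := fun u v => by
        rw [← MemLp.toLp_add]
        refine MemLp.toLp_congr _ _ ?_
        rw [← hadd]
        exact hcongr _ _ (Lp.coeFn_add u v)
      map_smul' := fun c u => by
        rw [RingHom.id_apply, ← MemLp.toLp_const_smul]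
        refine MemLp.toLp_congr _ _ ?_
        rw [← hsmul]
        exact hcongr _ _ (Lp.coeFn_smul c u) } C fun u => by
      change ‖(hT u (Lp.memLp u)).toLp‖ ≤ C * ‖u‖
      rw [Lp.norm_toLp, Lp.norm_def]
      have := ENNReal.toReal_mono (ENNReal.mul_ne_top ENNReal.coe_ne_top (Lp.eLpNorm_ne_top u))
        (hC u (Lp.memLp u))
      simpa using this

variable {T : (X → ℝ) → Y → ℝ} {C : ℝ≥0} {hadd : ∀ u v, T (u + v) = T u + T v}
  {hsmul : ∀ (c : ℝ) u, T (c • u) = c • T u} {hcongr : ∀ u v, u =ᵐ[μ] v → T u =ᵐ[ν] T v}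
  {hT : ∀ u, MemLp u 2 μ → MemLp (T u) 2 ν} {hC : ∀ u, MemLp u 2 μ →
      eLpNorm (T u) 2 ν ≤ C * eLpNorm u 2 μ}

theorem opL2_coeFn (u : Lp ℝ 2 μ) : opL2 T C hadd hsmul hcongr hT hC u =ᵐ[ν] T u :=
  (hT u (Lp.memLp u)).coeFn_toLp

theorem norm_opL2_le : ‖opL2 T C hadd hsmul hcongr hT hC‖ ≤ C :=
  LinearMap.mkContinuous_norm_le _ C.2 _

end Op

/-- Multiplication with a bounded function of `R`. -/
noncomputable def mulOp (m : ℝ → ℝ) (C : ℝ≥0) (hm : Continuous m) (hC : ∀ R, |m R| ≤ C) :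
    L2Half →L[ℝ] L2Half :=
  opL2 (fun u x => m x.1 * u x) C (fun u v => by ext x; simp [mul_add])
    (fun c u => by ext x; simp; ring) (fun u v h => by filter_upwards [h] with x hx; rw [hx])
    (fun u hu => MemLp.of_le_mul (c := C) hu
      ((hm.comp continuous_fst).aestronglyMeasurable.mul hu.1) (Eventually.of_forall fun x => by
        rw [norm_mul]; gcongr; exact hC _))
    (fun u hu => by
      have := eLpNorm_le_mul_eLpNorm_of_ae_le_mul (f := fun x : ℝ × ℝ => m x.1 * u x) (g := u)
        (c := C) (μ := volHalf) (Eventually.of_forall fun x => by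
          rw [norm_mul]; gcongr; exact hC _) 2
      simpa using this)

/-- The operator `b ↦ χ(R) b(H)`. -/
noncomputable def tensorOp (χ : ℝ → ℝ) (hχ : MemLp χ 2 volume) :
    Lp ℝ 2 ((volume : Measure ℝ).restrict (Ioi 0)) →L[ℝ] L2Half :=
  opL2 (fun b x => χ x.1 * b x.2) (eLpNorm χ 2 volume).toNNReal
    (fun u v => by ext x; simp [mul_add]) (fun c u => by ext x; simp; ring)
    (fun u v h => by
      filter_upwards [ae_eq_comp_snd h] with x hx
      rw [hx])
    (fun b hb => memLp_tensor hχ hb) (fun b hb => by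
      rw [eLpNorm_tensor hχ hb, ENNReal.coe_toNNReal hχ.2.ne])

theorem mulOp_coeFn {m : ℝ → ℝ} {C : ℝ≥0} {hm : Continuous m} {hC : ∀ R, |m R| ≤ C} (u : L2Half) :
    mulOp m C hm hC u =ᵐ[volHalf] fun x => m x.1 * u x := opL2_coeFn u

theorem norm_mulOp_le {m : ℝ → ℝ} {C : ℝ≥0} {hm : Continuous m} {hC : ∀ R, |m R| ≤ C} :
    ‖mulOp m C hm hC‖ ≤ C := norm_opL2_le

theorem tensorOp_coeFn {χ : ℝ → ℝ} (hχ : MemLp χ 2 volume)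
    (b : Lp ℝ 2 ((volume : Measure ℝ).restrict (Ioi 0))) :
    tensorOp χ hχ b =ᵐ[volHalf] fun x => χ x.1 * b x.2 := opL2_coeFn b

theorem norm_tensorOp_le {χ : ℝ → ℝ} (hχ : MemLp χ 2 volume) :
    ‖tensorOp χ hχ‖ ≤ (eLpNorm χ 2 volume).toReal := norm_opL2_le

/-- The adjoint of `tensorOp`, the moments with respect to `χ`. -/
noncomputable def momentOp (χ : ℝ → ℝ) (hχ : MemLp χ 2 volume) :
    L2Half →L[ℝ] Lp ℝ 2 ((volume : Measure ℝ).restrict (Ioi 0)) :=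
  ContinuousLinearMap.adjoint (tensorOp χ hχ)

theorem norm_momentOp_le {χ : ℝ → ℝ} (hχ : MemLp χ 2 volume) :
    ‖momentOp χ hχ‖ ≤ (eLpNorm χ 2 volume).toReal := by
  rw [momentOp, LinearIsometryEquiv.norm_map]
  exact norm_tensorOp_le hχ

theorem inner_momentOp {χ : ℝ → ℝ} (hχ : MemLp χ 2 volume) (u : L2Half)
    (b : Lp ℝ 2 ((volume : Measure ℝ).restrict (Ioi 0))) :
    inner ℝ (momentOp χ hχ u) b = ∫ x in halfPlane, u x * (χ x.1 * b x.2) := by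
  rw [momentOp, ContinuousLinearMap.adjoint_inner_left, ← Lp.toLp_coeFn (tensorOp χ hχ b) (Lp.memLp _),
    inner_toLp_right]
  refine integral_congr_ae ?_
  filter_upwards [tensorOp_coeFn hχ b] with x hx
  rw [hx]

theorem momentOp_sub {χ χ' : ℝ → ℝ} (hχ : MemLp χ 2 volume) (hχ' : MemLp χ' 2 volume) (u : L2Half) :
    momentOp χ hχ u - momentOp χ' hχ' u = momentOp (χ - χ') (hχ.sub hχ') u := by
  refine ext_inner_right ℝ fun b => ?_
  rw [inner_sub_left, inner_momentOp, inner_momentOp, inner_momentOp]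
  have hb := Lp.memLp b
  have i1 := integrable_mul_of_memLp (Lp.memLp u) (memLp_tensor hχ hb)
  have i2 := integrable_mul_of_memLp (Lp.memLp u) (memLp_tensor hχ' hb)
  change (∫ x, _ ∂volHalf) - (∫ x, _ ∂volHalf) = _
  rw [← integral_sub i1 i2]
  congr 1; ext x
  simp only [Pi.sub_apply]
  ring

theorem integral_moment_sq_le {χ : ℝ → ℝ} (hχ : MemLp χ 2 volume) {φ : ℝ × ℝ → ℝ} (hφ : IsTest φ) :
    ∫ H in Ioi 0, moment χ φ H ^ 2 ≤ ‖momentOp χ hχ (hφ.memLp volHalf 2).toLp‖ ^ 2 := by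
  have hm := memLp_moment hχ hφ
  set b := hm.toLp with hb
  have h1 : inner ℝ (momentOp χ hχ (hφ.memLp volHalf 2).toLp) b = ‖b‖ ^ 2 := by
    rw [inner_momentOp, ← real_inner_self_eq_norm_sq, hb, inner_toLp]
    have := integral_moment_mul hχ hφ (Lp.memLp b)
    rw [← integral_congr_ae (μ := volHalf) (f := fun x => φ x * (χ x.1 * b x.2)), this]
    · refine integral_congr_ae ?_
      filter_upwards [hm.coeFn_toLp] with x hx
      rw [hb, hx]
    · filter_upwards [(hφ.memLp volHalf 2).coeFn_toLp] with x hx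
      rw [hx]
  have h2 : ‖b‖ ^ 2 = ∫ H in Ioi 0, moment χ φ H ^ 2 := by
    rw [← real_inner_self_eq_norm_sq, hb, inner_toLp]
    simp only [sq]
  rw [← h2]
  have h3 := real_inner_le_norm (momentOp χ hχ (hφ.memLp volHalf 2).toLp) b
  rw [h1, sq] at h3
  have : ‖b‖ ≤ ‖momentOp χ hχ (hφ.memLp volHalf 2).toLp‖ := by
    by_contra hc
    push Not at hc
    have := (norm_nonneg (momentOp χ hχ (hφ.memLp volHalf 2).toLp)).trans_lt hc
    nlinarith
  gcongr

end

section

/-! ### The weak formulation -/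

variable {f θ η : ℝ → ℝ}

/-- The weighted profile `e^{sη} θ'`. -/
noncomputable def weightedProfile (η θ : ℝ → ℝ) (s : ℝ) (R : ℝ) : ℝ :=
  Real.exp (s * η R) * deriv θ R

theorem exists_weightedProfile (hf : IsDoubleWell f) (hθ : IsOptimalProfile f θ)
    (hη : IsSmoothAbs η) : ∃ b > 0, ∃ K : ℝ, 0 ≤ K ∧ ∀ s, |s| ≤ b →
      ∃ _ : MemLp (weightedProfile η θ s) 2 volume,
        (eLpNorm (weightedProfile η θ s - weightedProfile η θ 0) 2 volume).toReal ≤ K * |s| := by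
  obtain ⟨a, ha, C, hC, hd⟩ := hθ.exists_decay hf
  obtain ⟨L, hL, hηL⟩ := hη.exists_abs_le
  have hE := memLp_exp_neg (show 0 < a / 4 by positivity)
  set K := C * Real.exp (a / 2 * L) * (4 / a + L) with hK
  have hK0 : 0 ≤ K := by positivity
  have hc : ∀ s, Continuous (weightedProfile η θ s) := fun s => by
    have := hη.1.continuous
    have := hθ.continuous_deriv
    unfold weightedProfile; fun_prop
  have key : ∀ s, |s| ≤ a / 2 → ∀ z, |weightedProfile η θ s z - weightedProfile η θ 0 z|
      ≤ K * |s| * Real.exp (-(a / 4 * |z|)) := by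
    intro s hs z
    have e1 : weightedProfile η θ s z - weightedProfile η θ 0 z
        = (Real.exp (s * η z) - 1) * deriv θ z := by
      simp [weightedProfile]; ring
    have e2 : |Real.exp (s * η z) - 1| ≤ |s * η z| * Real.exp |s * η z| := by
      have h1 := Real.add_one_le_exp (s * η z)
      have h2 := Real.add_one_le_exp (-(s * η z))
      have h3 : Real.exp (s * η z) * Real.exp (-(s * η z)) = 1 := by rw [← Real.exp_add]; simp
      have h4 : (1:ℝ) ≤ Real.exp |s * η z| := Real.one_le_exp (abs_nonneg _)
      have h5 := Real.exp_pos (s * η z)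
      rcases le_total 0 (s * η z) with h | h
      · rw [abs_of_nonneg h, abs_of_nonneg (by linarith)]
        nlinarith
      · rw [abs_of_nonpos h] at h4 ⊢
        rw [abs_of_nonpos (by linarith [Real.exp_le_one_iff.2 h])]
        nlinarith
    have e3 : |s * η z| ≤ |s| * (|z| + L) := by
      rw [abs_mul]; gcongr; exact hηL z
    have e4 : |s * η z| ≤ a / 2 * (|z| + L) := e3.trans (by gcongr)
    have e5 : |z| + L ≤ (4 / a + L) * Real.exp (a / 4 * |z|) := by
      have h1 := Real.add_one_le_exp (a / 4 * |z|)
      have h2 : |z| = 4 / a * (a / 4 * |z|) := by field_simp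
      have h3 : |z| ≤ 4 / a * Real.exp (a / 4 * |z|) := by
        calc |z| = 4 / a * (a / 4 * |z|) := h2
          _ ≤ _ := by gcongr; linarith
      have h4 : L ≤ L * Real.exp (a / 4 * |z|) :=
        le_mul_of_one_le_right hL (Real.one_le_exp (by positivity))
      linarith
    rw [e1, abs_mul, abs_of_pos (hθ.deriv_pos hf z)]
    calc |Real.exp (s * η z) - 1| * deriv θ z
        ≤ (|s| * ((4 / a + L) * Real.exp (a / 4 * |z|)) * Real.exp (a / 2 * (|z| + L)))
          * (C * Real.exp (-(a * |z|))) := by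
          gcongr
          · exact (hθ.deriv_pos hf z).le
          · refine e2.trans ?_
            gcongr
            exact e3.trans (by gcongr)
          · exact hd z
      _ = K * |s| * (Real.exp (a / 4 * |z|) * Real.exp (a / 2 * |z|) * Real.exp (-(a * |z|))) := by
          rw [hK, show a / 2 * (|z| + L) = a / 2 * |z| + a / 2 * L by ring, Real.exp_add]; ring
      _ = _ := by
          rw [← Real.exp_add, ← Real.exp_add]; congr 2; ring
  have hm0 : MemLp (weightedProfile η θ 0) 2 volume := by
    have : weightedProfile η θ 0 = deriv θ := by ext; simp [weightedProfile]
    rw [this]; exact hθ.memLp_deriv hf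
  refine ⟨a / 2, by positivity, K * (eLpNorm (fun z : ℝ => Real.exp (-(a / 4 * |z|))) 2 volume).toReal,
    by positivity, fun s hs => ?_⟩
  have hdm : MemLp (weightedProfile η θ s - weightedProfile η θ 0) 2 volume := by
    refine (hE.const_mul (K * |s|)).mono ((hc s).sub (hc 0)).aestronglyMeasurable
      (Eventually.of_forall fun z => (key s hs z).trans (le_abs_self _))
  refine ⟨by simpa using hdm.add hm0, ?_⟩
  have := eLpNorm_le_mul_eLpNorm_of_ae_le_mul (f := weightedProfile η θ s - weightedProfile η θ 0)
    (g := fun z : ℝ => Real.exp (-(a / 4 * |z|))) (c := K * |s|) (μ := volume)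
    (Eventually.of_forall fun z => (key s hs z).trans (by rw [Real.norm_eq_abs, Real.abs_exp])) 2
  have := ENNReal.toReal_mono (ENNReal.mul_ne_top ENNReal.ofReal_ne_top hE.2.ne) this
  rw [ENNReal.toReal_mul, ENNReal.toReal_ofReal (by positivity)] at this
  linarith

/-- The real inner product as a bilinear form. -/
noncomputable def innerForm (X : Type*) [NormedAddCommGroup X] [InnerProductSpace ℝ X] :
    X →L[ℝ] X →L[ℝ] ℝ := innerSL ℝ

/-- The form `⟨vR, φR⟩ + ⟨vH, φH⟩ + ⟨T v, φ⟩ - γ⟨v, φH⟩` on jets. -/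
noncomputable def energyForm (T : JetSpace →L[ℝ] L2Half) (γ : ℝ) : JetSpace →L[ℝ] JetSpace →L[ℝ] ℝ :=
  (innerForm L2Half).bilinearComp jetFst jetFst + (innerForm L2Half).bilinearComp jetSnd jetSnd
    + (innerForm L2Half).bilinearComp T jetFun - γ • (innerForm L2Half).bilinearComp jetFun jetSnd

theorem energyForm_apply (T : JetSpace →L[ℝ] L2Half) (γ : ℝ) (e e' : JetSpace) :
    energyForm T γ e e' = inner ℝ (jetFst e) (jetFst e') + inner ℝ (jetSnd e) (jetSnd e')
      + inner ℝ (T e) (jetFun e') - γ * inner ℝ (jetFun e) (jetSnd e') := rfl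

theorem norm_jet_le (e : JetSpace) :
    ‖jetFun e‖ ≤ ‖e‖ ∧ ‖jetFst e‖ ≤ ‖e‖ ∧ ‖jetSnd e‖ ≤ ‖e‖ ∧ ‖jetTrace e‖ ≤ ‖e‖ := by
  have h := jet_norm_sq e
  refine ⟨?_, ?_, ?_, ?_⟩ <;> refine (sq_le_sq₀ (norm_nonneg _) (norm_nonneg _)).1 ?_ <;>
    nlinarith [sq_nonneg (norm (jetFun e)), sq_nonneg (norm (jetFst e)), sq_nonneg (norm (jetSnd e)),
      sq_nonneg (norm (jetTrace e))]

theorem exists_eq_of_coercive {X : Type*} [NormedAddCommGroup X] [InnerProductSpace ℝ X]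
    (V : Submodule ℝ X) [CompleteSpace V] (B : X →L[ℝ] X →L[ℝ] ℝ) {κ : ℝ} (hκ : 0 < κ)
    (h : ∀ e ∈ V, κ * ‖e‖ ^ 2 ≤ B e e) (ℓ : X →L[ℝ] ℝ) : ∃ e ∈ V, ∀ e' ∈ V, B e e' = ℓ e' := by
  let A : V →L[ℝ] V →L[ℝ] ℝ := B.bilinearComp V.subtypeL V.subtypeL
  have hA : IsCoercive A := ⟨κ, hκ, fun e => by
    have := h e e.2
    rw [sq, ← mul_assoc] at this
    exact this⟩
  let y := (InnerProductSpace.toDual ℝ V).symm (ℓ.comp V.subtypeL)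
  let e := hA.continuousLinearEquivOfBilin.symm y
  refine ⟨e, e.2, fun e' he' => ?_⟩
  have h1 := hA.continuousLinearEquivOfBilin_apply e ⟨e', he'⟩
  rw [ContinuousLinearEquiv.apply_symm_apply, InnerProductSpace.toDual_symm_apply] at h1
  exact h1.symm

theorem exists_energyForm_eq {T : JetSpace →L[ℝ] L2Half} {γ κ : ℝ} (hκ : 0 < κ)
    (h : ∀ e ∈ energySpace, κ * ‖e‖ ^ 2 ≤ energyForm T γ e e) (G : L2Half) (g : L2Line) :
    ∃ e ∈ energySpace, κ * ‖e‖ ≤ ‖G‖ + ‖g‖ ∧ ∀ e' ∈ energySpace,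
      energyForm T γ e e' = inner ℝ G (jetFun e') + inner ℝ g (jetTrace e') := by
  obtain ⟨e, heV, he⟩ := exists_eq_of_coercive energySpace (energyForm T γ) hκ h
    ((innerForm L2Half G).comp jetFun + (innerForm L2Line g).comp jetTrace)
  have hℓ : ∀ e : JetSpace, ((innerForm L2Half G).comp jetFun + (innerForm L2Line g).comp jetTrace) e
    = inner ℝ G (jetFun e) + inner ℝ g (jetTrace e) := fun _ => rfl
  simp only [hℓ] at he
  refine ⟨e, heV, ?_, he⟩
  have h1 := he e heV
  have h2 := h e heV
  rw [h1] at h2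
  have h3 := real_inner_le_norm G (jetFun e)
  have h4 := real_inner_le_norm g (jetTrace e)
  have h5 := jet_norm_sq (e : JetSpace)
  have h6 := (norm_jet_le e).1
  have h7 := (norm_jet_le e).2.2.2
  have h8 : ‖G‖ * ‖jetFun e‖ ≤ ‖G‖ * ‖e‖ := by gcongr
  have h9 : ‖g‖ * ‖jetTrace e‖ ≤ ‖g‖ * ‖e‖ := by gcongr
  rcases (norm_nonneg e).eq_or_lt with h0 | h0
  · rw [← h0]; simp; positivity
  · refine le_of_mul_le_mul_right ?_ h0
    nlinarith

theorem gap_energySpace (hf : IsDoubleWell f) (hθ : IsOptimalProfile f θ) {C : ℝ≥0}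
    (hc : Continuous fun R => deriv (deriv f) (θ R)) (hC : ∀ R, |deriv (deriv f) (θ R)| ≤ C)
    (hχ : MemLp (deriv θ) 2 volume) : ∃ Λ > 0, ∀ e ∈ energySpace, ‖jetFun e‖ ^ 2
      ≤ Λ * (‖jetFst e‖ ^ 2 + inner ℝ (mulOp _ C hc hC (jetFun e)) (jetFun e)
        + ‖momentOp _ hχ (jetFun e)‖ ^ 2) := by
  obtain ⟨Λ, hΛ, h⟩ := exists_gap_halfPlane hf hθ
  refine ⟨Λ, hΛ, fun e he => ?_⟩
  refine energySpace_induction (P := fun e => ‖jetFun e‖ ^ 2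
      ≤ Λ * (‖jetFst e‖ ^ 2 + inner ℝ (mulOp _ C hc hC (jetFun e)) (jetFun e)
        + ‖momentOp _ hχ (jetFun e)‖ ^ 2))
    (isClosed_le (by fun_prop) (by fun_prop)) (fun φ hφ => ?_) he
  simp only [testJet, jetFun_mkJet, jetFst_mkJet]
  have h1 := h φ hφ
  have h2 := integral_moment_sq_le hχ hφ
  have hm := hφ.memLp volHalf 2
  have hm' := (hφ.dirDeriv (1, 0)).memLp volHalf 2
  have e1 : ‖hm.toLp‖ ^ 2 = ∫ x in halfPlane, φ x ^ 2 := by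
    rw [← real_inner_self_eq_norm_sq, inner_toLp]
    simp only [sq]
  have e2 : ‖hm'.toLp‖ ^ 2 = ∫ x in halfPlane, dirDeriv (1, 0) φ x ^ 2 := by
    rw [← real_inner_self_eq_norm_sq, inner_toLp]
    simp only [sq]
  have e3 : inner ℝ (mulOp _ C hc hC hm.toLp) hm.toLp
      = ∫ x in halfPlane, deriv (deriv f) (θ x.1) * φ x ^ 2 := by
    rw [inner_toLp_right]
    refine integral_congr_ae ?_
    filter_upwards [mulOp_coeFn (hm := hc) (hC := hC) hm.toLp, hm.coeFn_toLp] with x a b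
    rw [a, b]; ring
  have i1 : Integrable (fun x => dirDeriv (1, 0) φ x ^ 2) volHalf := by
    simpa only [sq] using integrable_mul_of_memLp hm' hm'
  have i2 : Integrable (fun x => deriv (deriv f) (θ x.1) * φ x ^ 2) volHalf := by
    have a := (mulOp _ C hc hC hm.toLp)
    refine (integrable_mul_of_memLp (Lp.memLp (mulOp _ C hc hC hm.toLp)) hm).congr ?_
    filter_upwards [mulOp_coeFn (hm := hc) (hC := hC) hm.toLp, hm.coeFn_toLp] with x a b
    rw [a, b]; ring
  rw [e1, e2, e3]
  have h3 := integral_add i1 i2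
  change ∫ x in halfPlane, _ = _ at h3
  rw [h3] at h1
  refine h1.trans ?_
  change Λ * ((∫ x in halfPlane, _) + (∫ x in halfPlane, _) + _) ≤ _
  gcongr

end

section

/-! ### Coercivity -/

variable {f θ η : ℝ → ℝ}

theorem inner_mulOp_le {m m' : ℝ → ℝ} {C C' : ℝ≥0} {hm : Continuous m} {hC : ∀ R, |m R| ≤ C}
    {hm' : Continuous m'} {hC' : ∀ R, |m' R| ≤ C'} {ρ : ℝ} (h : ∀ R, m R ≤ m' R + ρ) (u : L2Half) :
    inner ℝ (mulOp m C hm hC u) u ≤ inner ℝ (mulOp m' C' hm' hC' u) u + ρ * ‖u‖ ^ 2 := by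
  have hu := Lp.memLp u
  have e : ∀ v : L2Half, inner ℝ v u = ∫ x, v x * u x ∂volHalf := fun v => by
    conv_lhs => rw [← Lp.toLp_coeFn u hu]
    rw [inner_toLp_right]
  rw [← real_inner_self_eq_norm_sq, e, e, e, ← integral_const_mul, ← integral_add
    (integrable_mul_of_memLp (Lp.memLp _) hu) ((integrable_mul_of_memLp hu hu).const_mul ρ)]
  refine integral_mono_ae (integrable_mul_of_memLp (Lp.memLp _) hu)
    ((integrable_mul_of_memLp (Lp.memLp _) hu).add ((integrable_mul_of_memLp hu hu).const_mul ρ)) ?_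
  filter_upwards [mulOp_coeFn (hm := hm) (hC := hC) u, mulOp_coeFn (hm := hm') (hC := hC') u]
    with x a b
  simp only [a, b]
  nlinarith [h x.1, mul_self_nonneg (u x)]

theorem coercive_aux {P Q R Y Z S B Λ C δ ρ ε : ℝ} (hP : 0 ≤ P) (hQ : 0 ≤ Q) (hZ : 0 ≤ Z)
    (hΛ : 0 < Λ) (hC : 0 ≤ C) (hgap : Q ≤ Λ * (P + Y + Z)) (hY : -(C * Q) ≤ Y)
    (hε : ε = 1 / (2 * (1 + Λ * C))) (hδ : δ ≤ ε / 2) (hρ : δ + ρ ≤ 1 / (4 * Λ))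
    (hS : Z - ρ * Q ≤ S) (hB : P + R + Y - δ * (P + Q) + S ≤ B) :
    ε / 2 * P + 1 / (4 * Λ) * Q + R ≤ B := by
  have hΛC : 0 ≤ Λ * C := by positivity
  have hε0 : 0 < ε := by rw [hε]; positivity
  have hε1 : ε ≤ 1 := by rw [hε, div_le_one (by positivity)]; linarith
  have hεe : ε * (1 + Λ * C) = 1 / 2 := by rw [hε]; field_simp
  have hg : Q / Λ ≤ P + Y + Z := by rw [div_le_iff₀ hΛ]; linarith
  have h1 : (1 - ε) * (Q / Λ) ≤ (1 - ε) * (P + Y + Z) := by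
    apply mul_le_mul_of_nonneg_left hg; linarith
  have h2 : ε * (P - C * Q) ≤ ε * (P + Y + Z) := by gcongr; linarith
  have h3 : (1 - ε) * (Q / Λ) - ε * (C * Q) = 1 / (2 * Λ) * Q := by
    have : ε * (C * Q) = (1 / 2 - ε) * (Q / Λ) := by
      rw [← hεe]; field_simp; ring
    rw [this]; field_simp; ring
  have h4 : 1 / (2 * Λ) * Q = 2 * (1 / (4 * Λ) * Q) := by field_simp; ring
  have h5 : δ * P ≤ ε / 2 * P := by gcongr
  have h6 : (δ + ρ) * Q ≤ 1 / (4 * Λ) * Q := by gcongr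
  nlinarith

theorem inner_momentOp_ge {χ χ₁ χ₂ : ℝ → ℝ} (hχ : MemLp χ 2 volume) (h₁ : MemLp χ₁ 2 volume)
    (h₂ : MemLp χ₂ 2 volume) {d N : ℝ} (hN : (eLpNorm χ 2 volume).toReal ≤ N)
    (hd₁ : (eLpNorm (χ₁ - χ) 2 volume).toReal ≤ d) (hd₂ : (eLpNorm (χ₂ - χ) 2 volume).toReal ≤ d)
    (u : L2Half) : ‖momentOp χ hχ u‖ ^ 2 - (2 * N * d + d ^ 2) * ‖u‖ ^ 2
      ≤ inner ℝ (momentOp χ₁ h₁ u) (momentOp χ₂ h₂ u) := by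
  have n0 : ‖momentOp χ hχ u‖ ≤ N * ‖u‖ := ContinuousLinearMap.le_of_opNorm_le _
    ((norm_momentOp_le hχ).trans hN) u
  have n1 : ‖momentOp (χ₁ - χ) (h₁.sub hχ) u‖ ≤ d * ‖u‖ := ContinuousLinearMap.le_of_opNorm_le _
    ((norm_momentOp_le _).trans hd₁) u
  have n2 : ‖momentOp (χ₂ - χ) (h₂.sub hχ) u‖ ≤ d * ‖u‖ := ContinuousLinearMap.le_of_opNorm_le _
    ((norm_momentOp_le _).trans hd₂) u
  have e1 : momentOp χ₁ h₁ u = momentOp χ hχ u + momentOp (χ₁ - χ) (h₁.sub hχ) u := by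
    rw [← momentOp_sub h₁ hχ]; abel
  have e2 : momentOp χ₂ h₂ u = momentOp χ hχ u + momentOp (χ₂ - χ) (h₂.sub hχ) u := by
    rw [← momentOp_sub h₂ hχ]; abel
  rw [e1, e2]
  generalize momentOp χ hχ u = a at *
  generalize momentOp (χ₁ - χ) (h₁.sub hχ) u = a1 at *
  generalize momentOp (χ₂ - χ) (h₂.sub hχ) u = a2 at *
  rw [inner_add_left, inner_add_right, inner_add_right, real_inner_self_eq_norm_sq]
  have i1 := (abs_le.1 (abs_real_inner_le_norm a a2)).1
  have i2 := (abs_le.1 (abs_real_inner_le_norm a1 a)).1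
  have i3 := (abs_le.1 (abs_real_inner_le_norm a1 a2)).1
  have j1 : ‖a‖ * ‖a2‖ ≤ (N * ‖u‖) * (d * ‖u‖) := by gcongr; exact (norm_nonneg a).trans n0
  have j2 : ‖a1‖ * ‖a‖ ≤ (d * ‖u‖) * (N * ‖u‖) := by gcongr; exact (norm_nonneg a1).trans n1
  have j3 : ‖a1‖ * ‖a2‖ ≤ (d * ‖u‖) * (d * ‖u‖) := by gcongr; exact (norm_nonneg a1).trans n1
  nlinarith

theorem neg_le_inner_mulOp {m : ℝ → ℝ} {C : ℝ≥0} {hm : Continuous m} {hC : ∀ R, |m R| ≤ C}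
    (u v : L2Half) : -(C * ‖u‖ * ‖v‖) ≤ inner ℝ (mulOp m C hm hC u) v := by
  have a1 := (abs_le.1 (abs_real_inner_le_norm (mulOp m C hm hC u) v)).1
  have a2 := ContinuousLinearMap.le_of_opNorm_le _ (norm_mulOp_le (hm := hm) (hC := hC)) u
  have a3 : ‖mulOp m C hm hC u‖ * ‖v‖ ≤ C * ‖u‖ * ‖v‖ := by gcongr
  linarith

/-- The lower order terms of the modified weak form. -/
noncomputable def lowerOp {m₁ m₂ χ₁ χ₂ : ℝ → ℝ} {C₁ C₂ : ℝ≥0} (h₁ : Continuous m₁)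
    (k₁ : ∀ R, |m₁ R| ≤ C₁) (h₂ : Continuous m₂) (k₂ : ∀ R, |m₂ R| ≤ C₂) (γ : ℝ)
    (hχ₁ : MemLp χ₁ 2 volume) (hχ₂ : MemLp χ₂ 2 volume) : JetSpace →L[ℝ] L2Half :=
  (mulOp _ _ h₁ k₁).comp jetFst + γ • jetSnd
    + (mulOp _ _ h₂ k₂).comp jetFun + (tensorOp _ hχ₁).comp ((momentOp _ hχ₂).comp jetFun)

section LowerOp

variable {m₁ m₂ χ₁ χ₂ : ℝ → ℝ} {C₁ C₂ : ℝ≥0} {h₁ : Continuous m₁}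
    {k₁ : ∀ R, |m₁ R| ≤ C₁} {h₂ : Continuous m₂} {k₂ : ∀ R, |m₂ R| ≤ C₂} {γ : ℝ}
    {hχ₁ : MemLp χ₁ 2 volume} {hχ₂ : MemLp χ₂ 2 volume}

theorem lowerOp_apply (e : JetSpace) : lowerOp h₁ k₁ h₂ k₂ γ hχ₁ hχ₂ e
    = mulOp _ _ h₁ k₁ (jetFst e) + γ • jetSnd e + mulOp _ _ h₂ k₂ (jetFun e)
    + tensorOp _ hχ₁ (momentOp _ hχ₂ (jetFun e)) := rfl

theorem lowerOp_coeFn (e : JetSpace) : lowerOp h₁ k₁ h₂ k₂ γ hχ₁ hχ₂ e =ᵐ[volHalf]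
    fun x => (m₁ x.1 * jetFst e x + γ * jetSnd e x + m₂ x.1 * jetFun e x)
      + χ₁ x.1 * momentOp _ hχ₂ (jetFun e) x.2 := by
  rw [lowerOp_apply]
  filter_upwards [mulOp_coeFn (hm := h₁) (hC := k₁) (jetFst e),
    mulOp_coeFn (hm := h₂) (hC := k₂) (jetFun e), tensorOp_coeFn hχ₁ (momentOp _ hχ₂ (jetFun e)),
    Lp.coeFn_add (mulOp _ _ h₁ k₁ (jetFst e) + γ • jetSnd e + mulOp _ _ h₂ k₂ (jetFun e))
      (tensorOp _ hχ₁ (momentOp _ hχ₂ (jetFun e))),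
    Lp.coeFn_add (mulOp _ _ h₁ k₁ (jetFst e) + γ • jetSnd e) (mulOp _ _ h₂ k₂ (jetFun e)),
    Lp.coeFn_add (mulOp _ _ h₁ k₁ (jetFst e)) (γ • jetSnd e),
    Lp.coeFn_smul γ (jetSnd e)] with x a1 a2 a3 a4 a5 a6 a7
  rw [a4, Pi.add_apply, a5, Pi.add_apply, a6, Pi.add_apply, a7, a1, a2, a3]
  simp only [Pi.smul_apply, smul_eq_mul]

theorem energyForm_lowerOp (e : JetSpace) :
    energyForm (lowerOp h₁ k₁ h₂ k₂ γ hχ₁ hχ₂) γ e e = ‖jetFst e‖ ^ 2 + ‖jetSnd e‖ ^ 2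
      + inner ℝ (mulOp _ _ h₁ k₁ (jetFst e)) (jetFun e)
      + inner ℝ (mulOp _ _ h₂ k₂ (jetFun e)) (jetFun e)
      + inner ℝ (momentOp _ hχ₂ (jetFun e)) (momentOp _ hχ₁ (jetFun e)) := by
  have h3 : inner ℝ (tensorOp _ hχ₁ (momentOp _ hχ₂ (jetFun e))) (jetFun e)
      = inner ℝ (momentOp _ hχ₂ (jetFun e)) (momentOp _ hχ₁ (jetFun e)) := by
    rw [momentOp, momentOp, ContinuousLinearMap.adjoint_inner_right]
  rw [energyForm_apply, lowerOp_apply, inner_add_left, inner_add_left, inner_add_left, h3,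
    inner_smul_left, real_inner_self_eq_norm_sq, real_inner_self_eq_norm_sq,
    real_inner_comm (jetSnd e) (jetFun e), conj_trivial]
  ring

theorem coercive_lowerOp {c χ : ℝ → ℝ} {C : ℝ≥0} {cc : Continuous c} {hC : ∀ R, |c R| ≤ C}
    {hχ : MemLp χ 2 volume} {Λ ε δ ρ N d : ℝ} (hΛ : 0 < Λ) (e : JetSpace)
    (hgap : ‖jetFun e‖ ^ 2 ≤ Λ * (‖jetFst e‖ ^ 2 + inner ℝ (mulOp _ C cc hC (jetFun e)) (jetFun e)
        + ‖momentOp _ hχ (jetFun e)‖ ^ 2))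
    (hδ : C₁ = 2 * δ) (hρ : ∀ R, c R ≤ m₂ R + ρ) (hN : (eLpNorm χ 2 volume).toReal ≤ N)
    (hd₁ : (eLpNorm (χ₁ - χ) 2 volume).toReal ≤ d) (hd₂ : (eLpNorm (χ₂ - χ) 2 volume).toReal ≤ d)
    (hε : ε = 1 / (2 * (1 + Λ * C))) (hδε : δ ≤ ε / 2)
    (hs : δ + (ρ + (2 * N * d + d ^ 2)) ≤ 1 / (4 * Λ)) :
    ε / 2 * ‖jetFst e‖ ^ 2 + 1 / (4 * Λ) * ‖jetFun e‖ ^ 2 + ‖jetSnd e‖ ^ 2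
      ≤ energyForm (lowerOp h₁ k₁ h₂ k₂ γ hχ₁ hχ₂) γ e e := by
  have hY := neg_le_inner_mulOp (hm := cc) (hC := hC) (jetFun e) (jetFun e)
  have hq := inner_mulOp_le (hm := cc) (hC := hC) (hm' := h₂) (hC' := k₂) hρ (jetFun e)
  have h1 := neg_le_inner_mulOp (hm := h₁) (hC := k₁) (jetFst e) (jetFun e)
  have h2 := inner_momentOp_ge hχ hχ₂ hχ₁ hN hd₂ hd₁ (jetFun e)
  rw [energyForm_lowerOp]
  have hδ0 : 0 ≤ δ := by have := C₁.2; linarith [hδ ▸ C₁.coe_nonneg]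
  have hC0 := C.coe_nonneg
  rw [hδ] at h1
  generalize inner ℝ (mulOp _ C cc hC (jetFun e)) (jetFun e) = y at *
  generalize inner ℝ (mulOp _ _ h₁ k₁ (jetFst e)) (jetFun e) = y1 at *
  generalize inner ℝ (mulOp _ _ h₂ k₂ (jetFun e)) (jetFun e) = y2 at *
  generalize inner ℝ (momentOp _ hχ₂ (jetFun e)) (momentOp _ hχ₁ (jetFun e)) = y3 at *
  generalize ‖momentOp _ hχ (jetFun e)‖ = z at *
  generalize ‖jetFst e‖ = p1 at *
  generalize ‖jetFun e‖ = p0 at *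
  generalize ‖jetSnd e‖ = p2 at *
  refine coercive_aux (Y := y) (Z := z ^ 2) (S := y3 - ρ * p0 ^ 2)
    (sq_nonneg _) (sq_nonneg _) (sq_nonneg _) hΛ hC0 hgap (by linarith) hε hδε hs (by linarith) ?_
  nlinarith [mul_nonneg hδ0 (sq_nonneg (p1 - p0))]

end LowerOp

theorem small_parameters {β γ K1 K2 N K μ : ℝ} (hβ0 : 0 ≤ β) (hβ1 : β ≤ 1)
    (hK1 : 0 ≤ K1) (hK2 : 0 ≤ K2) (hN : 0 ≤ N) (hK : 0 ≤ K)
    (hβμ : β * (K1 + (K2 + K1 ^ 2 + 1) + (2 * N * K + K ^ 2) + 1) ≤ μ)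
    (hγμ : γ * (K1 + (K2 + K1 ^ 2 + 1) + (2 * N * K + K ^ 2) + 1) ≤ μ) :
    β * K1 + ((β * K2 + β * K1 ^ 2 + γ) + (2 * N * (K * β) + (K * β) ^ 2)) ≤ μ := by
  have h1 : (K * β) ^ 2 ≤ β * K ^ 2 := by
    have : β * (β * K ^ 2) ≤ 1 * (β * K ^ 2) := by gcongr
    linarith
  have hx : 0 ≤ 2 * N * K + K ^ 2 := by positivity
  rcases le_total β γ with h | h
  · have t1 : β * K1 ≤ γ * K1 := by gcongr
    have t2 : β * K2 ≤ γ * K2 := by gcongr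
    have t3 : β * K1 ^ 2 ≤ γ * K1 ^ 2 := by gcongr
    have t4 : β * (2 * N * K + K ^ 2) ≤ γ * (2 * N * K + K ^ 2) := by gcongr
    linarith
  · linarith

theorem energy_aux {q ε μ p0 p1 p2 p3 n : ℝ} (m0 : 0 ≤ q) (m1 : q ≤ ε) (m2 : q ≤ μ) (m3 : q ≤ 1)
    (hn : n = p0 ^ 2 + p1 ^ 2 + (p2 ^ 2 + p3 ^ 2)) (ht : p3 ^ 2 ≤ p0 ^ 2 + p2 ^ 2) :
    q / 2 * n ≤ ε * p1 ^ 2 + μ * p0 ^ 2 + p2 ^ 2 := by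
  have s1 : q * p1 ^ 2 ≤ ε * p1 ^ 2 := by gcongr
  have s2 : q * p0 ^ 2 ≤ μ * p0 ^ 2 := by gcongr
  have s3 : q * p2 ^ 2 ≤ 1 * p2 ^ 2 := by gcongr
  have s4 : q * p3 ^ 2 ≤ q * (p0 ^ 2 + p2 ^ 2) := by gcongr
  have s5 : 0 ≤ q * p1 ^ 2 := by positivity
  rw [hn]; linarith

theorem exists_coercive (hf : IsDoubleWell f) (hθ : IsOptimalProfile f θ) (hη : IsSmoothAbs η) :
    ∃ b > 0, b ≤ 1 ∧ ∃ κ > 0, ∃ K : ℝ, ∀ γ ∈ Ioc 0 b, ∀ β ∈ Icc 0 b,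
      ∃ (_ : MemLp (weightedProfile η θ β) 2 volume) (hm : MemLp (weightedProfile η θ (-β)) 2 volume),
        (eLpNorm (weightedProfile η θ β) 2 volume).toReal ≤ K ∧
        (eLpNorm (weightedProfile η θ (-β)) 2 volume).toReal ≤ K ∧ ∃ T : JetSpace →L[ℝ] L2Half,
        (∀ e, T e =ᵐ[volHalf] fun x => (2 * β * deriv η x.1 * jetFst e x + γ * jetSnd e x
          + potential η (fun R => deriv (deriv f) (θ R)) β γ x.1 * jetFun e x)
          + weightedProfile η θ β x.1 * momentOp _ hm (jetFun e) x.2) ∧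
        ∀ e ∈ energySpace, κ * ‖e‖ ^ 2 ≤ energyForm T γ e e := by
  set c : ℝ → ℝ := fun R => deriv (deriv f) (θ R) with hcdef
  have hcs : BddSmooth c := hθ.bddSmooth_comp hf hf.contDiff_deriv2
  have hη1 := hη.bddSmooth_deriv
  obtain ⟨C, hC⟩ := hcs.bound
  obtain ⟨K1, hK1⟩ := hη1.bound
  obtain ⟨K2, hK2⟩ := hη1.deriv.bound
  have cc := hcs.1.continuous
  have c1 := hη1.1.continuous
  have c2 := hη1.deriv.1.continuous
  have hw0 : weightedProfile η θ 0 = deriv θ := by ext; simp [weightedProfile]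
  have hθm := hθ.memLp_deriv hf
  obtain ⟨Λ, hΛ, hgap⟩ := gap_energySpace hf hθ cc hC hθm
  obtain ⟨b0, hb0, Kχ, hKχ, hχ⟩ := exists_weightedProfile hf hθ hη
  rw [hw0] at hχ
  set N := (eLpNorm (deriv θ) 2 volume).toReal with hN
  set ε := 1 / (2 * (1 + Λ * C)) with hε
  have hε0 : 0 < ε := by positivity
  set M := K1 + (K2 + K1 ^ 2 + 1) + (2 * N * Kχ + Kχ ^ 2) with hM
  have hM0 : 0 ≤ M := by positivity
  set μ := min (ε / 2) (1 / (4 * Λ)) with hμ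
  have hμ0 : 0 < μ := by positivity
  refine ⟨min (min b0 1) (μ / (M + 1)), by positivity,
    (min_le_left _ _).trans (min_le_right _ _), min μ 1 / 2, by positivity, N + Kχ, ?_⟩
  intro γ hγ β hβ
  have hβ0 := hβ.1
  have hγ0 := hγ.1
  have hβ1 : β ≤ 1 := hβ.2.trans ((min_le_left _ _).trans (min_le_right _ _))
  have hγ1 : γ ≤ 1 := hγ.2.trans ((min_le_left _ _).trans (min_le_right _ _))
  have hβb : β ≤ b0 := hβ.2.trans ((min_le_left _ _).trans (min_le_left _ _))
  have hβμ : β * (M + 1) ≤ μ := by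
    rw [← le_div_iff₀ (by positivity)]; exact hβ.2.trans (min_le_right _ _)
  have hγμ : γ * (M + 1) ≤ μ := by
    rw [← le_div_iff₀ (by positivity)]; exact hγ.2.trans (min_le_right _ _)
  obtain ⟨hp, hpd⟩ := hχ β (by rwa [abs_of_nonneg hβ0])
  obtain ⟨hm, hmd⟩ := hχ (-β) (by rwa [abs_neg, abs_of_nonneg hβ0])
  rw [abs_neg] at hmd
  rw [abs_of_nonneg hβ0] at hpd hmd
  have hKβ : Kχ * β ≤ Kχ := mul_le_of_le_one_right hKχ hβ1
  have hnorm : ∀ {χ : ℝ → ℝ}, MemLp χ 2 volume →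
      (eLpNorm (χ - deriv θ) 2 volume).toReal ≤ Kχ * β → (eLpNorm χ 2 volume).toReal ≤ N + Kχ := by
    intro χ hm hmd
    have e : χ = deriv θ + (χ - deriv θ) := by abel
    have h1 := eLpNorm_add_le hθm.1 (hm.sub hθm).1 one_le_two
    rw [← e] at h1
    have := ENNReal.toReal_mono (ENNReal.add_ne_top.2 ⟨hθm.2.ne, (hm.sub hθm).2.ne⟩) h1
    rw [ENNReal.toReal_add hθm.2.ne (hm.sub hθm).2.ne] at this
    linarith
  refine ⟨hp, hm, hnorm hp hpd, hnorm hm hmd, ?_⟩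
  have d1 : ∀ R, |2 * β * deriv η R| ≤ ((Real.toNNReal (2 * β) * K1 : ℝ≥0) : ℝ) := fun R => by
    rw [abs_mul, abs_of_nonneg (by positivity : 0 ≤ 2 * β)]
    rw [NNReal.coe_mul, Real.coe_toNNReal _ (by positivity)]
    exact mul_le_mul_of_nonneg_left (hK1 R) (by positivity)
  have hr : ∀ R, |β * deriv (deriv η) R - β ^ 2 * deriv η R ^ 2 - γ ^ 2|
      ≤ β * K2 + β * K1 ^ 2 + γ := fun R => by
    have a1 : |β * deriv (deriv η) R| ≤ β * K2 := by
      rw [abs_mul, abs_of_nonneg hβ0]; gcongr; exact hK2 R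
    have a2 : deriv η R ^ 2 ≤ (K1 : ℝ) ^ 2 := by
      rw [← sq_abs]; gcongr; exact hK1 R
    have a3 : β ^ 2 * deriv η R ^ 2 ≤ β * K1 ^ 2 := by
      gcongr
      nlinarith
    have a4 : γ ^ 2 ≤ γ := by nlinarith
    have a5 : 0 ≤ β ^ 2 * deriv η R ^ 2 := by positivity
    rw [abs_le] at a1 ⊢
    constructor <;> nlinarith [a1.1, a1.2, sq_nonneg γ]
  have d2 : ∀ R, |potential η c β γ R| ≤ ((K2 + K1 ^ 2 + 1 + C : ℝ≥0) : ℝ) := fun R => by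
    have a1 := hr R
    have a2 := hC R
    rw [potential]
    refine (abs_add_le _ _).trans ?_
    push_cast
    have : β * K2 ≤ K2 := mul_le_of_le_one_left K2.2 hβ1
    have : β * (K1 : ℝ) ^ 2 ≤ K1 ^ 2 := mul_le_of_le_one_left (by positivity) hβ1
    linarith
  have k1 : Continuous fun R => 2 * β * deriv η R := by fun_prop
  have k2 : Continuous (potential η c β γ) := by unfold potential; fun_prop
  refine ⟨lowerOp k1 d1 k2 d2 γ hp hm, lowerOp_coeFn, fun e he => ?_⟩
  · have hg := hgap e he
    have ht := jetTrace_sq_le he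
    have hn := jet_norm_sq e
    have hsum := small_parameters hβ0 hβ1 K1.coe_nonneg K2.coe_nonneg ENNReal.toReal_nonneg hKχ hβμ hγμ
    have hδ : β * K1 ≤ ε / 2 := by
      refine le_trans (le_add_of_nonneg_right ?_) (hsum.trans (min_le_left _ _))
      positivity
    have main := coercive_lowerOp (h₁ := k1) (k₁ := d1) (h₂ := k2) (k₂ := d2) (γ := γ) (hχ₁ := hp)
      (hχ₂ := hm) hΛ e hg (δ := β * K1) (by
        rw [NNReal.coe_mul, Real.coe_toNNReal _ (by positivity)]; ring) (ρ := β * K2 + β * K1 ^ 2 + γ) (fun R => by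
        have := (abs_le.1 (hr R)).1
        rw [potential]; linarith) (le_of_eq hN.symm) hpd hmd hε hδ (hsum.trans (min_le_right _ _))
    refine le_trans ?_ main
    exact energy_aux (by positivity) ((min_le_left _ _).trans (min_le_left _ _))
      ((min_le_left _ _).trans (min_le_right _ _)) (min_le_right _ _) hn ht

end

section

/-! ### Testing with products -/

variable {f θ η : ℝ → ℝ}

/-- Smooth functions of class `H¹`. -/
structure SmoothL2 (ν : Measure ℝ) (a : ℝ → ℝ) : Prop where
  smooth : ContDiff ℝ ∞ a
  mem : MemLp a 2 ν
  mem_deriv : MemLp (deriv a) 2 ν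

theorem SmoothL2.hasDerivAt {ν : Measure ℝ} {a : ℝ → ℝ} (h : SmoothL2 ν a) (r : ℝ) :
    HasDerivAt a (deriv a r) r := (h.smooth.differentiable (by simp) r).hasDerivAt

theorem dirDeriv_tensor {a b : ℝ → ℝ} (ha : Differentiable ℝ a) (hb : Differentiable ℝ b)
    (e : ℝ × ℝ) : dirDeriv e (fun x : ℝ × ℝ => a x.1 * b x.2)
      = fun x => e.1 * (deriv a x.1 * b x.2) + e.2 * (a x.1 * deriv b x.2) := by
  ext x
  have h1 := (ha x.1).hasDerivAt.comp_hasFDerivAt x (hasFDerivAt_fst (𝕜 := ℝ) (p := x))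
  have h2 := (hb x.2).hasDerivAt.comp_hasFDerivAt x (hasFDerivAt_snd (𝕜 := ℝ) (p := x))
  have h3 : HasFDerivAt (fun x : ℝ × ℝ => a x.1 * b x.2) _ x := h1.mul h2
  rw [dirDeriv, h3.fderiv]
  simp
  ring

theorem exists_test_seq_tensor {a b : ℝ → ℝ} (ha : SmoothL2 volume a)
    (hb : SmoothL2 (volume.restrict (Ioi 0)) b) : ∃ φ : ℕ → ℝ × ℝ → ℝ, (∀ n, IsTest (φ n)) ∧
      Tendsto (fun n => eLpNorm (fun x => φ n x - a x.1 * b x.2) 2 volHalf) atTop (𝓝 0) ∧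
      Tendsto (fun n => eLpNorm (fun x => dirDeriv (1, 0) (φ n) x - deriv a x.1 * b x.2) 2 volHalf)
        atTop (𝓝 0) ∧
      Tendsto (fun n => eLpNorm (fun x => dirDeriv (0, 1) (φ n) x - a x.1 * deriv b x.2) 2 volHalf)
        atTop (𝓝 0) ∧
      ∀ g, MemLp g 2 volume → Tendsto (fun n => ∫ r, g r * φ n (r, 0)) atTop
        (𝓝 (b 0 * ∫ r, g r * a r)) := by
  have d := dirDeriv_tensor (ha.smooth.differentiable (by simp)) (hb.smooth.differentiable (by simp))
  obtain ⟨φ, h0, h1, h2, h3, h4⟩ := exists_test_seq_smooth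
    (Φ := fun x : ℝ × ℝ => a x.1 * b x.2)
    ((ha.smooth.comp contDiff_fst).mul (hb.smooth.comp contDiff_snd)) (memLp_tensor ha.mem hb.mem)
    fun e => by
      rw [d]
      exact ((memLp_tensor ha.mem_deriv hb.mem).const_mul e.1).add
        ((memLp_tensor ha.mem hb.mem_deriv).const_mul e.2)
  refine ⟨φ, h0, h1, by simpa [d] using h2 (1, 0), by simpa [d] using h2 (0, 1), fun g hg => ?_⟩
  rw [← integral_const_mul]
  refine tendsto_integral_of_dominated_convergence (fun r => |b 0| * |g r * a r|) (fun n => ?_) ?_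
    (fun n => ?_) ?_
  · exact hg.1.mul ((h0 n).slice_snd 0).continuous.aestronglyMeasurable
  · exact (integrable_mul_of_memLp hg ha.mem).abs.const_mul _
  · refine Eventually.of_forall fun r => ?_
    rw [norm_mul, abs_mul]
    have := h3 n (r, 0)
    rw [abs_mul] at this
    calc ‖g r‖ * ‖φ n (r, 0)‖ ≤ |g r| * (|a r| * |b 0|) :=
          mul_le_mul_of_nonneg_left this (abs_nonneg _)
      _ = _ := by ring
  · refine Eventually.of_forall fun r => ?_
    have := (h4 (r, 0)).const_mul (g r)
    simpa [mul_comm, mul_left_comm, mul_assoc] using this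

/-- An equation in weak form, including the boundary condition. -/
def WeakEq (A B C : ℝ × ℝ → ℝ) (g : ℝ → ℝ) : Prop :=
  ∀ φ : ℝ × ℝ → ℝ, IsTest φ → (∫ x in halfPlane, A x * dirDeriv (1, 0) φ x)
    + (∫ x in halfPlane, B x * dirDeriv (0, 1) φ x) + (∫ x in halfPlane, C x * φ x)
    = ∫ r, g r * φ (r, 0)

theorem WeakEq.tensor {A B C : ℝ × ℝ → ℝ} {g : ℝ → ℝ} (h : WeakEq A B C g) (mA : MemLp A 2 volHalf)
    (mB : MemLp B 2 volHalf) (mC : MemLp C 2 volHalf) (mg : MemLp g 2 volume) {a b : ℝ → ℝ}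
    (ha : SmoothL2 volume a) (hb : SmoothL2 (volume.restrict (Ioi 0)) b) :
    (∫ x in halfPlane, A x * (deriv a x.1 * b x.2)) + (∫ x in halfPlane, B x * (a x.1 * deriv b x.2))
      + (∫ x in halfPlane, C x * (a x.1 * b x.2)) = b 0 * ∫ r, g r * a r := by
  obtain ⟨φ, h0, h1, h2, h3, h4⟩ := exists_test_seq_tensor ha hb
  have key : ∀ {D : ℝ × ℝ → ℝ} {F : ℕ → ℝ × ℝ → ℝ} {Φ : ℝ × ℝ → ℝ}, MemLp D 2 volHalf →
      (∀ n, MemLp (F n) 2 volHalf) → MemLp Φ 2 volHalf →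
      Tendsto (fun n => eLpNorm (fun x => F n x - Φ x) 2 volHalf) atTop (𝓝 0) →
      Tendsto (fun n => ∫ x in halfPlane, D x * F n x) atTop (𝓝 (∫ x in halfPlane, D x * Φ x)) := by
    intro D F Φ hD hF hΦ hl
    simpa only [mul_comm, volHalf] using tendsto_integral_mul hF hΦ hD hl
  have l := ((key mA (fun n => ((h0 n).dirDeriv (1, 0)).memLp volHalf 2)
    (memLp_tensor ha.mem_deriv hb.mem) h2).add (key mB (fun n => ((h0 n).dirDeriv (0, 1)).memLp volHalf 2)
    (memLp_tensor ha.mem hb.mem_deriv) h3)).add (key mC (fun n => (h0 n).memLp volHalf 2)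
    (memLp_tensor ha.mem hb.mem) h1)
  refine tendsto_nhds_unique l ((h4 g mg).congr fun n => ?_)
  exact (h _ (h0 n)).symm

theorem memLp_zero_half : MemLp (fun _ : ℝ × ℝ => (0 : ℝ)) 2 volHalf := MemLp.zero

theorem WeakDir.tensor {v vR : ℝ × ℝ → ℝ} (h : WeakDir volHalf (1, 0) v vR) {a b : ℝ → ℝ}
    (ha : SmoothL2 volume a) (hb : SmoothL2 (volume.restrict (Ioi 0)) b) :
    ∫ x in halfPlane, v x * (deriv a x.1 * b x.2) = -∫ x in halfPlane, vR x * (a x.1 * b x.2) := by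
  have h1 : WeakEq v (fun _ => 0) vR (fun _ => 0) := fun φ hφ => by
    have : ∫ x in halfPlane, v x * dirDeriv (1, 0) φ x = -∫ x in halfPlane, vR x * φ x := h.2.2 φ hφ
    rw [this]
    simp
  have := h1.tensor h.1 memLp_zero_half h.2.1 MemLp.zero ha hb
  simp only [zero_mul, integral_zero, mul_zero] at this
  linarith

theorem Green.tensor {w wH : ℝ × ℝ → ℝ} {t : ℝ → ℝ} (h : Green w wH t) (m : MemLp w 2 volHalf)
    (mH : MemLp wH 2 volHalf) (mt : MemLp t 2 volume) {a b : ℝ → ℝ}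
    (ha : SmoothL2 volume a) (hb : SmoothL2 (volume.restrict (Ioi 0)) b) :
    (∫ x in halfPlane, w x * (a x.1 * deriv b x.2)) + ∫ x in halfPlane, wH x * (a x.1 * b x.2)
      = -(b 0 * ∫ r, t r * a r) := by
  have h1 : WeakEq (fun _ => 0) w wH (fun r => -t r) := fun φ hφ => by
    have := h φ hφ
    simp only [zero_mul, integral_zero, zero_add, neg_mul, integral_neg]
    exact this
  have := h1.tensor memLp_zero_half m mH mt.neg ha hb
  simp only [zero_mul, integral_zero, zero_add, neg_mul, integral_neg] at this
  rw [this]; ring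

/-! ### The weighted profiles -/

section Profile

variable {s : ℝ}

theorem hasDerivAt_weightedProfile (hθ : IsOptimalProfile f θ)
    (hη : IsSmoothAbs η) (R : ℝ) : HasDerivAt (weightedProfile η θ s)
      (s * deriv η R * weightedProfile η θ s R + Real.exp (s * η R) * deriv f (θ R)) R := by
  have h1 := ((hη.1.differentiable (by simp) R).hasDerivAt.const_mul s).exp
  refine (h1.mul (hθ.hasDerivAt_deriv R)).congr_deriv ?_
  simp only [weightedProfile]; ring

theorem contDiff_weightedProfile (hf : IsDoubleWell f) (hθ : IsOptimalProfile f θ)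
    (hη : IsSmoothAbs η) : ContDiff ℝ ∞ (weightedProfile η θ s) :=
  (contDiff_const.mul hη.1).exp.mul (contDiff_infty_iff_deriv.1 (hθ.smooth hf)).2

theorem deriv_weightedProfile (hθ : IsOptimalProfile f θ) (hη : IsSmoothAbs η) :
    deriv (weightedProfile η θ s) = fun R => s * deriv η R * weightedProfile η θ s R
      + Real.exp (s * η R) * deriv f (θ R) := by
  ext R; exact (hasDerivAt_weightedProfile hθ hη R).deriv

theorem deriv_deriv_weightedProfile (hf : IsDoubleWell f) (hθ : IsOptimalProfile f θ)
    (hη : IsSmoothAbs η) (R : ℝ) : deriv (deriv (weightedProfile η θ s)) R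
      = 2 * s * deriv η R * deriv (weightedProfile η θ s) R
        + (s * deriv (deriv η) R - s ^ 2 * deriv η R ^ 2 + deriv (deriv f) (θ R))
          * weightedProfile η θ s R := by
  have hη' := (contDiff_infty_iff_deriv.1 hη.1).2
  have h0 := (hη.1.differentiable (by simp) R).hasDerivAt
  have h1 := (hη'.differentiable (by simp) R).hasDerivAt
  have h2 := (hf.hasDerivAt_deriv (θ R)).comp R (hθ.hasDerivAt R)
  have h3 := ((h1.const_mul s).mul (hasDerivAt_weightedProfile (s := s) hθ hη R)).add
    ((h0.const_mul s).exp.mul h2)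
  rw [deriv_weightedProfile hθ hη]
  refine (h3.deriv).trans ?_
  simp only [weightedProfile, Function.comp]
  ring

theorem exists_deriv_weightedProfile_le (hf : IsDoubleWell f) (hθ : IsOptimalProfile f θ)
    (hη : IsSmoothAbs η) : ∃ C : ℝ≥0, ∀ s R,
      ‖deriv (weightedProfile η θ s) R‖ ≤ C * (|s| + 1) * ‖weightedProfile η θ s R‖ := by
  obtain ⟨a, ha, K, hK, hb⟩ := hθ.exists_bounds hf
  obtain ⟨C, hC⟩ := hη.bddSmooth_deriv.bound
  refine ⟨C + (K / a).toNNReal, fun s R => ?_⟩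
  have hχ : 0 ≤ weightedProfile η θ s R :=
    mul_nonneg (Real.exp_pos _).le (hθ.deriv_pos hf R).le
  rw [deriv_weightedProfile hθ hη, Real.norm_eq_abs, Real.norm_of_nonneg hχ]
  have h1 : |deriv f (θ R)| ≤ K / a * deriv θ R := by
    obtain ⟨b1, b2, b3⟩ := hb R
    calc _ ≤ K / a * (a * (1 - θ R ^ 2)) := by
          refine b3.trans_eq ?_
          field_simp
      _ ≤ _ := by gcongr
  have h2 := Real.le_coe_toNNReal (K / a)
  have h3 : 0 ≤ (K / a).toNNReal * |s| * weightedProfile η θ s R := by positivity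
  have h4 : 0 ≤ C * weightedProfile η θ s R := by positivity
  calc _ ≤ |s * deriv η R * weightedProfile η θ s R| + |Real.exp (s * η R) * deriv f (θ R)| :=
        abs_add_le _ _
    _ ≤ |s| * C * weightedProfile η θ s R + Real.exp (s * η R) * (K / a * deriv θ R) := by
        rw [abs_mul, abs_mul, abs_mul, abs_of_nonneg hχ, Real.abs_exp]
        gcongr
        exact hC R
    _ = |s| * C * weightedProfile η θ s R + K / a * weightedProfile η θ s R := by
        rw [weightedProfile]; ring
    _ ≤ |s| * C * weightedProfile η θ s R + (K / a).toNNReal * weightedProfile η θ s R := by gcongr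
    _ ≤ _ := by push_cast; linarith

theorem memLp_deriv_weightedProfile (hf : IsDoubleWell f) (hθ : IsOptimalProfile f θ)
    (hη : IsSmoothAbs η) (h : MemLp (weightedProfile η θ s) 2 volume) :
    MemLp (deriv (weightedProfile η θ s)) 2 volume := by
  obtain ⟨C, hC⟩ := exists_deriv_weightedProfile_le hf hθ hη
  exact h.of_le_mul (contDiff_infty_iff_deriv.1
    (contDiff_weightedProfile hf hθ hη)).2.continuous.aestronglyMeasurable (Eventually.of_forall (hC s))

theorem smoothL2_weightedProfile (hf : IsDoubleWell f) (hθ : IsOptimalProfile f θ)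
    (hη : IsSmoothAbs η) (h : MemLp (weightedProfile η θ s) 2 volume) :
    SmoothL2 volume (weightedProfile η θ s) :=
  ⟨contDiff_weightedProfile hf hθ hη, h, memLp_deriv_weightedProfile hf hθ hη h⟩

theorem MemLp.bddSmooth_mul {m a : ℝ → ℝ} (hm : BddSmooth m) (ha : MemLp a 2 volume) :
    MemLp (fun r => m r * a r) 2 volume := by
  obtain ⟨C, hC⟩ := hm.bound
  refine MemLp.of_le_mul (c := C) ha (hm.1.continuous.aestronglyMeasurable.mul ha.1)
    (Eventually.of_forall fun r => ?_)
  rw [norm_mul]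
  gcongr
  exact hC r

theorem bddSmooth_potential (hf : IsDoubleWell f) (hθ : IsOptimalProfile f θ)
    (hη : IsSmoothAbs η) (β γ : ℝ) :
    BddSmooth (potential η (fun R => deriv (deriv f) (θ R)) β γ) := by
  have h1 := hη.bddSmooth_deriv
  have h2 := (((bddSmooth_const β).mul h1.deriv).add ((bddSmooth_const (-β ^ 2)).mul (h1.mul h1))).add
    ((bddSmooth_const (-γ ^ 2)).add (hθ.bddSmooth_comp hf hf.contDiff_deriv2))
  refine (congrArg BddSmooth ?_).mp h2
  ext R
  simp only [potential]
  ring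

end Profile

/-! ### The moments of a solution -/

/-- The moments of weak solutions with respect to `e^{-βη} θ'`. -/
theorem moment_identity (hf : IsDoubleWell f) (hθ : IsOptimalProfile f θ) (hη : IsSmoothAbs η)
    {β γ : ℝ} (hχ : MemLp (weightedProfile η θ (-β)) 2 volume) {v vR vH G : ℝ × ℝ → ℝ} {g : ℝ → ℝ}
    (hR : IsWeakPartial 1 0 v vR) (m0 : MemLp v 2 volHalf) (m1 : MemLp vR 2 volHalf)
    (m2 : MemLp vH 2 volHalf) (mG : MemLp G 2 volHalf) (mg : MemLp g 2 volume)
    (h : WeakEq vR (fun x => vH x - γ * v x) (fun x => 2 * β * deriv η x.1 * vR x + γ * vH x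
      + potential η (fun R => deriv (deriv f) (θ R)) β γ x.1 * v x - G x) g)
    {b : ℝ → ℝ} (hb : SmoothL2 (volume.restrict (Ioi 0)) b) :
    ∫ x in halfPlane, (vH x - γ * v x) * (weightedProfile η θ (-β) x.1 * (deriv b x.2 + γ * b x.2))
      = (∫ x in halfPlane, G x * (weightedProfile η θ (-β) x.1 * b x.2))
        + b 0 * ∫ r, g r * weightedProfile η θ (-β) r := by
  set χ := weightedProfile η θ (-β) with hχdef
  have hχs := smoothL2_weightedProfile hf hθ hη hχ
  have hη1 := hη.bddSmooth_deriv
  set q := potential η (fun R => deriv (deriv f) (θ R)) β γ with hq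
  have hqb : BddSmooth q := bddSmooth_potential hf hθ hη β γ
  have hη2 := (contDiff_infty_iff_deriv.1 hη1.1)
  have hχ2 := (contDiff_infty_iff_deriv.1 hχs.smooth).2
  set p : ℝ → ℝ := fun R => deriv χ R + 2 * β * deriv η R * χ R with hp
  have hps : ContDiff ℝ ∞ p := hχ2.add ((contDiff_const.mul hη1.1).mul hχs.smooth)
  have hpd : deriv p = fun R => (q R + γ ^ 2) * χ R := by
    ext R
    have e1 := (hχ2.differentiable (by simp) R).hasDerivAt
    have e2 := (hη2.1 R).hasDerivAt
    have e3 := e1.add ((e2.const_mul (2 * β)).mul (hχs.hasDerivAt R))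
    refine e3.deriv.trans ?_
    rw [hχdef, deriv_deriv_weightedProfile hf hθ hη, ← hχdef, hq]
    simp only [potential]
    ring
  have mp : MemLp p 2 volume := by
    have := (MemLp.bddSmooth_mul ((bddSmooth_const (2 * β)).mul hη1) hχ)
    exact hχs.mem_deriv.add this
  have mpd : MemLp (deriv p) 2 volume := by
    rw [hpd]
    exact MemLp.bddSmooth_mul (hqb.add (bddSmooth_const _)) hχ
  have t1 := (weakDir_of_isWeakPartial hR m0 m1).tensor ⟨hps, mp, mpd⟩ hb
  have mul : ∀ {m : ℝ → ℝ} {u : ℝ × ℝ → ℝ}, BddSmooth m → MemLp u 2 volHalf →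
      MemLp (fun x => m x.1 * u x) 2 volHalf := fun hm hu => by
    obtain ⟨C, hC⟩ := hm.bound
    exact (L2Bound.mul_fst ⟨hu, le_rfl⟩ hm.1.continuous.measurable hC).1
  have n1 := mul ((bddSmooth_const (2 * β)).mul hη1) m1
  have n2 := mul hqb m0
  have mB : MemLp (fun x => vH x - γ * v x) 2 volHalf := m2.sub (m0.const_mul γ)
  have mC : MemLp (fun x => 2 * β * deriv η x.1 * vR x + γ * vH x + q x.1 * v x - G x) 2 volHalf :=
    ((n1.add (m2.const_mul γ)).add n2).sub mG
  have t2 := h.tensor m1 mB mC mg hχs hb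
  have T0 := memLp_tensor hχ hb.mem
  have T1 := memLp_tensor hχs.mem_deriv hb.mem
  have T2 := memLp_tensor hχ hb.mem_deriv
  have T3 := memLp_tensor mp hb.mem
  have T4 := memLp_tensor mpd hb.mem
  have i1 := integrable_mul_of_memLp m1 T1
  have i2 := integrable_mul_of_memLp mB T2
  have i3 := integrable_mul_of_memLp mC T0
  have i4 := integrable_mul_of_memLp mG T0
  have i5 := integrable_mul_of_memLp m1 T3
  have i6 := integrable_mul_of_memLp m0 T4
  have e : ∫ x, (vR x * (deriv χ x.1 * b x.2) + (vH x - γ * v x) * (χ x.1 * deriv b x.2)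
      + (2 * β * deriv η x.1 * vR x + γ * vH x + q x.1 * v x - G x) * (χ x.1 * b x.2))
      + G x * (χ x.1 * b x.2) - vR x * (p x.1 * b x.2) - v x * (deriv p x.1 * b x.2) ∂volHalf
      = b 0 * (∫ r, g r * χ r) + (∫ x in halfPlane, G x * (χ x.1 * b x.2)) := by
    have j2 := i1.add i2
    have j3 := j2.add i3
    have j4 := j3.add i4
    have j5 := j4.sub i5
    have s6 := integral_sub j5 i6
    have s5 := integral_sub j4 i5
    have s4 := integral_add j3 i4
    have s3 := integral_add j2 i3
    have s2 := integral_add i1 i2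
    refine s6.trans ?_
    refine (congrArg (· - _) (s5.trans (congrArg (· - _) (s4.trans (congrArg (· + _)
      (s3.trans (congrArg (· + _) s2))))))).trans ?_
    rw [← t2]
    have : ∫ x, v x * (deriv p x.1 * b x.2) ∂volHalf = -∫ x, vR x * (p x.1 * b x.2) ∂volHalf := t1
    rw [this]
    simp only [volHalf]
    ring
  rw [add_comm, ← e]
  refine integral_congr_ae (Eventually.of_forall fun x => ?_)
  beta_reduce
  rw [congrFun hpd x.1]
  simp only [hp]
  ring

end

section

/-! ### Uniqueness and the compatibility condition -/

variable {f θ η : ℝ → ℝ}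

theorem memLp_exp_neg_Ioi {γ : ℝ} (hγ : 0 < γ) :
    MemLp (fun H : ℝ => Real.exp (-(γ * H))) 2 (volume.restrict (Ioi 0)) := by
  refine ((memLp_exp_neg hγ).restrict (Ioi 0)).ae_eq ?_
  filter_upwards [ae_restrict_mem measurableSet_Ioi] with H hH
  rw [abs_of_pos hH]

theorem smoothL2_exp_neg {γ : ℝ} (hγ : 0 < γ) :
    SmoothL2 (volume.restrict (Ioi 0)) fun H : ℝ => Real.exp (-(γ * H)) := by
  have hd : deriv (fun H : ℝ => Real.exp (-(γ * H))) = fun H => -γ * Real.exp (-(γ * H)) := by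
    ext H
    have := ((hasDerivAt_id H).const_mul γ).neg.exp
    refine this.deriv.trans ?_
    simp; ring
  refine ⟨by fun_prop, memLp_exp_neg_Ioi hγ, ?_⟩
  rw [hd]
  exact (memLp_exp_neg_Ioi hγ).const_mul _

theorem exists_smoothL2_ode {γ : ℝ} (hγ : 0 < γ) {ρ : ℝ → ℝ} (hρ : IsTest ρ) :
    ∃ b, SmoothL2 (volume.restrict (Ioi 0)) b ∧ b 0 = 0 ∧ ∀ H, deriv b H + γ * b H = ρ H := by
  set p : ℝ → ℝ := fun t => Real.exp (γ * t) * ρ t with hp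
  have hpt : IsTest p := hρ.mul_left (by fun_prop)
  have hP : ∀ H, HasDerivAt (fun H => ∫ t in (0:ℝ)..H, p t) (p H) H := fun H =>
    intervalIntegral.integral_hasDerivAt_right (hpt.continuous.intervalIntegrable _ _)
      hpt.continuous.stronglyMeasurable.stronglyMeasurableAtFilter hpt.continuous.continuousAt
  have hPs : ContDiff ℝ ∞ fun H => ∫ t in (0:ℝ)..H, p t := by
    rw [contDiff_infty_iff_deriv]
    refine ⟨fun H => (hP H).differentiableAt, ?_⟩
    rw [show (deriv fun H => ∫ t in (0:ℝ)..H, p t) = p from funext fun H => (hP H).deriv]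
    exact hpt.smooth
  have hE : ContDiff ℝ ∞ fun H : ℝ => Real.exp (-(γ * H)) := by fun_prop
  have hbs := hE.mul hPs
  set b : ℝ → ℝ := fun H => Real.exp (-(γ * H)) * ∫ t in (0:ℝ)..H, p t with hb
  have hd : ∀ H, deriv b H = ρ H - γ * b H := by
    intro H
    have h1 := (((hasDerivAt_id H).const_mul γ).neg.exp).mul (hP H)
    refine h1.deriv.trans ?_
    have h2 : Real.exp (-(γ * H)) * Real.exp (γ * H) = 1 := by rw [← Real.exp_add]; simp
    simp only [hb, hp, id, mul_one, Pi.neg_apply]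
    linear_combination ρ H * h2
  have hm : MemLp b 2 (volume.restrict (Ioi 0)) := by
    refine MemLp.of_le_mul (c := ∫ t, |p t|) (memLp_exp_neg_Ioi hγ)
      hbs.continuous.aestronglyMeasurable (Eventually.of_forall fun H => ?_)
    rw [hb, norm_mul, mul_comm]
    gcongr
    refine (intervalIntegral.norm_integral_le_integral_norm_uIoc).trans ?_
    exact setIntegral_le_integral (hpt.integrable volume).norm (Eventually.of_forall fun _ => norm_nonneg _)
  refine ⟨b, ⟨hbs, hm, ?_⟩, by simp [hb], fun H => by rw [hd]; ring⟩
  rw [funext hd]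
  exact (hρ.memLp _ 2).sub (hm.const_mul γ)

theorem momentOp_eq_zero {χ : ℝ → ℝ} (hχ : MemLp χ 2 volume) {u : ℝ × ℝ → ℝ} (hu : MemLp u 2 volHalf)
    (h : ∀ ρ : ℝ → ℝ, IsTest ρ → ∫ x in halfPlane, u x * (χ x.1 * ρ x.2) = 0) :
    momentOp χ hχ hu.toLp = 0 := by
  set m := momentOp χ hχ hu.toLp with hm
  have hm2 := Lp.memLp m
  have key : ∀ b (hb : MemLp b 2 (volume.restrict (Ioi 0))), ∫ H in Ioi 0, m H * b H
      = ∫ x in halfPlane, u x * (χ x.1 * b x.2) := by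
    intro b hb
    rw [← inner_toLp_right m hb, hm, inner_momentOp]
    refine integral_congr_ae ?_
    filter_upwards [hu.coeFn_toLp, ae_eq_comp_snd hb.coeFn_toLp] with x a b
    rw [a, b]
  have h1 : (Ioi (0:ℝ)).indicator m =ᵐ[volume] fun _ => (0:ℝ) := by
    have hmi : MemLp ((Ioi (0:ℝ)).indicator m) 2 volume :=
      (memLp_indicator_iff_restrict measurableSet_Ioi).2 hm2
    refine ae_eq_of_forall_isTest (hmi.locallyIntegrable (by norm_num))
      (locallyIntegrable_const 0) fun ρ hρ => ?_
    have h2 := key ρ (hρ.memLp _ 2)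
    rw [h ρ hρ, ← integral_indicator measurableSet_Ioi] at h2
    simp only [zero_mul, integral_zero]
    refine Eq.trans (congrArg (integral volume) (funext fun H => ?_)) h2
    simp only [indicator]
    split_ifs <;> simp
  refine (Lp.eq_zero_iff_ae_eq_zero).2 ?_
  have h2 := ae_restrict_of_ae (s := Ioi (0:ℝ)) h1
  filter_upwards [h2, ae_restrict_mem measurableSet_Ioi] with H a b
  rw [indicator_of_mem b] at a
  exact a

theorem integral_mul_tensor_eq_zero {χ : ℝ → ℝ} (hχ : MemLp χ 2 volume) {u : ℝ × ℝ → ℝ}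
    (hu : MemLp u 2 volHalf) (h : momentOp χ hχ hu.toLp = 0) {b : ℝ → ℝ}
    (hb : MemLp b 2 (volume.restrict (Ioi 0))) : ∫ x in halfPlane, u x * (χ x.1 * b x.2) = 0 := by
  have h1 := inner_momentOp hχ hu.toLp hb.toLp
  rw [h, inner_zero_left] at h1
  rw [h1]
  refine integral_congr_ae ?_
  filter_upwards [hu.coeFn_toLp, ae_eq_comp_snd hb.coeFn_toLp] with x a b
  rw [a, b]

section

variable {β γ : ℝ} {v vR vH G : ℝ × ℝ → ℝ} {g : ℝ → ℝ}

/-- The equation of `IsSol` in weak form. -/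
def WeakSol (η c : ℝ → ℝ) (β γ : ℝ) (v vR vH G : ℝ × ℝ → ℝ) (g : ℝ → ℝ) : Prop :=
  WeakEq vR (fun x => vH x - γ * v x) (fun x => 2 * β * deriv η x.1 * vR x + γ * vH x
    + potential η c β γ x.1 * v x - G x) g

theorem WeakSol.momentOp_eq_zero (hf : IsDoubleWell f) (hθ : IsOptimalProfile f θ)
    (hη : IsSmoothAbs η) (hγ : 0 < γ) (hχ : MemLp (weightedProfile η θ (-β)) 2 volume)
    (hR : IsWeakPartial 1 0 v vR) (m0 : MemLp v 2 volHalf) (m1 : MemLp vR 2 volHalf)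
    (m2 : MemLp vH 2 volHalf) {t : ℝ → ℝ} (ht : Green v vH t) (mt : MemLp t 2 volume)
    (h : WeakSol η (fun R => deriv (deriv f) (θ R)) β γ v vR vH (fun _ => 0) (fun _ => 0)) :
    momentOp _ hχ m0.toLp = 0 := by
  have mB : MemLp (fun x => vH x - γ * v x) 2 volHalf := m2.sub (m0.const_mul γ)
  have hu : momentOp _ hχ mB.toLp = 0 := by
    refine ContactModel.momentOp_eq_zero hχ mB fun ρ hρ => ?_
    obtain ⟨b, hb, hb0, hbρ⟩ := exists_smoothL2_ode hγ hρ
    have := moment_identity hf hθ hη hχ hR m0 m1 m2 memLp_zero_half MemLp.zero h hb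
    simpa [hb0, hbρ] using this
  refine ContactModel.momentOp_eq_zero hχ m0 fun ρ hρ => ?_
  obtain ⟨b, hb, hb0, hbρ⟩ := exists_smoothL2_ode hγ hρ
  have h1 := integral_mul_tensor_eq_zero hχ mB hu hb.mem
  have h2 := ht.tensor m0 m2 mt (smoothL2_weightedProfile hf hθ hη hχ) hb
  have i1 := integrable_mul_of_memLp m0 (memLp_tensor hχ hb.mem)
  have i3 := integrable_mul_of_memLp m0 (memLp_tensor hχ hb.mem_deriv)
  rw [hb0, zero_mul, neg_zero] at h2
  have e1 : ∫ x in halfPlane, (vH x - γ * v x) * (weightedProfile η θ (-β) x.1 * b x.2)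
      = (∫ x in halfPlane, vH x * (weightedProfile η θ (-β) x.1 * b x.2))
        - γ * ∫ x in halfPlane, v x * (weightedProfile η θ (-β) x.1 * b x.2) :=
    integral_sub_const_mul_mul m2 m0 (memLp_tensor hχ hb.mem) γ
  have e2 : ∫ x in halfPlane, v x * (weightedProfile η θ (-β) x.1 * ρ x.2)
      = (∫ x in halfPlane, v x * (weightedProfile η θ (-β) x.1 * deriv b x.2))
        + γ * ∫ x in halfPlane, v x * (weightedProfile η θ (-β) x.1 * b x.2) := by
    rw [← integral_const_mul]
    refine Eq.trans ?_ (integral_add i3 (i1.const_mul γ))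
    refine integral_congr_ae (Eventually.of_forall fun x => ?_)
    simp only [← hbρ]; ring
  rw [e2]
  linarith

theorem WeakSol.compat (hf : IsDoubleWell f) (hθ : IsOptimalProfile f θ)
    (hη : IsSmoothAbs η) (hγ : 0 < γ) (hχ : MemLp (weightedProfile η θ (-β)) 2 volume)
    (hR : IsWeakPartial 1 0 v vR) (m0 : MemLp v 2 volHalf) (m1 : MemLp vR 2 volHalf)
    (m2 : MemLp vH 2 volHalf) (mG : MemLp G 2 volHalf) (mg : MemLp g 2 volume)
    (h : WeakSol η (fun R => deriv (deriv f) (θ R)) β γ v vR vH G g) :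
    (∫ x in halfPlane, G x * (weightedProfile η θ (-β) x.1 * Real.exp (-(γ * x.2))))
      + ∫ r, g r * weightedProfile η θ (-β) r = 0 := by
  have hb := smoothL2_exp_neg hγ
  have := moment_identity hf hθ hη hχ hR m0 m1 m2 mG mg h hb
  have hd : ∀ H, deriv (fun H : ℝ => Real.exp (-(γ * H))) H + γ * Real.exp (-(γ * H)) = 0 := by
    intro H
    have := ((hasDerivAt_id H).const_mul γ).neg.exp
    rw [show deriv (fun H : ℝ => Real.exp (-(γ * H))) H = _ from this.deriv]
    simp; ring
  simp only [hd, mul_zero, integral_zero, neg_zero, Real.exp_zero, one_mul] at this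
  linarith

end

theorem IsSol.weakSol {η c : ℝ → ℝ} {β γ : ℝ} {v vR vH vRR vRH vHH G : ℝ × ℝ → ℝ} {g : ℝ → ℝ}
    (h : H2Jet v vR vH vRR vRH vHH)
    (hG : ∀ᵐ x ∂volHalf, G x = -(vRR x + vHH x) + 2 * β * deriv η x.1 * vR x + 2 * γ * vH x
      + potential η c β γ x.1 * v x)
    (hg : Green (fun x => vH x - γ * v x) (fun x => vHH x - γ * vH x) fun r => -g r) :
    WeakSol η c β γ v vR vH G g := by
  intro φ hφ
  have h1 := hg φ hφ
  have h2 : ∫ x in halfPlane, vR x * dirDeriv (1, 0) φ x = -∫ x in halfPlane, vRR x * φ x :=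
    (weakDir_of_isWeakPartial h.fst_fst h.mem_fst h.mem_fst_fst).2.2 φ hφ
  simp only [neg_mul, integral_neg, neg_neg] at h1
  rw [← h1, h2]
  have m := hφ.memLp volHalf 2
  have i1 := integrable_mul_of_memLp h.mem_fst_fst m
  have i2 := integrable_mul_of_memLp (h.mem_snd_snd.sub (h.mem_snd.const_mul γ)) m
  have e : ∫ x in halfPlane, (2 * β * deriv η x.1 * vR x + γ * vH x
      + potential η c β γ x.1 * v x - G x) * φ x = (∫ x in halfPlane, vRR x * φ x)
        + ∫ x in halfPlane, (vHH x - γ * vH x) * φ x := by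
    refine Eq.trans ?_ (integral_add i1 i2)
    refine integral_congr_ae ?_
    filter_upwards [hG] with x hx
    rw [hx]
    ring
  rw [e]; ring

end

section

/-! ### Arithmetic of `H^{1/2}` bounds -/

theorem aestronglyMeasurable_slobKernel {g : ℝ → ℝ} (hg : AEStronglyMeasurable g volume) :
    AEStronglyMeasurable (fun p : ℝ × ℝ => |p.1 - p.2|⁻¹ * (g p.1 - g p.2))
      ((volume : Measure ℝ).prod volume) := by
  have : Measurable fun p : ℝ × ℝ => |p.1 - p.2|⁻¹ :=
    (measurable_norm.comp (measurable_fst.sub measurable_snd)).inv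
  exact this.aestronglyMeasurable.mul (hg.comp_fst.sub hg.comp_snd)

theorem slobSemi_eq_eLpNorm {g : ℝ → ℝ} (hg : AEStronglyMeasurable g volume) :
    slobSemi g = eLpNorm (fun p : ℝ × ℝ => |p.1 - p.2|⁻¹ * (g p.1 - g p.2)) 2
      ((volume : Measure ℝ).prod volume) ^ 2 := by
  rw [eLpNorm_two_sq, lintegral_prod _ ((aestronglyMeasurable_slobKernel hg).enorm.pow_const 2)]
  refine lintegral_congr fun x => lintegral_congr fun y => ?_
  rw [Real.enorm_eq_ofReal_abs, ← ENNReal.ofReal_pow (abs_nonneg _), sq_abs (_ * _), mul_pow, inv_pow,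
    div_eq_inv_mul]

theorem HalfBound.add {g h : ℝ → ℝ} {A B : ℝ≥0∞} (hg : HalfBound g A) (hh : HalfBound h B) :
    HalfBound (fun r => g r + h r) (A + B) := by
  refine ⟨hg.1.add hh.1, (eLpNorm_add_le hg.1.1 hh.1.1 one_le_two).trans (add_le_add hg.2.1 hh.2.1), ?_⟩
  have a := hg.2.2
  have b := hh.2.2
  rw [slobSemi_eq_eLpNorm hg.1.1, ENNReal.pow_le_pow_left_iff two_ne_zero] at a
  rw [slobSemi_eq_eLpNorm hh.1.1, ENNReal.pow_le_pow_left_iff two_ne_zero] at b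
  have e := slobSemi_eq_eLpNorm (hg.1.1.add hh.1.1)
  refine e.trans_le ?_
  gcongr
  refine le_trans (le_of_eq ?_) ((eLpNorm_add_le (aestronglyMeasurable_slobKernel hg.1.1)
    (aestronglyMeasurable_slobKernel hh.1.1) one_le_two).trans (add_le_add a b))
  congr 1; ext p
  simp only [Pi.add_apply]
  ring

theorem HalfBound.const_mul {g : ℝ → ℝ} {A : ℝ≥0∞} (hg : HalfBound g A) (c : ℝ) :
    HalfBound (fun r => c * g r) (‖c‖ₑ * A) := by
  have e : ∀ {X : Type} [MeasurableSpace X] {ν : Measure X} {F : X → ℝ},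
      eLpNorm (fun x => c * F x) 2 ν = ‖c‖ₑ * eLpNorm F 2 ν := fun {X} _ {ν F} =>
    eLpNorm_const_smul c F 2 ν
  refine ⟨hg.1.const_mul c, ?_, ?_⟩
  · rw [e]; gcongr; exact hg.2.1
  · have a := hg.2.2
    rw [slobSemi_eq_eLpNorm hg.1.1, ENNReal.pow_le_pow_left_iff two_ne_zero] at a
    refine (slobSemi_eq_eLpNorm (hg.1.1.const_mul c)).trans_le ?_
    gcongr
    refine le_trans (le_of_eq ?_) (mul_le_mul_right a ‖c‖ₑ)
    rw [← e]
    congr 1; ext p; ring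

theorem HalfBound.neg {g : ℝ → ℝ} {A : ℝ≥0∞} (hg : HalfBound g A) :
    HalfBound (fun r => -g r) A := by
  simpa using hg.const_mul (-1)

theorem HalfBound.sub {g h : ℝ → ℝ} {A B : ℝ≥0∞} (hg : HalfBound g A) (hh : HalfBound h B) :
    HalfBound (fun r => g r - h r) (A + B) := by
  simpa [sub_eq_add_neg] using hg.add hh.neg

theorem L2Bound.sub {u v : ℝ × ℝ → ℝ} {A B : ℝ≥0∞} (h : L2Bound u A) (h' : L2Bound v B) :
    L2Bound (fun x => u x - v x) (A + B) := SobBound.sub (k := 0) h h'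

theorem Green.add {w wH w' wH' : ℝ × ℝ → ℝ} {t t' : ℝ → ℝ} (h : Green w wH t) (h' : Green w' wH' t')
    (m : MemLp w 2 volHalf) (mH : MemLp wH 2 volHalf) (m' : MemLp w' 2 volHalf)
    (mH' : MemLp wH' 2 volHalf) (ht : LocallyIntegrable t) (ht' : LocallyIntegrable t') :
    Green (fun x => w x + w' x) (fun x => wH x + wH' x) (fun r => t r + t' r) := by
  intro φ hφ
  have n := hφ.memLp volHalf 2
  have n' := (hφ.dirDeriv (0, 1)).memLp volHalf 2
  have hs := hφ.slice_snd 0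
  have it : ∀ {t : ℝ → ℝ}, LocallyIntegrable t → Integrable fun r => t r * φ (r, 0) := fun ht => by
    simpa only [smul_eq_mul, mul_comm] using
      ht.integrable_smul_left_of_hasCompactSupport hs.continuous hs.compact
  have e1 : ∫ x in halfPlane, (w x + w' x) * dirDeriv (0, 1) φ x
      = (∫ x in halfPlane, w x * dirDeriv (0, 1) φ x) + ∫ x in halfPlane, w' x * dirDeriv (0, 1) φ x := by
    refine Eq.trans ?_ (integral_add (integrable_mul_of_memLp m n') (integrable_mul_of_memLp m' n'))
    simp only [add_mul]
  have e2 : ∫ x in halfPlane, (wH x + wH' x) * φ x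
      = (∫ x in halfPlane, wH x * φ x) + ∫ x in halfPlane, wH' x * φ x := by
    refine Eq.trans ?_ (integral_add (integrable_mul_of_memLp mH n) (integrable_mul_of_memLp mH' n))
    simp only [add_mul]
  have e3 : ∫ r, (t r + t' r) * φ (r, 0) = (∫ r, t r * φ (r, 0)) + ∫ r, t' r * φ (r, 0) := by
    rw [← integral_add (it ht) (it ht')]
    simp only [add_mul]
  rw [e1, e2, e3]
  linarith [h φ hφ, h' φ hφ]

theorem Green.const_mul {w wH : ℝ × ℝ → ℝ} {t : ℝ → ℝ} (h : Green w wH t) (c : ℝ) :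
    Green (fun x => c * w x) (fun x => c * wH x) (fun r => c * t r) := by
  intro φ hφ
  simp only [mul_assoc, integral_const_mul]
  linear_combination c * h φ hφ

theorem Green.congr {w wH w' wH' : ℝ × ℝ → ℝ} {t t' : ℝ → ℝ} (h : Green w wH t)
    (hw : w =ᵐ[volHalf] w') (hwH : wH =ᵐ[volHalf] wH') (ht : t =ᵐ[volume] t') : Green w' wH' t' := by
  intro φ hφ
  have := h φ hφ
  rwa [integral_mul_congr_ae hw, integral_mul_congr_ae hwH,
    integral_mul_congr_ae (ψ := fun r => φ (r, 0)) ht] at this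

theorem WeakEq.congr {A B C A' B' C' : ℝ × ℝ → ℝ} {g g' : ℝ → ℝ} (h : WeakEq A B C g)
    (hA : A =ᵐ[volHalf] A') (hB : B =ᵐ[volHalf] B') (hC : C =ᵐ[volHalf] C')
    (hg : g =ᵐ[volume] g') : WeakEq A' B' C' g' := by
  intro φ hφ
  have := h φ hφ
  rwa [integral_mul_congr_ae hA, integral_mul_congr_ae hB, integral_mul_congr_ae hC,
    integral_mul_congr_ae (ψ := fun r => φ (r, 0)) hg] at this

/-! ### Weak solutions of the coercive problem -/

theorem energyForm_testJet {T : JetSpace →L[ℝ] L2Half} {γ : ℝ} (e : JetSpace) {φ : ℝ × ℝ → ℝ}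
    (hφ : IsTest φ) : energyForm T γ e (testJet φ hφ)
      = (∫ x in halfPlane, jetFst e x * dirDeriv (1, 0) φ x)
        + (∫ x in halfPlane, (jetSnd e x - γ * jetFun e x) * dirDeriv (0, 1) φ x)
        + ∫ x in halfPlane, T e x * φ x := by
  have n' := (hφ.dirDeriv (0, 1)).memLp volHalf 2
  have e1 : ∫ x in halfPlane, (jetSnd e x - γ * jetFun e x) * dirDeriv (0, 1) φ x
      = (∫ x in halfPlane, jetSnd e x * dirDeriv (0, 1) φ x)
        - γ * ∫ x in halfPlane, jetFun e x * dirDeriv (0, 1) φ x :=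
    integral_sub_const_mul_mul (Lp.memLp (jetSnd e)) (Lp.memLp (jetFun e)) n' γ
  rw [energyForm_apply, testJet, jetFst_mkJet, jetSnd_mkJet, jetFun_mkJet, inner_toLp_right,
    inner_toLp_right, inner_toLp_right, inner_toLp_right, e1]
  simp only [volHalf]
  ring

variable {f θ η : ℝ → ℝ} {β γ κ : ℝ}

theorem exists_weakSol {c χ₁ χ₂ : ℝ → ℝ} {hm : MemLp χ₂ 2 volume} {T : JetSpace →L[ℝ] L2Half}
    (hT : ∀ e, T e =ᵐ[volHalf] fun x => (2 * β * deriv η x.1 * jetFst e x + γ * jetSnd e x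
      + potential η c β γ x.1 * jetFun e x) + χ₁ x.1 * momentOp χ₂ hm (jetFun e) x.2) (hκ : 0 < κ)
    (hcoer : ∀ e ∈ energySpace, κ * ‖e‖ ^ 2 ≤ energyForm T γ e e) {G : ℝ × ℝ → ℝ} {g : ℝ → ℝ}
    (mG : MemLp G 2 volHalf) (mg : MemLp g 2 volume) :
    ∃ e ∈ energySpace, κ * ‖e‖ ≤ (eLpNorm G 2 volHalf).toReal + (eLpNorm g 2 volume).toReal ∧
      WeakSol η c β γ (jetFun e) (jetFst e) (jetSnd e)
        (fun x => G x - χ₁ x.1 * momentOp χ₂ hm (jetFun e) x.2) g := by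
  obtain ⟨e, heV, hn, he⟩ := exists_energyForm_eq hκ hcoer mG.toLp mg.toLp
  rw [Lp.norm_toLp, Lp.norm_toLp] at hn
  have h1 : WeakEq (jetFst e) (fun x => jetSnd e x - γ * jetFun e x) (fun x => T e x - G x) g := by
    intro φ hφ
    have h2 := he _ (testJet_mem hφ)
    rw [energyForm_testJet, testJet, jetFun_mkJet, jetTrace_mkJet, inner_toLp, inner_toLp] at h2
    have n := hφ.memLp volHalf 2
    have e1 : ∫ x in halfPlane, (T e x - G x) * φ x
        = (∫ x in halfPlane, T e x * φ x) - ∫ x in halfPlane, G x * φ x := by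
      refine Eq.trans ?_ (integral_sub (integrable_mul_of_memLp (Lp.memLp (T e)) n)
        (integrable_mul_of_memLp mG n))
      simp only [sub_mul]
    rw [e1]
    simp only [volHalf] at h2
    linarith
  refine ⟨e, heV, hn, h1.congr ae_eq_rfl ae_eq_rfl ?_ ae_eq_rfl⟩
  filter_upwards [hT e] with x hx
  rw [hx]
  ring

theorem eq_zero_of_weakSol (hf : IsDoubleWell f) (hθ : IsOptimalProfile f θ)
    (hη : IsSmoothAbs η) (hγ : 0 < γ) {χ₁ : ℝ → ℝ} {hm : MemLp (weightedProfile η θ (-β)) 2 volume}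
    {T : JetSpace →L[ℝ] L2Half}
    (hT : ∀ e, T e =ᵐ[volHalf] fun x => (2 * β * deriv η x.1 * jetFst e x + γ * jetSnd e x
      + potential η (fun R => deriv (deriv f) (θ R)) β γ x.1 * jetFun e x)
      + χ₁ x.1 * momentOp _ hm (jetFun e) x.2) (hκ : 0 < κ)
    (hcoer : ∀ e ∈ energySpace, κ * ‖e‖ ^ 2 ≤ energyForm T γ e e) {v vR vH : ℝ × ℝ → ℝ}
    (hR : IsWeakPartial 1 0 v vR) (hH : IsWeakPartial 0 1 v vH) (m0 : MemLp v 2 volHalf)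
    (m1 : MemLp vR 2 volHalf) (m2 : MemLp vH 2 volHalf)
    (h : WeakSol η (fun R => deriv (deriv f) (θ R)) β γ v vR vH (fun _ => 0) (fun _ => 0)) :
    v =ᵐ[volHalf] fun _ => 0 := by
  obtain ⟨t, ht, heV⟩ := exists_mem_energySpace hR hH m0 m1 m2
  have hgr : Green v vH t := (jetGreen heV).congr (by simpa using m0.coeFn_toLp)
    (by simpa using m2.coeFn_toLp) (by simpa using ht.coeFn_toLp)
  have hmom := h.momentOp_eq_zero hf hθ hη hγ hm hR m0 m1 m2 hgr ht
  set e := mkJet m0.toLp m1.toLp m2.toLp ht.toLp with he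
  have c0 : jetFun e =ᵐ[volHalf] v := by rw [he, jetFun_mkJet]; exact m0.coeFn_toLp
  have c1 : jetFst e =ᵐ[volHalf] vR := by rw [he, jetFst_mkJet]; exact m1.coeFn_toLp
  have c2 : jetSnd e =ᵐ[volHalf] vH := by rw [he, jetSnd_mkJet]; exact m2.coeFn_toLp
  have hz : (fun x : ℝ × ℝ => momentOp _ hm (jetFun e) x.2) =ᵐ[volHalf] fun _ => (0:ℝ) := by
    have e0 : momentOp _ hm (jetFun e) = 0 := by rw [he, jetFun_mkJet, hmom]
    rw [e0]
    exact ae_eq_comp_snd (Lp.coeFn_zero ℝ 2 ((volume : Measure ℝ).restrict (Ioi 0)))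
  have h1 : WeakEq (jetFst e) (fun x => jetSnd e x - γ * jetFun e x) (T e) (fun _ => 0) := by
    refine WeakEq.congr h c1.symm ?_ ?_ ae_eq_rfl
    · filter_upwards [c0, c2] with x a b
      rw [a, b]
    · filter_upwards [c0, c1, c2, hT e, hz] with x a0 a1 a2 a3 a4
      rw [a3, a4, a0, a1, a2]
      ring
  have h2 : ∀ e' ∈ energySpace, energyForm T γ e e' = 0 := fun e' he' => by
    refine energySpace_induction (P := fun e' => energyForm T γ e e' = 0)
      (isClosed_eq (by fun_prop) continuous_const) (fun φ hφ => ?_) he'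
    rw [energyForm_testJet, h1 φ hφ]
    simp
  have h3 := hcoer e heV
  rw [h2 e heV] at h3
  have h4 : ‖e‖ = 0 := by
    have : ‖e‖ ^ 2 ≤ 0 := by
      by_contra hc
      push Not at hc
      have := mul_pos hκ hc
      linarith
    nlinarith [norm_nonneg e]
  have h5 := (norm_jet_le e).1
  rw [h4] at h5
  have h6 : jetFun e = 0 := norm_le_zero_iff.1 h5
  rw [h6] at c0
  exact c0.symm.trans (Lp.coeFn_zero ℝ 2 volHalf)

/-- Regularity of weak solutions with data in `L²` and `H^{1/2}`. -/
theorem WeakSol.regularity {c : ℝ → ℝ} {w wR wH G : ℝ × ℝ → ℝ} {g : ℝ → ℝ} {M : ℝ≥0} {B D : ℝ≥0∞}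
    (h : WeakSol η c β γ w wR wH G g) (hR : IsWeakPartial 1 0 w wR) (hH : IsWeakPartial 0 1 w wH)
    (b0 : L2Bound w B) (b1 : L2Bound wR B) (b2 : L2Bound wH B) (bG : L2Bound G D) (bg : HalfBound g D)
    (hB : B ≠ ⊤) (hD : D ≠ ⊤) (c2 : Continuous (potential η c β γ))
    (k1 : ∀ R, |2 * β * deriv η R| ≤ M) (k2 : ∀ R, |potential η c β γ R| ≤ M) (hγ : 0 ≤ γ)
    (k3 : 2 * γ ≤ M) : SobBound 2 w ((7 + 117 * M) * (D + B)) ∧ IsSol η c β γ w G g := by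
  obtain ⟨t, ht, hth⟩ := exists_green hR hH b0.1 b1.1 b2.1
  have hth : HalfBound t (36 * B) := hth.mono (by
    calc _ ≤ 12 * (B + B + B) := by gcongr; exacts [b0.2, b1.2, b2.2]
      _ = _ := by ring)
  have eγ : ‖γ‖ₑ ≤ M := by
    rw [Real.enorm_of_nonneg hγ, ← ENNReal.ofReal_coe_nnreal]
    exact ENNReal.ofReal_le_ofReal (by linarith)
  have e2γ : ‖2 * γ‖ₑ ≤ M := by
    rw [Real.enorm_of_nonneg (by positivity), ← ENNReal.ofReal_coe_nnreal]
    exact ENNReal.ofReal_le_ofReal (by linarith)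
  have l1 := L2Bound.mul_fst (m := fun R => 2 * β * deriv η R) b1 (by fun_prop) k1
  have l2 : L2Bound (fun x => 2 * γ * wH x) (M * B) := (b2.const_mul (2 * γ)).mono (by
    gcongr; exact_mod_cast e2γ)
  have l3 := b0.mul_fst c2.measurable k2
  have bG' := bG.sub ((l1.add l2).add l3)
  have bg' := bg.sub (hth.const_mul γ)
  have hA : D + ‖γ‖ₑ * (36 * B) ≠ ⊤ := by finiteness
  have hw : ∀ φ, IsTest φ → (∫ x in halfPlane, wR x * dirDeriv (1, 0) φ x)
      + ∫ x in halfPlane, wH x * dirDeriv (0, 1) φ x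
      = (∫ x in halfPlane, (G x - (2 * β * deriv η x.1 * wR x + 2 * γ * wH x
          + potential η c β γ x.1 * w x)) * φ x) + ∫ r, (g r - γ * t r) * φ (r, 0) := by
    intro φ hφ
    have n := hφ.memLp volHalf 2
    have n' := (hφ.dirDeriv (0, 1)).memLp volHalf 2
    have s1 := h φ hφ
    have s2 := ht φ hφ
    have e1 : ∫ x in halfPlane, (wH x - γ * w x) * dirDeriv (0, 1) φ x
        = (∫ x in halfPlane, wH x * dirDeriv (0, 1) φ x)
          - γ * ∫ x in halfPlane, w x * dirDeriv (0, 1) φ x :=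
      integral_sub_const_mul_mul b2.1 b0.1 n' γ
    have e2 : ∫ x in halfPlane, (2 * β * deriv η x.1 * wR x + γ * wH x
        + potential η c β γ x.1 * w x - G x) * φ x
        = -(∫ x in halfPlane, (G x - (2 * β * deriv η x.1 * wR x + 2 * γ * wH x
          + potential η c β γ x.1 * w x)) * φ x) - γ * ∫ x in halfPlane, wH x * φ x := by
      rw [← integral_const_mul, ← integral_neg]
      refine Eq.trans ?_ (integral_sub (integrable_mul_of_memLp bG'.1 n).neg
        ((integrable_mul_of_memLp b2.1 n).const_mul γ))
      refine integral_congr_ae (Eventually.of_forall fun x => ?_)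
      simp only; ring
    have e3 : ∫ r, (g r - γ * t r) * φ (r, 0) = (∫ r, g r * φ (r, 0)) - γ * ∫ r, t r * φ (r, 0) :=
      integral_sub_const_mul_mul bg.1 hth.1 ((hφ.slice_snd 0).memLp volume 2) γ
    rw [e1, e2] at s1
    rw [e3]
    linear_combination s1 + γ * s2
  obtain ⟨wRR, wRH, wHH, r1, r2, r3, r4, r5, r6, r7, r8, r9⟩ :=
    neumann_regularity hR hH b0.1 b1.1 b2.1 bG'.1 hA bg' hw
  have hJ : H2Jet w wR wH wRR wRH wHH :=
    ⟨hR, hH, r1, r2, r3, r4, b0.1, b1.1, b2.1, r5.1, r6.1, r7.1⟩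
  have hS : 3 * (eLpNorm (fun x => G x - (2 * β * deriv η x.1 * wR x + 2 * γ * wH x
      + potential η c β γ x.1 * w x)) 2 volHalf + (D + ‖γ‖ₑ * (36 * B)))
      ≤ (7 + 117 * M) * (D + B) := by
    calc _ ≤ 3 * ((D + (M * B + M * B + M * B)) + (D + M * (36 * B))) := by
          gcongr; exact bG'.2
      _ = 6 * D + 117 * M * B := by ring
      _ ≤ (7 * D + 117 * M * B) + (7 * B + 117 * M * D) := by
          refine le_add_right ?_
          gcongr; norm_num
      _ = _ := by ring
  have hS2 : 2 * (eLpNorm (fun x => G x - (2 * β * deriv η x.1 * wR x + 2 * γ * wH x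
      + potential η c β γ x.1 * w x)) 2 volHalf + (D + ‖γ‖ₑ * (36 * B)))
      ≤ (7 + 117 * M) * (D + B) := le_trans (by gcongr; norm_num) hS
  have hSB : B ≤ (7 + 117 * M) * (D + B) := by
    calc B ≤ 1 * (D + B) := by rw [one_mul]; exact le_add_self
      _ ≤ _ := by
        gcongr
        exact le_add_right (by norm_num)
  refine ⟨hJ.sobBound (b0.2.trans hSB) (b1.2.trans hSB) (b2.2.trans hSB) (r5.2.trans hS2)
    (r6.2.trans hS2) (r7.2.trans hS), wR, wH, wRR, wRH, wHH, hJ, Eventually.of_forall fun x => ?_,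
    bg.1.locallyIntegrable (by norm_num), ?_⟩
  · have := r8 x
    linarith
  · have := r9.add (ht.const_mul (-γ)) b2.1 r7.1 (b0.1.const_mul _) (b2.1.const_mul _)
      ((bg'.1.neg).locallyIntegrable (by norm_num)) ((hth.1.const_mul _).locallyIntegrable (by norm_num))
    refine this.congr (Eventually.of_forall fun x => ?_) (Eventually.of_forall fun x => ?_)
      (Eventually.of_forall fun r => ?_) <;> simp only <;> ring

end

section

/-! ### The resolvent of the derivative on the half-line -/

/-- The bounded solution of `j' = γ j - b`. -/
noncomputable def resolvent (γ : ℝ) (b : ℝ → ℝ) (H : ℝ) : ℝ :=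
  ∫ s in Ioi H, Real.exp (γ * (H - s)) * b s

/-- The square root of the kernel of the resolvent. -/
noncomputable def resolventKernel (γ : ℝ) : ℝ → ℝ≥0∞ :=
  (Ioi (0 : ℝ)).indicator fun t => ENNReal.ofReal (Real.exp (-(γ / 2 * t)))

theorem measurable_resolventKernel (γ : ℝ) : Measurable (resolventKernel γ) :=
  Measurable.indicator (by fun_prop) measurableSet_Ioi

theorem lintegral_resolventKernel_sq {γ : ℝ} (hγ : 0 < γ) :
    ∫⁻ t, resolventKernel γ t ^ 2 = ENNReal.ofReal (1 / γ) := by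
  have e : (fun t => resolventKernel γ t ^ 2)
      = (Ioi (0:ℝ)).indicator fun t => ENNReal.ofReal (Real.exp (-γ * t)) := by
    ext t
    by_cases h : t ∈ Ioi (0:ℝ)
    · rw [resolventKernel, indicator_of_mem h, indicator_of_mem h,
        ← ENNReal.ofReal_pow (Real.exp_pos _).le, ← Real.exp_nat_mul]
      congr 2; push_cast; ring
    · rw [resolventKernel, indicator_of_notMem h, indicator_of_notMem h]; simp
  rw [e, lintegral_indicator measurableSet_Ioi, ← ofReal_integral_eq_lintegral_ofReal
    (exp_neg_integrableOn_Ioi 0 hγ) (Eventually.of_forall fun _ => (Real.exp_pos _).le),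
    integral_exp_mul_Ioi (by linarith)]
  congr 1
  simp

theorem enorm_resolvent_le (γ : ℝ) (b : ℝ → ℝ) (H : ℝ) : ‖resolvent γ b H‖ₑ
    ≤ ∫⁻ s, resolventKernel γ (s - H) * (resolventKernel γ (s - H) * ‖b s‖ₑ) := by
  refine (enorm_integral_le_lintegral_enorm _).trans_eq ?_
  rw [← lintegral_indicator measurableSet_Ioi]
  refine lintegral_congr fun s => ?_
  by_cases h : s ∈ Ioi H
  · have h' : s - H ∈ Ioi (0:ℝ) := sub_pos.2 (show H < s from h)
    rw [indicator_of_mem h, resolventKernel, indicator_of_mem h', ← mul_assoc,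
      ← ENNReal.ofReal_mul (Real.exp_pos _).le, ← Real.exp_add, enorm_mul,
      Real.enorm_of_nonneg (Real.exp_pos _).le]
    congr 3; ring
  · have h' : s - H ∉ Ioi (0:ℝ) := fun h2 => h (sub_pos.1 (show 0 < s - H from h2) : H < s)
    rw [indicator_of_notMem h, resolventKernel, indicator_of_notMem h']
    simp

theorem aestronglyMeasurable_resolvent (γ : ℝ) {b : ℝ → ℝ} (hb : AEStronglyMeasurable b volume) :
    AEStronglyMeasurable (resolvent γ b) volume := by
  have e : resolvent γ b = fun H => ∫ s, {p : ℝ × ℝ | p.1 < p.2}.indicator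
      (fun p => Real.exp (γ * (p.1 - p.2)) * b p.2) (H, s) := by
    ext H
    rw [resolvent, ← integral_indicator measurableSet_Ioi]
    rfl
  rw [e]
  refine AEStronglyMeasurable.integral_prod_right' (μ := volume) (ν := (volume : Measure ℝ)) ?_
  refine AEStronglyMeasurable.indicator ?_ (measurableSet_lt measurable_fst measurable_snd)
  exact (by fun_prop : Continuous fun p : ℝ × ℝ =>
    Real.exp (γ * (p.1 - p.2))).aestronglyMeasurable.mul hb.comp_snd

theorem resolvent_bound {γ : ℝ} (hγ : 0 < γ) {b : ℝ → ℝ} (hb : MemLp b 2 volume) :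
    MemLp (resolvent γ b) 2 volume ∧
      eLpNorm (resolvent γ b) 2 volume ≤ ENNReal.ofReal (1 / γ) * eLpNorm b 2 volume := by
  have hm := aestronglyMeasurable_resolvent γ hb.1
  have mk := measurable_resolventKernel γ
  have key : eLpNorm (resolvent γ b) 2 volume ≤ ENNReal.ofReal (1 / γ) * eLpNorm b 2 volume := by
    rw [← ENNReal.pow_le_pow_left_iff two_ne_zero, mul_pow, eLpNorm_two_sq, eLpNorm_two_sq]
    have m1 : ∀ H, AEMeasurable (fun s => resolventKernel γ (s - H)) volume := fun H =>
      (mk.comp (measurable_id.sub_const H)).aemeasurable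
    calc ∫⁻ H, ‖resolvent γ b H‖ₑ ^ 2
        ≤ ∫⁻ H, ENNReal.ofReal (1 / γ) * ∫⁻ s, resolventKernel γ (s - H) ^ 2 * ‖b s‖ₑ ^ 2 := by
          refine lintegral_mono fun H => ?_
          refine (pow_le_pow_left' (enorm_resolvent_le γ b H) 2).trans ?_
          refine (lintegral_mul_sq_le (m1 H) ((m1 H).mul hb.1.enorm)).trans ?_
          rw [lintegral_sub_right_eq_self (fun s => resolventKernel γ s ^ 2) H,
            lintegral_resolventKernel_sq hγ]
          exact le_of_eq (congrArg _ (lintegral_congr fun s => mul_pow _ _ _))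
      _ = ENNReal.ofReal (1 / γ) * ∫⁻ s, ∫⁻ H, resolventKernel γ (s - H) ^ 2 * ‖b s‖ₑ ^ 2 := by
          rw [lintegral_const_mul' _ _ ENNReal.ofReal_ne_top, lintegral_lintegral_swap]
          exact ((mk.comp (measurable_snd.sub measurable_fst)).pow_const 2).aemeasurable.mul
            (hb.1.comp_snd.enorm.pow_const 2)
      _ = ENNReal.ofReal (1 / γ) ^ 2 * ∫⁻ s, ‖b s‖ₑ ^ 2 := by
          have : ∀ s, ∫⁻ H, resolventKernel γ (s - H) ^ 2 * ‖b s‖ₑ ^ 2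
              = ENNReal.ofReal (1 / γ) * ‖b s‖ₑ ^ 2 := fun s => by
            rw [lintegral_mul_const' _ _ (by finiteness),
              lintegral_sub_left_eq_self (fun s => resolventKernel γ s ^ 2) s,
              lintegral_resolventKernel_sq hγ]
          simp only [this]
          rw [lintegral_const_mul' _ _ ENNReal.ofReal_ne_top, sq, mul_assoc]
  exact ⟨⟨hm, key.trans_lt (ENNReal.mul_lt_top ENNReal.ofReal_lt_top hb.2)⟩, key⟩

theorem resolvent_green {γ : ℝ} (hγ : 0 < γ) {b ψ : ℝ → ℝ} (hb : MemLp b 2 volume) (hψ : IsTest ψ) :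
    (∫ H in Ioi 0, resolvent γ b H * deriv ψ H) + ∫ H in Ioi 0, (γ * resolvent γ b H - b H) * ψ H
      = -(resolvent γ b 0 * ψ 0) := by
  set j := resolvent γ b with hj
  have hjm := (resolvent_bound hγ hb).1.restrict (Ioi 0)
  have hbm := hb.restrict (Ioi 0)
  have hψd : IsTest (deriv ψ) := by
    have := hψ.dirDeriv 1
    rwa [dirDeriv_one, iteratedDeriv_one] at this
  set Ψ : ℝ → ℝ := fun H => Real.exp (γ * H) * ψ H with hΨ
  have hΨt : IsTest Ψ := hψ.mul_left (by fun_prop)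
  have hΨd : ∀ H, HasDerivAt Ψ (Real.exp (γ * H) * (deriv ψ H + γ * ψ H)) H := fun H => by
    have h1 := ((hasDerivAt_id H).const_mul γ).exp.mul (hψ.differentiable H).hasDerivAt
    refine h1.congr_deriv ?_
    simp only [id, mul_one]; ring
  set Ψ' : ℝ → ℝ := fun H => Real.exp (γ * H) * (deriv ψ H + γ * ψ H) with hΨ'
  have hΨ't : IsTest Ψ' := (hψd.add (hψ.const_mul γ)).mul_left (by fun_prop)
  have hEb : Integrable (fun s => Real.exp (-(γ * s)) * b s) (volume.restrict (Ioi 0)) :=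
    integrable_mul_of_memLp (memLp_exp_neg_Ioi hγ) hbm
  have hF : Integrable (fun p : ℝ × ℝ => {p : ℝ × ℝ | p.1 < p.2}.indicator
      (fun p => Ψ' p.1 * (Real.exp (-(γ * p.2)) * b p.2)) p)
      ((volume.restrict (Ioi 0)).prod (volume.restrict (Ioi 0))) :=
    ((hΨ't.integrable (volume.restrict (Ioi 0))).mul_prod hEb).indicator
      (measurableSet_lt measurable_fst measurable_snd)
  have swap := integral_integral_swap (f := fun H s => {p : ℝ × ℝ | p.1 < p.2}.indicator
      (fun p => Ψ' p.1 * (Real.exp (-(γ * p.2)) * b p.2)) (H, s)) hF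
  have eL : ∀ H ∈ Ioi (0:ℝ), ∫ s in Ioi 0, {p : ℝ × ℝ | p.1 < p.2}.indicator
      (fun p => Ψ' p.1 * (Real.exp (-(γ * p.2)) * b p.2)) (H, s)
      = j H * deriv ψ H + γ * (j H * ψ H) := by
    intro H hH
    have e1 : ∀ s, {p : ℝ × ℝ | p.1 < p.2}.indicator
      (fun p => Ψ' p.1 * (Real.exp (-(γ * p.2)) * b p.2)) (H, s)
      = (Ioi H).indicator (fun s => (deriv ψ H + γ * ψ H) * (Real.exp (γ * (H - s)) * b s)) s := by
      intro s
      by_cases h : H < s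
      · rw [indicator_of_mem (show (H, s) ∈ {p : ℝ × ℝ | p.1 < p.2} from h),
          indicator_of_mem (show s ∈ Ioi H from h)]
        simp only [hΨ']
        rw [show γ * (H - s) = γ * H + -(γ * s) by ring, Real.exp_add]; ring
      · rw [indicator_of_notMem (show (H, s) ∉ {p : ℝ × ℝ | p.1 < p.2} from h),
          indicator_of_notMem (show s ∉ Ioi H from h)]
    simp only [e1]
    rw [setIntegral_indicator measurableSet_Ioi, inter_eq_self_of_subset_right
      (Ioi_subset_Ioi (le_of_lt hH)), integral_const_mul, hj, resolvent]
    ring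
  have eR : ∀ s ∈ Ioi (0:ℝ), ∫ H in Ioi 0, {p : ℝ × ℝ | p.1 < p.2}.indicator
      (fun p => Ψ' p.1 * (Real.exp (-(γ * p.2)) * b p.2)) (H, s)
      = b s * ψ s - ψ 0 * (Real.exp (-(γ * s)) * b s) := by
    intro s hs
    have hs : (0:ℝ) < s := hs
    have e1 : ∀ H, {p : ℝ × ℝ | p.1 < p.2}.indicator
      (fun p => Ψ' p.1 * (Real.exp (-(γ * p.2)) * b p.2)) (H, s)
      = (Iio s).indicator (fun H => Ψ' H * (Real.exp (-(γ * s)) * b s)) H := fun H => rfl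
    simp only [e1]
    rw [setIntegral_indicator measurableSet_Iio, Ioi_inter_Iio, integral_mul_const,
      ← integral_Ioc_eq_integral_Ioo, ← intervalIntegral.integral_of_le hs.le,
      intervalIntegral.integral_eq_sub_of_hasDerivAt (f := Ψ) (fun H _ => hΨd H)
        (hΨ't.continuous.intervalIntegrable _ _)]
    simp only [hΨ, mul_zero, Real.exp_zero, one_mul]
    have : Real.exp (γ * s) * Real.exp (-(γ * s)) = 1 := by rw [← Real.exp_add]; simp
    linear_combination b s * ψ s * this
  rw [setIntegral_congr_fun measurableSet_Ioi eL, setIntegral_congr_fun measurableSet_Ioi eR] at swap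
  have i1 := integrable_mul_of_memLp hjm (hψd.memLp _ 2)
  have i2 := integrable_mul_of_memLp hjm (hψ.memLp _ 2)
  have i3 := integrable_mul_of_memLp hbm (hψ.memLp _ 2)
  rw [integral_add i1 (i2.const_mul γ), integral_sub i3 (hEb.const_mul _), integral_const_mul,
    integral_const_mul] at swap
  have e0 : ∫ s in Ioi 0, Real.exp (-(γ * s)) * b s = j 0 := by
    rw [hj, resolvent]; simp
  rw [e0] at swap
  have e2 : ∫ H in Ioi 0, (γ * j H - b H) * ψ H
      = γ * (∫ H in Ioi 0, j H * ψ H) - ∫ H in Ioi 0, b H * ψ H := by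
    rw [← integral_const_mul, ← integral_sub (i2.const_mul γ) i3]
    congr 1; ext H; ring
  rw [e2]
  linarith

/-! ### Products as Sobolev functions -/

theorem green_tensor {χ k k' : ℝ → ℝ} {k₀ : ℝ} (hχ : MemLp χ 2 volume)
    (hk : MemLp k 2 (volume.restrict (Ioi 0))) (hk' : MemLp k' 2 (volume.restrict (Ioi 0)))
    (h : ∀ ψ : ℝ → ℝ, IsTest ψ → (∫ H in Ioi 0, k H * deriv ψ H) + ∫ H in Ioi 0, k' H * ψ H
      = -(k₀ * ψ 0)) :
    Green (fun x => χ x.1 * k x.2) (fun x => χ x.1 * k' x.2) fun r => χ r * k₀ := by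
  intro φ hφ
  have i1 := integrable_mul_of_memLp (memLp_tensor hχ hk) ((hφ.dirDeriv (0, 1)).memLp volHalf 2)
  have i2 := integrable_mul_of_memLp (memLp_tensor hχ hk') (hφ.memLp volHalf 2)
  refine (integral_add i1 i2).symm.trans ?_
  have i3 := i1.add i2
  rw [volHalf_eq_prod] at i1 i2 i3 ⊢
  refine (integral_prod _ i3).trans ?_
  rw [← integral_neg]
  refine integral_congr_ae (Eventually.of_forall fun r => ?_)
  have hs := hφ.slice_fst r
  have hd : IsTest (deriv fun H => φ (r, H)) := by
    have := hs.dirDeriv 1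
    rwa [dirDeriv_one, iteratedDeriv_one] at this
  have h1 := h _ hs
  rw [← integral_add (integrable_mul_of_memLp hk (hd.memLp _ 2))
    (integrable_mul_of_memLp hk' (hs.memLp _ 2))] at h1
  have e : ∀ H, deriv (fun H => φ (r, H)) H = dirDeriv (0, 1) φ (r, H) := fun H =>
    (hasDerivAt_slice_fst hφ r H).deriv
  simp only [e] at h1
  have h2 : ∫ H in Ioi 0, (χ r * k H * dirDeriv (0, 1) φ (r, H) + χ r * k' H * φ (r, H))
      = -(χ r * k₀ * φ (r, 0)) := by
    calc _ = ∫ H in Ioi 0, χ r * (k H * dirDeriv (0, 1) φ (r, H) + k' H * φ (r, H)) := by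
          congr 1; ext H; ring
      _ = _ := by rw [integral_const_mul, h1]; ring
  exact h2

theorem Green.isWeakPartial {w wH : ℝ × ℝ → ℝ} {t : ℝ → ℝ} (h : Green w wH t)
    (m : MemLp w 2 volHalf) (mH : MemLp wH 2 volHalf) : IsWeakPartial 0 1 w wH := by
  refine ⟨MemLp.locallyIntegrableOn_halfPlane m, MemLp.locallyIntegrableOn_halfPlane mH,
    fun ψ h1 h2 hs => ?_⟩
  have := h ψ ⟨h1, h2⟩
  have z : ∀ r, ψ (r, 0) = 0 := fun r => by
    refine image_eq_zero_of_notMem_tsupport fun h => ?_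
    have : (0 : ℝ) < 0 := hs h
    exact lt_irrefl _ this
  simp only [z, mul_zero, integral_zero, neg_zero] at this
  rw [partialDeriv_zero_one, zero_add, pow_one, neg_one_mul]
  linarith

theorem isWeakPartial_tensor_fst {χ k : ℝ → ℝ} (hχ : SmoothL2 volume χ)
    (hk : MemLp k 2 (volume.restrict (Ioi 0))) :
    IsWeakPartial 1 0 (fun x => χ x.1 * k x.2) (fun x => deriv χ x.1 * k x.2) := by
  have m1 := memLp_tensor hχ.mem hk
  have m2 := memLp_tensor hχ.mem_deriv hk
  refine WeakDir.isWeakPartial ⟨m1, m2, fun φ hφ => ?_⟩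
  have i1 := integrable_mul_of_memLp m1 ((hφ.dirDeriv (1, 0)).memLp volHalf 2)
  have i2 := integrable_mul_of_memLp m2 (hφ.memLp volHalf 2)
  rw [← add_eq_zero_iff_eq_neg]
  refine (integral_add i1 i2).symm.trans ?_
  have i3 := i1.add i2
  rw [volHalf_eq_prod] at i1 i2 i3 ⊢
  refine (integral_prod_symm _ i3).trans ?_
  refine integral_eq_zero_of_ae (Eventually.of_forall fun H => ?_)
  have hs := hφ.slice_snd H
  have hd := hs.mul_left hχ.smooth
  have h1 := integral_eq_zero_of_hasDerivAt_of_integrable (f := fun r => χ r * φ (r, H))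
    (f' := fun r => deriv χ r * φ (r, H) + χ r * dirDeriv (1, 0) φ (r, H))
    (fun r => by
      have := (hχ.hasDerivAt r).mul (hs.differentiable r).hasDerivAt
      refine this.congr_deriv ?_
      have e := congrFun (dirDeriv_slice_snd hφ H) r
      rw [dirDeriv_one, iteratedDeriv_one] at e
      rw [e])
    ((hs.mul_left (contDiff_infty_iff_deriv.1 hχ.smooth).2).integrable volume |>.add
      (((hφ.dirDeriv (1, 0)).slice_snd H).mul_left hχ.smooth |>.integrable volume))
    (hd.integrable volume)
  have h2 : ∫ r, (χ r * k H * dirDeriv (1, 0) φ (r, H) + deriv χ r * k H * φ (r, H)) = 0 := by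
    calc _ = ∫ r, k H * (deriv χ r * φ (r, H) + χ r * dirDeriv (1, 0) φ (r, H)) := by
          congr 1; ext r; ring
      _ = _ := by rw [integral_const_mul, h1, mul_zero]
  exact h2

end

section

/-! ### Solvability in the weighted spaces -/

variable {f θ η : ℝ → ℝ} {β γ : ℝ}

/-- The particular solution for data in the direction of the kernel. -/
theorem exists_corrector (hf : IsDoubleWell f) (hθ : IsOptimalProfile f θ) (hη : IsSmoothAbs η)
    (hγ : 0 < γ) (hχ : MemLp (weightedProfile η θ β) 2 volume) {b : ℝ → ℝ}
    (hb : MemLp b 2 (volume.restrict (Ioi 0))) {N : ℝ≥0∞}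
    (hN : eLpNorm b 2 (volume.restrict (Ioi 0)) ≤ N)
    (h0 : ∫ s in Ioi 0, Real.exp (-(γ * s)) * b s = 0) :
    ∃ z zR zH, IsWeakPartial 1 0 z zR ∧ IsWeakPartial 0 1 z zH ∧
      L2Bound z (eLpNorm (weightedProfile η θ β) 2 volume
        * (ENNReal.ofReal (1 / γ) * (ENNReal.ofReal (1 / γ) * N))) ∧
      L2Bound zR (eLpNorm (deriv (weightedProfile η θ β)) 2 volume
        * (ENNReal.ofReal (1 / γ) * (ENNReal.ofReal (1 / γ) * N))) ∧
      L2Bound zH (eLpNorm (weightedProfile η θ β) 2 volume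
        * (2 * (ENNReal.ofReal (1 / γ) * N))) ∧
      WeakSol η (fun R => deriv (deriv f) (θ R)) β γ z zR zH
        (fun x => weightedProfile η θ β x.1 * b x.2) fun _ => 0 := by
  set χ := weightedProfile η θ β with hχdef
  set b' := (Ioi (0:ℝ)).indicator b with hb'
  have hI : MeasurableSet (Ioi (0:ℝ)) := measurableSet_Ioi
  have hb'm : MemLp b' 2 volume := (memLp_indicator_iff_restrict hI).2 hb
  have hb'n : eLpNorm b' 2 volume ≤ N := (eLpNorm_indicator_eq_eLpNorm_restrict hI).trans_le hN
  have heq : ∀ s ∈ Ioi (0:ℝ), b' s = b s := fun s hs => indicator_of_mem hs _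
  set j := resolvent γ b' with hj
  obtain ⟨mj, nj⟩ := resolvent_bound hγ hb'm
  obtain ⟨mk, nk⟩ := resolvent_bound hγ mj
  rw [← hj] at mj nj mk nk
  have hj0 : j 0 = 0 := by
    refine Eq.trans ?_ h0
    refine setIntegral_congr_fun hI fun s hs => ?_
    rw [show γ * (0 - s) = -(γ * s) by ring, heq s hs]
  have hs := smoothL2_weightedProfile hf hθ hη hχ
  have hs' : SmoothL2 volume (deriv χ) := by
    refine ⟨(contDiff_infty_iff_deriv.1 hs.smooth).2, hs.mem_deriv, ?_⟩
    have h1 := hη.bddSmooth_deriv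
    have h2 := ((bddSmooth_const β).mul h1.deriv).add (((bddSmooth_const (-β ^ 2)).mul (h1.mul h1)).add
      (hθ.bddSmooth_comp hf hf.contDiff_deriv2))
    refine ((MemLp.bddSmooth_mul ((bddSmooth_const (2 * β)).mul h1) hs.mem_deriv).add
      (MemLp.bddSmooth_mul h2 hs.mem)).ae_eq (Eventually.of_forall fun R => ?_)
    rw [hχdef, deriv_deriv_weightedProfile hf hθ hη]
    simp only [Pi.add_apply]; ring
  set k : ℝ → ℝ := fun H => -resolvent γ j H with hk
  have mk : MemLp k 2 volume := mk.neg
  have nj : eLpNorm j 2 volume ≤ ENNReal.ofReal (1 / γ) * N := nj.trans (by gcongr)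
  have nk : eLpNorm k 2 volume ≤ ENNReal.ofReal (1 / γ) * (ENNReal.ofReal (1 / γ) * N) := by
    rw [show k = -resolvent γ j from rfl, eLpNorm_neg]
    exact nk.trans (by gcongr)
  have mk1 : MemLp (fun H => γ * k H + j H) 2 volume := (mk.const_mul γ).add mj
  have nk1 : eLpNorm (fun H => γ * k H + j H) 2 volume ≤ 2 * (ENNReal.ofReal (1 / γ) * N) := by
    refine (eLpNorm_add_le (mk.const_mul γ).1 mj.1 (by norm_num)).trans ?_
    rw [two_mul]
    refine add_le_add ((eLpNorm_const_smul_le (c := γ) (f := k)).trans ?_) nj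
    calc _ ≤ ENNReal.ofReal γ * (ENNReal.ofReal (1 / γ) * (ENNReal.ofReal (1 / γ) * N)) := by
          gcongr
          rw [Real.enorm_of_nonneg hγ.le]
      _ = _ := by
          rw [← mul_assoc, ← ENNReal.ofReal_mul hγ.le, mul_one_div_cancel hγ.ne',
            ENNReal.ofReal_one, one_mul]
  have rle : ∀ u : ℝ → ℝ, eLpNorm u 2 (volume.restrict (Ioi 0)) ≤ eLpNorm u 2 volume := fun u =>
    eLpNorm_mono_measure u Measure.restrict_le_self
  have hbr := hb'm.restrict (Ioi 0)
  have mjr := mj.restrict (Ioi 0)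
  have mkr := mk.restrict (Ioi 0)
  have mk1r := mk1.restrict (Ioi 0)
  have gk : Green (fun x => χ x.1 * k x.2) (fun x => χ x.1 * (γ * k x.2 + j x.2))
      fun r => χ r * k 0 := by
    refine green_tensor hs.mem mkr mk1r fun ψ hψ => ?_
    have := resolvent_green hγ mj hψ
    simp only [hk, neg_mul, integral_neg]
    rw [show (fun H => (γ * -resolvent γ j H + j H) * ψ H)
      = fun H => -((γ * resolvent γ j H - j H) * ψ H) by ext H; ring, integral_neg]
    linarith
  have gj : Green (fun x => χ x.1 * j x.2) (fun x => χ x.1 * (γ * j x.2 - b' x.2))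
      fun r => χ r * j 0 :=
    green_tensor hs.mem mjr ((mjr.const_mul γ).sub hbr) fun ψ hψ => resolvent_green hγ hb'm hψ
  have m0 := memLp_tensor hs.mem mkr
  have m2 := memLp_tensor hs.mem mk1r
  have m3 := memLp_tensor hs.mem ((mjr.const_mul γ).sub hbr)
  have m4 := memLp_tensor hs'.mem_deriv mkr
  refine ⟨_, _, _, isWeakPartial_tensor_fst hs mkr, gk.isWeakPartial m0 m2, ⟨m0, ?_⟩,
    ⟨memLp_tensor hs.mem_deriv mkr, ?_⟩, ⟨m2, ?_⟩, fun φ hφ => ?_⟩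
  · rw [eLpNorm_tensor hs.mem mkr]
    gcongr
    exact (rle _).trans nk
  · rw [eLpNorm_tensor hs.mem_deriv mkr]
    gcongr
    exact (rle _).trans nk
  · rw [eLpNorm_tensor hs.mem mk1r]
    gcongr
    exact (rle _).trans nk1
  · have s1 := (weakDir_of_isWeakPartial (isWeakPartial_tensor_fst hs' mkr)
      (memLp_tensor hs'.mem mkr) m4).2.2 φ hφ
    have s2 := gj φ hφ
    have n := hφ.memLp volHalf 2
    simp only [hj0, mul_zero, zero_mul, integral_zero, neg_zero] at s2 ⊢
    have s3 : ∫ x in halfPlane, (2 * β * deriv η x.1 * (deriv χ x.1 * k x.2)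
        + γ * (χ x.1 * (γ * k x.2 + j x.2)) + potential η (fun R => deriv (deriv f) (θ R)) β γ x.1
          * (χ x.1 * k x.2) - χ x.1 * b x.2) * φ x
        = (∫ x in halfPlane, deriv (deriv χ) x.1 * k x.2 * φ x)
          + ∫ x in halfPlane, χ x.1 * (γ * j x.2 - b' x.2) * φ x := by
      refine Eq.trans ?_ (integral_add (integrable_mul_of_memLp m4 n) (integrable_mul_of_memLp m3 n))
      refine setIntegral_congr_fun measurableSet_halfPlane fun x hx => ?_
      have e := deriv_deriv_weightedProfile (s := β) hf hθ hη x.1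
      rw [← hχdef] at e
      simp only [heq x.2 hx, e, potential]
      ring
    have s4 : ∀ x : ℝ × ℝ, χ x.1 * (γ * k x.2 + j x.2) - γ * (χ x.1 * k x.2) = χ x.1 * j x.2 :=
      fun x => by ring
    simp only [← hχdef, s4]
    rw [s3]
    linarith [show ∫ x in halfPlane, deriv χ x.1 * k x.2 * dirDeriv (1, 0) φ x = _ from s1]


theorem exists_coefficient_bound (hf : IsDoubleWell f) (hθ : IsOptimalProfile f θ)
    (hη : IsSmoothAbs η) (b : ℝ) : ∃ M : ℝ≥0, ∀ γ ∈ Icc 0 b, ∀ β ∈ Icc 0 b,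
      (∀ R, |2 * β * deriv η R| ≤ M) ∧
      (∀ R, |potential η (fun R => deriv (deriv f) (θ R)) β γ R| ≤ M) ∧ 2 * γ ≤ M := by
  obtain ⟨C, hC⟩ := (hθ.bddSmooth_comp hf hf.contDiff_deriv2).bound
  obtain ⟨K₁, h1⟩ := hη.bddSmooth_deriv.bound
  obtain ⟨K₂, h2⟩ := hη.bddSmooth_deriv.deriv.bound
  refine ⟨2 * b.toNNReal * K₁ + (b.toNNReal * K₂ + b.toNNReal ^ 2 * K₁ ^ 2 + b.toNNReal ^ 2 + C)
    + 2 * b.toNNReal, fun γ hγ β hβ => ?_⟩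
  have hb : (b.toNNReal : ℝ) = b := Real.coe_toNNReal b (hγ.1.trans hγ.2)
  obtain ⟨γ0, γ1⟩ := hγ
  obtain ⟨β0, β1⟩ := hβ
  have hb0 := γ0.trans γ1
  push_cast
  rw [hb]
  have p1 : 0 ≤ 2 * b * K₁ := by positivity
  have p2 : 0 ≤ b * K₂ + b ^ 2 * K₁ ^ 2 + b ^ 2 + C := by positivity
  have t1 : ∀ R, |2 * β * deriv η R| ≤ 2 * b * K₁ := fun R => by
    rw [abs_mul, abs_of_nonneg (by positivity)]
    gcongr
    exact h1 R
  refine ⟨fun R => (t1 R).trans (by linarith), fun R => ?_, by linarith⟩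
  have e : |potential η (fun R => deriv (deriv f) (θ R)) β γ R|
      ≤ b * K₂ + b ^ 2 * K₁ ^ 2 + b ^ 2 + C := by
    rw [potential]
    refine (abs_add_le _ _).trans (add_le_add ((abs_sub _ _).trans (add_le_add
      ((abs_sub _ _).trans (add_le_add ?_ ?_)) ?_)) (hC R))
    · rw [abs_mul, abs_of_nonneg β0]
      gcongr
      exact h2 R
    · rw [abs_mul, abs_of_nonneg (sq_nonneg β), abs_pow]
      gcongr
      exact h1 R
    · rw [abs_of_nonneg (sq_nonneg γ)]
      gcongr
  exact e.trans (by linarith)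

theorem WeakEq.add {A B C A' B' C' : ℝ × ℝ → ℝ} {g g' : ℝ → ℝ} (h : WeakEq A B C g)
    (h' : WeakEq A' B' C' g') (mA : MemLp A 2 volHalf) (mB : MemLp B 2 volHalf)
    (mC : MemLp C 2 volHalf) (mA' : MemLp A' 2 volHalf) (mB' : MemLp B' 2 volHalf)
    (mC' : MemLp C' 2 volHalf) (mg : MemLp g 2 volume) (mg' : MemLp g' 2 volume) :
    WeakEq (fun x => A x + A' x) (fun x => B x + B' x) (fun x => C x + C' x)
      fun r => g r + g' r := by
  intro φ hφ
  have key : ∀ {u u' ψ : ℝ × ℝ → ℝ}, MemLp u 2 volHalf → MemLp u' 2 volHalf → IsTest ψ →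
      ∫ x in halfPlane, (u x + u' x) * ψ x
        = (∫ x in halfPlane, u x * ψ x) + ∫ x in halfPlane, u' x * ψ x := fun m m' hψ => by
    simp only [add_mul]
    exact integral_add (integrable_mul_of_memLp m (hψ.memLp volHalf 2))
      (integrable_mul_of_memLp m' (hψ.memLp volHalf 2))
  have n := (hφ.slice_snd 0).memLp volume 2
  simp only [add_mul (g _)]
  rw [key mA mA' (hφ.dirDeriv _), key mB mB' (hφ.dirDeriv _), key mC mC' hφ,
    integral_add (integrable_mul_of_memLp mg n) (integrable_mul_of_memLp mg' n), ← h φ hφ, ← h' φ hφ]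
  ring

theorem l2Bound_of_norm_le {u : L2Half} {N : ℝ} (h : ‖u‖ ≤ N) : L2Bound u (ENNReal.ofReal N) :=
  ⟨Lp.memLp u, by rw [← Lp.enorm_def, ← ofReal_norm]; exact ENNReal.ofReal_le_ofReal h⟩

theorem memLp_weakSol (hf : IsDoubleWell f) (hθ : IsOptimalProfile f θ) (hη : IsSmoothAbs η)
    {v vR vH G : ℝ × ℝ → ℝ} (m0 : MemLp v 2 volHalf) (m1 : MemLp vR 2 volHalf)
    (m2 : MemLp vH 2 volHalf) (mG : MemLp G 2 volHalf) :
    MemLp (fun x => 2 * β * deriv η x.1 * vR x + γ * vH x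
      + potential η (fun R => deriv (deriv f) (θ R)) β γ x.1 * v x - G x) 2 volHalf := by
  have h1 := (bddSmooth_const (2 * β)).mul hη.bddSmooth_deriv
  have h2 := bddSmooth_potential hf hθ hη β γ
  obtain ⟨C₁, hC₁⟩ := h1.bound
  obtain ⟨C₂, hC₂⟩ := h2.bound
  exact (((L2Bound.mul_fst ⟨m1, le_rfl⟩ h1.1.continuous.measurable hC₁).1.add (m2.const_mul γ)).add
    (L2Bound.mul_fst ⟨m0, le_rfl⟩ h2.1.continuous.measurable hC₂).1).sub mG

theorem integral_kernel_eq_zero (hf : IsDoubleWell f) (hθ : IsOptimalProfile f θ) {b : ℝ → ℝ}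
    (h : ∫ x in halfPlane, weightedProfile η θ β x.1 * b x.2
      * (weightedProfile η θ (-β) x.1 * Real.exp (-(γ * x.2))) = 0) :
    ∫ s in Ioi 0, Real.exp (-(γ * s)) * b s = 0 := by
  have h1 : ∫ x in halfPlane, weightedProfile η θ β x.1 * b x.2
      * (weightedProfile η θ (-β) x.1 * Real.exp (-(γ * x.2)))
      = (∫ r, deriv θ r * deriv θ r) * ∫ s in Ioi 0, Real.exp (-(γ * s)) * b s := by
    rw [← integral_prod_mul, ← volHalf_eq_prod]
    refine integral_congr_ae (Eventually.of_forall fun x => ?_)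
    have : Real.exp (β * η x.1) * Real.exp (-β * η x.1) = 1 := by rw [← Real.exp_add]; simp
    simp only [weightedProfile]
    linear_combination deriv θ x.1 * deriv θ x.1 * (Real.exp (-(γ * x.2)) * b x.2) * this
  rw [h1] at h
  refine (mul_eq_zero.1 h).resolve_left (ne_of_gt ?_)
  have m := hθ.memLp_deriv hf
  refine (integral_pos_iff_support_of_nonneg (fun r => mul_self_nonneg _)
    (integrable_mul_of_memLp m m)).2 ?_
  have : Function.support (fun r => deriv θ r * deriv θ r) = univ := by
    ext r; simp [(hθ.deriv_pos hf r).ne']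
  rw [this]
  simp

theorem exists_solvable (hf : IsDoubleWell f) (hθ : IsOptimalProfile f θ) (hη : IsSmoothAbs η) :
    ∃ b > 0, ∃ C : ℝ≥0, ∀ γ ∈ Ioc 0 b, ∀ β ∈ Icc 0 b,
      MemLp (weightedProfile η θ (-β)) 2 volume ∧
      (∀ G g D, D ≠ ⊤ → L2Bound G D → HalfBound g D →
        (∫ x in halfPlane, G x * (weightedProfile η θ (-β) x.1 * Real.exp (-(γ * x.2))))
          + ∫ r, g r * weightedProfile η θ (-β) r = 0 →
        ∃ v, SobBound 2 v (C * ENNReal.ofReal (1 + 1 / γ ^ 2) * D) ∧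
          IsSol η (fun R => deriv (deriv f) (θ R)) β γ v G g) ∧
      ∀ v A, SobBound 2 v A → IsSol η (fun R => deriv (deriv f) (θ R)) β γ v (fun _ => 0) (fun _ => 0) →
        v =ᵐ[volHalf] fun _ => 0 := by
  obtain ⟨b, hb, hb1, κ, hκ, K, hK⟩ := exists_coercive hf hθ hη
  obtain ⟨Cχ, hCχ⟩ := exists_deriv_weightedProfile_le hf hθ hη
  obtain ⟨M, hM⟩ := exists_coefficient_bound hf hθ hη b
  set K' := K.toNNReal
  set k' := (2 / κ).toNNReal
  set Q : ℝ≥0 := 1 + (1 + 2 * Cχ) * K' * K'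
  refine ⟨b, hb, (7 + 117 * M) * (1 + Q * k'), fun γ hγ β hβ => ?_⟩
  obtain ⟨hχ₁, hχ₂, n1, n2, T, hT, hcoer⟩ := hK γ hγ β hβ
  obtain ⟨M1, M2, M3⟩ := hM γ ⟨hγ.1.le, hγ.2⟩ β hβ
  refine ⟨hχ₂, fun G g D hD bG bg hcomp => ?_, fun v A hv hsol => ?_⟩
  · obtain ⟨e, heV, hen, hw⟩ := exists_weakSol hT hκ hcoer bG.1 bg.1
    set b0 := momentOp _ hχ₂ (jetFun e)
    set N := ENNReal.ofReal ‖e‖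
    have w0 := l2Bound_of_norm_le (norm_jet_le e).1
    have w1 := l2Bound_of_norm_le (norm_jet_le e).2.1
    have w2 := l2Bound_of_norm_le (norm_jet_le e).2.2.1
    have hb0 : eLpNorm b0 2 (volume.restrict (Ioi 0)) ≤ K' * N := by
      rw [← Lp.enorm_def, ← ofReal_norm, ← ENNReal.ofReal_coe_nnreal, ← ENNReal.ofReal_mul (by simp)]
      refine ENNReal.ofReal_le_ofReal (((momentOp _ hχ₂).le_opNorm _).trans ?_)
      gcongr
      · exact (norm_momentOp_le hχ₂).trans (n2.trans (Real.le_coe_toNNReal K))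
      · exact (norm_jet_le e).1
    have hN : N ≤ k' * D := by
      have hsum : (eLpNorm G 2 volHalf).toReal + (eLpNorm g 2 volume).toReal ≤ 2 * D.toReal := by
        linarith [ENNReal.toReal_mono hD bG.2, ENNReal.toReal_mono hD bg.2.1]
      rw [← ENNReal.ofReal_toReal hD, ← ENNReal.ofReal_coe_nnreal, ← ENNReal.ofReal_mul (by simp)]
      refine ENNReal.ofReal_le_ofReal ?_
      rw [Real.coe_toNNReal _ (by positivity), div_mul_eq_mul_div, le_div_iff₀ hκ]
      linarith
    have mχb := memLp_tensor hχ₁ (Lp.memLp b0)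
    have mGb : MemLp (fun x => G x - weightedProfile η θ β x.1 * b0 x.2) 2 volHalf := bG.1.sub mχb
    have h0 : ∫ s in Ioi 0, Real.exp (-(γ * s)) * b0 s = 0 := by
      refine integral_kernel_eq_zero (β := β) (η := η) hf hθ ?_
      have h1 := hw.compat hf hθ hη hγ.1 hχ₂ (jetWeak_fst heV) w0.1 w1.1 w2.1 mGb bg.1
      have mt := memLp_tensor hχ₂ (memLp_exp_neg_Ioi hγ.1)
      have h2 : ∫ x in halfPlane, (G x - weightedProfile η θ β x.1 * b0 x.2)
          * (weightedProfile η θ (-β) x.1 * Real.exp (-(γ * x.2)))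
          = (∫ x in halfPlane, G x * (weightedProfile η θ (-β) x.1 * Real.exp (-(γ * x.2))))
            - ∫ x in halfPlane, weightedProfile η θ β x.1 * b0 x.2
              * (weightedProfile η θ (-β) x.1 * Real.exp (-(γ * x.2))) := by
        simp only [sub_mul]
        exact integral_sub (integrable_mul_of_memLp bG.1 mt) (integrable_mul_of_memLp mχb mt)
      rw [h2] at h1
      linarith
    obtain ⟨z, zR, zH, hzR, hzH, z0, z1, z2, hz⟩ :=
      exists_corrector hf hθ hη hγ.1 hχ₁ (Lp.memLp b0) hb0 h0
    set Γ := ENNReal.ofReal (1 + 1 / γ ^ 2)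
    have hγ0 := hγ.1
    have g1 : 1 ≤ Γ := ENNReal.one_le_ofReal.2 (by simp; positivity)
    have g2 : ENNReal.ofReal (1 / γ) * ENNReal.ofReal (1 / γ) ≤ Γ := by
      rw [← ENNReal.ofReal_mul (by positivity)]
      refine ENNReal.ofReal_le_ofReal ?_
      rw [div_mul_div_comm, one_mul, ← sq]
      linarith
    have g3 : 2 * ENNReal.ofReal (1 / γ) ≤ Γ := by
      rw [show (2:ℝ≥0∞) = ENNReal.ofReal 2 by simp, ← ENNReal.ofReal_mul (by norm_num)]
      refine ENNReal.ofReal_le_ofReal ?_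
      have := sq_nonneg (1 - 1 / γ)
      rw [sub_sq, div_pow] at this
      linarith
    have x1 : eLpNorm (weightedProfile η θ β) 2 volume ≤ K' := by
      rw [← ENNReal.ofReal_toReal hχ₁.2.ne, ← ENNReal.ofReal_coe_nnreal]
      exact ENNReal.ofReal_le_ofReal (n1.trans (Real.le_coe_toNNReal K))
    have x2 : eLpNorm (deriv (weightedProfile η θ β)) 2 volume ≤ 2 * Cχ * K' := by
      refine (eLpNorm_le_mul_eLpNorm_of_ae_le_mul (c := 2 * Cχ)
        (g := weightedProfile η θ β) (Eventually.of_forall fun R => ?_)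
        2).trans ?_
      · refine (hCχ β R).trans ?_
        rw [abs_of_nonneg hβ.1, mul_comm 2 (Cχ:ℝ)]
        gcongr
        linarith [hβ.2]
      · gcongr
        rw [ENNReal.ofReal_mul (by norm_num)]
        simp
    have y0 : N + K' * (Γ * (K' * N)) ≤ Q * (Γ * N) := by
      calc _ ≤ 1 * N + K' * (Γ * (K' * N)) + 2 * Cχ * K' * (Γ * (K' * N)) := by simp
        _ ≤ Γ * N + K' * (Γ * (K' * N)) + 2 * Cχ * K' * (Γ * (K' * N)) := by gcongr
        _ = _ := by simp only [Q]; push_cast; ring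
    have y1 : N + 2 * Cχ * K' * (Γ * (K' * N)) ≤ Q * (Γ * N) := by
      calc _ ≤ 1 * N + 2 * Cχ * K' * (Γ * (K' * N)) + K' * (Γ * (K' * N)) := by simp
        _ ≤ Γ * N + 2 * Cχ * K' * (Γ * (K' * N)) + K' * (Γ * (K' * N)) := by gcongr
        _ = _ := by simp only [Q]; push_cast; ring
    have v0 := (w0.add z0).mono (le_trans (by rw [← mul_assoc (ENNReal.ofReal _)]; gcongr) y0)
    have v1 := (w1.add z1).mono (le_trans (by rw [← mul_assoc (ENNReal.ofReal _)]; gcongr) y1)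
    have v2 := (w2.add z2).mono (le_trans (by rw [← mul_assoc 2]; gcongr) y0)
    have hv := WeakEq.add hw hz w1.1 (w2.1.sub (w0.1.const_mul γ))
      (memLp_weakSol hf hθ hη w0.1 w1.1 w2.1 mGb) z1.1 (z2.1.sub (z0.1.const_mul γ))
      (memLp_weakSol hf hθ hη z0.1 z1.1 z2.1 mχb) bg.1 MemLp.zero
    have hv' : WeakSol η (fun R => deriv (deriv f) (θ R)) β γ (fun x => jetFun e x + z x)
        (fun x => jetFst e x + zR x) (fun x => jetSnd e x + zH x) G g := by
      refine WeakEq.congr hv ae_eq_rfl ?_ ?_ ?_ <;> refine Eventually.of_forall fun x => ?_ <;>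
        simp only <;> ring
    obtain ⟨r1, r2⟩ := hv'.regularity ((jetWeak_fst heV).add hzR) ((jetWeak_snd heV).add hzH) v0 v1 v2
      bG bg (by finiteness) hD (bddSmooth_potential hf hθ hη β γ).1.continuous M1 M2 hγ.1.le M3
    refine ⟨_, r1.mono ?_, r2⟩
    calc _ ≤ (7 + 117 * M) * (1 * D + Q * (Γ * (k' * D))) := by gcongr; rw [one_mul]
      _ ≤ (7 + 117 * M) * (Γ * D + Q * (Γ * (k' * D))) := by gcongr
      _ = _ := by push_cast; ring
  · obtain ⟨vR, vH, vRR, vRH, vHH, hJ, hG, -, hg⟩ := hsol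
    exact eq_zero_of_weakSol hf hθ hη hγ.1 hT hκ hcoer hJ.fst hJ.snd hJ.mem hJ.mem_fst hJ.mem_snd
      (IsSol.weakSol hJ hG hg)

end

section

/-! ### Regularity of higher order -/

theorem WeakEq.deriv_fst {A B C A' B' C' : ℝ × ℝ → ℝ} {g g' : ℝ → ℝ} (h : WeakEq A B C g)
    (hA : WeakDir volHalf (1, 0) A A') (hB : WeakDir volHalf (1, 0) B B')
    (hC : WeakDir volHalf (1, 0) C C') (hg : IsWeakDeriv 1 g g') : WeakEq A' B' C' g' := by
  intro φ hφ
  have h1 := h _ (hφ.dirDeriv (1, 0))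
  rw [dirDeriv_comm (e := (0, 1)) hφ.smooth (1, 0)] at h1
  have a := hA.2.2 _ (hφ.dirDeriv (1, 0))
  have b := hB.2.2 _ (hφ.dirDeriv (0, 1))
  have c := hC.2.2 _ hφ
  have d := hg.2.2 _ (hφ.slice_snd 0).1 (hφ.slice_snd 0).2
  rw [← dirDeriv_one, dirDeriv_slice_snd hφ 0] at d
  simp only [volHalf, pow_one, neg_one_mul] at a b c d
  linarith

theorem exists_mul_fst_comb (k : ℕ) (b : ℝ) {m₀ m₁ m₂ m₃ : ℝ → ℝ} (h₀ : BddSmooth m₀)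
    (h₁ : BddSmooth m₁) (h₂ : BddSmooth m₂) (h₃ : BddSmooth m₃) :
    ∃ M : ℝ≥0, ∀ γ ∈ Icc 0 b, ∀ β ∈ Icc 0 b, ∀ u A, SobBound k u A → SobBound k (fun x =>
      (β * m₁ x.1 + β ^ 2 * m₂ x.1 + γ ^ 2 * m₃ x.1 + m₀ x.1) * u x) (M * A) := by
  obtain ⟨C₀, hC₀⟩ := SobBound.mul_fst k h₀
  obtain ⟨C₁, hC₁⟩ := SobBound.mul_fst k h₁
  obtain ⟨C₂, hC₂⟩ := SobBound.mul_fst k h₂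
  obtain ⟨C₃, hC₃⟩ := SobBound.mul_fst k h₃
  refine ⟨‖b‖₊ * C₁ + ‖b‖₊ ^ 2 * C₂ + ‖b‖₊ ^ 2 * C₃ + C₀, fun γ hγ β hβ u A h => ?_⟩
  have le : ∀ {s : ℝ}, s ∈ Icc 0 b → ‖s‖₊ ≤ ‖b‖₊ := fun {s} hs => by
    rw [← NNReal.coe_le_coe, coe_nnnorm, coe_nnnorm, Real.norm_of_nonneg hs.1,
      Real.norm_of_nonneg (hs.1.trans hs.2)]
    exact hs.2
  refine ((((((hC₁ u A h).const_mul β).add ((hC₂ u A h).const_mul (β ^ 2))).add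
    ((hC₃ u A h).const_mul (γ ^ 2))).add (hC₀ u A h)).mono ?_).congr
      (Eventually.of_forall fun x => by simp only; ring)
  rw [nnnorm_pow, nnnorm_pow]
  push_cast
  simp only [add_mul, mul_assoc]
  gcongr <;> exact_mod_cast le ‹_›

variable {f θ η : ℝ → ℝ}

theorem exists_regularity (hf : IsDoubleWell f) (hθ : IsOptimalProfile f θ) (hη : IsSmoothAbs η)
    (b : ℝ) (k : ℕ) : ∃ C : ℝ≥0, ∀ γ ∈ Icc 0 b, ∀ β ∈ Icc 0 b, ∀ v vR vH G g (E : ℕ → ℝ → ℝ) D B,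
      IsWeakPartial 1 0 v vR → IsWeakPartial 0 1 v vH → SobBound 1 v B → B ≠ ⊤ → D ≠ ⊤ →
      WeakSol η (fun R => deriv (deriv f) (θ R)) β γ v vR vH G g → SobBound k G D →
      (∀ i ≤ k, IsWeakDeriv i g (E i) ∧ HalfBound (E i) D) →
      SobBound (k + 2) v (C * (D + B)) ∧ IsSol η (fun R => deriv (deriv f) (θ R)) β γ v G g := by
  set c : ℝ → ℝ := fun R => deriv (deriv f) (θ R) with hcdef
  have hc : BddSmooth c := hθ.bddSmooth_comp hf hf.contDiff_deriv2
  have hη₁ := hη.bddSmooth_deriv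
  have hz := bddSmooth_const 0
  induction k with
  | zero =>
    obtain ⟨M, hM⟩ := exists_coefficient_bound hf hθ hη b
    refine ⟨7 + 117 * M, fun γ hγ β hβ v vR vH G g E D B hR hH hv hB hD h hG hg => ?_⟩
    obtain ⟨M1, M2, M3⟩ := hM γ hγ β hβ
    have h0 := (hg 0 le_rfl)
    have := h.regularity hR hH hv.l2Bound (hv.of_fst hR).l2Bound (hv.of_snd hH).l2Bound hG
      (h0.2.congr (h0.1.unique (isWeakDeriv_zero h0.1.1))) hB hD
      (bddSmooth_potential hf hθ hη β γ).1.continuous M1 M2 hγ.1 M3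
    exact_mod_cast this
  | succ k ih =>
    obtain ⟨C, hC⟩ := ih
    have two := bddSmooth_const 2
    have q1 := (bddSmooth_const (-1)).mul (hη₁.mul hη₁)
    obtain ⟨N₁, hN₁⟩ := exists_mul_fst_comb (k + 1) b hz (two.mul hη₁) hz hz
    obtain ⟨N₂, hN₂⟩ := exists_mul_fst_comb (k + 1) b hc hη₁.deriv q1 (bddSmooth_const (-1))
    obtain ⟨N₃, hN₃⟩ := exists_mul_fst_comb k b hz (two.mul hη₁.deriv) hz hz
    obtain ⟨N₄, hN₄⟩ := exists_mul_fst_comb k b hc.deriv hη₁.deriv.deriv q1.deriv hz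
    refine ⟨C * (1 + (N₃ + N₄ + 1) * C) + 1 + (N₁ + 2 * ‖b‖₊ + N₂ + 1) * C,
      fun γ hγ β hβ v vR vH G g E D B hR hH hv hB hD h hG hg => ?_⟩
    obtain ⟨e1, e2⟩ := hC γ hγ β hβ v vR vH G g E D B hR hH hv hB hD h hG.of_succ
      fun i hi => hg i (by omega)
    refine ⟨?_, e2⟩
    obtain ⟨sR, sH, sRR, sRH, sHH, hJ, hpde, -, hgr⟩ := e2
    obtain ⟨GR, hGR⟩ : ∃ GR, IsWeakPartial 1 0 G GR ∧ SobBound k GR D := by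
      obtain ⟨-, GR, -, h1, -, h2, -⟩ := hG
      exact ⟨GR, h1, h2⟩
    have hs := IsSol.weakSol hJ hpde hgr
    have p1 : BddSmooth fun R => 2 * β * deriv η R := (bddSmooth_const (2 * β)).mul hη₁
    have p2 : BddSmooth (potential η c β γ) := bddSmooth_potential hf hθ hη β γ
    have d1 : deriv (fun R => 2 * β * deriv η R) = fun R => 2 * β * deriv (deriv η) R := by
      ext R; exact deriv_const_mul _ (hη₁.differentiable R)
    have d2 : deriv (potential η c β γ)
        = fun R => β * deriv (deriv (deriv η)) R
          + β ^ 2 * deriv (fun x => -1 * (deriv η x * deriv η x)) R + γ ^ 2 * 0 + deriv c R := by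
      ext R
      have h1 := (((hη₁.deriv.differentiable R).hasDerivAt.const_mul β).add
        ((q1.differentiable R).hasDerivAt.const_mul (β ^ 2))).add_const (-γ ^ 2)
          |>.add (hc.differentiable R).hasDerivAt
      rw [mul_zero, add_zero, ← h1.deriv]
      congr 1
      ext x
      simp only [potential, Pi.add_apply]
      ring
    set F := C * (D + B) with hF
    have sR1 : SobBound (k + 1) sR F := e1.of_fst hJ.fst
    have sH1 : SobBound (k + 1) sH F := e1.of_snd hJ.snd
    have t1 := hN₃ γ hγ β hβ sR F sR1.of_succ
    have t2 := hN₄ γ hγ β hβ v F e1.of_succ.of_succ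
    have hs' : WeakSol η c β γ sR sRR sRH (fun x => GR x - (2 * β * deriv (deriv η) x.1 * sR x
        + deriv (potential η c β γ) x.1 * v x)) (E 1) := by
      have a := hJ.fst_fst.fst_mul_fst p1.1
      have b := hJ.fst.fst_mul_fst p2.1
      have b1 := (L2Bound.mul_fst ⟨hJ.mem_fst, le_rfl⟩ p1.deriv.1.continuous.measurable
        p1.deriv.bound.choose_spec).1
      have b2 := (L2Bound.mul_fst ⟨hJ.mem, le_rfl⟩ p2.deriv.1.continuous.measurable
        p2.deriv.bound.choose_spec).1
      rw [d1] at a b1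
      have m := memLp_weakSol hf hθ hη (β := β) (γ := γ) hJ.mem hJ.mem_fst hJ.mem_snd hG.l2Bound.1
      have m' := memLp_weakSol hf hθ hη (β := β) (γ := γ) hJ.mem_fst hJ.mem_fst_fst hJ.mem_fst_snd
        (hGR.2.l2Bound.1.sub (b1.add b2))
      refine WeakEq.deriv_fst hs (weakDir_of_isWeakPartial hJ.fst_fst hJ.mem_fst hJ.mem_fst_fst)
        (weakDir_of_isWeakPartial (hJ.snd_fst.sub (hJ.fst.const_mul γ))
          (hJ.mem_snd.sub (hJ.mem.const_mul γ)) (hJ.mem_fst_snd.sub (hJ.mem_fst.const_mul γ)))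
        (weakDir_of_isWeakPartial ((((a.add (hJ.snd_fst.const_mul γ)).add b).sub hGR.1).congr
          ae_eq_rfl (Eventually.of_forall fun x => ?_)) m m') (hg 1 (by omega)).1
      ring
    have hFt : F ≠ ⊤ := ENNReal.mul_ne_top ENNReal.coe_ne_top (ENNReal.add_ne_top.2 ⟨hD, hB⟩)
    have hG' : SobBound k (fun x => GR x - (2 * β * deriv (deriv η) x.1 * sR x
        + deriv (potential η c β γ) x.1 * v x)) (D + (N₃ * F + N₄ * F)) := by
      refine (hGR.2.sub (t1.add t2)).congr (Eventually.of_forall fun x => ?_)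
      simp only [d2]
      ring
    obtain ⟨r1, -⟩ := hC γ hγ β hβ sR sRR sRH _ (E 1) (fun i => E (i + 1)) (D + (N₃ * F + N₄ * F)) F
      hJ.fst_fst hJ.fst_snd (sR1.of_le (by omega)) hFt (by finiteness) hs' hG' fun i hi =>
        ⟨(hg 1 (by omega)).1.of_comp (add_comm i 1 ▸ (hg (i + 1) (by omega)).1),
          (hg (i + 1) (by omega)).2.mono le_self_add⟩
    set X := C * (D + (N₃ * F + N₄ * F) + F) with hX
    have u1 := hN₁ γ hγ β hβ sR F sR1
    have u2 := hN₂ γ hγ β hβ v F e1.of_succ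
    have u3 : SobBound (k + 1) (fun x => 2 * γ * sH x) (2 * ‖b‖₊ * F) :=
      (sH1.const_mul (2 * γ)).mono (by
        gcongr
        rw [nnnorm_mul]
        push_cast
        have : ‖γ‖₊ ≤ ‖b‖₊ := by
          rw [← NNReal.coe_le_coe, coe_nnnorm, coe_nnnorm, Real.norm_of_nonneg hγ.1,
            Real.norm_of_nonneg (hγ.1.trans hγ.2)]
          exact hγ.2
        have h2 : ‖(2:ℝ)‖₊ = 2 := by simp
        rw [h2]
        gcongr
        simp)
    set Y := X + D + (N₁ * F + 2 * ‖b‖₊ * F + N₂ * F) + F with hY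
    have hFY : F ≤ Y := le_add_self
    have hXY : X ≤ Y := by rw [hY, add_assoc, add_assoc]; exact le_self_add
    have sHH1 : SobBound (k + 1) sHH Y := by
      refine (((((r1.of_fst hJ.fst_fst).add hG).neg.add ((u1.add u3).add u2)).mono
        le_self_add)).congr ?_
      filter_upwards [hpde] with x hx
      simp only [potential, hx]
      ring
    have res : SobBound (k + 3) v Y := ⟨e1.l2Bound.mono hFY, sR, sH, hJ.fst, hJ.snd, r1.mono hXY,
      sH1.l2Bound.mono hFY, sRH, sHH, hJ.snd_fst, hJ.snd_snd, (r1.of_snd hJ.fst_snd).mono hXY, sHH1⟩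
    refine res.mono ?_
    calc Y ≤ C * (D + (N₃ * F + N₄ * F) + F) + D + (N₁ * F + 2 * ‖b‖₊ * F + N₂ * F) + F
          + (C * B + B) := le_self_add
      _ = _ := by rw [hF]; push_cast; ring

end

section

/-! ### Boundedness of the operator -/

theorem SobBound.exists_family_green : ∀ {k : ℕ} {q qH : ℝ × ℝ → ℝ} {t : ℝ → ℝ} {A : ℝ≥0∞},
    SobBound (k + 1) q A → IsWeakPartial 0 1 q qH → LocallyIntegrable t → Green q qH t →
      ∃ E : ℕ → ℝ → ℝ, ∀ i ≤ k, IsWeakDeriv i t (E i) ∧ HalfBound (E i) (36 * A)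
  | k, q, qH, t, A, h, hH, ht, hg => by
    have hqH := h.of_snd hH
    obtain ⟨h0, qR, -, hR, -, sR, -⟩ := h
    have le : ∀ {x y z : ℝ≥0∞}, x ≤ A → y ≤ A → z ≤ A → 12 * (x + y + z) ≤ 36 * A :=
      fun hx hy hz => (by gcongr : _ ≤ 12 * (A + A + A)).trans_eq (by ring)
    have ht0 : HalfBound t (36 * A) := by
      obtain ⟨t', ht', hb⟩ := exists_green hR hH h0.1 sR.l2Bound.1 hqH.l2Bound.1
      exact (hb.congr (green_unique (hb.1.locallyIntegrable (by norm_num)) ht ht' hg)).mono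
        (le h0.2 sR.l2Bound.2 hqH.l2Bound.2)
    match k with
    | 0 => exact ⟨fun _ => t, fun i hi => by
        obtain rfl := Nat.le_zero.1 hi
        exact ⟨isWeakDeriv_zero ht, ht0⟩⟩
    | k + 1 =>
      have sR' := sR
      obtain ⟨h1, qRR, qRH, hRR, hRH, sRR, sRH⟩ := sR'
      obtain ⟨t', ht', hb⟩ := exists_green hRR hRH h1.1 sRR.l2Bound.1 sRH.l2Bound.1
      have hloc := hb.1.locallyIntegrable (by norm_num)
      obtain ⟨E, hE⟩ := sR.exists_family_green hRH hloc ht'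
      have hd := hg.isWeakDeriv ht' ht hloc h0.1 h1.1 hqH.l2Bound.1 sRH.l2Bound.1 hR
        (hH.of_comp (hR.comp hRH))
      refine ⟨fun i => Nat.casesOn i t E, fun i hi => ?_⟩
      cases i with
      | zero => exact ⟨isWeakDeriv_zero ht, ht0⟩
      | succ i =>
        obtain ⟨a, b⟩ := hE i (by omega)
        have := hd.comp a
        rw [add_comm] at this
        exact ⟨this, b⟩

variable {f θ η : ℝ → ℝ} {β γ : ℝ}

theorem exists_data_bound (hf : IsDoubleWell f) (hθ : IsOptimalProfile f θ) (hη : IsSmoothAbs η)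
    (β γ : ℝ) (k : ℕ) : ∃ M : ℝ≥0, ∀ v A G g, SobBound (k + 2) v A →
      IsSol η (fun R => deriv (deriv f) (θ R)) β γ v G g → SobBound k G (M * A) ∧
      ∃ E : ℕ → ℝ → ℝ, ∀ i ≤ k, IsWeakDeriv i g (E i) ∧ HalfBound (E i) (M * A) := by
  obtain ⟨C₁, hC₁⟩ := SobBound.mul_fst k ((bddSmooth_const (2 * β)).mul hη.bddSmooth_deriv)
  obtain ⟨C₂, hC₂⟩ := SobBound.mul_fst k (bddSmooth_potential hf hθ hη β γ)
  refine ⟨(2 + C₁ + ‖2 * γ‖₊ + C₂) + 36 * (‖γ‖₊ + 1), fun v A G g hv h => ?_⟩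
  obtain ⟨vR, vH, vRR, vRH, vHH, hJ, hpde, hg, hgr⟩ := h
  have sR : SobBound (k + 1) vR A := hv.of_fst hJ.fst
  have sH : SobBound (k + 1) vH A := hv.of_snd hJ.snd
  constructor
  · refine (((((sR.of_fst hJ.fst_fst).add (sH.of_snd hJ.snd_snd)).neg.add (hC₁ _ _ sR.of_succ)).add
      (sH.of_succ.const_mul (2 * γ))).add (hC₂ _ _ hv.of_succ.of_succ) |>.mono ?_).congr ?_
    · calc _ = (2 + C₁ + ‖2 * γ‖₊ + C₂) * A := by ring
        _ ≤ _ := mul_le_mul' (by push_cast; exact le_self_add) le_rfl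
    · filter_upwards [hpde] with x hx
      rw [hx]
  · have s : SobBound (k + 1) (fun x => γ * v x - vH x) ((‖γ‖₊ + 1) * A) :=
      ((hv.of_succ.const_mul γ).sub sH).mono (by rw [add_mul, one_mul])
    have g1 : Green (fun x => γ * v x - vH x) (fun x => γ * vH x - vHH x) g :=
      (hgr.const_mul (-1)).congr (Eventually.of_forall fun x => by simp only; ring)
        (Eventually.of_forall fun x => by simp only; ring)
        (Eventually.of_forall fun x => by simp only; ring)
    obtain ⟨E, hE⟩ := s.exists_family_green ((hJ.snd.const_mul γ).sub hJ.snd_snd) hg g1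
    refine ⟨E, fun i hi => ⟨(hE i hi).1, (hE i hi).2.mono ?_⟩⟩
    rw [← mul_assoc]
    gcongr
    push_cast
    exact le_add_self

/-! ### Weighted norms -/

theorem weight_mul_cancel (u : ℝ × ℝ → ℝ) :
    (fun x => weight η β γ x * (weight η (-β) (-γ) x * u x)) = u := by
  ext x
  rw [weight_neg, mul_inv_cancel_left₀ (weight_pos η β γ x).ne']

theorem weight_neg_mul_cancel (u : ℝ × ℝ → ℝ) :
    (fun x => weight η (-β) (-γ) x * (weight η β γ x * u x)) = u := by
  ext x
  rw [weight_neg, inv_mul_cancel_left₀ (weight_pos η β γ x).ne']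

theorem weightedNorm_weight_neg (k : ℕ) (v : ℝ × ℝ → ℝ) :
    weightedNorm η k β γ (fun x => weight η (-β) (-γ) x * v x) = sobolevNorm k v :=
  congrArg (sobolevNorm k) (weight_mul_cancel v)

theorem MemWeighted.sobBound {k : ℕ} {u : ℝ × ℝ → ℝ} (h : MemWeighted η k β γ u) :
    SobBound k (fun x => weight η β γ x * u x) (weightedNorm η k β γ u) :=
  sobBound_of_sobolevNorm h

theorem SobBound.weightedNorm_le {k : ℕ} {u : ℝ × ℝ → ℝ} {A : ℝ≥0∞}
    (h : SobBound k (fun x => weight η β γ x * u x) A) : weightedNorm η k β γ u ≤ (k + 1) * A :=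
  h.sobolevNorm_le

theorem operatorEq_iff {k : ℕ} (hη : IsSmoothAbs η) (hβ : 0 ≤ β) (hγ : 0 ≤ γ) {u : ℝ × ℝ → ℝ}
    (hu : MemWeighted η (k + 2) β γ u) (G : ℝ × ℝ → ℝ) (g : ℝ → ℝ) : OperatorEq f θ u G g ↔
      IsSol η (fun R => deriv (deriv f) (θ R)) β γ (fun x => weight η β γ x * u x)
        (fun x => weight η β γ x * G x) (fun r => Real.exp (β * η r) * g r) := by
  rw [← operatorEq_iff_isSol hη hβ hγ (hu.sobBound.of_le le_add_self), weight_neg_mul_cancel]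

theorem weightedNorm_mono {k : ℕ} {u : ℝ × ℝ → ℝ} {l : ℕ} (hl : l ≤ k) (h : MemWeighted η k β γ u) :
    weightedNorm η l β γ u ≤ (l + 1) * weightedNorm η k β γ u :=
  (h.sobBound.of_le hl).weightedNorm_le

theorem weightedBdryNorm_zero_le {k : ℕ} {g : ℝ → ℝ} (h : weightedBdryNorm η k β g < ⊤) :
    weightedBdryNorm η 0 β g ≤ 8 * weightedBdryNorm η k β g := by
  obtain ⟨E, hE⟩ := exists_family_of_slobodeckijNorm h
  refine (HalfBound.slobodeckijNorm_le fun i hi => hE i (by omega)).trans_eq ?_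
  rw [weightedBdryNorm, ← mul_assoc]
  norm_num

theorem compat_weight (G : ℝ × ℝ → ℝ) (g : ℝ → ℝ) :
    (∫ x in halfPlane, weight η β γ x * G x * (weightedProfile η θ (-β) x.1 * Real.exp (-(γ * x.2))))
      + ∫ r, Real.exp (β * η r) * g r * weightedProfile η θ (-β) r
    = (∫ x in halfPlane, G x * deriv θ x.1) + ∫ r, g r * deriv θ r := by
  congr 1 <;> congr 1 <;> ext x
  · have : Real.exp (β * η x.1 + γ * x.2) * (Real.exp (-β * η x.1) * Real.exp (-(γ * x.2))) = 1 := by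
      rw [← Real.exp_add, ← Real.exp_add, Real.exp_eq_one_iff]; ring
    simp only [weight, weightedProfile]
    linear_combination G x * deriv θ x.1 * this
  · have : Real.exp (β * η x) * Real.exp (-β * η x) = 1 := by
      rw [← Real.exp_add, Real.exp_eq_one_iff]; ring
    simp only [weightedProfile]
    linear_combination g x * deriv θ x * this

theorem exists_dataNorm_le (hf : IsDoubleWell f) (hθ : IsOptimalProfile f θ) (hη : IsSmoothAbs η)
    (hβ : 0 ≤ β) (hγ : 0 ≤ γ) (k : ℕ) : ∃ M : ℝ≥0, ∀ u, MemWeighted η (k + 2) β γ u →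
      ∀ G g, OperatorEq f θ u G g → MemWeighted η k β γ G ∧ weightedBdryNorm η k β g < ⊤ ∧
        dataNorm η k β γ G g ≤ M * weightedNorm η (k + 2) β γ u := by
  obtain ⟨M, hM⟩ := exists_data_bound hf hθ hη β γ k
  refine ⟨(2 * k + 3) * M, fun u hu G g h => ?_⟩
  obtain ⟨h1, E, h2⟩ := hM _ _ _ _ hu.sobBound ((operatorEq_iff hη hβ hγ hu G g).1 h)
  have n1 := h1.weightedNorm_le
  have n2 : weightedBdryNorm η k β g ≤ _ := HalfBound.slobodeckijNorm_le h2
  have hA : weightedNorm η (k + 2) β γ u ≠ ⊤ := hu.ne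
  refine ⟨n1.trans_lt ?_, n2.trans_lt ?_, (add_le_add n1 n2).trans_eq ?_⟩
  · exact ENNReal.mul_lt_top (by finiteness) (by finiteness)
  · exact ENNReal.mul_lt_top (by finiteness) (by finiteness)
  · push_cast; ring

/-! ### The isomorphism -/

theorem isIso_zero (hf : IsDoubleWell f) (hθ : IsOptimalProfile f θ) (hη : IsSmoothAbs η)
    (hβ : 0 ≤ β) (hγ : 0 < γ) {K : ℝ≥0} (hχ : MemLp (weightedProfile η θ (-β)) 2 volume)
    (hsolve : ∀ G g D, D ≠ ⊤ → L2Bound G D → HalfBound g D →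
      (∫ x in halfPlane, G x * (weightedProfile η θ (-β) x.1 * Real.exp (-(γ * x.2))))
        + ∫ r, g r * weightedProfile η θ (-β) r = 0 →
      ∃ v, SobBound 2 v (K * D) ∧ IsSol η (fun R => deriv (deriv f) (θ R)) β γ v G g)
    (huniq : ∀ v A, SobBound 2 v A →
      IsSol η (fun R => deriv (deriv f) (θ R)) β γ v (fun _ => 0) (fun _ => 0) →
      v =ᵐ[volHalf] fun _ => 0) :
    IsIsoWithInverseBound f θ η 0 β γ (12 * K) := by
  have hinj : ∀ u u', MemWeighted η (0 + 2) β γ u → MemWeighted η (0 + 2) β γ u' →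
      ∀ G g, OperatorEq f θ u G g → OperatorEq f θ u' G g → u =ᵐ[volHalf] u' := by
    intro u u' hu hu' G g h h'
    rw [operatorEq_iff hη hβ hγ.le hu] at h
    rw [operatorEq_iff hη hβ hγ.le hu'] at h'
    obtain ⟨vR, vH, vRR, vRH, vHH, hJ, hpde, hg, hgr⟩ := h
    obtain ⟨wR, wH, wRR, wRH, wHH, hJ', hpde', -, hgr'⟩ := h'
    have hz := huniq _ _ (hu.sobBound.sub hu'.sobBound) ⟨_, _, _, _, _,
      ⟨hJ.fst.sub hJ'.fst, hJ.snd.sub hJ'.snd, hJ.fst_fst.sub hJ'.fst_fst, hJ.fst_snd.sub hJ'.fst_snd,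
        hJ.snd_fst.sub hJ'.snd_fst, hJ.snd_snd.sub hJ'.snd_snd, hJ.mem.sub hJ'.mem,
        hJ.mem_fst.sub hJ'.mem_fst, hJ.mem_snd.sub hJ'.mem_snd, hJ.mem_fst_fst.sub hJ'.mem_fst_fst,
        hJ.mem_fst_snd.sub hJ'.mem_fst_snd, hJ.mem_snd_snd.sub hJ'.mem_snd_snd⟩, ?_,
      locallyIntegrable_zero, ?_⟩
    · filter_upwards [hz] with x hx
      exact mul_left_cancel₀ (weight_pos η β γ x).ne' (sub_eq_zero.1 hx)
    · filter_upwards [hpde, hpde'] with x h1 h2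
      linear_combination h1 - h2
    · refine (hgr.add (hgr'.const_mul (-1)) (hJ.mem_snd.sub (hJ.mem.const_mul γ))
        (hJ.mem_snd_snd.sub (hJ.mem_snd.const_mul γ))
        ((hJ'.mem_snd.sub (hJ'.mem.const_mul γ)).const_mul _)
        ((hJ'.mem_snd_snd.sub (hJ'.mem_snd.const_mul γ)).const_mul _) hg.neg
        (hg.neg.smul (-1 : ℝ))).congr (Eventually.of_forall fun x => ?_)
        (Eventually.of_forall fun x => ?_) (Eventually.of_forall fun x => ?_) <;> simp only <;> ring
  have hsurj : ∀ G g, MemData θ η 0 β γ G g → ∃ u, MemWeighted η 2 β γ u ∧ OperatorEq f θ u G g ∧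
      SobBound 2 (fun x => weight η β γ x * u x) (K * (4 * dataNorm η 0 β γ G g)) := by
    intro G g ⟨h1, h2, h3⟩
    obtain ⟨E, hE⟩ := exists_family_of_slobodeckijNorm h2
    obtain ⟨e1, e2⟩ := hE 0 le_rfl
    have bG := h1.sobBound.mono (B := 4 * dataNorm η 0 β γ G g)
      ((le_self_add : _ ≤ dataNorm η 0 β γ G g).trans (le_mul_of_one_le_left' (by norm_num)))
    have bg := (e2.congr (e1.unique (isWeakDeriv_zero e1.1))).mono
      (B := 4 * dataNorm η 0 β γ G g) (by gcongr; exact le_add_self)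
    have hD : dataNorm η 0 β γ G g ≠ ⊤ := (ENNReal.add_lt_top.2 ⟨h1, h2⟩).ne
    obtain ⟨v, v1, v2⟩ := hsolve _ _ _ (by finiteness) bG bg ((compat_weight G g).trans h3)
    have hn := v1.sobolevNorm_le
    rw [← weightedNorm_weight_neg (η := η) (β := β) (γ := γ)] at hn
    refine ⟨_, hn.trans_lt ?_, (operatorEq_iff_isSol hη hβ hγ.le v1 G g).2 v2,
      (weight_mul_cancel v).symm ▸ v1⟩
    exact ENNReal.mul_lt_top (by finiteness) (by finiteness)
  obtain ⟨M, hM⟩ := exists_dataNorm_le hf hθ hη hβ hγ.le 0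
  have hb : ∀ u, MemWeighted η (0 + 2) β γ u → ∀ G g, OperatorEq f θ u G g →
      MemData θ η 0 β γ G g ∧ dataNorm η 0 β γ G g ≤ M * weightedNorm η (0 + 2) β γ u := by
    intro u hu G g h
    obtain ⟨m1, m2, m3⟩ := hM u hu G g h
    refine ⟨⟨m1, m2, ?_⟩, m3⟩
    obtain ⟨E, hE⟩ := exists_family_of_slobodeckijNorm m2
    obtain ⟨e1, e2⟩ := hE 0 le_rfl
    have bg := e2.congr (e1.unique (isWeakDeriv_zero e1.1))
    obtain ⟨vR, vH, vRR, vRH, vHH, hJ, hpde, -, hgr⟩ := (operatorEq_iff hη hβ hγ.le hu G g).1 h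
    rw [← compat_weight (η := η) (β := β) (γ := γ)]
    exact (IsSol.weakSol hJ hpde hgr).compat hf hθ hη hγ hχ hJ.fst hJ.mem hJ.mem_fst hJ.mem_snd
      m1.sobBound.l2Bound.1 bg.1
  refine ⟨fun u hu => ?_, ⟨M, hb⟩, hinj, fun G g h => ?_, fun u hu G g h => ?_⟩
  · obtain ⟨vR, vH, vRR, vRH, vHH, hJ, -⟩ := (hu.sobBound : SobBound 2 _ _).exists_h2Jet
    obtain ⟨t, ht, hb⟩ := exists_green (hJ.snd_fst.sub (hJ.fst.const_mul γ))
      (hJ.snd_snd.sub (hJ.snd.const_mul γ)) (hJ.mem_snd.sub (hJ.mem.const_mul γ))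
      (hJ.mem_fst_snd.sub (hJ.mem_fst.const_mul γ)) (hJ.mem_snd_snd.sub (hJ.mem_snd.const_mul γ))
    have hl := hb.1.locallyIntegrable (by norm_num)
    refine ⟨fun x => weight η (-β) (-γ) x * (-(vRR x + vHH x) + 2 * β * deriv η x.1 * vR x
      + 2 * γ * vH x + potential η (fun R => deriv (deriv f) (θ R)) β γ x.1
        * (weight η β γ x * u x)), fun r => Real.exp (-(β * η r)) * -t r,
      (operatorEq_iff hη hβ hγ.le hu _ _).2 ⟨vR, vH, vRR, vRH, vHH, hJ,
        Eventually.of_forall (congrFun (weight_mul_cancel fun x => -(vRR x + vHH x)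
          + 2 * β * deriv η x.1 * vR x + 2 * γ * vH x + potential η (fun R => deriv (deriv f) (θ R)) β γ x.1
          * (weight η β γ x * u x))), ?_⟩⟩
    have e : (fun r => Real.exp (β * η r) * (Real.exp (-(β * η r)) * -t r)) = fun r => -t r := by
      ext r
      rw [← mul_assoc, ← Real.exp_add, add_neg_cancel, Real.exp_zero, one_mul]
    refine ⟨by simp only [e]; exact hl.neg,
      ht.congr ae_eq_rfl ae_eq_rfl (Eventually.of_forall fun r => ?_)⟩
    have := congrFun e r
    simp only at this ⊢
    linarith
  · obtain ⟨u, h1, h2, -⟩ := hsurj G g h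
    exact ⟨u, h1, h2⟩
  · obtain ⟨u', h1, h2, h3⟩ := hsurj G g (hb u hu G g h).1
    have := hinj u' u h1 hu G g h2 h
    refine (h3.congr (by filter_upwards [this] with x hx; rw [hx])).weightedNorm_le.trans_eq ?_
    rw [ENNReal.ofReal_mul (by norm_num), ENNReal.ofReal_coe_nnreal, ENNReal.ofReal_ofNat]
    norm_num
    ring

end

section

variable {f θ η : ℝ → ℝ} {β γ : ℝ}

theorem exists_isDecayRange (hf : IsDoubleWell f) (hθ : IsOptimalProfile f θ) (hη : IsSmoothAbs η) :
    ∃ γbar βbar, IsDecayRange f θ η γbar βbar := by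
  obtain ⟨b, hb, C, h⟩ := exists_solvable hf hθ hη
  refine ⟨b, fun _ => b, hb, fun _ _ => hb, monotoneOn_const, 12 * (C + 1), by positivity,
    fun γ hγ β hβ => ?_⟩
  obtain ⟨hχ, hs, hu⟩ := h γ hγ β hβ
  have h0 : (0:ℝ) ≤ 1 + 1 / γ ^ 2 := by positivity
  have := isIso_zero hf hθ hη hβ.1 hγ.1 (K := (C + 1) * (1 + 1 / γ ^ 2).toNNReal) hχ
    (fun G g D hD bG bg hc => by
      obtain ⟨v, h1, h2⟩ := hs G g D hD bG bg hc
      refine ⟨v, h1.mono ?_, h2⟩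
      push_cast
      gcongr
      · exact le_self_add
      · exact le_rfl) hu
  push_cast [Real.coe_toNNReal _ h0] at this
  rwa [← mul_assoc] at this

/-- Boundedness of the inverse in spaces of higher order, from that in the space of lowest order. -/
theorem exists_weightedNorm_le (hf : IsDoubleWell f) (hθ : IsOptimalProfile f θ)
    (hη : IsSmoothAbs η) (b : ℝ) (k : ℕ) : ∃ C : ℝ≥0, ∀ γ ∈ Icc 0 b, ∀ β ∈ Icc 0 b, ∀ u G g,
      MemWeighted η 2 β γ u → OperatorEq f θ u G g → MemWeighted η k β γ G →
      weightedBdryNorm η k β g < ⊤ → weightedNorm η (k + 2) β γ u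
        ≤ C * (dataNorm η k β γ G g + weightedNorm η 2 β γ u) := by
  obtain ⟨C, hC⟩ := exists_regularity hf hθ hη b k
  refine ⟨(k + 3) * (C * 4), fun γ hγ β hβ u G g hu h hG hg => ?_⟩
  obtain ⟨vR, vH, vRR, vRH, vHH, hJ, hpde, -, hgr⟩ :=
    (operatorEq_iff (k := 0) hη hβ.1 hγ.1 hu G g).1 h
  obtain ⟨E, hE⟩ := exists_family_of_slobodeckijNorm hg
  have hD : dataNorm η k β γ G g ≠ ⊤ := (ENNReal.add_lt_top.2 ⟨hG, hg⟩).ne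
  have bG := hG.sobBound.mono (B := 4 * dataNorm η k β γ G g)
    ((le_self_add : _ ≤ dataNorm η k β γ G g).trans (le_mul_of_one_le_left' (by norm_num)))
  obtain ⟨r, -⟩ := hC γ hγ β hβ _ _ _ _ _ E (4 * dataNorm η k β γ G g) (weightedNorm η 2 β γ u)
    hJ.fst hJ.snd hu.sobBound.of_succ hu.ne (by finiteness) (IsSol.weakSol hJ hpde hgr) bG
    fun i hi => ⟨(hE i hi).1, (hE i hi).2.mono (by gcongr; exact le_add_self)⟩
  refine r.weightedNorm_le.trans ?_
  calc _ ≤ ((k + 2 : ℕ) + 1) * (C * (4 * dataNorm η k β γ G g + 4 * weightedNorm η 2 β γ u)) := by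
        gcongr; exact le_mul_of_one_le_left' (by norm_num)
    _ = _ := by push_cast; ring

theorem dataNorm_zero_le {k : ℕ} {G : ℝ × ℝ → ℝ} {g : ℝ → ℝ} (hG : MemWeighted η k β γ G)
    (hg : weightedBdryNorm η k β g < ⊤) : dataNorm η 0 β γ G g ≤ 8 * dataNorm η k β γ G g := by
  rw [dataNorm, dataNorm, mul_add]
  refine add_le_add ((weightedNorm_mono (Nat.zero_le k) hG).trans ?_) (weightedBdryNorm_zero_le hg)
  gcongr
  norm_num

theorem IsDecayRange.exists_isIso (hf : IsDoubleWell f) (hθ : IsOptimalProfile f θ)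
    (hη : IsSmoothAbs η) {γbar : ℝ} {βbar : ℝ → ℝ} (h : IsDecayRange f θ η γbar βbar) (k : ℕ) :
    ∃ C : ℝ, 0 < C ∧ ∀ γ ∈ Ioc 0 γbar, ∀ β ∈ Icc 0 (βbar γ),
      IsIsoWithInverseBound f θ η k β γ (C * (1 + 1 / γ ^ 2) ^ (k + 1)) := by
  obtain ⟨C₀, hC₀, h0⟩ := h.iso
  set b := max γbar (βbar γbar)
  obtain ⟨C, hC⟩ := exists_weightedNorm_le hf hθ hη b k
  refine ⟨C * (1 + 8 * C₀) + 1, by positivity, fun γ hγ β hβ => ?_⟩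
  have hγb : γ ∈ Icc 0 b := ⟨hγ.1.le, hγ.2.trans (le_max_left _ _)⟩
  have hβb : β ∈ Icc 0 b := ⟨hβ.1, (hβ.2.trans (h.mono hγ ⟨h.pos, le_rfl⟩ hγ.2)).trans
    (le_max_right _ _)⟩
  have H := h0 γ hγ β hβ
  obtain ⟨M, hM⟩ := exists_dataNorm_le hf hθ hη hβ.1 hγ.1.le k
  obtain ⟨M₀, hM₀⟩ := H.bounded
  have low : ∀ u, MemWeighted η (k + 2) β γ u → MemWeighted η 2 β γ u := fun u hu =>
    (weightedNorm_mono le_add_self hu).trans_lt (ENNReal.mul_lt_top (by finiteness) hu)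
  refine ⟨fun u hu => H.total u (low u hu), ⟨M, fun u hu G g hop => ?_⟩,
    fun u u' hu hu' => H.injective u u' (low u hu) (low u' hu'), fun G g hD => ?_,
    fun u hu G g hop => ?_⟩
  · obtain ⟨m1, m2, m3⟩ := hM u hu G g hop
    exact ⟨⟨m1, m2, (hM₀ u (low u hu) G g hop).1.2.2⟩, m3⟩
  · have hdk : dataNorm η k β γ G g < ⊤ := ENNReal.add_lt_top.2 ⟨hD.1, hD.2.1⟩
    have hd : dataNorm η 0 β γ G g < ⊤ := (dataNorm_zero_le hD.1 hD.2.1).trans_lt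
      (ENNReal.mul_lt_top (by finiteness) hdk)
    obtain ⟨u, hu, hop⟩ := H.surjective G g
      ⟨(ENNReal.add_lt_top.1 hd).1, (ENNReal.add_lt_top.1 hd).2, hD.2.2⟩
    exact ⟨u, (hC γ hγb β hβb u G g hu hop hD.1 hD.2.1).trans_lt
      (ENNReal.mul_lt_top (by finiteness) (ENNReal.add_lt_top.2 ⟨hdk, hu⟩)), hop⟩
  · obtain ⟨m1, m2, -⟩ := hM u hu G g hop
    have n1 := H.inverse_bound u (low u hu) G g hop
    have hK : 1 ≤ 1 + 1 / γ ^ 2 := by simp; positivity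
    calc _ ≤ C * (dataNorm η k β γ G g + weightedNorm η 2 β γ u) :=
          hC γ hγb β hβb u G g (low u hu) hop m1 m2
      _ ≤ C * (dataNorm η k β γ G g + ENNReal.ofReal (C₀ * (1 + 1 / γ ^ 2))
          * (8 * dataNorm η k β γ G g)) := by
          gcongr
          exact n1.trans (by gcongr; exact dataNorm_zero_le m1 m2)
      _ = ENNReal.ofReal (C * (1 + 8 * (C₀ * (1 + 1 / γ ^ 2)))) * dataNorm η k β γ G g := by
          have hx : 0 ≤ C₀ * (1 + 1 / γ ^ 2) := by positivity
          generalize C₀ * (1 + 1 / γ ^ 2) = x at hx ⊢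
          rw [ENNReal.ofReal_mul (by positivity), ENNReal.ofReal_add (by norm_num) (by positivity),
            ENNReal.ofReal_mul (by norm_num), ENNReal.ofReal_coe_nnreal, ENNReal.ofReal_one,
            ENNReal.ofReal_ofNat]
          ring
      _ ≤ _ := by
          refine mul_le_mul' (ENNReal.ofReal_le_ofReal ?_) le_rfl
          have hp : 1 + 1 / γ ^ 2 ≤ (1 + 1 / γ ^ 2) ^ (k + 1) := le_self_pow₀ hK (by omega)
          calc C * (1 + 8 * (C₀ * (1 + 1 / γ ^ 2)))
              ≤ C * (1 * (1 + 1 / γ ^ 2) + 8 * (C₀ * (1 + 1 / γ ^ 2))) := by gcongr; linarith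
            _ = C * (1 + 8 * C₀) * (1 + 1 / γ ^ 2) := by ring
            _ ≤ (C * (1 + 8 * C₀) + 1) * (1 + 1 / γ ^ 2) ^ (k + 1) := by gcongr; linarith

end

end ContactModel

theorem theorem3p10 (f θ η : ℝ → ℝ) (hf : ContactModel.IsDoubleWell f)
    (hθ : ContactModel.IsOptimalProfile f θ) (hη : ContactModel.IsSmoothAbs η) :
    (∃ (γbar : ℝ) (βbar : ℝ → ℝ), ContactModel.IsDecayRange f θ η γbar βbar) ∧
    ∀ (γbar : ℝ) (βbar : ℝ → ℝ), ContactModel.IsDecayRange f θ η γbar βbar →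
      ∀ k : ℕ, ∃ C : ℝ, 0 < C ∧ ∀ γ ∈ Set.Ioc 0 γbar, ∀ β ∈ Set.Icc 0 (βbar γ),
        ContactModel.IsIsoWithInverseBound f θ η k β γ (C * (1 + 1 / γ ^ 2) ^ (k + 1)) :=
  ⟨ContactModel.exists_isDecayRange hf hθ hη, fun _ _ h k => h.exists_isIso hf hθ hη k⟩
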